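/- **Setting.** Let $n\ge 1$. The Nichols Hopf algebra $\mathcal K_n$ is the complex Hopf algebra with generators $K,\xi_1,\dots,\xi_n$, relations $K^2=1$, $\xi_i^2=0$, $K\xi_i=-\xi_iK$, $\xi_i\xi_j=-\xi_j\xi_i$, and $\Delta K=K\otimes K$, $\Delta\xi_i=K\otimes\xi_i+\xi_i\otimes 1$, $\epsilon(K)=1$, $\epsilon(\xi_i)=0$, $S(K)=K$, $S(\xi_i)=-K\xi_i$. Let $W$ be the set of words $w=\xi_{i_1}\cdots\xi_{i_k}$, $i_1<\dots<i_k$, $|w|=k$; then $B=W\cup KW$ is a basis of $\mathcal K_n$, with dual basis $(b^*)_{b\in B}$. Let $D\mathcal K_n=\mathcal K_n^{*\mathrm{cop}}\bowtie\mathcal K_n$ be the Drinfeld double, i.e. $\mathcal K_n^*\otimes\mathcal K_n$ with product $$(\phi\otimes h)(\phi'\otimes h')=\phi\,\phi'\big(S^{-1}(h_{(3)})(-)h_{(1)}\big)\otimes h_{(2)}h'.$$ Identify $h\in\mathcal K_n$ with $\epsilon\otimes h$ and $\phi\in\mathcal K_n^*$ with $\phi\otimes 1$. Put $\bar K=1^*-K^*$,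 $\bar\xi_i=\xi_i^*+(K\xi_i)^*$, and $\bar w=\bar\xi_{i_1}\cdots\bar\xi_{i_k}$ for $w=\xi_{i_1}\cdots\xi_{i_k}\in W$; write $t=\xi_1\cdots\xi_n\bar\xi_1\cdots\bar\xi_n$. Let $R=\sum_{b\in B}b\otimes b^*$ be the canonical $R$-matrix and $G=K$ the balancing element. Put $$\Lambda=\tfrac12(1+K+\bar K+K\bar K)\,t,$$ let $\lambda\in(D\mathcal K_n)^*$ be twice the coefficient of $t$ in the basis $\{K^a\bar K^b w\bar w' : a,b\in\{0,1\},\ w,w'\in W\}$, and for even $n$ let $$\nu=(1+K-\bar K+K\bar K)\sum_{w\in W}\tfrac12(-1)^{\lfloor(|w|+1)/2\rfloor}w\bar w .$$ Let $\tau(x)=S(\Lambda_{(2)})\,x\,\Lambda_{(1)}G^{-1}$; its image is the Higman ideal $\mathrm{Hig}(D\mathcal K_n)$. Let $\hat f_Q(\chi)=(\chi(G\,\cdot)\otimes\mathrm{id})(R_{21}R)$ be the shifted Drinfeld map, $S_{LM}(x)=(\mathrm{id}\otimes\lambda)(R^{-1}(1\otimes x)R_{21}^{-1})$ and $T_{LM}(x)=\nu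 x$. For $\sigma\in\{1,K\bar K,K,\bar K\}$ let $(\epsilon_\sigma,\bar\epsilon_\sigma)=(1,1),(-1,-1),(1,-1),(-1,1)$ respectively. Let $V_1,V_{K\bar K}$ be the one-dimensional modules on which $K,\bar K$ act by $\epsilon_\sigma,\bar\epsilon_\sigma$ and all $\xi_i,\bar\xi_i$ by $0$. Let $V_K,V_{\bar K}$ be the modules generated by one vector $v$ subject to $Kv=\epsilon_\sigma v$, $\bar Kv=\bar\epsilon_\sigma v$, $\xi_iv=0$ for all $i$. Let $\chi_\sigma$ be the character of $V_\sigma$, put $$e_1=\tfrac14(1+K+\bar K+K\bar K),\qquad e_{K\bar K}=\tfrac14(1-K-\bar K+K\bar K),$$ $$e_K=\tfrac{(-1)^{\lfloor n/2\rfloor}}{2^{n+2}}(1+K-\bar K-K\bar K)\,t,\qquad e_{\bar K}=\tfrac{(-1)^{\lfloor n/2\rfloor}}{2^{n+2}}(1-K+\bar K-K\bar K)\,t,$$ and let $p_e$ be the character of the left module $D\mathcal K_n\,e$. Products of functionals are taken in $(D\mathcal K_n)^*$. **Theorem.** (a) For every $n\ge1$ the center is $Z(D\mathcal K_n)=Z_H\oplus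 Z_\Lambda$, where $$Z_H=\mathrm{span}\Big\{1-K\bar K,\ (K+\bar K)t,\ (K-\bar K)\sum_{w\in W}(-1)^{\lfloor(|w|+1)/2\rfloor}w\bar w\Big\}$$ has dimension $3$ and $$Z_\Lambda=\mathrm{span}\{(1+K\bar K)w\bar w' : w,w'\in W,\ |w|+|w'|\text{ even}\}.$$ (b) Let $n$ be even. Then $Z_H=\mathrm{Hig}(D\mathcal K_n)$. The element $\Lambda$ is a two-sided integral of $D\mathcal K_n$, $\lambda$ is an integral of the dual (that is, $\beta\lambda=\beta(1)\lambda$ for every $\beta\in(D\mathcal K_n)^*$), and $\lambda(\Lambda)=1$. The four modules $V_\sigma$ are simple and pairwise non-isomorphic, and every simple $D\mathcal K_n$-module is isomorphic to one of them. The elements $e_\sigma$ are pairwise orthogonal primitive idempotents, each $D\mathcal K_ne_\sigma$ maps onto $V_\sigma$, and $p_{e_{K\bar K}}=p_{e_1}$. With $(e_{(1)},e_{(2)},e_{(3)})=(e_1,e_K,e_{\bar K})$, both $B_\chi=\{\hat f_Q(p_{e_{(j)}})\}_{j=1}^3$ and $B_\tau=\{\tau(e_{(j)})\}_{j=1}^3$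 are bases of $\mathrm{Hig}(D\mathcal K_n)$. The Cohen–Westreich matrix $S_{CW}$, defined by $\tau(e_{(j)})=\sum_k(S_{CW})_{kj}\hat f_Q(p_{e_{(k)}})$, and the matrix $T_{CW}$ of $T_{LM}$ in the basis $B_\tau$, defined by $T_{LM}(\tau(e_{(j)}))=\sum_k(T_{CW})_{kj}\tau(e_{(k)})$, are $$S_{CW}=(-1)^{n/2}\begin{pmatrix}0&2^{-n}&-2^{-n}\\2^{n-1}&1/2&1/2\\-2^{n-1}&1/2&1/2\end{pmatrix},\qquad T_{CW}=\begin{pmatrix}1&0&0\\0&1&0\\0&0&-1\end{pmatrix};$$ moreover $S_{CW}$ is also the matrix of $S_{LM}$ in the basis $B_\tau$. The mixed fusion matrices $N^\sigma$, defined by $\chi_\sigma p_{e_{(j)}}=\sum_kN^\sigma_{kj}p_{e_{(k)}}$, are $$N^1=I,\qquad N^{K\bar K}=\begin{pmatrix}1&0&0\\0&0&1\\0&1&0\end{pmatrix},\qquad N^K=N^{\bar K}=\begin{pmatrix}0&1&1\\2^{2n-1}&0&0\\2^{2n-1}&0&0\end{pmatrix},$$ and $S_{CW}$ is invertible and diagonalizes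 them: $S_{CW}N^1S_{CW}^{-1}=I$, $S_{CW}N^{K\bar K}S_{CW}^{-1}=\mathrm{diag}(-1,1,1)$, and $S_{CW}N^KS_{CW}^{-1}=S_{CW}N^{\bar K}S_{CW}^{-1}=\mathrm{diag}(0,2^n,-2^n)$. -/

import Mathlib

open scoped TensorProduct

noncomputable section

/-- The product of the `x i`, `i ∈ I`, in ascending order of the index. -/
def orderedProd {A : Type*} [Monoid A] {n : ℕ} (x : Fin n → A) (I : Finset (Fin n)) : A :=
  ((List.finRange n).map fun i => if i ∈ I then x i else 1).prod

/-- Generators of the Nichols Hopf algebra `𝒦ₙ`. -/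
inductive NicholsGen (n : ℕ) : Type
  | K : NicholsGen n
  | xi : Fin n → NicholsGen n

/-- Defining relations of `𝒦ₙ`. -/
inductive NicholsRel (n : ℕ) :
    FreeAlgebra ℂ (NicholsGen n) → FreeAlgebra ℂ (NicholsGen n) → Prop
  | K_sq : NicholsRel n (FreeAlgebra.ι ℂ .K * FreeAlgebra.ι ℂ .K) 1
  | xi_sq (i : Fin n) : NicholsRel n (FreeAlgebra.ι ℂ (.xi i) * FreeAlgebra.ι ℂ (.xi i)) 0
  | K_xi (i : Fin n) : NicholsRel n (FreeAlgebra.ι ℂ .K * FreeAlgebra.ι ℂ (.xi i))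
      (-(FreeAlgebra.ι ℂ (.xi i) * FreeAlgebra.ι ℂ .K))
  | xi_xi (i j : Fin n) : NicholsRel n (FreeAlgebra.ι ℂ (.xi i) * FreeAlgebra.ι ℂ (.xi j))
      (-(FreeAlgebra.ι ℂ (.xi j) * FreeAlgebra.ι ℂ (.xi i)))

/-- The Nichols algebra `𝒦ₙ` over `ℂ`, by generators and relations. -/
def Nichols (n : ℕ) : Type := RingQuot (NicholsRel n)

instance (n : ℕ) : Ring (Nichols n) := inferInstanceAs (Ring (RingQuot (NicholsRel n)))

instance (n : ℕ) : Algebra ℂ (Nichols n) := inferInstanceAs (Algebra ℂ (RingQuot (NicholsRel n)))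

namespace Nichols

variable {n : ℕ}

/-- The quotient map from the free algebra. -/
def mk (n : ℕ) : FreeAlgebra ℂ (NicholsGen n) →ₐ[ℂ] Nichols n :=
  RingQuot.mkAlgHom ℂ (NicholsRel n)

theorem mk_rel {a b : FreeAlgebra ℂ (NicholsGen n)} (h : NicholsRel n a b) : mk n a = mk n b :=
  RingQuot.mkAlgHom_rel ℂ h

def K (n : ℕ) : Nichols n := mk n (FreeAlgebra.ι ℂ .K)

def xi (i : Fin n) : Nichols n := mk n (FreeAlgebra.ι ℂ (.xi i))

theorem K_mul_K : K n * K n = 1 := by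
  simpa [K] using mk_rel (NicholsRel.K_sq (n := n))

theorem xi_mul_self (i : Fin n) : xi i * xi i = 0 := by
  simpa [xi] using mk_rel (NicholsRel.xi_sq i)

theorem K_mul_xi (i : Fin n) : K n * xi i = -(xi i * K n) := by
  simpa [K, xi] using mk_rel (NicholsRel.K_xi i)

theorem xi_mul_xi (i j : Fin n) : xi i * xi j = -(xi j * xi i) := by
  simpa [xi] using mk_rel (NicholsRel.xi_xi i j)

/-- Algebra maps out of `𝒦ₙ` from elements satisfying the defining relations. -/
def lift {A : Type*} [Ring A] [Algebra ℂ A] (k : A) (x : Fin n → A) (h1 : k * k = 1)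
    (h2 : ∀ i, x i * x i = 0) (h3 : ∀ i, k * x i = -(x i * k))
    (h4 : ∀ i j, x i * x j = -(x j * x i)) : Nichols n →ₐ[ℂ] A :=
  RingQuot.liftAlgHom ℂ ⟨FreeAlgebra.lift ℂ fun g => match g with | .K => k | .xi i => x i, by
    intro a b h
    cases h with
    | K_sq => simpa using h1
    | xi_sq i => simpa using h2 i
    | K_xi i => simpa using h3 i
    | xi_xi i j => simpa using h4 i j⟩

section lift
variable {A : Type*} [Ring A] [Algebra ℂ A] (k : A) (x : Fin n → A) (h1 : k * k = 1)
    (h2 : ∀ i, x i * x i = 0) (h3 : ∀ i, k * x i = -(x i * k))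
    (h4 : ∀ i j, x i * x j = -(x j * x i))

@[simp] theorem lift_K : lift k x h1 h2 h3 h4 (K n) = k := by
  exact (RingQuot.liftAlgHom_mkAlgHom_apply _ _ _ _).trans (by simp)

@[simp] theorem lift_xi (i : Fin n) : lift k x h1 h2 h3 h4 (xi i) = x i := by
  exact (RingQuot.liftAlgHom_mkAlgHom_apply _ _ _ _).trans (by simp)
end lift

theorem algHom_ext {A : Type*} [Ring A] [Algebra ℂ A] {f g : Nichols n →ₐ[ℂ] A}
    (hK : f (K n) = g (K n)) (hx : ∀ i, f (xi i) = g (xi i)) : f = g := by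
  refine RingQuot.ringQuot_ext' _ _ _ ?_
  ext a
  cases a with
  | K => exact hK
  | xi i => exact hx i

theorem subalgebra_eq_top (s : Subalgebra ℂ (Nichols n)) (hK : K n ∈ s) (hx : ∀ i, xi i ∈ s) :
    s = ⊤ := by
  let f : Nichols n →ₐ[ℂ] s := lift ⟨K n, hK⟩ (fun i => ⟨xi i, hx i⟩)
    (Subtype.ext K_mul_K) (fun i => Subtype.ext (xi_mul_self i))
    (fun i => Subtype.ext (K_mul_xi i)) (fun i j => Subtype.ext (xi_mul_xi i j))
  have : s.val.comp f = AlgHom.id ℂ _ := algHom_ext (by simp [f]) (by simp [f])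
  rw [eq_top_iff]
  rintro a -
  have h := congrArg (fun g => g a) this
  simp only [AlgHom.comp_apply, AlgHom.id_apply] at h
  rw [← h]
  exact (f a).2

theorem mem_of_gens {s : Subalgebra ℂ (Nichols n)} (hK : K n ∈ s) (hx : ∀ i, xi i ∈ s)
    (a : Nichols n) : a ∈ s := by
  rw [subalgebra_eq_top s hK hx]
  trivial

/-! ### Hopf algebra structure -/

def comulAlgHom : Nichols n →ₐ[ℂ] Nichols n ⊗[ℂ] Nichols n :=
  lift (K n ⊗ₜ K n) (fun i => K n ⊗ₜ xi i + xi i ⊗ₜ 1)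
    (by simp [K_mul_K, Algebra.TensorProduct.one_def])
    (fun i => by simp [mul_add, add_mul, xi_mul_self, K_mul_xi, TensorProduct.neg_tmul])
    (fun i => by
      simp [mul_add, add_mul, K_mul_xi, TensorProduct.neg_tmul, TensorProduct.tmul_neg]
      abel)
    (fun i j => by
      simp only [mul_add, add_mul, Algebra.TensorProduct.tmul_mul_tmul, K_mul_K, K_mul_xi, mul_one,
        one_mul, TensorProduct.neg_tmul]
      rw [xi_mul_xi i j]
      simp only [TensorProduct.neg_tmul, TensorProduct.tmul_neg]
      abel)

def counitAlgHom : Nichols n →ₐ[ℂ] ℂ :=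
  lift 1 (fun _ => 0) (by simp) (by simp) (by simp) (by simp)

instance : Bialgebra ℂ (Nichols n) :=
  Bialgebra.ofAlgHom comulAlgHom counitAlgHom
    (algHom_ext (by simp [comulAlgHom]) (fun i => by
      simp [comulAlgHom, TensorProduct.tmul_add, TensorProduct.add_tmul,
        Algebra.TensorProduct.one_def, add_assoc]))
    (algHom_ext (by simp [comulAlgHom, counitAlgHom])
      (fun i => by simp [comulAlgHom, counitAlgHom]))
    (algHom_ext (by simp [comulAlgHom, counitAlgHom])
      (fun i => by simp [comulAlgHom, counitAlgHom]))

open Coalgebra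

@[simp] theorem comul_K : comul (R := ℂ) (K n) = K n ⊗ₜ K n := by
  change comulAlgHom (K n) = _
  simp [comulAlgHom]

@[simp] theorem comul_xi (i : Fin n) :
    comul (R := ℂ) (xi i) = K n ⊗ₜ xi i + xi i ⊗ₜ 1 := by
  change comulAlgHom (xi i) = _
  simp [comulAlgHom]

@[simp] theorem counit_K : counit (R := ℂ) (K n) = 1 := by
  change counitAlgHom (K n) = _
  simp [counitAlgHom]

@[simp] theorem counit_xi (i : Fin n) : counit (R := ℂ) (xi i) = 0 := by
  change counitAlgHom (xi i) = _
  simp [counitAlgHom]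

theorem K_xi_mul_K_xi (i j : Fin n) : K n * xi i * (K n * xi j) = -(xi i * xi j) := by
  rw [K_mul_xi, neg_mul, mul_assoc, ← mul_assoc (K n), K_mul_K, one_mul]

theorem K_xi_mul_K (i : Fin n) : K n * xi i * K n = -xi i := by
  rw [K_mul_xi, neg_mul, mul_assoc, K_mul_K, mul_one]

theorem K_mul_K_xi (i : Fin n) : K n * (K n * xi i) = xi i := by
  rw [← mul_assoc, K_mul_K, one_mul]

open MulOpposite in
/-- The antipode, `S K = K`, `S ξᵢ = -K ξᵢ`, as an algebra map to the opposite algebra. -/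
def antipodeOp : Nichols n →ₐ[ℂ] (Nichols n)ᵐᵒᵖ :=
  lift (op (K n)) (fun i => op (-(K n * xi i)))
    (by rw [← op_mul, K_mul_K, op_one])
    (fun i => by rw [← op_mul, neg_mul_neg, K_xi_mul_K_xi, xi_mul_self, neg_zero, op_zero])
    (fun i => by
      rw [← op_mul, ← op_mul, ← op_neg, neg_mul, mul_neg, K_xi_mul_K, K_mul_K_xi, neg_neg])
    (fun i j => by
      rw [← op_mul, ← op_mul, ← op_neg, neg_mul_neg, neg_mul_neg, K_xi_mul_K_xi, K_xi_mul_K_xi,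
        xi_mul_xi])

open MulOpposite in
/-- The inverse antipode, `S⁻¹ K = K`, `S⁻¹ ξᵢ = K ξᵢ`, as an algebra map to the opposite
algebra. -/
def antipodeInvOp : Nichols n →ₐ[ℂ] (Nichols n)ᵐᵒᵖ :=
  lift (op (K n)) (fun i => op (K n * xi i))
    (by rw [← op_mul, K_mul_K, op_one])
    (fun i => by rw [← op_mul, K_xi_mul_K_xi, xi_mul_self, neg_zero, op_zero])
    (fun i => by rw [← op_mul, ← op_mul, ← op_neg, K_xi_mul_K, K_mul_K_xi])
    (fun i j => by
      rw [← op_mul, ← op_mul, ← op_neg, K_xi_mul_K_xi, K_xi_mul_K_xi, xi_mul_xi])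

def antipodeLin : Nichols n →ₗ[ℂ] Nichols n :=
  (MulOpposite.opLinearEquiv ℂ).symm.toLinearMap ∘ₗ antipodeOp.toLinearMap

def antipodeInv : Nichols n →ₗ[ℂ] Nichols n :=
  (MulOpposite.opLinearEquiv ℂ).symm.toLinearMap ∘ₗ antipodeInvOp.toLinearMap

theorem antipodeLin_mul (a b : Nichols n) :
    antipodeLin (a * b) = antipodeLin b * antipodeLin a := by simp [antipodeLin]
@[simp] theorem antipodeLin_one : antipodeLin (1 : Nichols n) = 1 := by simp [antipodeLin]
@[simp] theorem antipodeLin_K : antipodeLin (K n) = K n := by simp [antipodeLin, antipodeOp]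
@[simp] theorem antipodeLin_xi (i : Fin n) : antipodeLin (xi i) = -(K n * xi i) := by
  simp [antipodeLin, antipodeOp]

theorem antipodeInv_mul (a b : Nichols n) :
    antipodeInv (a * b) = antipodeInv b * antipodeInv a := by simp [antipodeInv]
@[simp] theorem antipodeInv_one : antipodeInv (1 : Nichols n) = 1 := by simp [antipodeInv]
@[simp] theorem antipodeInv_K : antipodeInv (K n) = K n := by simp [antipodeInv, antipodeInvOp]
@[simp] theorem antipodeInv_xi (i : Fin n) : antipodeInv (xi i) = K n * xi i := by
  simp [antipodeInv, antipodeInvOp]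

theorem hopf_left_aux (h : Nichols n) (t : Nichols n ⊗[ℂ] Nichols n) :
    LinearMap.mul' ℂ _ (antipodeLin.rTensor _ (comul (R := ℂ) h * t)) =
      counit (R := ℂ) h • LinearMap.mul' ℂ _ (antipodeLin.rTensor _ t) := by
  let s : Subalgebra ℂ (Nichols n) :=
    { carrier := {h | ∀ t, LinearMap.mul' ℂ _ (antipodeLin.rTensor _ (comul (R := ℂ) h * t)) =
        counit (R := ℂ) h • LinearMap.mul' ℂ _ (antipodeLin.rTensor _ t)}
      mul_mem' := fun {a b} ha hb t => by
        rw [Bialgebra.comul_mul, mul_assoc, ha, hb, Bialgebra.counit_mul, mul_smul]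
      add_mem' := fun {a b} ha hb t => by
        rw [map_add, add_mul, map_add, map_add, ha, hb, map_add, add_smul]
      algebraMap_mem' := fun r t => by
        simp [Algebra.algebraMap_eq_smul_one] }
  have hs : s = ⊤ := by
    refine subalgebra_eq_top s (fun t => ?_) (fun i t => ?_)
    · induction t with
      | zero => simp
      | add a b ha hb => simp only [mul_add, map_add, smul_add, ha, hb]
      | tmul a b => 
        simp [antipodeLin_mul, mul_assoc]
        rw [← mul_assoc (K n), K_mul_K, one_mul]
    · induction t with
      | zero => simp
      | add a b ha hb => simp only [mul_add, map_add, smul_add, ha, hb]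
      | tmul a b =>
        simp [antipodeLin_mul, mul_assoc, add_mul]
  have : h ∈ s := by rw [hs]; trivial
  exact this t

theorem hopf_right_aux (h : Nichols n) (t : Nichols n ⊗[ℂ] Nichols n) :
    LinearMap.mul' ℂ _ (antipodeLin.lTensor _ (t * comul (R := ℂ) h)) =
      counit (R := ℂ) h • LinearMap.mul' ℂ _ (antipodeLin.lTensor _ t) := by
  let s : Subalgebra ℂ (Nichols n) :=
    { carrier := {h | ∀ t, LinearMap.mul' ℂ _ (antipodeLin.lTensor _ (t * comul (R := ℂ) h)) =
        counit (R := ℂ) h • LinearMap.mul' ℂ _ (antipodeLin.lTensor _ t)}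
      mul_mem' := fun {a b} ha hb t => by
        rw [Bialgebra.comul_mul, ← mul_assoc, hb, ha, Bialgebra.counit_mul, mul_comm, mul_smul]
      add_mem' := fun {a b} ha hb t => by
        rw [map_add, mul_add, map_add, map_add, ha, hb, map_add, add_smul]
      algebraMap_mem' := fun r t => by
        simp [Algebra.algebraMap_eq_smul_one] }
  have hs : s = ⊤ := by
    refine subalgebra_eq_top s (fun t => ?_) (fun i t => ?_)
    · induction t with
      | zero => simp
      | add a b ha hb => simp only [add_mul, map_add, smul_add, ha, hb]
      | tmul a b => 
        simp [antipodeLin_mul, mul_assoc]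
        rw [← mul_assoc (K n), K_mul_K, one_mul]
    · induction t with
      | zero => simp
      | add a b ha hb => simp only [add_mul, map_add, smul_add, ha, hb]
      | tmul a b =>
        simp [antipodeLin_mul, mul_assoc, mul_add]
        rw [← mul_assoc (K n) (K n), K_mul_K, one_mul, neg_add_cancel]
  have : h ∈ s := by rw [hs]; trivial
  exact this t

instance : HopfAlgebra ℂ (Nichols n) where
  antipode := antipodeLin
  mul_antipode_rTensor_comul := by
    ext h
    have := hopf_left_aux h 1
    rw [mul_one] at this
    simpa [Algebra.TensorProduct.one_def, Algebra.algebraMap_eq_smul_one] using this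
  mul_antipode_lTensor_comul := by
    ext h
    have := hopf_right_aux h 1
    rw [one_mul] at this
    simpa [Algebra.TensorProduct.one_def, Algebra.algebraMap_eq_smul_one] using this

theorem antipode_antipodeInv (a : Nichols n) : HopfAlgebra.antipode ℂ (antipodeInv a) = a := by
  change antipodeLin (antipodeInv a) = a
  have h : ∀ a : Nichols n, a ∈ ({
      carrier := {a | antipodeLin (antipodeInv a) = a}
      mul_mem' := fun {a b} (ha : _ = _) (hb : _ = _) => by
        simp only [Set.mem_ofPred_eq, antipodeInv_mul, antipodeLin_mul, ha, hb]
      add_mem' := fun {a b} (ha : _ = _) (hb : _ = _) => by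
        simp only [Set.mem_ofPred_eq, map_add, ha, hb]
      algebraMap_mem' := fun r => by
        simp [Algebra.algebraMap_eq_smul_one] } : Subalgebra ℂ (Nichols n)) := fun a => by
    refine mem_of_gens ?_ ?_ a
    · simp
    · intro i
      simp [antipodeLin_mul, K_xi_mul_K]
  exact h a

theorem antipodeInv_antipode (a : Nichols n) : antipodeInv (HopfAlgebra.antipode ℂ a) = a := by
  change antipodeInv (antipodeLin a) = a
  have h : ∀ a : Nichols n, a ∈ ({
      carrier := {a | antipodeInv (antipodeLin a) = a}
      mul_mem' := fun {a b} (ha : _ = _) (hb : _ = _) => by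
        simp only [Set.mem_ofPred_eq, antipodeInv_mul, antipodeLin_mul, ha, hb]
      add_mem' := fun {a b} (ha : _ = _) (hb : _ = _) => by
        simp only [Set.mem_ofPred_eq, map_add, ha, hb]
      algebraMap_mem' := fun r => by
        simp [Algebra.algebraMap_eq_smul_one] } : Subalgebra ℂ (Nichols n)) := fun a => by
    refine mem_of_gens ?_ ?_ a
    · simp
    · intro i
      simp [antipodeInv_mul, K_xi_mul_K]
  exact h a

/-! ### The basis `W ∪ KW` -/

/-- The word `ξ_{i₁} ⋯ ξ_{iₖ}`, `I = {i₁ < ⋯ < iₖ}`. -/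
def word (I : Finset (Fin n)) : Nichols n := orderedProd xi I

def basisVec (b : Fin 2 × Finset (Fin n)) : Nichols n := K n ^ (b.1 : ℕ) * word b.2

/-- `(-1)` to the number of elements of `I` below `i`. -/
def sgn (i : Fin n) (I : Finset (Fin n)) : ℂ := (-1) ^ (I.filter (· < i)).card

abbrev Model (n : ℕ) : Type := (Fin 2 × Finset (Fin n)) →₀ ℂ

def modelK : Module.End ℂ (Model n) :=
  Finsupp.lsum ℂ fun b => Finsupp.lsingle (b.1 + 1, b.2)

def modelXi (i : Fin n) : Module.End ℂ (Model n) :=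
  Finsupp.lsum ℂ fun b => if i ∈ b.2 then 0 else
    ((-1) ^ (b.1 : ℕ) * sgn i b.2) • Finsupp.lsingle (b.1, insert i b.2)

theorem modelK_single (b : Fin 2 × Finset (Fin n)) (c : ℂ) :
    modelK (Finsupp.single b c) = Finsupp.single (b.1 + 1, b.2) c := by
  simp [modelK]

theorem modelXi_single (i : Fin n) (b : Fin 2 × Finset (Fin n)) (c : ℂ) :
    modelXi i (Finsupp.single b c) = if i ∈ b.2 then 0 else
      Finsupp.single (b.1, insert i b.2) ((-1) ^ (b.1 : ℕ) * sgn i b.2 * c) := by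
  simp only [modelXi, Finsupp.lsum_single]
  split_ifs <;> simp

theorem sgn_insert {i j : Fin n} {I : Finset (Fin n)} (hj : j ∉ I) :
    sgn i (insert j I) = if j < i then -sgn i I else sgn i I := by
  simp only [sgn, Finset.filter_insert]
  split_ifs with h
  · rw [Finset.card_insert_of_notMem (by simp [hj]), pow_succ, mul_neg_one]
  · rfl

theorem model_ext {f g : Module.End ℂ (Model n)}
    (h : ∀ b, f (Finsupp.single b 1) = g (Finsupp.single b 1)) : f = g :=
  Finsupp.lhom_ext' fun b => LinearMap.ext_ring (h b)

def toModel : Nichols n →ₐ[ℂ] Module.End ℂ (Model n) :=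
  lift modelK modelXi
    (model_ext fun b => by
      rcases b with ⟨a, I⟩
      rw [Module.End.mul_apply, modelK_single, modelK_single]
      have : a + 1 + 1 = a := by fin_cases a <;> rfl
      simp [this])
    (fun i => model_ext fun b => by
      rw [Module.End.mul_apply, modelXi_single]
      split_ifs with h
      · simp
      · rw [modelXi_single]; simp)
    (fun i => model_ext fun b => by
      rcases b with ⟨a, I⟩
      rw [Module.End.mul_apply, LinearMap.neg_apply, Module.End.mul_apply, modelK_single,
        modelXi_single, modelXi_single]
      by_cases h : i ∈ I
      · simp [h]
      · rw [if_neg h, if_neg h, modelK_single, ← Finsupp.single_neg]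
        congr 1
        fin_cases a <;> simp)
    (fun i j => model_ext fun b => by
      rcases b with ⟨a, I⟩
      rw [Module.End.mul_apply, LinearMap.neg_apply, Module.End.mul_apply,
        modelXi_single, modelXi_single]
      by_cases hij : i = j
      · subst hij
        by_cases h : i ∈ I
        · simp [h]
        · rw [if_neg h, modelXi_single, if_pos (Finset.mem_insert_self _ _), neg_zero]
      by_cases h : i ∈ I
      · by_cases h' : j ∈ I
        · simp [h, h']
        · rw [if_pos h, if_neg h', modelXi_single, if_pos (Finset.mem_insert_of_mem h), map_zero,
            neg_zero]
      · by_cases h' : j ∈ I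
        · rw [if_pos h', if_neg h, modelXi_single, if_pos (Finset.mem_insert_of_mem h'), map_zero,
            neg_zero]
        · rw [if_neg h, if_neg h', modelXi_single, modelXi_single,
            if_neg (by simp [hij, h]), if_neg (by simp [Ne.symm hij, h']), ← Finsupp.single_neg,
            Finset.insert_comm i j]
          congr 1
          simp only [sgn_insert h, sgn_insert h']
          rcases lt_or_gt_of_ne hij with h1 | h1
          · simp only [h1, not_lt_of_gt h1, if_true, if_false]; ring
          · simp only [h1, not_lt_of_gt h1, if_true, if_false]; ring)

@[simp] theorem toModel_K : toModel (K n) = modelK := by simp [toModel]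
@[simp] theorem toModel_xi (i : Fin n) : toModel (xi i) = modelXi i := by simp [toModel]

theorem toModel_word_aux (I : Finset (Fin n)) (l : List (Fin n)) (hl : l.Pairwise (· < ·)) :
    toModel ((l.map fun i => if i ∈ I then xi i else 1).prod) (Finsupp.single (0, ∅) 1) =
      Finsupp.single (0, I.filter (· ∈ l)) 1 := by
  induction l with
  | nil => simp
  | cons j l ih =>
    rw [List.pairwise_cons] at hl
    rw [List.map_cons, List.prod_cons, map_mul, Module.End.mul_apply, ih hl.2]
    have hjl : j ∉ l := fun h => lt_irrefl _ (hl.1 j h)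
    by_cases h : j ∈ I
    · have h0 : (I.filter (· ∈ l)).filter (· < j) = ∅ := by
        ext k
        simp only [Finset.mem_filter, Finset.notMem_empty, iff_false, not_and, and_imp]
        intro _ hk
        exact not_lt_of_gt (hl.1 k hk)
      have h1 : insert j (I.filter (· ∈ l)) = I.filter (· ∈ j :: l) := by
        ext k
        simp only [Finset.mem_insert, Finset.mem_filter, List.mem_cons]
        constructor
        · rintro (rfl | ⟨h2, h3⟩)
          · exact ⟨h, Or.inl rfl⟩
          · exact ⟨h2, Or.inr h3⟩
        · rintro ⟨h2, rfl | h3⟩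
          · exact Or.inl rfl
          · exact Or.inr ⟨h2, h3⟩
      rw [if_pos h, toModel_xi, modelXi_single, if_neg (by simp [hjl]), h1]
      simp [sgn, h0]
    · rw [if_neg h, map_one, Module.End.one_apply]
      congr 2
      ext k
      simp only [Finset.mem_filter, List.mem_cons]
      refine and_congr_right fun hk => ⟨Or.inr, ?_⟩
      rintro (rfl | h3)
      · exact absurd hk h
      · exact h3

theorem toModel_basisVec (b : Fin 2 × Finset (Fin n)) :
    toModel (basisVec b) (Finsupp.single (0, ∅) 1) = Finsupp.single b 1 := by
  rcases b with ⟨a, I⟩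
  rw [basisVec, map_mul, Module.End.mul_apply, word, orderedProd,
    toModel_word_aux _ _ (List.pairwise_lt_finRange n)]
  simp only [List.mem_finRange, Finset.filter_true, map_pow, toModel_K]
  fin_cases a
  · simp
  · simp [modelK_single]

theorem linearIndependent_basisVec : LinearIndependent ℂ (basisVec (n := n)) := by
  apply LinearIndependent.of_comp
    ((LinearMap.applyₗ (Finsupp.single (0, ∅) 1 : Model n)) ∘ₗ toModel.toLinearMap)
  have : ⇑((LinearMap.applyₗ (Finsupp.single (0, ∅) 1 : Model n)) ∘ₗ toModel.toLinearMap) ∘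
      basisVec (n := n) = fun b => Finsupp.single b (1 : ℂ) := by
    funext b
    exact toModel_basisVec b
  rw [this]
  exact Finsupp.basisSingleOne.linearIndependent

theorem xi_mul_word_aux (I : Finset (Fin n)) (i : Fin n) (l : List (Fin n)) (hi : i ∈ l)
    (hl : l.Nodup) : ∃ c : ℂ, xi i * (l.map fun j => if j ∈ I then xi j else 1).prod =
      c • (l.map fun j => if j ∈ insert i I then xi j else 1).prod := by
  induction l with
  | nil => simp at hi
  | cons j l ih =>
    rw [List.nodup_cons] at hl
    simp only [List.map_cons, List.prod_cons]
    by_cases hij : j = i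
    · subst hij
      have h1 : (l.map fun k => if k ∈ insert j I then xi k else 1) =
          l.map fun k => if k ∈ I then xi k else 1 := by
        apply List.map_congr_left
        intro k hk
        have : k ≠ j := fun h => hl.1 (h ▸ hk)
        simp [this]
      by_cases h : j ∈ I
      · exact ⟨0, by rw [if_pos h, ← mul_assoc, xi_mul_self, zero_mul, zero_smul]⟩
      · exact ⟨1, by rw [if_neg h, one_mul, h1, if_pos (Finset.mem_insert_self _ _), one_smul]⟩
    · obtain ⟨c, hc⟩ := ih ((List.mem_cons.1 hi).resolve_left (Ne.symm hij)) hl.2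
      by_cases h : j ∈ I
      · refine ⟨-c, ?_⟩
        rw [if_pos h, if_pos (Finset.mem_insert_of_mem h), ← mul_assoc, xi_mul_xi, neg_mul,
          mul_assoc, hc, mul_smul_comm, neg_smul]
      · refine ⟨c, ?_⟩
        rw [if_neg h, if_neg (by simp [hij, h]), one_mul, one_mul, hc]

theorem span_basisVec : Submodule.span ℂ (Set.range (basisVec (n := n))) = ⊤ := by
  set s := Submodule.span ℂ (Set.range (basisVec (n := n))) with hs
  let A : Subalgebra ℂ (Nichols n) :=
    { carrier := {a | ∀ x ∈ s, a * x ∈ s}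
      mul_mem' := fun {a b} ha hb x hx => by rw [mul_assoc]; exact ha _ (hb _ hx)
      add_mem' := fun {a b} ha hb x hx => by rw [add_mul]; exact s.add_mem (ha _ hx) (hb _ hx)
      algebraMap_mem' := fun r x hx => by
        rw [Algebra.algebraMap_eq_smul_one, smul_mul_assoc, one_mul]
        exact s.smul_mem _ hx }
  have key : ∀ a : Nichols n, (∀ b, a * basisVec b ∈ s) → a ∈ A := by
    intro a ha x hx
    induction hx using Submodule.span_induction with
    | mem x hx => obtain ⟨b, rfl⟩ := hx; exact ha b
    | zero => simp
    | add x y _ _ h1 h2 => rw [mul_add]; exact s.add_mem h1 h2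
    | smul c x _ h => rw [mul_smul_comm]; exact s.smul_mem _ h
  have hmem : ∀ b : Fin 2 × Finset (Fin n), basisVec b ∈ s := fun b =>
    Submodule.subset_span ⟨b, rfl⟩
  have hA : A = ⊤ := by
    refine subalgebra_eq_top A (key _ ?_) (fun i => key _ ?_)
    · rintro ⟨a, I⟩
      have : K n * basisVec (a, I) = basisVec (a + 1, I) := by
        fin_cases a
        · simp [basisVec]
        · simp [basisVec, ← mul_assoc, K_mul_K]
      rw [this]
      exact hmem _
    · rintro ⟨a, I⟩
      obtain ⟨c, hc⟩ := xi_mul_word_aux I i (List.finRange n) (List.mem_finRange i)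
        (List.nodup_finRange n)
      have hc' : xi i * word I = c • word (insert i I) := hc
      fin_cases a
      · simp only [basisVec, pow_zero, one_mul, hc']
        exact s.smul_mem _ (by simpa [basisVec] using hmem (0, insert i I))
      · have : xi i * K n = -(K n * xi i) := by rw [K_mul_xi, neg_neg]
        simp only [basisVec, pow_one]
        rw [← mul_assoc, this, neg_mul, mul_assoc, hc', mul_smul_comm]
        exact s.neg_mem (s.smul_mem _ (by simpa [basisVec] using hmem (1, insert i I)))
  have h1 : (1 : Nichols n) ∈ s := by
    have := hmem (0, ∅)
    simpa [basisVec, word, orderedProd] using this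
  rw [eq_top_iff]
  rintro a -
  have ha : a ∈ A := by rw [hA]; trivial
  simpa using ha 1 h1

/-- The basis `B = W ∪ KW`; the pair `(a, I)` stands for `Kᵃ ξ_{i₁} ⋯ ξ_{iₖ}`. -/
def basis (n : ℕ) : Module.Basis (Fin 2 × Finset (Fin n)) ℂ (Nichols n) :=
  Module.Basis.mk linearIndependent_basisVec span_basisVec.ge

theorem basis_apply (b : Fin 2 × Finset (Fin n)) : basis n b = K n ^ (b.1 : ℕ) * word b.2 :=
  Module.Basis.mk_apply _ _ _

instance : Module.Finite ℂ (Nichols n) := Module.Finite.of_basis (basis n)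

end Nichols

/-! ## The Drinfeld double -/

namespace Nichols

variable {n : ℕ}

open Coalgebra

/-- The convolution product of `𝒦ₙ*`: `(φψ)(x) = φ(x₍₁₎) ψ(x₍₂₎)`. -/
def dualMul : Module.Dual ℂ (Nichols n) →ₗ[ℂ] Module.Dual ℂ (Nichols n) →ₗ[ℂ]
    Module.Dual ℂ (Nichols n) :=
  (TensorProduct.mk ℂ _ _).compr₂
    ((comul (R := ℂ) (A := Nichols n)).dualMap ∘ₗ
      TensorProduct.dualDistrib ℂ (Nichols n) (Nichols n))

/-- `x ↦ φ (c x a)`. -/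
def sandwich (c a : Nichols n) : Module.End ℂ (Module.Dual ℂ (Nichols n)) :=
  (LinearMap.mulLeft ℂ c ∘ₗ LinearMap.mulRight ℂ a).dualMap

/-- The operator `φ ⊗ h ↦ φ(S⁻¹(c) - a) ⊗ b h` on `𝒦ₙ* ⊗ 𝒦ₙ`, linear in `a ⊗ (b ⊗ c)`. -/
def crossOp : Nichols n ⊗[ℂ] (Nichols n ⊗[ℂ] Nichols n) →ₗ[ℂ]
    Module.End ℂ (Module.Dual ℂ (Nichols n) ⊗[ℂ] Nichols n) :=
  TensorProduct.lift
    { toFun := fun a => TensorProduct.lift (LinearMap.mk₂ ℂ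
        (fun b c => TensorProduct.map (sandwich (antipodeInv c) a) (LinearMap.mulLeft ℂ b))
        (fun b b' c => by ext; simp [add_mul, TensorProduct.tmul_add])
        (fun r b c => by ext; simp)
        (fun b c c' => by
          have h : sandwich (antipodeInv (c + c')) a =
              sandwich (antipodeInv c) a + sandwich (antipodeInv c') a := by
            ext; simp [sandwich, add_mul]
          rw [h, TensorProduct.map_add_left])
        (fun r b c => by
          have h : sandwich (antipodeInv (r • c)) a = r • sandwich (antipodeInv c) a := by
            ext; simp [sandwich]
          rw [h, TensorProduct.map_smul_left]))
      map_add' := fun a a' => by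
        ext b c : 3
        have h : sandwich (antipodeInv c) (a + a') =
            sandwich (antipodeInv c) a + sandwich (antipodeInv c) a' := by
          ext; simp [sandwich, mul_add]
        simp [h, TensorProduct.map_add_left]
      map_smul' := fun r a => by
        ext b c : 3
        have h : sandwich (antipodeInv c) (r • a) = r • sandwich (antipodeInv c) a := by
          ext; simp [sandwich]
        simp [h, TensorProduct.map_smul_left] }

/-- The operator `φ ⊗ h' ↦ φ(S⁻¹(h₍₃₎) - h₍₁₎) ⊗ h₍₂₎ h'` on `𝒦ₙ* ⊗ 𝒦ₙ`. -/
def opH : Nichols n →ₗ[ℂ] Module.End ℂ (Module.Dual ℂ (Nichols n) ⊗[ℂ] Nichols n) :=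
  crossOp ∘ₗ (comul (R := ℂ)).lTensor (Nichols n) ∘ₗ comul (R := ℂ)

/-- The operator `φ' ⊗ h ↦ φφ' ⊗ h` on `𝒦ₙ* ⊗ 𝒦ₙ`. -/
def opDual : Module.Dual ℂ (Nichols n) →ₗ[ℂ]
    Module.End ℂ (Module.Dual ℂ (Nichols n) ⊗[ℂ] Nichols n) :=
  (LinearMap.rTensorHom (Nichols n)) ∘ₗ dualMul

/-- The multiplication of the Drinfeld double on `𝒦ₙ* ⊗ 𝒦ₙ`:
`(φ ⊗ h)(φ' ⊗ h') = φ φ'(S⁻¹(h₍₃₎) - h₍₁₎) ⊗ h₍₂₎ h'`. -/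
def doubleMul : Module.Dual ℂ (Nichols n) ⊗[ℂ] Nichols n →ₗ[ℂ]
    Module.End ℂ (Module.Dual ℂ (Nichols n) ⊗[ℂ] Nichols n) :=
  TensorProduct.lift ((LinearMap.mul ℂ (Module.End ℂ _)).compl₁₂ opDual opH)

theorem dualMul_apply (φ ψ : Module.Dual ℂ (Nichols n)) (x : Nichols n) :
    dualMul φ ψ x = TensorProduct.dualDistrib ℂ _ _ (φ ⊗ₜ ψ) (comul (R := ℂ) x) := rfl

theorem sandwich_apply (c a : Nichols n) (φ : Module.Dual ℂ (Nichols n)) (x : Nichols n) :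
    sandwich c a φ x = φ (c * (x * a)) := rfl

theorem dualMul_eq_conv (φ ψ : Module.Dual ℂ (Nichols n)) :
    dualMul φ ψ = (WithConv.toConv φ * WithConv.toConv ψ).ofConv := by
  have h : ∀ t : Nichols n ⊗[ℂ] Nichols n, TensorProduct.dualDistrib ℂ _ _ (φ ⊗ₜ ψ) t =
      LinearMap.mul' ℂ ℂ (TensorProduct.map φ ψ t) := fun t => by
    induction t with
    | zero => simp
    | add a b ha hb => rw [map_add, ha, hb, map_add, map_add]
    | tmul a b => simp
  exact LinearMap.ext fun x => h _

theorem dualMul_assoc (φ ψ χ : Module.Dual ℂ (Nichols n)) :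
    dualMul (dualMul φ ψ) χ = dualMul φ (dualMul ψ χ) := by
  simp only [dualMul_eq_conv, WithConv.toConv_ofConv, mul_assoc]

theorem counit_dualMul (φ : Module.Dual ℂ (Nichols n)) : dualMul (counit (R := ℂ)) φ = φ := by
  have h : WithConv.toConv (counit (R := ℂ) (A := Nichols n)) = 1 := rfl
  rw [dualMul_eq_conv, h, one_mul]

theorem dualMul_counit (φ : Module.Dual ℂ (Nichols n)) : dualMul φ (counit (R := ℂ)) = φ := by
  have h : WithConv.toConv (counit (R := ℂ) (A := Nichols n)) = 1 := rfl
  rw [dualMul_eq_conv, h, mul_one]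

theorem dualDistrib_sandwich (φ ψ : Module.Dual ℂ (Nichols n)) (c c' a a' : Nichols n)
    (t : Nichols n ⊗[ℂ] Nichols n) :
    TensorProduct.dualDistrib ℂ _ _ (φ ⊗ₜ ψ) ((c ⊗ₜ c') * (t * (a ⊗ₜ a'))) =
      TensorProduct.dualDistrib ℂ _ _ (sandwich c a φ ⊗ₜ sandwich c' a' ψ) t := by
  induction t with
  | zero => simp
  | add x y hx hy => rw [add_mul, mul_add, map_add, hx, hy, map_add]
  | tmul x y => simp [sandwich_apply]

theorem crossOp_tmul (a b c h : Nichols n) (φ : Module.Dual ℂ (Nichols n)) :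
    crossOp (a ⊗ₜ (b ⊗ₜ c)) (φ ⊗ₜ h) = sandwich (antipodeInv c) a φ ⊗ₜ (b * h) := by
  simp [crossOp]

theorem crossOp_mul (s t : Nichols n ⊗[ℂ] (Nichols n ⊗[ℂ] Nichols n)) :
    crossOp (s * t) = crossOp s * crossOp t := by
  induction s with
  | zero => simp
  | add x y hx hy => rw [add_mul, map_add, hx, hy, map_add, add_mul]
  | tmul a bc =>
    induction bc with
    | zero => simp
    | add x y hx hy => rw [TensorProduct.tmul_add, add_mul, map_add, hx, hy, map_add, add_mul]
    | tmul b c =>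
      induction t with
      | zero => simp
      | add x y hx hy => rw [mul_add, map_add, hx, hy, map_add, mul_add]
      | tmul a' bc' =>
        induction bc' with
        | zero => simp
        | add x y hx hy =>
          rw [TensorProduct.tmul_add, mul_add, map_add, hx, hy, map_add, mul_add]
        | tmul b' c' =>
          refine TensorProduct.ext' fun φ h => ?_
          simp only [Algebra.TensorProduct.tmul_mul_tmul, Module.End.mul_apply, crossOp_tmul,
            antipodeInv_mul, mul_assoc]
          congr 1
          ext x
          simp only [sandwich_apply, mul_assoc]

theorem opH_mul (h h' : Nichols n) : opH (h * h') = opH h * opH h' := by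
  have key : ∀ s t : Nichols n ⊗[ℂ] Nichols n, (comul (R := ℂ)).lTensor (Nichols n) (s * t) =
      (comul (R := ℂ)).lTensor (Nichols n) s * (comul (R := ℂ)).lTensor (Nichols n) t :=
    fun s t => map_mul (Algebra.TensorProduct.map (AlgHom.id ℂ (Nichols n))
      (Bialgebra.comulAlgHom ℂ (Nichols n))) s t
  simp only [opH, LinearMap.comp_apply, Bialgebra.comul_mul, key, crossOp_mul]

theorem opH_one : opH (1 : Nichols n) = 1 := by
  refine TensorProduct.ext' fun φ h => ?_
  simp only [opH, LinearMap.comp_apply, Bialgebra.comul_one, Algebra.TensorProduct.one_def,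
    LinearMap.lTensor_tmul, crossOp_tmul, antipodeInv_one, one_mul, Module.End.one_apply]
  congr 1
  ext x
  simp [sandwich_apply]

theorem opH_K (φ : Module.Dual ℂ (Nichols n)) (h : Nichols n) :
    opH (K n) (φ ⊗ₜ h) = sandwich (K n) (K n) φ ⊗ₜ (K n * h) := by
  simp [opH, crossOp_tmul]

theorem opH_xi (i : Fin n) (φ : Module.Dual ℂ (Nichols n)) (h : Nichols n) :
    opH (xi i) (φ ⊗ₜ h) = sandwich (K n * xi i) (K n) φ ⊗ₜ (K n * h) +
      sandwich 1 (K n) φ ⊗ₜ (xi i * h) + sandwich 1 (xi i) φ ⊗ₜ h := by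
  simp [opH, crossOp_tmul, TensorProduct.tmul_add, Algebra.TensorProduct.one_def]

theorem opDual_tmul (φ ψ : Module.Dual ℂ (Nichols n)) (h : Nichols n) :
    opDual φ (ψ ⊗ₜ h) = dualMul φ ψ ⊗ₜ h := by
  simp [opDual]

theorem opDual_mul (φ ψ : Module.Dual ℂ (Nichols n)) :
    opDual (dualMul φ ψ) = opDual φ * opDual ψ := by
  refine TensorProduct.ext' fun χ h => ?_
  simp only [Module.End.mul_apply, opDual_tmul, dualMul_assoc]

theorem doubleMul_tmul (φ : Module.Dual ℂ (Nichols n)) (h : Nichols n) :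
    doubleMul (φ ⊗ₜ h) = opDual φ * opH h := by
  simp [doubleMul]

theorem opH_K_opDual (φ : Module.Dual ℂ (Nichols n)) :
    opH (K n) * opDual φ = opDual (sandwich (K n) (K n) φ) * opH (K n) := by
  refine TensorProduct.ext' fun ψ h => ?_
  simp only [Module.End.mul_apply, opDual_tmul, opH_K]
  congr 1
  ext x
  rw [sandwich_apply, dualMul_apply, Bialgebra.comul_mul, Bialgebra.comul_mul, comul_K,
    dualDistrib_sandwich, ← dualMul_apply]

theorem opH_xi_opDual (i : Fin n) (φ : Module.Dual ℂ (Nichols n)) :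
    opH (xi i) * opDual φ = opDual (sandwich (K n * xi i) (K n) φ) * opH (K n) +
      opDual (sandwich 1 (K n) φ) * opH (xi i) + opDual (sandwich 1 (xi i) φ) := by
  have one_eq : (1 : Nichols n ⊗[ℂ] Nichols n) = 1 ⊗ₜ 1 := rfl
  have h0 : ∀ ψ : Module.Dual ℂ (Nichols n), sandwich 1 1 ψ = ψ := fun ψ => by
    ext x; simp [sandwich_apply]
  refine TensorProduct.ext' fun ψ h => ?_
  have h1 : sandwich (K n * xi i) (K n) (dualMul φ ψ) =
      dualMul (sandwich 1 (K n) φ) (sandwich (K n * xi i) (K n) ψ) +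
        dualMul (sandwich (K n * xi i) (K n) φ) (sandwich (K n) (K n) ψ) := by
    ext x
    rw [sandwich_apply, dualMul_apply, Bialgebra.comul_mul, Bialgebra.comul_mul,
      Bialgebra.comul_mul, comul_K, comul_xi, mul_add, add_mul, map_add]
    simp only [Algebra.TensorProduct.tmul_mul_tmul, K_mul_K, mul_one, dualDistrib_sandwich]
    rfl
  have h2 : sandwich 1 (K n) (dualMul φ ψ) =
      dualMul (sandwich 1 (K n) φ) (sandwich 1 (K n) ψ) := by
    ext x
    rw [sandwich_apply, dualMul_apply, Bialgebra.comul_mul, Bialgebra.comul_mul, comul_K,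
      Bialgebra.comul_one, one_eq, dualDistrib_sandwich]
    rfl
  have h3 : sandwich 1 (xi i) (dualMul φ ψ) =
      dualMul (sandwich 1 (K n) φ) (sandwich 1 (xi i) ψ) +
        dualMul (sandwich 1 (xi i) φ) ψ := by
    ext x
    rw [sandwich_apply, dualMul_apply, Bialgebra.comul_mul, Bialgebra.comul_mul, comul_xi,
      Bialgebra.comul_one, one_eq, mul_add, mul_add, map_add, dualDistrib_sandwich,
      dualDistrib_sandwich, h0]
    rfl
  simp only [Module.End.mul_apply, LinearMap.add_apply, opDual_tmul, opH_K, opH_xi, map_add,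
    h1, h2, h3, TensorProduct.add_tmul]
  abel

theorem doubleMul_opDual (φ : Module.Dual ℂ (Nichols n))
    (z : Module.Dual ℂ (Nichols n) ⊗[ℂ] Nichols n) :
    doubleMul (opDual φ z) = opDual φ * doubleMul z := by
  induction z with
  | zero => simp
  | add x y hx hy => rw [map_add, map_add, hx, hy, map_add, mul_add]
  | tmul ψ h => rw [opDual_tmul, doubleMul_tmul, doubleMul_tmul, opDual_mul, mul_assoc]

theorem doubleMul_opH (h : Nichols n) (z : Module.Dual ℂ (Nichols n) ⊗[ℂ] Nichols n) :
    doubleMul (opH h z) = opH h * doubleMul z := by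
  have key : ∀ h : Nichols n, h ∈ ({
      carrier := {h | ∀ z, doubleMul (opH h z) = opH h * doubleMul z}
      mul_mem' := fun {a b} ha hb z => by
        rw [opH_mul, Module.End.mul_apply, ha, hb, mul_assoc]
      add_mem' := fun {a b} ha hb z => by
        rw [map_add, LinearMap.add_apply, map_add, ha, hb, add_mul]
      algebraMap_mem' := fun r z => by
        simp [Algebra.algebraMap_eq_smul_one, opH_one] } : Subalgebra ℂ (Nichols n)) := by
    refine mem_of_gens (fun z => ?_) (fun i z => ?_)
    · induction z with
      | zero => simp
      | add x y hx hy => rw [map_add, map_add, hx, hy, map_add, mul_add]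
      | tmul ψ g =>
        rw [opH_K, doubleMul_tmul, doubleMul_tmul, opH_mul, ← mul_assoc, ← mul_assoc,
          opH_K_opDual]
    · induction z with
      | zero => simp
      | add x y hx hy => rw [map_add, map_add, hx, hy, map_add, mul_add]
      | tmul ψ g =>
        rw [opH_xi, map_add, map_add, doubleMul_tmul, doubleMul_tmul, doubleMul_tmul,
          doubleMul_tmul, opH_mul, opH_mul, ← mul_assoc, ← mul_assoc, ← mul_assoc, opH_xi_opDual,
          add_mul, add_mul]
  exact key h z

theorem doubleMul_doubleMul (x y : Module.Dual ℂ (Nichols n) ⊗[ℂ] Nichols n) :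
    doubleMul (doubleMul x y) = doubleMul x * doubleMul y := by
  induction x with
  | zero => simp
  | add a b ha hb => rw [map_add, LinearMap.add_apply, map_add, ha, hb, add_mul]
  | tmul φ h =>
    rw [doubleMul_tmul, Module.End.mul_apply, doubleMul_opDual, doubleMul_opH, mul_assoc]

theorem doubleMul_one_left :
    doubleMul ((counit (R := ℂ) : Module.Dual ℂ (Nichols n)) ⊗ₜ (1 : Nichols n)) = 1 := by
  refine TensorProduct.ext' fun φ h => ?_
  rw [doubleMul_tmul, opH_one, mul_one, opDual_tmul, counit_dualMul, Module.End.one_apply]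

theorem opH_counit (h g : Nichols n) :
    opH h ((counit (R := ℂ) : Module.Dual ℂ (Nichols n)) ⊗ₜ g) = counit (R := ℂ) ⊗ₜ (h * g) := by
  have key : ∀ h : Nichols n, h ∈ ({
      carrier := {h | ∀ g, opH h ((counit (R := ℂ) : Module.Dual ℂ (Nichols n)) ⊗ₜ g) =
        counit (R := ℂ) ⊗ₜ (h * g)}
      mul_mem' := fun {a b} ha hb z => by
        rw [opH_mul, Module.End.mul_apply, hb, ha, mul_assoc]
      add_mem' := fun {a b} ha hb z => by
        rw [map_add, LinearMap.add_apply, ha, hb, add_mul, TensorProduct.tmul_add]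
      algebraMap_mem' := fun r z => by
        simp [Algebra.algebraMap_eq_smul_one, opH_one] } : Subalgebra ℂ (Nichols n)) := by
    refine mem_of_gens (fun g => ?_) (fun i g => ?_)
    · rw [opH_K]
      congr 1
      ext x
      simp [sandwich_apply]
    · have h1 : sandwich (K n * xi i) (K n) (counit (R := ℂ)) = 0 := by
        ext x; simp [sandwich_apply]
      have h2 : sandwich 1 (K n) (counit (R := ℂ)) = counit (R := ℂ) := by
        ext x; simp [sandwich_apply]
      have h3 : sandwich 1 (xi i) (counit (R := ℂ)) = 0 := by
        ext x; simp [sandwich_apply]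
      rw [opH_xi, h1, h2, h3]
      simp
  exact key h g

theorem doubleMul_one_right (x : Module.Dual ℂ (Nichols n) ⊗[ℂ] Nichols n) :
    doubleMul x (counit (R := ℂ) ⊗ₜ 1) = x := by
  induction x with
  | zero => simp
  | add a b ha hb => rw [map_add, LinearMap.add_apply, ha, hb]
  | tmul φ h =>
    rw [doubleMul_tmul, Module.End.mul_apply, opH_counit, opDual_tmul, mul_one, dualMul_counit]

end Nichols

/-- The Drinfeld double `D𝒦ₙ = 𝒦ₙ*ᶜᵒᵖ ⋈ 𝒦ₙ`, with underlying space `𝒦ₙ* ⊗ 𝒦ₙ`. -/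
def NicholsDouble (n : ℕ) : Type := Module.Dual ℂ (Nichols n) ⊗[ℂ] Nichols n

namespace NicholsDouble

open Coalgebra

variable {n : ℕ}

instance : AddCommGroup (NicholsDouble n) :=
  inferInstanceAs (AddCommGroup (Module.Dual ℂ (Nichols n) ⊗[ℂ] Nichols n))

instance : Module ℂ (NicholsDouble n) :=
  inferInstanceAs (Module ℂ (Module.Dual ℂ (Nichols n) ⊗[ℂ] Nichols n))

/-- The identification of `D𝒦ₙ` with `𝒦ₙ* ⊗ 𝒦ₙ` as a vector space. -/
def equiv (n : ℕ) : NicholsDouble n ≃ₗ[ℂ] Module.Dual ℂ (Nichols n) ⊗[ℂ] Nichols n :=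
  LinearEquiv.refl ℂ _

/-- The element `φ ⊗ h`. -/
def tmul (φ : Module.Dual ℂ (Nichols n)) (h : Nichols n) : NicholsDouble n :=
  (equiv n).symm (φ ⊗ₜ h)

instance : Mul (NicholsDouble n) :=
  ⟨fun x y => (equiv n).symm (Nichols.doubleMul (equiv n x) (equiv n y))⟩

instance : One (NicholsDouble n) := ⟨tmul (counit (R := ℂ)) 1⟩

instance : Ring (NicholsDouble n) where
  __ := (inferInstance : AddCommGroup (NicholsDouble n))
  left_distrib x y z := map_add (Nichols.doubleMul (equiv n x)) _ _
  right_distrib x y z :=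
    congrArg (fun f => f (equiv n z)) (map_add Nichols.doubleMul (equiv n x) (equiv n y))
  zero_mul x := congrArg (fun f => f (equiv n x)) (map_zero Nichols.doubleMul)
  mul_zero x := map_zero (Nichols.doubleMul (equiv n x))
  mul_assoc x y z :=
    congrArg (fun f => f (equiv n z)) (Nichols.doubleMul_doubleMul (equiv n x) (equiv n y))
  one_mul x := congrArg (fun f => f (equiv n x)) Nichols.doubleMul_one_left
  mul_one x := Nichols.doubleMul_one_right (equiv n x)

theorem mul_def (x y : NicholsDouble n) :
    x * y = (equiv n).symm (Nichols.doubleMul (equiv n x) (equiv n y)) := rfl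

theorem one_def : (1 : NicholsDouble n) = tmul (counit (R := ℂ)) 1 := rfl

instance : Algebra ℂ (NicholsDouble n) :=
  Algebra.ofModule
    (fun r x y => congrArg (fun f => f (equiv n y)) (map_smul Nichols.doubleMul r (equiv n x)))
    (fun r x y => map_smul (Nichols.doubleMul (equiv n x)) r (equiv n y))

instance : Module.Finite ℂ (NicholsDouble n) :=
  inferInstanceAs (Module.Finite ℂ (Module.Dual ℂ (Nichols n) ⊗[ℂ] Nichols n))

/-! ### Generators and Hopf algebra structure maps -/

/-- `h ↦ ε ⊗ h`. -/
def ofHopf : Nichols n →ₗ[ℂ] NicholsDouble n :=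
  (equiv n).symm.toLinearMap ∘ₗ TensorProduct.mk ℂ _ _ (counit (R := ℂ))

/-- `φ ↦ φ ⊗ 1`. -/
def ofDual : Module.Dual ℂ (Nichols n) →ₗ[ℂ] NicholsDouble n :=
  (equiv n).symm.toLinearMap ∘ₗ (TensorProduct.mk ℂ _ _).flip 1

def K (n : ℕ) : NicholsDouble n := ofHopf (Nichols.K n)

def xi (i : Fin n) : NicholsDouble n := ofHopf (Nichols.xi i)

/-- `K̄ = 1* - K*`. -/
def Kbar (n : ℕ) : NicholsDouble n :=
  ofDual ((Nichols.basis n).coord (0, ∅) - (Nichols.basis n).coord (1, ∅))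

/-- `ξ̄ᵢ = ξᵢ* + (K ξᵢ)*`. -/
def xibar (i : Fin n) : NicholsDouble n :=
  ofDual ((Nichols.basis n).coord (0, {i}) + (Nichols.basis n).coord (1, {i}))

/-- The word `w = ξ_{i₁} ⋯ ξ_{iₖ}` for `I = {i₁ < ⋯ < iₖ}`. -/
def word (I : Finset (Fin n)) : NicholsDouble n := orderedProd xi I

/-- The word `w̄ = ξ̄_{i₁} ⋯ ξ̄_{iₖ}` for `I = {i₁ < ⋯ < iₖ}`. -/
def wordBar (I : Finset (Fin n)) : NicholsDouble n := orderedProd xibar I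

/-- `ξ₁ ⋯ ξₙ ξ̄₁ ⋯ ξ̄ₙ`. -/
def top (n : ℕ) : NicholsDouble n := word Finset.univ * wordBar Finset.univ

/-- The comultiplication of `𝒦ₙ*`, dual to the multiplication of `𝒦ₙ`:
`φ(xy) = φ₍₁₎(x) φ₍₂₎(y)`. -/
def dualComul : Module.Dual ℂ (Nichols n) →ₗ[ℂ]
    Module.Dual ℂ (Nichols n) ⊗[ℂ] Module.Dual ℂ (Nichols n) :=
  (TensorProduct.dualDistribEquivOfBasis (Nichols.basis n) (Nichols.basis n)).symm.toLinearMap ∘ₗ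
    (LinearMap.mul' ℂ (Nichols n)).dualMap

/-- The comultiplication of the double, `Δ(φ ⊗ h) = (φ₍₂₎ ⊗ h₍₁₎) ⊗ (φ₍₁₎ ⊗ h₍₂₎)`. -/
def comulD (n : ℕ) : NicholsDouble n →ₗ[ℂ] NicholsDouble n ⊗[ℂ] NicholsDouble n :=
  TensorProduct.map (equiv n).symm.toLinearMap (equiv n).symm.toLinearMap ∘ₗ
    (TensorProduct.tensorTensorTensorComm ℂ _ _ _ _).toLinearMap ∘ₗ
    TensorProduct.map ((TensorProduct.comm ℂ _ _).toLinearMap ∘ₗ dualComul) (comul (R := ℂ)) ∘ₗ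
    (equiv n).toLinearMap

/-- The counit of the double, `ε(φ ⊗ h) = φ(1) ε(h)`. -/
def counitD (n : ℕ) : Module.Dual ℂ (NicholsDouble n) :=
  TensorProduct.lift ((LinearMap.mul ℂ ℂ).compl₁₂ (LinearMap.applyₗ 1) (counit (R := ℂ))) ∘ₗ
    (equiv n).toLinearMap

/-- The antipode of the double, `S(φ ⊗ h) = (ε ⊗ S(h)) (φ ∘ S⁻¹ ⊗ 1)`. -/
def antipodeD (n : ℕ) : NicholsDouble n →ₗ[ℂ] NicholsDouble n :=
  TensorProduct.lift ((LinearMap.mul ℂ (NicholsDouble n)).flip.compl₁₂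
    (ofDual ∘ₗ Nichols.antipodeInv.dualMap) (ofHopf ∘ₗ HopfAlgebra.antipode ℂ)) ∘ₗ
    (equiv n).toLinearMap

/-- The canonical R-matrix `∑ (ε ⊗ b) ⊗ (b* ⊗ 1)`, `b` running over a basis of `𝒦ₙ`. -/
def rMatrix (n : ℕ) : NicholsDouble n ⊗[ℂ] NicholsDouble n :=
  ∑ b, ofHopf (Nichols.basis n b) ⊗ₜ ofDual ((Nichols.basis n).coord b)

/-- The Drinfeld matrix `Q = R₂₁ R`. -/
def drinfeldMatrix (n : ℕ) : NicholsDouble n ⊗[ℂ] NicholsDouble n :=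
  TensorProduct.comm ℂ _ _ (rMatrix n) * rMatrix n

/-- The balancing element `G = K`; it satisfies `G⁻¹ = G`. -/
def balancing (n : ℕ) : NicholsDouble n := K n

/-- The shifted Drinfeld map `χ ↦ (χ(G -) ⊗ id)(R₂₁ R)`. -/
def drinfeldMap (χ : Module.Dual ℂ (NicholsDouble n)) : NicholsDouble n :=
  TensorProduct.lid ℂ _ ((χ ∘ₗ LinearMap.mulLeft ℂ (balancing n)).rTensor _ (drinfeldMatrix n))

/-- The integral `Λ = ½ (1 + K + K̄ + K K̄) ξ₁ ⋯ ξₙ ξ̄₁ ⋯ ξ̄ₙ` of `D𝒦ₙ`. -/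
def integral (n : ℕ) : NicholsDouble n :=
  (1 / 2 : ℂ) • ((1 + K n + Kbar n + K n * Kbar n) * top n)

/-- The integral `λ` of `(D𝒦ₙ)*`. It is twice the coefficient of `ξ₁ ⋯ ξₙ ξ̄₁ ⋯ ξ̄ₙ` in the basis
`Kᵃ K̄ᵇ w w̄'`, which in terms of `𝒦ₙ* ⊗ 𝒦ₙ` is
`λ(φ ⊗ h) = (-1)^(n + ⌊n/2⌋) φ((1 + K) ξ₁ ⋯ ξₙ) (ξ₁ ⋯ ξₙ)*(h)`. -/
def cointegral (n : ℕ) : Module.Dual ℂ (NicholsDouble n) :=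
  TensorProduct.lift ((LinearMap.mul ℂ ℂ).compl₁₂
    (((-1 : ℂ) ^ (n + n / 2)) •
      LinearMap.applyₗ ((1 + Nichols.K n) * Nichols.word Finset.univ))
    ((Nichols.basis n).coord (0, Finset.univ))) ∘ₗ (equiv n).toLinearMap

/-- The trace map `τ(x) = ∑ S(Λ₍₂₎) x Λ₍₁₎ G⁻¹`. -/
def higmanTrace (n : ℕ) : NicholsDouble n →ₗ[ℂ] NicholsDouble n :=
  TensorProduct.lift
    (LinearMap.mk₂ ℂ
      (fun a b => LinearMap.mulLeft ℂ (antipodeD n b) ∘ₗ LinearMap.mulRight ℂ (a * balancing n))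
      (fun a a' b => by ext; simp [add_mul, mul_add, mul_assoc])
      (fun r a b => by ext; simp [mul_assoc])
      (fun a b b' => by ext; simp [add_mul])
      (fun r a b => by ext; simp))
    (comulD n (integral n))

/-- The Higman ideal, the image of the trace map. -/
def higmanIdeal (n : ℕ) : Submodule ℂ (NicholsDouble n) := LinearMap.range (higmanTrace n)

/-- The ribbon element
`ν = (1 + K - K̄ + K K̄) ∑_w ½ (-1)^⌊(|w|+1)/2⌋ w w̄` (for even `n`). -/
def ribbon (n : ℕ) : NicholsDouble n :=
  (1 + K n - Kbar n + K n * Kbar n) *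
    ∑ I : Finset (Fin n), ((-1 : ℂ) ^ ((I.card + 1) / 2) / 2) • (word I * wordBar I)

/-- The Lyubashenko-Majid map `S_LM(x) = (id ⊗ λ)(R⁻¹ (1 ⊗ x) R₂₁⁻¹)`. -/
def lmS (x : NicholsDouble n) : NicholsDouble n :=
  TensorProduct.rid ℂ _ ((cointegral n).lTensor _
    (Ring.inverse (rMatrix n) * ((1 : NicholsDouble n) ⊗ₜ[ℂ] x) *
      TensorProduct.comm ℂ _ _ (Ring.inverse (rMatrix n))))

/-- The Lyubashenko-Majid map `T_LM(x) = ν x`. -/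
def lmT (x : NicholsDouble n) : NicholsDouble n := ribbon n * x

/-! ### The two summands of the center -/

def ZH (n : ℕ) : Submodule ℂ (NicholsDouble n) :=
  Submodule.span ℂ {1 - K n * Kbar n, (K n + Kbar n) * top n,
    (K n - Kbar n) *
      ∑ I : Finset (Fin n), (-1 : ℂ) ^ ((I.card + 1) / 2) • (word I * wordBar I)}

def ZLambda (n : ℕ) : Submodule ℂ (NicholsDouble n) :=
  Submodule.span ℂ {z | ∃ I J : Finset (Fin n), Even (I.card + J.card) ∧
    z = (1 + K n * Kbar n) * (word I * wordBar J)}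

/-! ### Modules, characters, mixed fusion -/

/-- The character of a `D𝒦ₙ`-module. -/
def character (V : Type*) [AddCommGroup V] [Module ℂ V] [Module (NicholsDouble n) V]
    [IsScalarTower ℂ (NicholsDouble n) V] : Module.Dual ℂ (NicholsDouble n) :=
  LinearMap.trace ℂ V ∘ₗ (Algebra.lsmul ℂ ℂ V : NicholsDouble n →ₐ[ℂ] Module.End ℂ V).toLinearMap

/-- The product of functionals dual to the comultiplication, `(χψ)(x) = χ(x₍₁₎) ψ(x₍₂₎)`; on
characters it is the character of the tensor product. -/
def charMul (χ ψ : Module.Dual ℂ (NicholsDouble n)) : Module.Dual ℂ (NicholsDouble n) :=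
  TensorProduct.dualDistrib ℂ _ _ (χ ⊗ₜ ψ) ∘ₗ comulD n

/-- Labels of the simple modules `V₁`, `V_{K K̄}`, `V_K`, `V_{K̄}`. -/
inductive Label : Type
  | one
  | KKbar
  | K
  | Kbar

/-- The eigenvalue of `K` on the generating vector of the simple module. -/
def Label.signK : Label → ℂ
  | .one => 1
  | .KKbar => -1
  | .K => 1
  | .Kbar => -1

/-- The eigenvalue of `K̄` on the generating vector of the simple module. -/
def Label.signKbar : Label → ℂ
  | .one => 1
  | .KKbar => -1
  | .K => -1
  | .Kbar => 1

/-- The left ideal of relations of the generating vector of a simple module: `V₁` and `V_{K K̄}` are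
generated by an eigenvector of `K`, `K̄` that is killed by all `ξᵢ` and `ξ̄ᵢ`; `V_K` and `V_{K̄}` are
generated by an eigenvector `|0⋯0⟩` of `K`, `K̄` that is killed by all `ξᵢ`. -/
def relations (n : ℕ) (σ : Label) : Ideal (NicholsDouble n) :=
  Ideal.span ({K n - algebraMap ℂ _ σ.signK, Kbar n - algebraMap ℂ _ σ.signKbar} ∪
    Set.range xi ∪ {y | σ.signK = σ.signKbar ∧ y ∈ Set.range xibar})

/-- The simple modules `V₁`, `V_{K K̄}`, `V_K`, `V_{K̄}`. -/
abbrev SimpleMod (n : ℕ) (σ : Label) : Type := NicholsDouble n ⧸ relations n σ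

/-- The primitive idempotents `e₁`, `e_{K K̄}`, `e_K`, `e_{K̄}`. -/
def idem (n : ℕ) : Label → NicholsDouble n
  | .one => (1 / 4 : ℂ) • (1 + K n + Kbar n + K n * Kbar n)
  | .KKbar => (1 / 4 : ℂ) • (1 - K n - Kbar n + K n * Kbar n)
  | .K => ((-1 : ℂ) ^ (n / 2) / 2 ^ (n + 2)) • ((1 + K n - Kbar n - K n * Kbar n) * top n)
  | .Kbar => ((-1 : ℂ) ^ (n / 2) / 2 ^ (n + 2)) • ((1 - K n + Kbar n - K n * Kbar n) * top n)

/-- The projective module `D𝒦ₙ e`. -/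
abbrev ProjMod (n : ℕ) (σ : Label) : Ideal (NicholsDouble n) := Ideal.span {idem n σ}

/-- `p_e`, the character of `D𝒦ₙ e`. -/
def projChar (n : ℕ) (σ : Label) : Module.Dual ℂ (NicholsDouble n) := character (ProjMod n σ)

/-- The three labels `1`, `K`, `K̄` that index the two bases of the Higman ideal. -/
def idx : Fin 3 → Label := ![.one, .K, .Kbar]

/-- The basis `B_χ`. -/
def basisChi (n : ℕ) (j : Fin 3) : NicholsDouble n := drinfeldMap (projChar n (idx j))

/-- The basis `B_τ`. -/
def basisTau (n : ℕ) (j : Fin 3) : NicholsDouble n := higmanTrace n (idem n (idx j))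

/-- The Cohen-Westreich `S`-matrix. -/
def SCW (n : ℕ) : Matrix (Fin 3) (Fin 3) ℂ :=
  (-1 : ℂ) ^ (n / 2) • !![0, (2 ^ n)⁻¹, -(2 ^ n)⁻¹;
    2 ^ (n - 1), 1 / 2, 1 / 2;
    -2 ^ (n - 1), 1 / 2, 1 / 2]

/-- The Cohen-Westreich `T`-matrix. -/
def TCW : Matrix (Fin 3) (Fin 3) ℂ := Matrix.diagonal ![1, 1, -1]

/-- The mixed fusion matrices. -/
def fusion (n : ℕ) : Label → Matrix (Fin 3) (Fin 3) ℂ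
  | .one => 1
  | .KKbar => !![1, 0, 0; 0, 0, 1; 0, 1, 0]
  | _ => !![0, 1, 1; 2 ^ (2 * n - 1), 0, 0; 2 ^ (2 * n - 1), 0, 0]

/-- The diagonal forms of the mixed fusion matrices. -/
def fusionDiag (n : ℕ) : Label → Matrix (Fin 3) (Fin 3) ℂ
  | .one => 1
  | .KKbar => Matrix.diagonal ![-1, 1, 1]
  | _ => Matrix.diagonal ![0, 2 ^ n, -2 ^ n]

end NicholsDouble

/-- A nonzero idempotent that is not a sum of two nonzero orthogonal idempotents. -/
def IsPrimitiveIdempotent {A : Type*} [Ring A] (e : A) : Prop :=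
  IsIdempotentElem e ∧ e ≠ 0 ∧ ∀ f g : A, IsIdempotentElem f → IsIdempotentElem g →
    f * g = 0 → g * f = 0 → f + g = e → f = 0 ∨ g = 0

end

/-!
The canonical pairing `Nichols.dualMap` identifies `𝒦ₙ` with its dual and sends `K`, `ξᵢ` to `K̄`, `ξ̄ᵢ`.
So `D𝒦ₙ` is generated by two copies `hop`, `bar` of `𝒦ₙ`, subject to commutation of `K`, `K̄`,
anticommutation of either with all `ξᵢ`, `ξ̄ᵢ`, and `ξᵢ ξ̄ⱼ + ξ̄ⱼ ξᵢ = δᵢⱼ (1 - c)`, where `c = K K̄`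
(`cen`) is a central involution. Products `x̄ y` and `x ȳ` are two normal forms (`normalForm`,
`induction_bar_hop`, `induction_hop_bar`), and maps out of `D𝒦ₙ` are defined by `lift`. The whole
theorem rests on the splitting by `c = 1` and `c = -1`.

*The block `c = 1`* is an exterior algebra in `2n` variables, extended by the sign `K`. It has the two
one-dimensional modules, and its central elements are `(1 + c) w w̄'` with `|w| + |w'|` even together
with `(K + K̄) t` (`one_add_cen_mul_mem`).

*The block `c = -1`* is a Clifford algebra extended by `K`, that is a product of two matrix algebras
with simple modules `V_K`, `V_K̄`. Its center is spanned by `1 - c` and a multiple `chir` of the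
chirality element, `chir² = ½ (1 - c)`. A central element of this block is determined by its
products with the two idempotents `e_K`, `e_K̄` (`eq_zero_of_mul_idem`), because a two-sided ideal that
contains `(1 - c) t` contains `1 - c` (`one_sub_cen_mem_of_top_mem`). This gives `center_eq`.

*Simple modules and idempotents.* A simple module contains a common null vector of the `ξᵢ` that is an
eigenvector of `K` and `K̄`, which gives the classification `exists_equiv_simpleMod`. The elements
`e_σ` act on `V_τ` with trace `δ_στ`.

*Characters.* Call a functional trace-like (`IsTraceLike`) if it is a trace and kills the ideal generated
by `(1 + c) ξᵢ` and `(1 + c) ξ̄ᵢ`. All characters are trace-like, since `(1 + c) ξᵢ x` acts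
nilpotently, and so are their products. A trace-like functional is determined by its values on the
four `e_σ` (`IsTraceLike.ext`). Every identity between characters, in particular the fusion rules
`charMul_character_projChar`, is checked on the `e_σ`.

*The Higman ideal, `n` even.* The form `λ(G -)` (`symForm`) is symmetric and nondegenerate, and
`S(Λ₍₂₎) ⊗ Λ₍₁₎ G⁻¹` is its Casimir element (`mul_casimir`, `symForm_mul_comm`). Hence
`λ(G τ(x) y)` is the trace of `z ↦ y z x`, so `τ(e_σ)` is the element `charElem σ` that represents
`p_{e_σ}` by the form, and all of them lie in `Z_H` (`projChar_eq_symForm`, `higmanTrace_idem`).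

*The two `S`-maps.* Through the self-duality the Drinfeld map of `λ(G z -)`, `z` central, becomes the
bilinear form `λ(z p̄ q)` (`pairHB_drinfeldMap`), and the Lyubashenko–Majid map is the same form with
antipodes (`pairHB_lmS`). The form is evaluated for the three basis elements of `Z_H`: the Drinfeld
map exchanges `1 - c` and `(K + K̄) t` and multiplies `chir` by `(-1)^(n/2)`. For
`(K + K̄) t` the functional is the sum of the two one-dimensional characters, and on the block
`c = -1` it is a trace on a Clifford algebra (`trace_wordBar_mul_word`). On `Z_H` both `S`-maps agree,
so the matrix of `S_LM` in the basis `τ(e_j)` is the one that expresses `B_χ` by `B_τ`; it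
is an involution, and therefore equal to `S_CW`. The remaining statements are `3 × 3` matrix identities.
-/

noncomputable section

theorem eq_zero_of_eq_neg {M : Type*} [AddCommGroup M] [Module ℂ M] {x : M} (h : x = -x) :
    x = 0 := by
  have h2 : (2 : ℂ) • x = 0 := by rw [two_smul]; nth_rw 2 [h]; exact add_neg_cancel x
  exact (smul_eq_zero.1 h2).resolve_left two_ne_zero

/-! ### Ordered products of anticommuting families -/

section OrderedProd

variable {A : Type*} [Ring A] {n : ℕ} (x : Fin n → A)

theorem orderedProd_empty : orderedProd x ∅ = 1 := by
  simp [orderedProd]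

theorem prod_map_ite_of_forall_notMem (l : List (Fin n)) (I : Finset (Fin n))
    (h : ∀ j ∈ l, j ∉ I) : (l.map fun j => if j ∈ I then x j else 1).prod = 1 := by
  apply List.prod_eq_one
  intro a ha
  obtain ⟨j, hj, rfl⟩ := List.mem_map.1 ha
  rw [if_neg (h j hj)]

theorem finRange_split (i : Fin n) : ∃ l₁ l₂ : List (Fin n), List.finRange n = l₁ ++ i :: l₂ ∧
    (∀ j ∈ l₁, j < i) ∧ ∀ j ∈ l₂, i < j := by
  obtain ⟨l₁, l₂, h⟩ := List.append_of_mem (List.mem_finRange i)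
  have hp := List.pairwise_lt_finRange n
  rw [h, List.pairwise_append, List.pairwise_cons] at hp
  exact ⟨l₁, l₂, h, fun j hj => hp.2.2 j hj i (by simp), hp.2.1.1⟩

theorem orderedProd_insert_max {i : Fin n} {I : Finset (Fin n)} (h : ∀ j ∈ I, j < i) :
    orderedProd x (insert i I) = orderedProd x I * x i := by
  obtain ⟨l₁, l₂, hl, h1, h2⟩ := finRange_split i
  have h3 : ∀ j ∈ l₂, j ∉ I := fun j hj hI => lt_asymm (h2 j hj) (h j hI)
  have h4 : ∀ j ∈ l₂, j ∉ insert i I := fun j hj => by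
    rw [Finset.mem_insert, not_or]
    exact ⟨(h2 j hj).ne', h3 j hj⟩
  have h5 : (l₁.map fun j => if j ∈ insert i I then x j else 1) =
      l₁.map fun j => if j ∈ I then x j else 1 := by
    apply List.map_congr_left
    intro j hj
    simp [(h1 j hj).ne]
  have h6 : i ∉ I := fun hi => lt_irrefl _ (h i hi)
  rw [orderedProd, orderedProd, hl, List.map_append, List.map_append, List.prod_append,
    List.prod_append, List.map_cons, List.map_cons, List.prod_cons, List.prod_cons,
    prod_map_ite_of_forall_notMem x _ _ h3, prod_map_ite_of_forall_notMem x _ _ h4, h5,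
    if_pos (Finset.mem_insert_self _ _), if_neg h6, mul_one, mul_one, mul_one]

theorem orderedProd_insert_min {i : Fin n} {I : Finset (Fin n)} (h : ∀ j ∈ I, i < j) :
    orderedProd x (insert i I) = x i * orderedProd x I := by
  obtain ⟨l₁, l₂, hl, h1, h2⟩ := finRange_split i
  have h3 : ∀ j ∈ l₁, j ∉ I := fun j hj hI => lt_asymm (h1 j hj) (h j hI)
  have h4 : ∀ j ∈ l₁, j ∉ insert i I := fun j hj => by
    rw [Finset.mem_insert, not_or]
    exact ⟨(h1 j hj).ne, h3 j hj⟩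
  have h5 : (l₂.map fun j => if j ∈ insert i I then x j else 1) =
      l₂.map fun j => if j ∈ I then x j else 1 := by
    apply List.map_congr_left
    intro j hj
    simp [(h2 j hj).ne']
  have h6 : i ∉ I := fun hi => lt_irrefl _ (h i hi)
  rw [orderedProd, orderedProd, hl, List.map_append, List.map_append, List.prod_append,
    List.prod_append, List.map_cons, List.map_cons, List.prod_cons, List.prod_cons,
    prod_map_ite_of_forall_notMem x _ _ h3, prod_map_ite_of_forall_notMem x _ _ h4, h5,
    if_pos (Finset.mem_insert_self _ _), if_neg h6, one_mul, one_mul, one_mul]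

theorem map_orderedProd {B F : Type*} [Monoid B] [FunLike F A B] [MonoidHomClass F A B] (f : F)
    (I : Finset (Fin n)) : f (orderedProd x I) = orderedProd (fun i => f (x i)) I := by
  rw [orderedProd, orderedProd, map_list_prod, List.map_map]
  congr 1
  apply List.map_congr_left
  intro i _
  by_cases h : i ∈ I <;> simp [h]

variable {x}

theorem mul_orderedProd_of_mem (h2 : ∀ i, x i * x i = 0) (h4 : ∀ i j, x i * x j = -(x j * x i))
    {i : Fin n} {I : Finset (Fin n)} (hi : i ∈ I) : x i * orderedProd x I = 0 := by
  induction I using Finset.induction_on_min with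
  | empty => simp at hi
  | insert j I hj ih =>
    rw [orderedProd_insert_min x hj, ← mul_assoc]
    rcases Finset.mem_insert.1 hi with rfl | hi
    · rw [h2, zero_mul]
    · rw [h4, neg_mul, mul_assoc, ih hi, mul_zero, neg_zero]

variable [Algebra ℂ A]

theorem mul_orderedProd_of_anticomm {a : A} {I : Finset (Fin n)}
    (h : ∀ i ∈ I, a * x i = -(x i * a)) :
    a * orderedProd x I = (-1 : ℂ) ^ I.card • (orderedProd x I * a) := by
  induction I using Finset.induction_on_max with
  | empty => simp [orderedProd_empty]
  | insert i I hi ih =>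
    have h6 : i ∉ I := fun hi' => lt_irrefl _ (hi i hi')
    rw [orderedProd_insert_max x hi, ← mul_assoc, ih fun j hj => h j (Finset.mem_insert_of_mem hj),
      smul_mul_assoc, mul_assoc, h i (Finset.mem_insert_self _ _), Finset.card_insert_of_notMem h6,
      pow_succ, mul_neg, mul_assoc, smul_neg, mul_neg_one, neg_smul]

theorem orderedProd_mul_of_anticomm {a : A} {I : Finset (Fin n)}
    (h : ∀ i ∈ I, a * x i = -(x i * a)) :
    orderedProd x I * a = (-1 : ℂ) ^ I.card • (a * orderedProd x I) := by
  rw [mul_orderedProd_of_anticomm h, smul_smul, ← mul_pow]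
  simp

theorem orderedProd_mul_of_mem (h2 : ∀ i, x i * x i = 0) (h4 : ∀ i j, x i * x j = -(x j * x i))
    {i : Fin n} {I : Finset (Fin n)} (hi : i ∈ I) : orderedProd x I * x i = 0 := by
  rw [orderedProd_mul_of_anticomm fun j _ => h4 i j, mul_orderedProd_of_mem h2 h4 hi, smul_zero]

open Nichols in
theorem mul_orderedProd_of_notMem (h4 : ∀ i j, x i * x j = -(x j * x i))
    {i : Fin n} {I : Finset (Fin n)} (hi : i ∉ I) :
    x i * orderedProd x I = sgn i I • orderedProd x (insert i I) := by
  induction I using Finset.induction_on_max with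
  | empty =>
    have := orderedProd_insert_max x (i := i) (I := ∅) (by simp)
    rw [this]
    simp [sgn, orderedProd_empty]
  | insert m I hm ih =>
    have hmI : m ∉ I := fun h => lt_irrefl _ (hm m h)
    rw [Finset.mem_insert, not_or] at hi
    rcases lt_or_gt_of_ne hi.1 with h | h
    · rw [orderedProd_insert_max x hm, ← mul_assoc, ih hi.2, smul_mul_assoc, sgn_insert hmI,
        if_neg (not_lt_of_gt h), Finset.insert_comm, orderedProd_insert_max x (i := m)]
      intro j hj
      rcases Finset.mem_insert.1 hj with rfl | hj
      · exact h
      · exact hm j hj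
    · have h1 : ∀ j ∈ insert m I, j < i := fun j hj => by
        rcases Finset.mem_insert.1 hj with rfl | hj
        · exact h
        · exact (hm j hj).trans h
      rw [mul_orderedProd_of_anticomm fun j _ => h4 i j, orderedProd_insert_max x h1, sgn,
        Finset.filter_true_of_mem h1]

end OrderedProd

namespace Nichols

variable {n : ℕ}

theorem sgn_mul_self (i : Fin n) (I : Finset (Fin n)) : sgn i I * sgn i I = 1 := by
  rw [sgn, ← mul_pow]; simp

theorem sgn_eq_one {i : Fin n} {I : Finset (Fin n)} (h : ∀ j ∈ I, i < j) : sgn i I = 1 := by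
  rw [sgn, Finset.filter_false_of_mem fun j hj => not_lt_of_gt (h j hj)]
  simp

/-! ### Words in the Nichols algebra -/

theorem word_empty : word (∅ : Finset (Fin n)) = 1 := orderedProd_empty _

theorem xi_mul_word_of_mem {i : Fin n} {I : Finset (Fin n)} (h : i ∈ I) : xi i * word I = 0 :=
  mul_orderedProd_of_mem xi_mul_self xi_mul_xi h

theorem word_mul_xi_of_mem {i : Fin n} {I : Finset (Fin n)} (h : i ∈ I) : word I * xi i = 0 :=
  orderedProd_mul_of_mem xi_mul_self xi_mul_xi h

theorem xi_mul_word_of_notMem {i : Fin n} {I : Finset (Fin n)} (h : i ∉ I) :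
    xi i * word I = sgn i I • word (insert i I) :=
  mul_orderedProd_of_notMem xi_mul_xi h

theorem word_insert {i : Fin n} {I : Finset (Fin n)} (h : i ∉ I) :
    word (insert i I) = sgn i I • (xi i * word I) := by
  rw [xi_mul_word_of_notMem h, smul_smul, sgn_mul_self, one_smul]

theorem word_insert_min {i : Fin n} {I : Finset (Fin n)} (h : ∀ j ∈ I, i < j) :
    word (insert i I) = xi i * word I := orderedProd_insert_min _ h

theorem word_insert_max {i : Fin n} {I : Finset (Fin n)} (h : ∀ j ∈ I, j < i) :
    word (insert i I) = word I * xi i := orderedProd_insert_max _ h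

theorem K_mul_word (I : Finset (Fin n)) : K n * word I = (-1 : ℂ) ^ I.card • (word I * K n) :=
  mul_orderedProd_of_anticomm fun i _ => K_mul_xi i

theorem word_mul_K (I : Finset (Fin n)) : word I * K n = (-1 : ℂ) ^ I.card • (K n * word I) :=
  orderedProd_mul_of_anticomm fun i _ => K_mul_xi i

theorem xi_mul_K (i : Fin n) : xi i * K n = -(K n * xi i) := by rw [K_mul_xi, neg_neg]

theorem K_mul_K_mul (a : Nichols n) : K n * (K n * a) = a := by rw [← mul_assoc, K_mul_K, one_mul]

theorem basis_zero (I : Finset (Fin n)) : basis n (0, I) = word I := by simp [basis_apply]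

theorem basis_one (I : Finset (Fin n)) : basis n (1, I) = K n * word I := by simp [basis_apply]

theorem coord_word (b : Fin 2 × Finset (Fin n)) (I : Finset (Fin n)) :
    (basis n).coord b (word I) = if (0, I) = b then 1 else 0 := by
  rw [← basis_zero, Module.Basis.coord_apply, Module.Basis.repr_self, Finsupp.single_apply]

theorem coord_K_mul_word (b : Fin 2 × Finset (Fin n)) (I : Finset (Fin n)) :
    (basis n).coord b (K n * word I) = if (1, I) = b then 1 else 0 := by
  rw [← basis_one, Module.Basis.coord_apply, Module.Basis.repr_self, Finsupp.single_apply]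

/-- Linear maps out of `𝒦ₙ` agree if they agree on the words `w` and `K w`. -/
theorem lin_ext {M : Type*} [AddCommGroup M] [Module ℂ M] {f g : Nichols n →ₗ[ℂ] M}
    (h0 : ∀ I, f (word I) = g (word I)) (h1 : ∀ I, f (K n * word I) = g (K n * word I)) :
    f = g := by
  refine (basis n).ext fun b => ?_
  rcases b with ⟨a, I⟩
  fin_cases a
  · simpa [basis_apply] using h0 I
  · simpa [basis_apply] using h1 I

/-- A property of elements of `𝒦ₙ` that is linear and stable under left multiplication by the
generators holds everywhere once it holds for `1`. -/
theorem induction_left {p : Nichols n → Prop} (h1 : p 1) (hadd : ∀ a b, p a → p b → p (a + b))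
    (hsmul : ∀ (r : ℂ) a, p a → p (r • a)) (hK : ∀ a, p a → p (K n * a))
    (hx : ∀ i a, p a → p (xi i * a)) (a : Nichols n) : p a := by
  have h := mem_of_gens (s := { 
    carrier := {a | ∀ b, p b → p (a * b)}
    mul_mem' := fun {a b} ha hb c hc => by rw [mul_assoc]; exact ha _ (hb _ hc)
    add_mem' := fun {a b} ha hb c hc => by rw [add_mul]; exact hadd _ _ (ha _ hc) (hb _ hc)
    algebraMap_mem' := fun r c hc => by
      rw [Algebra.algebraMap_eq_smul_one, smul_mul_assoc, one_mul]; exact hsmul _ _ hc }) hK hx a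
  simpa using h 1 h1

/-! ### The self-duality of the Nichols algebra -/

/-- The algebra map `K ↦ -1`, `ξᵢ ↦ 0`. -/
def kbar (n : ℕ) : Nichols n →ₐ[ℂ] ℂ := lift (-1) (fun _ => 0) (by simp) (by simp) (by simp)
    (by simp)

@[simp] theorem kbar_K : kbar n (K n) = -1 := by simp [kbar]
@[simp] theorem kbar_xi (i : Fin n) : kbar n (xi i) = 0 := by simp [kbar]

theorem kbar_word (I : Finset (Fin n)) : kbar n (word I) = if I = ∅ then 1 else 0 := by
  split_ifs with h
  · rw [h, word_empty, map_one]
  · obtain ⟨i, hi⟩ := Finset.nonempty_iff_ne_empty.2 h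
    rw [← Finset.insert_erase hi, word_insert (Finset.notMem_erase _ _)]
    simp

open Coalgebra

theorem counit_word (I : Finset (Fin n)) :
    counit (R := ℂ) (word I) = if I = ∅ then (1 : ℂ) else 0 := by
  split_ifs with h
  · rw [h, word_empty, Bialgebra.counit_one]
  · obtain ⟨i, hi⟩ := Finset.nonempty_iff_ne_empty.2 h
    rw [← Finset.insert_erase hi, word_insert (Finset.notMem_erase _ _)]
    simp

theorem kbar_eq_coord :
    (basis n).coord (0, ∅) - (basis n).coord (1, ∅) = (kbar n).toLinearMap := by
  refine lin_ext (fun I => ?_) (fun I => ?_)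
  · rw [LinearMap.sub_apply, coord_word, coord_word, AlgHom.toLinearMap_apply, kbar_word]
    simp
  · rw [LinearMap.sub_apply, coord_K_mul_word, coord_K_mul_word, AlgHom.toLinearMap_apply,
      map_mul, kbar_word]
    by_cases h : I = ∅ <;> simp [h]

/-- The functional `ξᵢ* + (K ξᵢ)*`. -/
def xb (i : Fin n) : Module.Dual ℂ (Nichols n) :=
  (basis n).coord (0, {i}) + (basis n).coord (1, {i})

theorem xb_word (i : Fin n) (I : Finset (Fin n)) : xb i (word I) = if I = {i} then 1 else 0 := by
  rw [xb, LinearMap.add_apply, coord_word, coord_word]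
  simp

theorem xb_K_mul_word (i : Fin n) (I : Finset (Fin n)) :
    xb i (K n * word I) = if I = {i} then 1 else 0 := by
  rw [xb, LinearMap.add_apply, coord_K_mul_word, coord_K_mul_word]
  simp

theorem xb_K_mul (i : Fin n) (y : Nichols n) : xb i (K n * y) = xb i y := by
  have : xb i ∘ₗ LinearMap.mulLeft ℂ (K n) = xb i := by
    refine lin_ext (fun I => ?_) (fun I => ?_)
    · simp [xb_word, xb_K_mul_word]
    · simp [xb_word, xb_K_mul_word, K_mul_K_mul]
  exact congrArg (fun f => f y) this

theorem xb_xi_mul_word (i j : Fin n) (I : Finset (Fin n)) :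
    xb i (xi j * word I) = if i = j ∧ I = ∅ then 1 else 0 := by
  by_cases hj : j ∈ I
  · rw [xi_mul_word_of_mem hj, map_zero, if_neg]
    rintro ⟨-, rfl⟩
    simp at hj
  · rw [xi_mul_word_of_notMem hj, map_smul, xb_word]
    by_cases h : i = j ∧ I = ∅
    · obtain ⟨rfl, rfl⟩ := h
      simp [sgn]
    · rw [if_neg h, if_neg, smul_zero]
      intro h'
      apply h
      have h1 : j = i := by
        have : j ∈ insert j I := Finset.mem_insert_self _ _
        rw [h'] at this
        simpa using this
      subst h1
      refine ⟨rfl, Finset.eq_empty_of_forall_notMem fun k hk => ?_⟩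
      have : k ∈ insert j I := Finset.mem_insert_of_mem hk
      rw [h', Finset.mem_singleton] at this
      exact hj (this ▸ hk)

theorem xb_xi_mul (i j : Fin n) (y : Nichols n) :
    xb i (xi j * y) = if i = j then kbar n y else 0 := by
  have : xb i ∘ₗ LinearMap.mulLeft ℂ (xi j) =
      (if i = j then (1 : ℂ) else 0) • (kbar n).toLinearMap := by
    refine lin_ext (fun I => ?_) (fun I => ?_)
    · simp only [LinearMap.comp_apply, LinearMap.mulLeft_apply, xb_xi_mul_word,
        LinearMap.smul_apply, AlgHom.toLinearMap_apply, kbar_word]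
      by_cases h : i = j <;> simp [h]
    · simp only [LinearMap.comp_apply, LinearMap.mulLeft_apply,
        LinearMap.smul_apply, AlgHom.toLinearMap_apply, map_mul, kbar_word]
      rw [← mul_assoc, xi_mul_K, neg_mul, mul_assoc, map_neg, xb_K_mul, xb_xi_mul_word]
      by_cases h : i = j <;> by_cases h' : I = ∅ <;> simp [h, h']
  have := congrArg (fun f => f y) this
  simp only [LinearMap.comp_apply, LinearMap.mulLeft_apply, LinearMap.smul_apply,
    AlgHom.toLinearMap_apply] at this
  rw [this]
  split_ifs <;> simp

/-- `ξ̄ᵢ` is a skew derivation of `𝒦ₙ` with values in `ℂ`. -/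
theorem xb_mul (i : Fin n) (x y : Nichols n) :
    xb i (x * y) = counit (R := ℂ) x * xb i y + xb i x * kbar n y := by
  have h := mem_of_gens (s := { 
    carrier := {x | ∀ y, xb i (x * y) = counit (R := ℂ) x * xb i y + xb i x * kbar n y}
    mul_mem' := fun {a b} ha hb c => by
      rw [mul_assoc, ha, hb, ha, Bialgebra.counit_mul, map_mul]; ring
    add_mem' := fun {a b} ha hb c => by
      rw [add_mul, map_add, ha, hb, map_add, map_add]; ring
    algebraMap_mem' := fun r c => by
      have : xb i 1 = 0 := by rw [← word_empty, xb_word, if_neg (Finset.singleton_ne_empty i).symm]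
      simp [Algebra.algebraMap_eq_smul_one, this] })
    (fun y => by
      have : xb i (K n) = 0 := by
        rw [← mul_one (K n), xb_K_mul, ← word_empty, xb_word,
          if_neg (Finset.singleton_ne_empty i).symm]
      rw [xb_K_mul, this, counit_K]; ring)
    (fun j y => by
      have : xb i (xi j) = if i = j then 1 else 0 := by
        rw [← mul_one (xi j), xb_xi_mul, map_one]
      rw [xb_xi_mul, this, counit_xi]
      split_ifs <;> ring) x
  exact h y

theorem xb_xi (i j : Fin n) : xb i (xi j) = if i = j then 1 else 0 := by
  rw [← mul_one (xi j), xb_xi_mul, map_one]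

theorem xb_K (i : Fin n) : xb i (K n) = 0 := by
  rw [← mul_one (K n), xb_K_mul, ← word_empty, xb_word, if_neg (Finset.singleton_ne_empty i).symm]

/-- The automorphism `K ↦ -K`, `ξᵢ ↦ -ξᵢ`; right multiplication of functionals by it is left
multiplication by `K̄`. -/
def kappa (n : ℕ) : Nichols n →ₐ[ℂ] Nichols n :=
  lift (-K n) (fun i => -xi i) (by simp [K_mul_K]) (by simp [xi_mul_self])
    (by simp [K_mul_xi]) (fun i j => by rw [neg_mul_neg, neg_mul_neg, xi_mul_xi])

@[simp] theorem kappa_K : kappa n (K n) = -K n := by simp [kappa]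
@[simp] theorem kappa_xi (i : Fin n) : kappa n (xi i) = -xi i := by simp [kappa]

theorem kappa_kappa (y : Nichols n) : kappa n (kappa n y) = y := by
  have : (kappa n).comp (kappa n) = AlgHom.id ℂ _ := algHom_ext (by simp) (by simp)
  exact congrArg (fun f => f y) this

theorem kappa_word (I : Finset (Fin n)) : kappa n (word I) = (-1 : ℂ) ^ I.card • word I := by
  induction I using Finset.induction_on_max with
  | empty => simp [word_empty]
  | insert i I hi ih =>
    have h6 : i ∉ I := fun hi' => lt_irrefl _ (hi i hi')
    rw [word_insert_max hi, map_mul, ih, kappa_xi, Finset.card_insert_of_notMem h6, pow_succ]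
    simp

theorem counit_kappa (y : Nichols n) : counit (R := ℂ) (kappa n y) = kbar n y := by
  have : (Bialgebra.counitAlgHom ℂ (Nichols n)).comp (kappa n) = kbar n :=
    algHom_ext (by simp) (by simp)
  exact congrArg (fun f => f y) this

theorem kbar_rTensor_comul (y : Nichols n) :
    TensorProduct.lid ℂ _ ((kbar n).toLinearMap.rTensor _ (comul (R := ℂ) y)) = kappa n y := by
  have : ((Algebra.TensorProduct.lid ℂ (Nichols n)).toAlgHom.comp
      (Algebra.TensorProduct.map (kbar n) (AlgHom.id ℂ (Nichols n)))).comp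
      (Bialgebra.comulAlgHom ℂ (Nichols n)) = kappa n :=
    algHom_ext (by simp) (by simp)
  exact congrArg (fun f => f y) this

/-- The skew derivation `y ↦ ξ̄ᵢ(y₍₁₎) y₍₂₎`. -/
def skewDer (i : Fin n) : Nichols n →ₗ[ℂ] Nichols n :=
  (TensorProduct.lid ℂ _).toLinearMap ∘ₗ (xb i).rTensor _ ∘ₗ comul (R := ℂ)

theorem skewDer_mul (i : Fin n) (x y : Nichols n) :
    skewDer i (x * y) = x * skewDer i y + skewDer i x * kappa n y := by
  have key : ∀ s t : Nichols n ⊗[ℂ] Nichols n,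
      TensorProduct.lid ℂ _ ((xb i).rTensor _ (s * t)) =
        TensorProduct.lid ℂ _ ((counit (R := ℂ)).rTensor _ s) *
          TensorProduct.lid ℂ _ ((xb i).rTensor _ t) +
        TensorProduct.lid ℂ _ ((xb i).rTensor _ s) *
          TensorProduct.lid ℂ _ ((kbar n).toLinearMap.rTensor _ t) := by
    intro s t
    induction s with
    | zero => simp
    | add a b ha hb => simp only [add_mul, map_add, ha, hb]; abel
    | tmul a b =>
      induction t with
      | zero => simp
      | add c d hc hd => simp only [mul_add, map_add, hc, hd]; abel
      | tmul c d =>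
        simp only [Algebra.TensorProduct.tmul_mul_tmul, LinearMap.rTensor_tmul,
          TensorProduct.lid_tmul, xb_mul, add_smul, smul_mul_smul_comm, AlgHom.toLinearMap_apply]
  have h : TensorProduct.lid ℂ _ ((counit (R := ℂ)).rTensor _ (comul (R := ℂ) x)) = x := by
    rw [Coalgebra.rTensor_counit_comul, TensorProduct.lid_tmul, one_smul]
  have := key (comul (R := ℂ) x) (comul (R := ℂ) y)
  rw [← Bialgebra.comul_mul, h, kbar_rTensor_comul] at this
  exact this

@[simp] theorem skewDer_K (i : Fin n) : skewDer i (K n) = 0 := by simp [skewDer, xb_K]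

@[simp] theorem skewDer_xi (i j : Fin n) : skewDer i (xi j) = if i = j then 1 else 0 := by
  simp only [skewDer, LinearMap.comp_apply, comul_xi, map_add, LinearMap.rTensor_tmul, xb_K, xb_xi]
  split_ifs <;> simp

@[simp] theorem skewDer_one (i : Fin n) : skewDer i (1 : Nichols n) = 0 := by
  have := skewDer_mul i (1 : Nichols n) 1
  simpa using this

theorem skewDer_kappa (i : Fin n) (y : Nichols n) :
    skewDer i (kappa n y) = -kappa n (skewDer i y) := by
  induction y using induction_left with
  | h1 => simp
  | hadd a b ha hb => simp only [map_add, ha, hb]; abel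
  | hsmul r a ha => simp only [map_smul, ha, smul_neg]
  | hK a ha => simp [skewDer_mul, ha]
  | hx j a ha =>
    simp only [map_mul, skewDer_mul, ha, kappa_xi, map_add, map_neg, skewDer_xi, kappa_kappa]
    split_ifs <;> simp
    abel

theorem skewDer_skewDer (i j : Fin n) (y : Nichols n) :
    skewDer i (skewDer j y) = -skewDer j (skewDer i y) := by
  induction y using induction_left with
  | h1 => simp
  | hadd a b ha hb => simp only [map_add, ha, hb]; abel
  | hsmul r a ha => simp only [map_smul, ha, smul_neg]
  | hK a ha => simp [skewDer_mul, ha]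
  | hx k a ha =>
    simp only [skewDer_mul, ha, map_add, skewDer_xi]
    split_ifs <;> simp [skewDer_kappa] <;> abel

theorem skewDer_K_mul (i : Fin n) (y : Nichols n) : skewDer i (K n * y) = K n * skewDer i y := by
  simp [skewDer_mul]

theorem skewDer_xi_mul (i j : Fin n) (y : Nichols n) :
    skewDer i (xi j * y) = xi j * skewDer i y + if i = j then kappa n y else 0 := by
  rw [skewDer_mul, skewDer_xi]
  split_ifs <;> simp

theorem skewDer_word_of_notMem {i : Fin n} {I : Finset (Fin n)} (h : i ∉ I) :
    skewDer i (word I) = 0 := by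
  induction I using Finset.induction_on_min with
  | empty => simp [word_empty]
  | insert j I hj ih =>
    rw [Finset.mem_insert, not_or] at h
    rw [word_insert_min hj, skewDer_xi_mul, if_neg h.1, ih h.2]
    simp

theorem skewDer_word_insert {i : Fin n} {I : Finset (Fin n)} (h : i ∉ I) :
    skewDer i (word (insert i I)) = (sgn i I * (-1) ^ I.card) • word I := by
  rw [word_insert h, map_smul, skewDer_xi_mul, skewDer_word_of_notMem h, if_pos rfl, kappa_word]
  simp [mul_smul]

theorem skewDer_skewDer_self (i : Fin n) (y : Nichols n) : skewDer i (skewDer i y) = 0 :=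
  eq_zero_of_eq_neg (skewDer_skewDer i i y)

open MulOpposite in
/-- The right action of `𝒦ₙ` on itself by `K ↦ κ` and `ξᵢ ↦` the skew derivation of `ξ̄ᵢ`. -/
def dualAction (n : ℕ) : Nichols n →ₐ[ℂ] (Module.End ℂ (Nichols n))ᵐᵒᵖ :=
  lift (op (kappa n).toLinearMap) (fun i => op (skewDer i))
    (by
      rw [← op_mul, ← op_one]
      congr 1
      ext y : 1
      exact kappa_kappa y)
    (fun i => by
      rw [← op_mul, ← op_zero]
      congr 1
      ext y : 1
      exact skewDer_skewDer_self i y)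
    (fun i => by
      rw [← op_mul, ← op_mul, ← op_neg]
      congr 1
      ext y : 1
      exact skewDer_kappa i y)
    (fun i j => by
      rw [← op_mul, ← op_mul, ← op_neg]
      congr 1
      ext y : 1
      exact skewDer_skewDer j i y)

/-- The map `𝒦ₙ → 𝒦ₙ*` given on generators by `K ↦ K̄`, `ξᵢ ↦ ξ̄ᵢ`. -/
def dualMap (n : ℕ) : Nichols n →ₗ[ℂ] Module.Dual ℂ (Nichols n) :=
  (LinearMap.llcomp ℂ (Nichols n) (Nichols n) ℂ (counit (R := ℂ))) ∘ₗ
    (MulOpposite.opLinearEquiv ℂ).symm.toLinearMap ∘ₗ (dualAction n).toLinearMap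

theorem dualMap_apply (x y : Nichols n) :
    dualMap n x y = counit (R := ℂ) ((dualAction n x).unop y) := rfl

theorem dualMap_mul_apply (x y z : Nichols n) :
    dualMap n (x * y) z = dualMap n y ((dualAction n x).unop z) := by
  simp [dualMap_apply]

theorem dualMap_K_mul_apply (x y : Nichols n) : dualMap n (K n * x) y =
    dualMap n x (kappa n y) := by
  rw [dualMap_mul_apply]; simp [dualAction]

theorem dualMap_xi_mul_apply (i : Fin n) (x y : Nichols n) :
    dualMap n (xi i * x) y = dualMap n x (skewDer i y) := by
  rw [dualMap_mul_apply]; simp [dualAction]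

theorem dualMap_one : dualMap n 1 = counit (R := ℂ) := by
  ext y; simp [dualMap_apply]

theorem dualMap_K : dualMap n (K n) = (kbar n).toLinearMap := by
  ext y
  rw [← mul_one (K n), dualMap_K_mul_apply, dualMap_one, counit_kappa]; rfl

theorem counit_skewDer (i : Fin n) (y : Nichols n) :
    counit (R := ℂ) (skewDer i y) = xb i y := by
  have key : ∀ t : Nichols n ⊗[ℂ] Nichols n, counit (R := ℂ)
      (TensorProduct.lid ℂ _ ((xb i).rTensor _ t)) =
      xb i (TensorProduct.rid ℂ _ ((counit (R := ℂ)).lTensor _ t)) := by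
    intro t
    induction t with
    | zero => simp
    | add a b ha hb => simp only [map_add, ha, hb]
    | tmul a b => simp [mul_comm]
  refine (key _).trans ?_
  rw [Coalgebra.lTensor_counit_comul, TensorProduct.rid_tmul, one_smul]

theorem dualMap_xi (i : Fin n) : dualMap n (xi i) = xb i := by
  ext y
  rw [← mul_one (xi i), dualMap_xi_mul_apply, dualMap_one, counit_skewDer]

theorem dualMul_comp (φ ψ : Module.Dual ℂ (Nichols n)) (y : Nichols n) :
    dualMul φ ψ y = ψ (TensorProduct.lid ℂ _ (φ.rTensor _ (comul (R := ℂ) y))) := by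
  rw [dualMul_apply]
  induction comul (R := ℂ) y with
  | zero => simp
  | add a b ha hb => simp only [map_add, ha, hb]
  | tmul a b => simp

theorem dualMap_mul (x y : Nichols n) : dualMap n (x * y) = dualMul (dualMap n x)
    (dualMap n y) := by
  induction x using induction_left generalizing y with
  | h1 => rw [one_mul, dualMap_one, counit_dualMul]
  | hadd a b ha hb => rw [add_mul, map_add, map_add, map_add, ha, hb, LinearMap.add_apply]
  | hsmul r a ha => rw [smul_mul_assoc, map_smul, map_smul, map_smul, ha, LinearMap.smul_apply]
  | hK a ha =>
    have h : ∀ b : Nichols n, dualMap n (K n * b) = dualMul (dualMap n (K n)) (dualMap n b) := by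
      intro b
      ext z
      rw [dualMap_K_mul_apply, dualMul_comp, dualMap_K, kbar_rTensor_comul]
    rw [mul_assoc, h, ha, h, dualMul_assoc]
  | hx i a ha =>
    have h : ∀ b : Nichols n, dualMap n (xi i * b) = dualMul (dualMap n (xi i)) (dualMap n b) := by
      intro b
      ext z
      rw [dualMap_xi_mul_apply, dualMul_comp, dualMap_xi]
      rfl
    rw [mul_assoc, h, ha, h, dualMul_assoc]

/-- The sign `(-1)^(k(k-1)/2)` of the reversal of `k` anticommuting letters. -/
def revSign (k : ℕ) : ℂ := (-1) ^ (k * (k - 1) / 2)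

theorem revSign_zero : revSign 0 = 1 := by simp [revSign]

theorem revSign_succ (k : ℕ) : revSign (k + 1) = (-1) ^ k * revSign k := by
  rw [revSign, revSign, ← pow_add]
  congr 1
  have := Nat.triangle_succ k
  rw [this, add_comm]

theorem revSign_mul_self (k : ℕ) : revSign k * revSign k = 1 := by
  rw [revSign, ← mul_pow]; simp

theorem dualMap_word_word (I J : Finset (Fin n)) :
    dualMap n (word J) (word I) = if I = J then revSign J.card else 0 := by
  induction J using Finset.induction_on_min generalizing I with
  | empty => rw [word_empty, dualMap_one, counit_word]; simp [revSign_zero]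
  | insert j J hj ih =>
    have hjJ : j ∉ J := fun h => lt_irrefl _ (hj j h)
    rw [word_insert_min hj, dualMap_xi_mul_apply]
    by_cases h : j ∈ I
    · obtain ⟨I', hI', rfl⟩ : ∃ I', j ∉ I' ∧ I = insert j I' :=
        ⟨I.erase j, Finset.notMem_erase _ _, (Finset.insert_erase h).symm⟩
      rw [skewDer_word_insert hI', map_smul, ih]
      by_cases h' : I' = J
      · subst h'
        rw [if_pos rfl, if_pos rfl, sgn_eq_one hj, Finset.card_insert_of_notMem hjJ, revSign_succ]
        simp
      · rw [if_neg h', if_neg, smul_zero]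
        intro h''
        apply h'
        rw [← Finset.erase_insert hI', h'', Finset.erase_insert hjJ]
    · rw [skewDer_word_of_notMem h, map_zero, if_neg]
      rintro rfl
      exact h (Finset.mem_insert_self _ _)

theorem dualMap_word_K_mul (J : Finset (Fin n)) (y : Nichols n) :
    dualMap n (word J) (K n * y) = dualMap n (word J) y := by
  induction J using Finset.induction_on_min generalizing y with
  | empty => simp [word_empty, dualMap_one]
  | insert j J hj ih =>
    rw [word_insert_min hj, dualMap_xi_mul_apply, dualMap_xi_mul_apply, skewDer_K_mul, ih]

/-- The dual basis of `W ∪ KW` in terms of the generators `K̄`, `ξ̄ᵢ`. -/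
theorem coord_eq_dualMap (a : Fin 2) (I : Finset (Fin n)) :
    (basis n).coord (a, I) = dualMap n ((revSign I.card / 2) •
      (word I + (-1 : ℂ) ^ ((a : ℕ) + I.card) • (K n * word I))) := by
  have h2 : revSign I.card * revSign I.card = 1 := revSign_mul_self _
  have h3 : ((-1 : ℂ) ^ I.card) * (-1) ^ I.card = 1 := by rw [← mul_pow]; simp
  refine lin_ext (fun J => ?_) (fun J => ?_)
  · rw [coord_word, map_smul, LinearMap.smul_apply, map_add, LinearMap.add_apply, map_smul,
      LinearMap.smul_apply, dualMap_K_mul_apply, kappa_word, map_smul, dualMap_word_word]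
    by_cases h : J = I
    · subst h
      fin_cases a
      · simp only [Fin.zero_eta, if_true, smul_eq_mul, zero_add]
        linear_combination (-1 / 2 : ℂ) * h2 - (1 / 2 :
            ℂ) * h3 * (revSign J.card * revSign J.card) - 1 / 2 * h2
      · simp only [Fin.mk_one, smul_eq_mul, if_true, Prod.mk.injEq, zero_ne_one, false_and,
          if_false,
          pow_add, pow_one]
        linear_combination (1 / 2 : ℂ) * h3 * (revSign J.card * revSign J.card)
    · simp [h]
  · rw [coord_K_mul_word, map_smul, LinearMap.smul_apply, map_add, LinearMap.add_apply, map_smul,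
      LinearMap.smul_apply, dualMap_K_mul_apply, map_mul (kappa n), kappa_K, kappa_word, neg_mul, 
      mul_smul_comm, map_neg, map_smul, dualMap_word_K_mul, dualMap_word_word]
    by_cases h : J = I
    · subst h
      fin_cases a
      · simp only [Fin.zero_eta, smul_eq_mul, zero_add, if_true, Prod.mk.injEq, one_ne_zero,
          false_and, if_false]
        linear_combination (1 / 2 : ℂ) * h3 * (revSign J.card * revSign J.card)
      · simp only [Fin.mk_one, smul_eq_mul, if_true, pow_add, pow_one]
        linear_combination (-1 / 2 : ℂ) * h2 - (1 / 2 :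
            ℂ) * h3 * (revSign J.card * revSign J.card) - 1 / 2 * h2
    · simp [h]

theorem dualMap_surjective : Function.Surjective (dualMap n) := by
  rw [← LinearMap.range_eq_top, eq_top_iff, ← (basis n).dualBasis.span_eq, Submodule.span_le]
  rintro _ ⟨⟨a, I⟩, rfl⟩
  rw [Module.Basis.coe_dualBasis]
  exact ⟨_, (coord_eq_dualMap a I).symm⟩

theorem dualMap_bijective : Function.Bijective (dualMap n) := by
  refine ⟨?_, dualMap_surjective⟩
  exact (LinearMap.injective_iff_surjective_of_finrank_eq_finrank
    (Subspace.dual_finrank_eq (K := ℂ) (V := Nichols n)).symm).2 dualMap_surjective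

end Nichols

end

noncomputable section

namespace Nichols

variable {n : ℕ}

open Coalgebra

theorem comul_antipodeInv (y : Nichols n) : comul (R := ℂ) (antipodeInv y) =
    TensorProduct.comm ℂ _ _ (TensorProduct.map antipodeInv antipodeInv (comul (R := ℂ) y)) := by
  have key : ∀ s t : Nichols n ⊗[ℂ] Nichols n,
      TensorProduct.comm ℂ _ _ (TensorProduct.map antipodeInv antipodeInv (s * t)) =
      TensorProduct.comm ℂ _ _ (TensorProduct.map antipodeInv antipodeInv t) *
        TensorProduct.comm ℂ _ _ (TensorProduct.map antipodeInv antipodeInv s) := by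
    intro s t
    induction s with
    | zero => simp
    | add a b ha hb => simp only [add_mul, mul_add, map_add, ha, hb]
    | tmul a b =>
      induction t with
      | zero => simp
      | add c d hc hd => simp only [add_mul, mul_add, map_add, hc, hd]
      | tmul c d => simp [antipodeInv_mul]
  induction y using induction_left with
  | h1 => simp [Algebra.TensorProduct.one_def]
  | hadd a b ha hb => simp only [map_add, ha, hb]
  | hsmul r a ha => simp only [map_smul, ha]
  | hK a ha => rw [antipodeInv_mul, Bialgebra.comul_mul, ha, Bialgebra.comul_mul, key]; simp
  | hx i a ha =>
    rw [antipodeInv_mul, Bialgebra.comul_mul, ha, Bialgebra.comul_mul, key]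
    congr 1
    rw [antipodeInv_xi, Bialgebra.comul_mul, comul_xi, comul_K]
    simp [mul_add, K_mul_K, add_comm]

theorem counit_antipodeInv (y : Nichols n) :
    counit (R := ℂ) (antipodeInv y) = counit (R := ℂ) y := by
  induction y using induction_left with
  | h1 => simp
  | hadd a b ha hb => simp only [map_add, ha, hb]
  | hsmul r a ha => simp only [map_smul, ha]
  | hK a ha => rw [antipodeInv_mul, Bialgebra.counit_mul, Bialgebra.counit_mul, ha]; simp
  | hx i a ha => rw [antipodeInv_mul, Bialgebra.counit_mul, Bialgebra.counit_mul, ha]; simp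

theorem dualMul_antipodeInv (φ ψ : Module.Dual ℂ (Nichols n)) :
    dualMul φ ψ ∘ₗ antipodeInv = dualMul (ψ ∘ₗ antipodeInv) (φ ∘ₗ antipodeInv) := by
  ext y
  rw [LinearMap.comp_apply, dualMul_apply, dualMul_apply, comul_antipodeInv]
  induction comul (R := ℂ) y with
  | zero => simp
  | add a b ha hb => simp only [map_add, ha, hb]
  | tmul a b => simp [mul_comm]

theorem xb_antipodeInv (i : Fin n) (y : Nichols n) :
    xb i (antipodeInv y) = -xb i (kappa n y) := by
  induction y using induction_left with
  | h1 =>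
    have h : xb i 1 = 0 := by rw [← word_empty, xb_word, if_neg (Finset.singleton_ne_empty i).symm]
    simp [h]
  | hadd a b ha hb => simp only [map_add, ha, hb]; ring
  | hsmul r a ha => simp only [map_smul, ha, smul_neg]
  | hK a ha => simp [antipodeInv_mul, xb_mul i _ (K n), ha, xb_K, xb_K_mul]
  | hx j a ha =>
    have h : kbar n (kappa n a) = counit (R := ℂ) a := by rw [← counit_kappa, kappa_kappa]
    rw [antipodeInv_mul, antipodeInv_xi, xb_mul, xb_K_mul, map_mul, map_mul, kappa_xi, neg_mul,
      map_neg, xb_xi_mul, h, counit_antipodeInv, xb_xi]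
    split_ifs <;> simp

/-- The antipode of the dual: `φ ∘ S⁻¹` corresponds to `S` under the self-duality. -/
theorem dualMap_antipodeInv (x y : Nichols n) :
    dualMap n x (antipodeInv y) = dualMap n (antipodeLin x) y := by
  suffices h : dualMap n x ∘ₗ antipodeInv = dualMap n (antipodeLin x) from congrArg (fun f => f y) h
  induction x using induction_left with
  | h1 => ext y; simp [dualMap_one, counit_antipodeInv]
  | hadd a b ha hb => simp only [map_add, LinearMap.add_comp, ha, hb]
  | hsmul r a ha => simp only [map_smul, LinearMap.smul_comp, ha]
  | hK a ha =>
    rw [dualMap_mul, dualMul_antipodeInv, ha, antipodeLin_mul, dualMap_mul]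
    congr 1
    ext y
    rw [antipodeLin_K, LinearMap.comp_apply, dualMap_K]
    induction y using induction_left with
    | h1 => simp
    | hadd a b ha hb => simp only [map_add, ha, hb]
    | hsmul r a ha => simp only [map_smul, ha]
    | hK a ha => simpa [antipodeInv_mul] using ha
    | hx i a ha => simp [antipodeInv_mul]
  | hx i a ha =>
    rw [dualMap_mul, dualMul_antipodeInv, ha, antipodeLin_mul, dualMap_mul]
    congr 1
    ext y
    rw [antipodeLin_xi, LinearMap.comp_apply, dualMap_xi, xb_antipodeInv, map_neg,
      LinearMap.neg_apply, dualMap_K_mul_apply, dualMap_xi]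

theorem dualMap_antipode (x y : Nichols n) :
    dualMap n x (antipodeLin y) = dualMap n (antipodeInv x) y := by
  have h1 : antipodeLin (antipodeInv x) = x := antipode_antipodeInv x
  have h2 : antipodeInv (antipodeLin y) = y := antipodeInv_antipode y
  nth_rw 1 [← h1]
  rw [← dualMap_antipodeInv, h2]

/-- The self-duality turns the multiplication of `𝒦ₙ` into the opposite comultiplication of the
dual. -/
theorem dualMap_mul_eq_dualDistrib (x a b : Nichols n) : dualMap n x (a * b) =
    TensorProduct.dualDistrib ℂ _ _ (TensorProduct.map (dualMap n) (dualMap n) (comul (R := ℂ) x))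
      (b ⊗ₜ a) := by
  induction x using induction_left generalizing a b with
  | h1 => simp [dualMap_one, Algebra.TensorProduct.one_def, mul_comm]
  | hadd x y hx hy => simp only [map_add, LinearMap.add_apply, hx, hy]
  | hsmul r x hx => simp only [map_smul, LinearMap.smul_apply, hx]
  | hK x hx =>
    rw [dualMap_K_mul_apply, map_mul, hx, Bialgebra.comul_mul, comul_K]
    induction comul (R := ℂ) x with
    | zero => simp
    | add s t hs ht => simp only [mul_add, map_add, LinearMap.add_apply, hs, ht]
    | tmul s t => simp [dualMap_K_mul_apply]
  | hx i x hx =>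
    rw [dualMap_xi_mul_apply, skewDer_mul, map_add, hx, hx, Bialgebra.comul_mul, comul_xi]
    induction comul (R := ℂ) x with
    | zero => simp
    | add s t hs ht =>
      simp only [mul_add, map_add, LinearMap.add_apply, ← hs, ← ht]; ring
    | tmul s t => simp [add_mul, dualMap_K_mul_apply, dualMap_xi_mul_apply]; ring

end Nichols

namespace NicholsDouble

open Coalgebra

variable {n : ℕ}

/-! ### Generators and relations of the double -/

theorem tmul_mul_tmul (φ ψ : Module.Dual ℂ (Nichols n)) (h g : Nichols n) :
    tmul φ h * tmul ψ g = (equiv n).symm (Nichols.opDual φ (Nichols.opH h (ψ ⊗ₜ g))) := by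
  rw [mul_def, tmul, tmul, LinearEquiv.apply_symm_apply, LinearEquiv.apply_symm_apply,
    Nichols.doubleMul_tmul, Module.End.mul_apply]

theorem ofDual_mul_ofHopf (φ : Module.Dual ℂ (Nichols n)) (h : Nichols n) :
    ofDual φ * ofHopf h = tmul φ h := by
  change tmul φ 1 * tmul _ h = _
  rw [tmul_mul_tmul, Nichols.opH_one, Module.End.one_apply, Nichols.opDual_tmul,
    Nichols.dualMul_counit]
  rfl

/-- `h ↦ ε ⊗ h` as an algebra map. -/
def hop (n : ℕ) : Nichols n →ₐ[ℂ] NicholsDouble n :=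
  AlgHom.ofLinearMap ofHopf rfl fun x y => by
    change tmul _ (x * y) = tmul _ x * tmul _ y
    rw [tmul_mul_tmul, Nichols.opH_counit, Nichols.opDual_tmul, Nichols.dualMul_counit]
    rfl

theorem ofDual_mul (φ ψ : Module.Dual ℂ (Nichols n)) :
    ofDual (Nichols.dualMul φ ψ) = ofDual φ * ofDual ψ := by
  change tmul _ 1 = tmul φ 1 * tmul ψ 1
  rw [tmul_mul_tmul, Nichols.opH_one, Module.End.one_apply, Nichols.opDual_tmul]
  rfl

/-- The algebra map `𝒦ₙ → D𝒦ₙ`, `K ↦ K̄`, `ξᵢ ↦ ξ̄ᵢ`, whose image is `𝒦ₙ*`. -/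
def bar (n : ℕ) : Nichols n →ₐ[ℂ] NicholsDouble n :=
  AlgHom.ofLinearMap (ofDual ∘ₗ Nichols.dualMap n)
    (by rw [LinearMap.comp_apply, Nichols.dualMap_one]; rfl)
    (fun x y => by simp only [LinearMap.comp_apply, Nichols.dualMap_mul, ofDual_mul])

theorem bar_apply (x : Nichols n) : bar n x = ofDual (Nichols.dualMap n x) := rfl

theorem hop_apply (x : Nichols n) : hop n x = ofHopf x := rfl

@[simp] theorem hop_K : hop n (Nichols.K n) = K n := rfl
@[simp] theorem hop_xi (i : Fin n) : hop n (Nichols.xi i) = xi i := rfl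
@[simp] theorem bar_K : bar n (Nichols.K n) = Kbar n := by
  rw [bar_apply, Nichols.dualMap_K, ← Nichols.kbar_eq_coord]; rfl
@[simp] theorem bar_xi (i : Fin n) : bar n (Nichols.xi i) = xibar i := by
  rw [bar_apply, Nichols.dualMap_xi]; rfl

@[simp] theorem hop_word (I : Finset (Fin n)) : hop n (Nichols.word I) = word I :=
  map_orderedProd _ _ _

@[simp] theorem bar_word (I : Finset (Fin n)) : bar n (Nichols.word I) = wordBar I := by
  rw [Nichols.word, map_orderedProd]
  simp only [bar_xi]
  rfl

theorem K_mul_K : K n * K n = 1 := by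
  rw [← hop_K, ← map_mul, Nichols.K_mul_K, map_one]

theorem Kbar_mul_Kbar : Kbar n * Kbar n = 1 := by
  rw [← bar_K, ← map_mul, Nichols.K_mul_K, map_one]

theorem xi_mul_self (i : Fin n) : xi i * xi i = 0 := by
  rw [← hop_xi, ← map_mul, Nichols.xi_mul_self, map_zero]

theorem xibar_mul_self (i : Fin n) : xibar i * xibar i = 0 := by
  rw [← bar_xi, ← map_mul, Nichols.xi_mul_self, map_zero]

theorem K_mul_xi (i : Fin n) : K n * xi i = -(xi i * K n) := by
  rw [← hop_xi, ← hop_K, ← map_mul, Nichols.K_mul_xi, map_neg, map_mul]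

theorem Kbar_mul_xibar (i : Fin n) : Kbar n * xibar i = -(xibar i * Kbar n) := by
  rw [← bar_xi, ← bar_K, ← map_mul, Nichols.K_mul_xi, map_neg, map_mul]

theorem xi_mul_xi (i j : Fin n) : xi i * xi j = -(xi j * xi i) := by
  rw [← hop_xi, ← hop_xi, ← map_mul, Nichols.xi_mul_xi, map_neg, map_mul]

theorem xibar_mul_xibar (i j : Fin n) : xibar i * xibar j = -(xibar j * xibar i) := by
  rw [← bar_xi, ← bar_xi, ← map_mul, Nichols.xi_mul_xi, map_neg, map_mul]

theorem K_mul_ofDual (φ : Module.Dual ℂ (Nichols n)) :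
    K n * ofDual φ = ofDual (Nichols.sandwich (Nichols.K n) (Nichols.K n) φ) * K n := by
  change _ = ofDual _ * ofHopf _
  rw [ofDual_mul_ofHopf]
  change tmul _ _ * tmul φ 1 = _
  rw [tmul_mul_tmul, Nichols.opH_K, Nichols.opDual_tmul, Nichols.counit_dualMul, mul_one]
  rfl

theorem xi_mul_ofDual (i : Fin n) (φ : Module.Dual ℂ (Nichols n)) :
    xi i * ofDual φ =
      ofDual (Nichols.sandwich (Nichols.K n * Nichols.xi i) (Nichols.K n) φ) * K n +
      ofDual (Nichols.sandwich 1 (Nichols.K n) φ) * xi i +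
      ofDual (Nichols.sandwich 1 (Nichols.xi i) φ) := by
  change _ = ofDual _ * ofHopf _ + ofDual _ * ofHopf _ + _
  rw [ofDual_mul_ofHopf, ofDual_mul_ofHopf]
  change tmul _ _ * tmul φ 1 = _
  rw [tmul_mul_tmul, Nichols.opH_xi]
  simp only [map_add, Nichols.opDual_tmul, Nichols.counit_dualMul, mul_one]
  rfl

theorem ofDual_kbar : ofDual (Nichols.kbar n).toLinearMap = Kbar n := by
  rw [← Nichols.dualMap_K, ← bar_K, bar_apply]

theorem ofDual_xb (i : Fin n) : ofDual (Nichols.xb i) = xibar i := rfl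

theorem K_mul_Kbar : K n * Kbar n = Kbar n * K n := by
  have h : Nichols.sandwich (Nichols.K n) (Nichols.K n) (Nichols.kbar n).toLinearMap =
      (Nichols.kbar n).toLinearMap := by
    ext y; simp [Nichols.sandwich_apply]
  rw [← ofDual_kbar, K_mul_ofDual, h]

theorem K_mul_xibar (i : Fin n) : K n * xibar i = -(xibar i * K n) := by
  have h : Nichols.sandwich (Nichols.K n) (Nichols.K n) (Nichols.xb i) = -Nichols.xb i := by
    ext y
    simp [Nichols.sandwich_apply, Nichols.xb_K_mul, Nichols.xb_mul i y, Nichols.xb_K]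
  rw [← ofDual_xb, K_mul_ofDual, h, map_neg, neg_mul]

theorem xi_mul_Kbar (i : Fin n) : xi i * Kbar n = -(Kbar n * xi i) := by
  have h1 : Nichols.sandwich (Nichols.K n * Nichols.xi i) (Nichols.K n)
      (Nichols.kbar n).toLinearMap = 0 := by ext y; simp [Nichols.sandwich_apply]
  have h2 : Nichols.sandwich 1 (Nichols.K n)
      (Nichols.kbar n).toLinearMap = -(Nichols.kbar n).toLinearMap := by
    ext y; simp [Nichols.sandwich_apply]
  have h3 : Nichols.sandwich 1 (Nichols.xi i)
      (Nichols.kbar n).toLinearMap = 0 := by ext y; simp [Nichols.sandwich_apply]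
  rw [← ofDual_kbar, xi_mul_ofDual, h1, h2, h3]
  simp

theorem Kbar_mul_xi (i : Fin n) : Kbar n * xi i = -(xi i * Kbar n) := by
  rw [xi_mul_Kbar, neg_neg]

/-- The anticommutator `{ξᵢ, ξ̄ⱼ} = δᵢⱼ (1 - K K̄)`. -/
theorem xi_mul_xibar (i j : Fin n) : xi i * xibar j + xibar j * xi i =
    if i = j then 1 - K n * Kbar n else 0 := by
  have h1 : Nichols.sandwich (Nichols.K n * Nichols.xi i) (Nichols.K n) (Nichols.xb j) =
      (if i = j then (-1 : ℂ) else 0) • (Nichols.kbar n).toLinearMap := by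
    ext y
    rw [Nichols.sandwich_apply, mul_assoc, Nichols.xb_K_mul, Nichols.xb_xi_mul]
    by_cases h : i = j
    · simp [h]
    · simp [h, Ne.symm h]
  have h2 : Nichols.sandwich 1 (Nichols.K n) (Nichols.xb j) = -Nichols.xb j := by
    ext y; simp [Nichols.sandwich_apply, Nichols.xb_mul j y, Nichols.xb_K]
  have h3 : Nichols.sandwich 1 (Nichols.xi i) (Nichols.xb j) =
      (if i = j then (1 : ℂ) else 0) • counit (R := ℂ) := by
    ext y
    rw [Nichols.sandwich_apply, one_mul, Nichols.xb_mul, Nichols.xb_xi]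
    by_cases h : i = j
    · simp [h]
    · simp [h, Ne.symm h]
  have h4 : ofDual (counit (R := ℂ)) = (1 : NicholsDouble n) := rfl
  rw [← ofDual_xb, xi_mul_ofDual, h1, h2, h3, map_smul, map_smul, h4, ofDual_kbar, map_neg,
    neg_mul, K_mul_Kbar]
  split_ifs
  · simp; abel
  · simp

theorem xibar_mul_xi (i j : Fin n) : xibar i * xi j + xi j * xibar i =
    if i = j then 1 - K n * Kbar n else 0 := by
  rw [add_comm, xi_mul_xibar]
  simp only [eq_comm]

/-! ### The normal form `x̄ y` and the universal property of the double -/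

/-- The linear isomorphism `𝒦ₙ ⊗ 𝒦ₙ ≃ D𝒦ₙ`, `x ⊗ y ↦ x̄ y`. -/
def normalForm (n : ℕ) : Nichols n ⊗[ℂ] Nichols n ≃ₗ[ℂ] NicholsDouble n :=
  (TensorProduct.congr (LinearEquiv.ofBijective (Nichols.dualMap n) Nichols.dualMap_bijective)
    (LinearEquiv.refl ℂ _)).trans (equiv n).symm

theorem normalForm_tmul (x y : Nichols n) : normalForm n (x ⊗ₜ y) = bar n x * hop n y := by
  rw [bar_apply, hop_apply, ofDual_mul_ofHopf]
  rfl

theorem tmul_dualMap (x y : Nichols n) : tmul (Nichols.dualMap n x) y = bar n x * hop n y :=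
  (ofDual_mul_ofHopf _ _).symm

theorem normalForm_symm_mul (x y : Nichols n) :
    (normalForm n).symm (bar n x * hop n y) = x ⊗ₜ y := by
  rw [← normalForm_tmul, LinearEquiv.symm_apply_apply]

theorem induction_bar_hop {p : NicholsDouble n → Prop} (h : ∀ x y, p (bar n x * hop n y))
    (hadd : ∀ a b, p a → p b → p (a + b)) (a : NicholsDouble n) : p a := by
  rw [← (normalForm n).apply_symm_apply a]
  induction (normalForm n).symm a with
  | zero => simpa using h 0 0
  | add s t hs ht => rw [map_add]; exact hadd _ _ hs ht
  | tmul x y => rw [normalForm_tmul]; exact h x y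

theorem lin_ext {M : Type*} [AddCommGroup M] [Module ℂ M] {f g : NicholsDouble n →ₗ[ℂ] M}
    (h : ∀ x y, f (bar n x * hop n y) = g (bar n x * hop n y)) : f = g := by
  ext a
  induction a using induction_bar_hop with
  | h x y => exact h x y
  | hadd a b ha hb => rw [map_add, map_add, ha, hb]

theorem algHom_ext {A : Type*} [Ring A] [Algebra ℂ A] {f g : NicholsDouble n →ₐ[ℂ] A}
    (hK : f (K n) = g (K n)) (hKbar : f (Kbar n) = g (Kbar n)) (hx : ∀ i, f (xi i) = g (xi i))
    (hxbar : ∀ i, f (xibar i) = g (xibar i)) : f = g := by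
  have h1 : f.comp (hop n) = g.comp (hop n) := Nichols.algHom_ext (by simpa) (by simpa)
  have h2 : f.comp (bar n) = g.comp (bar n) := Nichols.algHom_ext (by simpa) (by simpa)
  apply AlgHom.toLinearMap_injective
  refine lin_ext fun x y => ?_
  have h1' := congrArg (fun F => F y) h1
  have h2' := congrArg (fun F => F x) h2
  simp only [AlgHom.comp_apply] at h1' h2'
  simp [h1', h2']

section lift

variable {A : Type*} [Ring A] [Algebra ℂ A] (f g : Nichols n →ₐ[ℂ] A)

/-- The linear map `x̄ y ↦ g(x) f(y)`. -/
def liftLin : NicholsDouble n →ₗ[ℂ] A :=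
  LinearMap.mul' ℂ A ∘ₗ TensorProduct.map g.toLinearMap f.toLinearMap ∘ₗ
    (normalForm n).symm.toLinearMap

theorem liftLin_bar_mul_hop (x y : Nichols n) : liftLin f g (bar n x * hop n y) = g x * f y := by
  rw [liftLin, LinearMap.comp_apply, LinearMap.comp_apply, LinearEquiv.coe_coe,
    normalForm_symm_mul]
  rfl

theorem liftLin_bar_mul (x : Nichols n) (w : NicholsDouble n) :
    liftLin f g (bar n x * w) = g x * liftLin f g w := by
  induction w using induction_bar_hop with
  | h u v => rw [← mul_assoc, ← map_mul, liftLin_bar_mul_hop, liftLin_bar_mul_hop, map_mul,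
      mul_assoc]
  | hadd a b ha hb => rw [mul_add, map_add, ha, hb, map_add, mul_add]

theorem liftLin_mul_aux (a : Nichols n)
    (hK : ∀ w, liftLin f g (hop n a * w) = f a * liftLin f g w →
      liftLin f g (hop n a * (Kbar n * w)) = f a * (g (Nichols.K n) * liftLin f g w))
    (hx : ∀ i w, liftLin f g (hop n a * w) = f a * liftLin f g w →
      liftLin f g (hop n a * (xibar i * w)) = f a * (g (Nichols.xi i) * liftLin f g w))
    (w : NicholsDouble n) : liftLin f g (hop n a * w) = f a * liftLin f g w := by
  have key : ∀ u : Nichols n, ∀ w, liftLin f g (hop n a * w) = f a * liftLin f g w →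
      liftLin f g (hop n a * (bar n u * w)) = f a * (g u * liftLin f g w) := by
    refine Nichols.mem_of_gens (s := { 
      carrier := {u | ∀ w, liftLin f g (hop n a * w) = f a * liftLin f g w →
        liftLin f g (hop n a * (bar n u * w)) = f a * (g u * liftLin f g w)}
      mul_mem' := fun {u v} hu hv w hw => by
        have hv' := hv w hw
        rw [← liftLin_bar_mul] at hv'
        rw [map_mul (bar n), mul_assoc, hu _ hv', liftLin_bar_mul, map_mul g, mul_assoc]
      add_mem' := fun {u v} hu hv w hw => by
        rw [map_add, add_mul, mul_add, map_add, hu w hw, hv w hw, map_add, add_mul, mul_add]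
      algebraMap_mem' := fun r w hw => by
        simp [Algebra.algebraMap_eq_smul_one, hw] }) ?_ ?_
    · intro w hw
      rw [bar_K]; exact hK w hw
    · intro i w hw
      rw [bar_xi]; exact hx i w hw
  induction w using induction_bar_hop with
  | h x y =>
    rw [key, liftLin_bar_mul]
    have h1 := liftLin_bar_mul_hop f g 1 (a * y)
    have h2 := liftLin_bar_mul_hop f g 1 y
    simp only [map_one, one_mul] at h1 h2
    rw [← map_mul, h1, h2, map_mul]
  | hadd a b ha hb => rw [mul_add, map_add, ha, hb, map_add, mul_add]

theorem liftLin_mul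
    (hKK : f (Nichols.K n) * g (Nichols.K n) = g (Nichols.K n) * f (Nichols.K n))
    (hKx : ∀ i, f (Nichols.K n) * g (Nichols.xi i) = -(g (Nichols.xi i) * f (Nichols.K n)))
    (hxK : ∀ i, f (Nichols.xi i) * g (Nichols.K n) = -(g (Nichols.K n) * f (Nichols.xi i)))
    (hxx : ∀ i j, f (Nichols.xi i) * g (Nichols.xi j) + g (Nichols.xi j) * f (Nichols.xi i) =
      if i = j then 1 - g (Nichols.K n) * f (Nichols.K n) else 0)
    (z w : NicholsDouble n) :
    liftLin f g (z * w) = liftLin f g z * liftLin f g w := by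
  have hK : ∀ w, liftLin f g (K n * w) = f (Nichols.K n) * liftLin f g w := by
    refine liftLin_mul_aux f g (Nichols.K n) (fun w hw => ?_) (fun i w hw => ?_)
    · rw [hop_K, ← mul_assoc, K_mul_Kbar, mul_assoc, ← bar_K, liftLin_bar_mul, ← hop_K, hw,
        ← mul_assoc, ← hKK, mul_assoc]
    · rw [hop_K, ← mul_assoc, K_mul_xibar, neg_mul, mul_assoc, ← bar_xi, map_neg, liftLin_bar_mul,
        ← hop_K, hw, ← mul_assoc, ← mul_assoc, hKx, neg_mul]
  have hx : ∀ i w, liftLin f g (xi i * w) = f (Nichols.xi i) * liftLin f g w := by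
    intro i
    refine liftLin_mul_aux f g (Nichols.xi i) (fun w hw => ?_) (fun j w hw => ?_)
    · rw [hop_xi, ← mul_assoc, xi_mul_Kbar, neg_mul, mul_assoc, ← bar_K, map_neg, liftLin_bar_mul,
        ← hop_xi, hw, ← mul_assoc, ← mul_assoc, hxK, neg_mul]
    · rw [hop_xi, ← mul_assoc, eq_sub_of_add_eq (xi_mul_xibar i j), sub_mul, map_sub, mul_assoc,
        ← bar_xi, liftLin_bar_mul, ← hop_xi, hw, ← mul_assoc (f _),
        eq_sub_of_add_eq (hxx i j), sub_mul, mul_assoc]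
      congr 1
      split_ifs
      · rw [sub_mul, sub_mul, map_sub, one_mul, one_mul, K_mul_Kbar, mul_assoc, ← bar_K,
          liftLin_bar_mul, hK, mul_assoc]
      · simp
  have hh : ∀ y w, liftLin f g (hop n y * w) = f y * liftLin f g w := by
    intro y
    induction y using Nichols.induction_left with
    | h1 => simp
    | hadd a b ha hb => intro w; rw [map_add, add_mul, map_add, ha, hb, map_add, add_mul]
    | hsmul r a ha => intro w; rw [map_smul, smul_mul_assoc, map_smul, ha, map_smul, smul_mul_assoc]
    | hK a ha => intro w; rw [map_mul (hop n), hop_K, mul_assoc, hK, ha, map_mul f, mul_assoc]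
    | hx i a ha => intro w; rw [map_mul (hop n), hop_xi, mul_assoc, hx, ha, map_mul f, mul_assoc]
  induction z using induction_bar_hop with
  | h x y => rw [mul_assoc, liftLin_bar_mul, hh, liftLin_bar_mul_hop, mul_assoc]
  | hadd a b ha hb => rw [add_mul, map_add, ha, hb, map_add, add_mul]

variable
  (hKK : f (Nichols.K n) * g (Nichols.K n) = g (Nichols.K n) * f (Nichols.K n))
  (hKx : ∀ i, f (Nichols.K n) * g (Nichols.xi i) = -(g (Nichols.xi i) * f (Nichols.K n)))
  (hxK : ∀ i, f (Nichols.xi i) * g (Nichols.K n) = -(g (Nichols.K n) * f (Nichols.xi i)))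
  (hxx : ∀ i j, f (Nichols.xi i) * g (Nichols.xi j) + g (Nichols.xi j) * f (Nichols.xi i) =
    if i = j then 1 - g (Nichols.K n) * f (Nichols.K n) else 0)

/-- The algebra map out of the double given by compatible algebra maps on its two halves. -/
def lift : NicholsDouble n →ₐ[ℂ] A :=
  AlgHom.ofLinearMap (liftLin f g)
    (by have := liftLin_bar_mul_hop f g 1 1; simpa using this)
    (liftLin_mul f g hKK hKx hxK hxx)

theorem lift_bar_mul_hop (x y : Nichols n) :
    lift f g hKK hKx hxK hxx (bar n x * hop n y) = g x * f y :=
  liftLin_bar_mul_hop f g x y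

theorem lift_bar (x : Nichols n) : lift f g hKK hKx hxK hxx (bar n x) = g x := by
  have := lift_bar_mul_hop f g hKK hKx hxK hxx x 1
  simpa using this

theorem lift_hop (y : Nichols n) : lift f g hKK hKx hxK hxx (hop n y) = f y := by
  have := lift_bar_mul_hop f g hKK hKx hxK hxx 1 y
  simpa using this

end lift

/-- The involution of the double that exchanges `K` with `K̄` and `ξᵢ` with `ξ̄ᵢ`. -/
def swap (n : ℕ) : NicholsDouble n →ₐ[ℂ] NicholsDouble n :=
  lift (bar n) (hop n) (by simp [K_mul_Kbar]) (by simp [Kbar_mul_xi]) (by simp [K_mul_xibar])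
    (fun i j => by simp only [bar_xi, hop_xi, hop_K, bar_K, xibar_mul_xi])

@[simp] theorem swap_bar (x : Nichols n) : swap n (bar n x) = hop n x := lift_bar _ _ _ _ _ _ x
@[simp] theorem swap_hop (x : Nichols n) : swap n (hop n x) = bar n x := lift_hop _ _ _ _ _ _ x
@[simp] theorem swap_K : swap n (K n) = Kbar n := by rw [← hop_K, swap_hop, bar_K]
@[simp] theorem swap_Kbar : swap n (Kbar n) = K n := by rw [← bar_K, swap_bar, hop_K]
@[simp] theorem swap_xi (i : Fin n) : swap n (xi i) = xibar i := by rw [← hop_xi, swap_hop, bar_xi]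
@[simp] theorem swap_xibar (i : Fin n) : swap n (xibar i) = xi i := by
  rw [← bar_xi, swap_bar, hop_xi]

theorem swap_swap (x : NicholsDouble n) : swap n (swap n x) = x := by
  have : (swap n).comp (swap n) = AlgHom.id ℂ _ :=
      algHom_ext (by simp) (by simp) (by simp) (by simp)
  exact congrArg (fun f => f x) this

theorem induction_hop_bar {p : NicholsDouble n → Prop} (h : ∀ x y, p (hop n x * bar n y))
    (hadd : ∀ a b, p a → p b → p (a + b)) (a : NicholsDouble n) : p a := by
  rw [← swap_swap a]
  induction swap n a using induction_bar_hop with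
  | h x y => simpa using h x y
  | hadd a b ha hb => rw [map_add]; exact hadd _ _ ha hb

/-- A property stable under sums, scalars, and left multiplication by generators holds on all of
`D𝒦ₙ` once it holds for `1`. -/
theorem induction_left {p : NicholsDouble n → Prop} (h1 : p 1)
    (hadd : ∀ a b, p a → p b → p (a + b)) (hsmul : ∀ (r : ℂ) a, p a → p (r • a))
    (hK : ∀ a, p a → p (K n * a)) (hKb : ∀ a, p a → p (Kbar n * a))
    (hx : ∀ i a, p a → p (xi i * a)) (hxb : ∀ i a, p a → p (xibar i * a)) (a : NicholsDouble n) :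
    p a := by
  induction a using induction_bar_hop with
  | hadd a b ha hb => exact hadd a b ha hb
  | h x y =>
    induction x using Nichols.induction_left with
    | h1 =>
      rw [map_one, one_mul]
      induction y using Nichols.induction_left with
      | h1 => simpa
      | hadd a b ha hb => rw [map_add]; exact hadd _ _ ha hb
      | hsmul r a ha => rw [map_smul]; exact hsmul _ _ ha
      | hK a ha => rw [map_mul]; exact hK _ ha
      | hx i a ha => rw [map_mul]; exact hx i _ ha
    | hadd a b ha hb => rw [map_add, add_mul]; exact hadd _ _ ha hb
    | hsmul r a ha => rw [map_smul, smul_mul_assoc]; exact hsmul _ _ ha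
    | hK a ha => rw [map_mul, mul_assoc, bar_K]; exact hKb _ ha
    | hx i a ha => rw [map_mul, mul_assoc, bar_xi]; exact hxb i _ ha

/-! ### The Hopf structure maps are (anti)multiplicative -/

theorem Kbar_mul_K : Kbar n * K n = K n * Kbar n := K_mul_Kbar.symm

/-- The counit of the double as an algebra map. -/
def counitHom (n : ℕ) : NicholsDouble n →ₐ[ℂ] ℂ :=
  lift (Bialgebra.counitAlgHom ℂ _) (Bialgebra.counitAlgHom ℂ _) (by simp) (by simp) (by simp)
    (fun i j => by simp)

theorem dualMap_apply_one (x : Nichols n) : Nichols.dualMap n x 1 = counit (R := ℂ) x := by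
  induction x using Nichols.induction_left with
  | h1 => simp [Nichols.dualMap_one]
  | hadd a b ha hb => simp only [map_add, LinearMap.add_apply, ha, hb]
  | hsmul r a ha => simp only [map_smul, LinearMap.smul_apply, ha]
  | hK a ha => simp [Nichols.dualMap_K_mul_apply, ha]
  | hx i a ha => simp [Nichols.dualMap_xi_mul_apply]

theorem counitD_eq : counitD n = (counitHom n).toLinearMap := by
  refine lin_ext fun x y => ?_
  rw [← tmul_dualMap, AlgHom.toLinearMap_apply, tmul_dualMap, counitHom, lift_bar_mul_hop,
    ← tmul_dualMap]
  change Nichols.dualMap n x 1 * _ = _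
  rw [dualMap_apply_one]
  rfl

/-- The comultiplication of the double as an algebra map. -/
def comulHom (n : ℕ) : NicholsDouble n →ₐ[ℂ] NicholsDouble n ⊗[ℂ] NicholsDouble n :=
  lift ((Algebra.TensorProduct.map (hop n) (hop n)).comp (Bialgebra.comulAlgHom ℂ _))
    ((Algebra.TensorProduct.map (bar n) (bar n)).comp (Bialgebra.comulAlgHom ℂ _))
    (by simp [K_mul_Kbar])
    (fun i => by simp [mul_add, add_mul, K_mul_Kbar, K_mul_xibar, TensorProduct.tmul_neg,
      TensorProduct.neg_tmul]; abel)
    (fun i => by simp [mul_add, add_mul, Kbar_mul_K, xi_mul_Kbar, TensorProduct.tmul_neg,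
      TensorProduct.neg_tmul]; abel)
    (fun i j => by
      simp only [AlgHom.comp_apply, Bialgebra.comulAlgHom_apply, Nichols.comul_xi,
        Nichols.comul_K, map_add, Algebra.TensorProduct.map_tmul, hop_K, bar_K, hop_xi, bar_xi,
        mul_add, add_mul, Algebra.TensorProduct.tmul_mul_tmul, map_one, one_mul, mul_one,
        Kbar_mul_K, K_mul_xibar, xi_mul_Kbar, TensorProduct.neg_tmul]
      have h1 := eq_sub_of_add_eq (xi_mul_xibar i j)
      rw [h1]
      split_ifs
      · simp only [TensorProduct.tmul_sub, TensorProduct.sub_tmul, Algebra.TensorProduct.one_def]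
        abel
      · simp only [TensorProduct.tmul_sub, TensorProduct.sub_tmul, TensorProduct.tmul_zero,
          TensorProduct.zero_tmul]
        abel)

theorem comulHom_K : comulHom n (K n) = K n ⊗ₜ K n := by
  rw [← hop_K, comulHom, lift_hop]; simp

theorem comulHom_Kbar : comulHom n (Kbar n) = Kbar n ⊗ₜ Kbar n := by
  rw [← bar_K, comulHom, lift_bar]; simp

theorem comulHom_xi (i : Fin n) : comulHom n (xi i) = K n ⊗ₜ xi i + xi i ⊗ₜ 1 := by
  rw [← hop_xi, comulHom, lift_hop]; simp

theorem comulHom_xibar (i : Fin n) :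
    comulHom n (xibar i) = Kbar n ⊗ₜ xibar i + xibar i ⊗ₜ 1 := by
  rw [← bar_xi, comulHom, lift_bar]; simp

theorem comm_dualComul_dualMap (x : Nichols n) :
    TensorProduct.comm ℂ _ _ (dualComul (Nichols.dualMap n x)) =
      TensorProduct.map (Nichols.dualMap n) (Nichols.dualMap n) (comul (R := ℂ) x) := by
  rw [← LinearEquiv.eq_symm_apply, dualComul, LinearMap.comp_apply, LinearEquiv.coe_coe,
    LinearEquiv.symm_apply_eq]
  ext a b
  have h := Nichols.dualMap_mul_eq_dualDistrib x a b
  have h2 : ∀ t : Module.Dual ℂ (Nichols n) ⊗[ℂ] Module.Dual ℂ (Nichols n),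
      TensorProduct.dualDistrib ℂ _ _ t (b ⊗ₜ a) =
      TensorProduct.dualDistribEquivOfBasis (Nichols.basis n) (Nichols.basis n)
        ((TensorProduct.comm ℂ _ _).symm t) (a ⊗ₜ b) := by
    intro t
    induction t with
    | zero => simp
    | add s t hs ht => simp only [map_add, LinearMap.add_apply, hs, ht]
    | tmul s t => simp [TensorProduct.dualDistribEquivOfBasis_apply_apply, mul_comm]
  rw [h2] at h
  exact h

theorem comulD_eq : comulD n = (comulHom n).toLinearMap := by
  refine lin_ext fun x y => ?_
  rw [AlgHom.toLinearMap_apply, comulHom, lift_bar_mul_hop, ← tmul_dualMap]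
  have h : comulD n (tmul (Nichols.dualMap n x) y) =
      TensorProduct.map (equiv n).symm.toLinearMap (equiv n).symm.toLinearMap
        (TensorProduct.tensorTensorTensorComm ℂ _ _ _ _
          (TensorProduct.comm ℂ _ _ (dualComul (Nichols.dualMap n x)) ⊗ₜ comul (R := ℂ) y)) := rfl
  rw [h, comm_dualComul_dualMap, AlgHom.comp_apply, AlgHom.comp_apply,
    Bialgebra.comulAlgHom_apply, Bialgebra.comulAlgHom_apply]
  induction comul (R := ℂ) x with
  | zero => simp
  | add s t hs ht => simp only [map_add, TensorProduct.add_tmul, add_mul, hs, ht]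
  | tmul s t =>
    induction comul (R := ℂ) y with
    | zero => simp
    | add u v hu hv => simp only [map_add, TensorProduct.tmul_add, mul_add, hu, hv]
    | tmul u v =>
      simp only [TensorProduct.map_tmul, TensorProduct.tensorTensorTensorComm_tmul,
        Algebra.TensorProduct.map_tmul, Algebra.TensorProduct.tmul_mul_tmul, ← tmul_dualMap]
      rfl

open MulOpposite in
/-- The antipode of the double as an algebra map to the opposite algebra. -/
def antipodeHom (n : ℕ) : NicholsDouble n →ₐ[ℂ] (NicholsDouble n)ᵐᵒᵖ :=
  lift ((AlgHom.op (hop n)).comp Nichols.antipodeOp) ((AlgHom.op (bar n)).comp Nichols.antipodeOp)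
    (by simp [Nichols.antipodeOp, ← op_mul, K_mul_Kbar])
    (fun i => by
      simp only [Nichols.antipodeOp, AlgHom.comp_apply, Nichols.lift_K, Nichols.lift_xi,
        AlgHom.op_apply_apply, unop_op, map_neg, map_mul, hop_K, bar_K, bar_xi, ← op_mul, ← op_neg]
      rw [neg_mul, mul_neg, neg_neg, ← mul_assoc, K_mul_Kbar, mul_assoc, mul_assoc, K_mul_xibar,
        mul_neg])
    (fun i => by
      simp only [Nichols.antipodeOp, AlgHom.comp_apply, Nichols.lift_K, Nichols.lift_xi,
        AlgHom.op_apply_apply, unop_op, map_neg, map_mul, hop_K, bar_K, hop_xi, ← op_mul, ← op_neg]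
      rw [neg_mul, mul_neg, neg_neg, ← mul_assoc, ← K_mul_Kbar, mul_assoc, mul_assoc, Kbar_mul_xi,
        mul_neg, neg_neg])
    (fun i j => by
      simp only [Nichols.antipodeOp, AlgHom.comp_apply, Nichols.lift_K, Nichols.lift_xi,
        AlgHom.op_apply_apply, unop_op, map_neg, map_mul, hop_K, bar_K, hop_xi, bar_xi, ← op_mul,
        ← op_add, ← op_one, ← op_sub]
      have h1 : Kbar n * xibar j * (K n * xi i) = -(K n * Kbar n * (xibar j * xi i)) := by
        rw [mul_assoc, ← mul_assoc (xibar j), ← neg_eq_iff_eq_neg.2 (K_mul_xibar j), neg_mul,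
          mul_neg, mul_assoc, ← mul_assoc, Kbar_mul_K]
      have h2 : K n * xi i * (Kbar n * xibar j) = -(K n * Kbar n * (xi i * xibar j)) := by
        rw [mul_assoc, ← mul_assoc (xi i), xi_mul_Kbar, neg_mul, mul_neg, mul_assoc, ← mul_assoc]
      rw [neg_mul_neg, neg_mul_neg, h1, h2, ← neg_add, ← mul_add, add_comm (xibar j * _),
        xi_mul_xibar]
      split_ifs
      · congr 1
        rw [mul_sub, mul_one, mul_assoc, ← mul_assoc (Kbar n), Kbar_mul_K, mul_assoc,
          Kbar_mul_Kbar, mul_one, K_mul_K, neg_sub]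
      · simp)

theorem antipodeD_eq (x : NicholsDouble n) : antipodeD n x = (antipodeHom n x).unop := by
  have : antipodeD n = (MulOpposite.opLinearEquiv ℂ).symm.toLinearMap ∘ₗ
      (antipodeHom n).toLinearMap := by
    refine lin_ext fun x y => ?_
    rw [LinearMap.comp_apply, AlgHom.toLinearMap_apply, antipodeHom, lift_bar_mul_hop,
      ← tmul_dualMap]
    change ofHopf (Nichols.antipodeLin y) * ofDual (Nichols.dualMap n x ∘ₗ Nichols.antipodeInv) = _
    have : Nichols.dualMap n x ∘ₗ Nichols.antipodeInv =
        Nichols.dualMap n (Nichols.antipodeLin x) := by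
      ext z; exact Nichols.dualMap_antipodeInv x z
    rw [this]
    rfl
  exact congrArg (fun f => f x) this

theorem antipodeD_mul (x y : NicholsDouble n) :
    antipodeD n (x * y) = antipodeD n y * antipodeD n x := by
  simp [antipodeD_eq]

@[simp] theorem antipodeD_K : antipodeD n (K n) = K n := by
  rw [antipodeD_eq, ← hop_K, antipodeHom, lift_hop]; simp [Nichols.antipodeOp]

@[simp] theorem antipodeD_Kbar : antipodeD n (Kbar n) = Kbar n := by
  rw [antipodeD_eq, ← bar_K, antipodeHom, lift_bar]; simp [Nichols.antipodeOp]

@[simp] theorem antipodeD_xi (i : Fin n) : antipodeD n (xi i) = -(K n * xi i) := by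
  rw [antipodeD_eq, ← hop_xi, antipodeHom, lift_hop]; simp [Nichols.antipodeOp]

@[simp] theorem antipodeD_xibar (i : Fin n) : antipodeD n (xibar i) = -(Kbar n * xibar i) := by
  rw [antipodeD_eq, ← bar_xi, antipodeHom, lift_bar]; simp [Nichols.antipodeOp]

end NicholsDouble

end

noncomputable section

namespace Nichols

theorem revSign_eq (k : ℕ) : revSign k = (-1) ^ (k / 2) := by
  induction k with
  | zero => simp [revSign_zero]
  | succ k ih =>
    rw [revSign_succ, ih]
    rcases Nat.even_or_odd' k with ⟨m, rfl | rfl⟩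
    · rw [pow_mul, show (2 * m + 1) / 2 = m by omega, show 2 * m / 2 = m by omega]
      simp
    · rw [show (2 * m + 1 + 1) / 2 = m + 1 by omega, show (2 * m + 1) / 2 = m by omega, pow_succ,
        pow_mul]
      ring

theorem neg_one_pow_eq_mul_revSign (k : ℕ) :
    (-1 : ℂ) ^ ((k + 1) / 2) = (-1) ^ k * revSign k := by
  rw [← revSign_eq, revSign_succ]

end Nichols

namespace NicholsDouble

open Nichols (revSign sgn)

variable {n : ℕ}

/-! ### The central involution `K K̄` and the group-like elements -/

/-- The central element `K K̄`, whose square is `1`. -/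
def cen (n : ℕ) : NicholsDouble n := K n * Kbar n

theorem K_mul_K_mul (a : NicholsDouble n) : K n * (K n * a) = a := by
  rw [← mul_assoc, K_mul_K, one_mul]

theorem Kbar_mul_Kbar_mul (a : NicholsDouble n) : Kbar n * (Kbar n * a) = a := by
  rw [← mul_assoc, Kbar_mul_Kbar, one_mul]

theorem Kbar_mul_K_mul (a : NicholsDouble n) : Kbar n * (K n * a) = K n * (Kbar n * a) := by
  rw [← mul_assoc, Kbar_mul_K, mul_assoc]

theorem xi_mul_K (i : Fin n) : xi i * K n = -(K n * xi i) := by rw [K_mul_xi, neg_neg]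

theorem xibar_mul_K (i : Fin n) : xibar i * K n = -(K n * xibar i) := by
  rw [K_mul_xibar, neg_neg]

theorem xibar_mul_Kbar (i : Fin n) : xibar i * Kbar n = -(Kbar n * xibar i) := by
  rw [Kbar_mul_xibar, neg_neg]

theorem xi_mul_K_mul (i : Fin n) (a : NicholsDouble n) :
    xi i * (K n * a) = -(K n * (xi i * a)) := by
  rw [← mul_assoc, xi_mul_K, neg_mul, mul_assoc]

theorem xi_mul_Kbar_mul (i : Fin n) (a : NicholsDouble n) :
    xi i * (Kbar n * a) = -(Kbar n * (xi i * a)) := by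
  rw [← mul_assoc, xi_mul_Kbar, neg_mul, mul_assoc]

theorem cen_mul_cen : cen n * cen n = 1 := by
  rw [cen, mul_assoc, Kbar_mul_K_mul, Kbar_mul_Kbar, mul_one, K_mul_K]

theorem cen_mul_cen_mul (a : NicholsDouble n) : cen n * (cen n * a) = a := by
  rw [← mul_assoc, cen_mul_cen, one_mul]

theorem K_mul_cen : K n * cen n = Kbar n := by rw [cen, K_mul_K_mul]

theorem cen_mul_K : cen n * K n = Kbar n := by rw [cen, mul_assoc, Kbar_mul_K, K_mul_K_mul]

theorem commute_cen (x : NicholsDouble n) : Commute (cen n) x := by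
  induction x using induction_left with
  | h1 => exact Commute.one_right _
  | hadd a b ha hb => exact ha.add_right hb
  | hsmul r a ha => exact ha.smul_right r
  | hK a ha =>
    refine Commute.mul_right ?_ ha
    change _ = _
    rw [K_mul_cen, cen_mul_K]
  | hKb a ha =>
    refine Commute.mul_right ?_ ha
    change _ = _
    rw [cen, mul_assoc, Kbar_mul_K_mul]
  | hx i a ha =>
    refine Commute.mul_right ?_ ha
    change _ = _
    rw [cen, mul_assoc, Kbar_mul_xi, mul_neg, ← mul_assoc, K_mul_xi, neg_mul, neg_neg, mul_assoc]
  | hxb i a ha =>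
    refine Commute.mul_right ?_ ha
    change _ = _
    rw [cen, mul_assoc, Kbar_mul_xibar, mul_neg, ← mul_assoc, K_mul_xibar, neg_mul, neg_neg,
      mul_assoc]

theorem cen_mul (x : NicholsDouble n) : cen n * x = x * cen n := commute_cen x

theorem mul_cen_mul (x y : NicholsDouble n) : x * (cen n * y) = cen n * (x * y) := by
  rw [← mul_assoc, ← cen_mul, mul_assoc]

/-- An element that commutes with the generators is central. -/
theorem commute_of_gens {z : NicholsDouble n} (hK : Commute z (K n)) (hKb : Commute z (Kbar n))
    (hx : ∀ i, Commute z (xi i)) (hxb : ∀ i, Commute z (xibar i)) (x : NicholsDouble n) :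
    Commute z x := by
  induction x using induction_left with
  | h1 => exact Commute.one_right _
  | hadd a b ha hb => exact ha.add_right hb
  | hsmul r a ha => exact ha.smul_right r
  | hK a ha => exact hK.mul_right ha
  | hKb a ha => exact hKb.mul_right ha
  | hx i a ha => exact (hx i).mul_right ha
  | hxb i a ha => exact (hxb i).mul_right ha

/-! ### Words in the double -/

theorem word_empty : word (∅ : Finset (Fin n)) = 1 := orderedProd_empty _

theorem wordBar_empty : wordBar (∅ : Finset (Fin n)) = 1 := orderedProd_empty _

theorem swap_word (I : Finset (Fin n)) : swap n (word I) = wordBar I := by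
  rw [← hop_word, swap_hop, bar_word]

theorem xi_mul_word_of_mem {i : Fin n} {I : Finset (Fin n)} (h : i ∈ I) : xi i * word I = 0 :=
  mul_orderedProd_of_mem xi_mul_self xi_mul_xi h

theorem xibar_mul_wordBar_of_mem {i : Fin n} {I : Finset (Fin n)} (h : i ∈ I) :
    xibar i * wordBar I = 0 :=
  mul_orderedProd_of_mem xibar_mul_self xibar_mul_xibar h

theorem wordBar_mul_xibar_of_mem {i : Fin n} {I : Finset (Fin n)} (h : i ∈ I) :
    wordBar I * xibar i = 0 :=
  orderedProd_mul_of_mem xibar_mul_self xibar_mul_xibar h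

theorem word_insert {i : Fin n} {I : Finset (Fin n)} (h : i ∉ I) :
    word (insert i I) = sgn i I • (xi i * word I) := by
  rw [word, word, mul_orderedProd_of_notMem xi_mul_xi h, smul_smul, Nichols.sgn_mul_self, one_smul]

theorem wordBar_insert {i : Fin n} {I : Finset (Fin n)} (h : i ∉ I) :
    wordBar (insert i I) = sgn i I • (xibar i * wordBar I) := by
  rw [← swap_word, word_insert h, map_smul, map_mul, swap_xi, swap_word]

theorem word_insert_max {i : Fin n} {I : Finset (Fin n)} (h : ∀ j ∈ I, j < i) :
    word (insert i I) = word I * xi i := orderedProd_insert_max _ h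

theorem wordBar_insert_max {i : Fin n} {I : Finset (Fin n)} (h : ∀ j ∈ I, j < i) :
    wordBar (insert i I) = wordBar I * xibar i := orderedProd_insert_max _ h

theorem xi_mul_word (i : Fin n) (I : Finset (Fin n)) :
    xi i * word I = (-1 : ℂ) ^ I.card • (word I * xi i) :=
  mul_orderedProd_of_anticomm fun j _ => xi_mul_xi i j

theorem xibar_mul_wordBar (i : Fin n) (I : Finset (Fin n)) :
    xibar i * wordBar I = (-1 : ℂ) ^ I.card • (wordBar I * xibar i) :=
  mul_orderedProd_of_anticomm fun j _ => xibar_mul_xibar i j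

theorem K_mul_word (I : Finset (Fin n)) : K n * word I = (-1 : ℂ) ^ I.card • (word I * K n) :=
  mul_orderedProd_of_anticomm fun i _ => K_mul_xi i

theorem Kbar_mul_word (I : Finset (Fin n)) :
    Kbar n * word I = (-1 : ℂ) ^ I.card • (word I * Kbar n) :=
  mul_orderedProd_of_anticomm fun i _ => Kbar_mul_xi i

theorem K_mul_wordBar (I : Finset (Fin n)) :
    K n * wordBar I = (-1 : ℂ) ^ I.card • (wordBar I * K n) :=
  mul_orderedProd_of_anticomm fun i _ => K_mul_xibar i

theorem Kbar_mul_wordBar (I : Finset (Fin n)) :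
    Kbar n * wordBar I = (-1 : ℂ) ^ I.card • (wordBar I * Kbar n) :=
  mul_orderedProd_of_anticomm fun i _ => Kbar_mul_xibar i

theorem wordBar_mul_K (I : Finset (Fin n)) :
    wordBar I * K n = (-1 : ℂ) ^ I.card • (K n * wordBar I) :=
  orderedProd_mul_of_anticomm fun i _ => K_mul_xibar i

theorem word_mul_K (I : Finset (Fin n)) :
    word I * K n = (-1 : ℂ) ^ I.card • (K n * word I) :=
  orderedProd_mul_of_anticomm fun i _ => K_mul_xi i

theorem word_mul_Kbar (I : Finset (Fin n)) :
    word I * Kbar n = (-1 : ℂ) ^ I.card • (Kbar n * word I) :=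
  orderedProd_mul_of_anticomm fun i _ => Kbar_mul_xi i

theorem xi_mul_xibar_of_ne {i j : Fin n} (h : i ≠ j) : xi i * xibar j = -(xibar j * xi i) := by
  have := xi_mul_xibar i j
  rw [if_neg h] at this
  exact eq_neg_of_add_eq_zero_left this

theorem xibar_mul_xi_of_ne {i j : Fin n} (h : i ≠ j) : xibar i * xi j = -(xi j * xibar i) := by
  rw [xi_mul_xibar_of_ne h.symm, neg_neg]

theorem xi_mul_xibar_self (i : Fin n) : xi i * xibar i = 1 - cen n - xibar i * xi i := by
  have := xi_mul_xibar i i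
  rw [if_pos rfl] at this
  exact eq_sub_of_add_eq this

theorem xibar_mul_xi_self (i : Fin n) : xibar i * xi i = 1 - cen n - xi i * xibar i := by
  rw [xi_mul_xibar_self]; abel

theorem xi_mul_wordBar_of_notMem {i : Fin n} {I : Finset (Fin n)} (h : i ∉ I) :
    xi i * wordBar I = (-1 : ℂ) ^ I.card • (wordBar I * xi i) :=
  mul_orderedProd_of_anticomm fun _ hj => xi_mul_xibar_of_ne fun hij => h (hij ▸ hj)

theorem xibar_mul_word_of_notMem {i : Fin n} {I : Finset (Fin n)} (h : i ∉ I) :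
    xibar i * word I = (-1 : ℂ) ^ I.card • (word I * xibar i) :=
  mul_orderedProd_of_anticomm fun _ hj => xibar_mul_xi_of_ne fun hij => h (hij ▸ hj)

theorem word_mul_xibar_of_notMem {i : Fin n} {I : Finset (Fin n)} (h : i ∉ I) :
    word I * xibar i = (-1 : ℂ) ^ I.card • (xibar i * word I) :=
  orderedProd_mul_of_anticomm fun _ hj => xibar_mul_xi_of_ne fun hij => h (hij ▸ hj)

theorem neg_one_pow_mul_self (k : ℕ) : (-1 : ℂ) ^ k * (-1) ^ k = 1 := by
  rw [← mul_pow]; simp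

theorem commute_K_word_mul_wordBar {I J : Finset (Fin n)} (h : Even (I.card + J.card)) :
    Commute (K n) (word I * wordBar J) := by
  change _ = _
  rw [← mul_assoc, K_mul_word, smul_mul_assoc, mul_assoc, K_mul_wordBar, mul_smul_comm, smul_smul,
    ← pow_add, h.neg_one_pow, one_smul, mul_assoc]

theorem commute_Kbar_word_mul_wordBar {I J : Finset (Fin n)} (h : Even (I.card + J.card)) :
    Commute (Kbar n) (word I * wordBar J) := by
  rw [← cen_mul_K]
  exact (commute_cen _).mul_left (commute_K_word_mul_wordBar h)

theorem commute_K_top : Commute (K n) (top n) := commute_K_word_mul_wordBar ⟨_, rfl⟩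

theorem commute_Kbar_top : Commute (Kbar n) (top n) := commute_Kbar_word_mul_wordBar ⟨_, rfl⟩

theorem xi_mul_top (i : Fin n) : xi i * top n = 0 := by
  rw [top, ← mul_assoc, xi_mul_word_of_mem (Finset.mem_univ i), zero_mul]

theorem top_mul_xibar (i : Fin n) : top n * xibar i = 0 := by
  rw [top, mul_assoc, wordBar_mul_xibar_of_mem (Finset.mem_univ i), mul_zero]

/-! ### Coefficients in the basis `Kᵃ w K̄ᵇ w̄'` -/

/-- The functional `x ȳ ↦ f(x) g(y)`. -/
def coefHB (f g : Module.Dual ℂ (Nichols n)) : Module.Dual ℂ (NicholsDouble n) :=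
  LinearMap.mul' ℂ ℂ ∘ₗ TensorProduct.map f g ∘ₗ (normalForm n).symm.toLinearMap ∘ₗ
    (swap n).toLinearMap

theorem coefHB_apply (f g : Module.Dual ℂ (Nichols n)) (x y : Nichols n) :
    coefHB f g (hop n x * bar n y) = f x * g y := by
  simp only [coefHB, LinearMap.comp_apply, AlgHom.toLinearMap_apply, map_mul, swap_hop, swap_bar,
    LinearEquiv.coe_coe, normalForm_symm_mul]
  simp

/-! ### Vacuum vectors

On a vector `u` with `K K̄ u = -u` the pairs `ξᵢ`, `ξ̄ᵢ` act as annihilation and creation operators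
with `{ξᵢ, ξ̄ⱼ} = 2 δᵢⱼ`. -/

section vacuum

variable {M : Type*} [AddCommGroup M] [Module (NicholsDouble n) M] {u : M}

theorem cen_smul_smul (hc : cen n • u = -u) (x : NicholsDouble n) : cen n • x • u = -(x • u) := by
  rw [smul_smul, cen_mul, mul_smul, hc, smul_neg]

variable [Module ℂ M] [IsScalarTower ℂ (NicholsDouble n) M]

theorem xi_smul_wordBar_smul_of_notMem (hu : ∀ i : Fin n, xi i • u = 0) {i : Fin n}
    {J : Finset (Fin n)} (h : i ∉ J) : xi i • wordBar J • u = 0 := by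
  rw [smul_smul, xi_mul_wordBar_of_notMem h, smul_assoc, mul_smul, hu, smul_zero, smul_zero]

theorem word_smul_wordBar_smul_self (hu : ∀ i : Fin n, xi i • u = 0) (hc : cen n • u = -u)
    (J : Finset (Fin n)) :
    word J • wordBar J • u = (revSign J.card * 2 ^ J.card : ℂ) • u := by
  induction J using Finset.induction_on_max with
  | empty => simp [word_empty, wordBar_empty, Nichols.revSign_zero]
  | insert i I hi ih =>
    have h6 : i ∉ I := fun hi' => lt_irrefl _ (hi i hi')
    have h1 : xi i • xibar i • u = (2 : ℂ) • u := by
      rw [smul_smul, xi_mul_xibar_self, sub_smul, sub_smul, one_smul, hc, mul_smul, hu, smul_zero,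
        two_smul]
      abel
    rw [word_insert_max hi, wordBar_insert_max hi, mul_smul, mul_smul, smul_smul (xi i),
      xi_mul_wordBar_of_notMem h6, smul_assoc, mul_smul, h1, smul_comm (wordBar I),
      smul_comm (word I), smul_comm (word I), ih,
      Finset.card_insert_of_notMem h6, Nichols.revSign_succ, smul_smul, smul_smul]
    congr 1
    ring

theorem word_smul_wordBar_smul_of_ne (hu : ∀ i : Fin n, xi i • u = 0)
    {I J : Finset (Fin n)} (h : J.card ≤ I.card) (hne : J ≠ I) : word I • wordBar J • u = 0 := by
  obtain ⟨i, hi, hiJ⟩ : ∃ i ∈ I, i ∉ J := by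
    by_contra! hcon
    exact hne (Finset.eq_of_subset_of_card_le hcon h).symm
  have h1 : word I = sgn i (I.erase i) • ((-1 :
      ℂ) ^ (I.erase i).card • (word (I.erase i) * xi i)) := by
    rw [← xi_mul_word, ← word_insert (Finset.notMem_erase _ _), Finset.insert_erase hi]
  rw [h1, smul_assoc, smul_assoc, mul_smul, xi_smul_wordBar_smul_of_notMem hu hiJ, smul_zero,
    smul_zero, smul_zero]

end vacuum

/-! ### The chirality element -/

/-- The sum `∑_w (-1)^⌊(|w|+1)/2⌋ w w̄`. -/
def wordSum (n : ℕ) : NicholsDouble n :=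
  ∑ I : Finset (Fin n), (-1 : ℂ) ^ ((I.card + 1) / 2) • (word I * wordBar I)

theorem word_insert_mul_wordBar_insert {i : Fin n} {I : Finset (Fin n)} (h : i ∉ I) :
    word (insert i I) * wordBar (insert i I) =
      (-1 : ℂ) ^ I.card • (xi i * xibar i * (word I * wordBar I)) := by
  rw [word_insert h, wordBar_insert h, smul_mul_smul_comm, Nichols.sgn_mul_self, one_smul,
    mul_assoc, ← mul_assoc (word I), word_mul_xibar_of_notMem h, smul_mul_assoc, mul_smul_comm,
    ← mul_assoc, ← mul_assoc, ← mul_assoc, mul_assoc (xi i * xibar i)]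

/-- The sum `∑_w (-1)^⌊(|w|+1)/2⌋ w w̄` is the product of the commuting factors `1 - ξᵢ ξ̄ᵢ`; here
one factor is split off. -/
theorem wordSum_eq (i : Fin n) : wordSum n = (1 - xi i * xibar i) *
    ∑ I : Finset (Fin n) with i ∉ I, (-1 : ℂ) ^ ((I.card + 1) / 2) • (word I * wordBar I) := by
  have h1 : ∑ I : Finset (Fin n) with i ∈ I, (-1 : ℂ) ^ ((I.card + 1) / 2) • (word I * wordBar I) =
      ∑ I : Finset (Fin n) with i ∉ I, (-1 : ℂ) ^ (((insert i I).card + 1) / 2) •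
        (word (insert i I) * wordBar (insert i I)) := by
    refine Finset.sum_bij' (fun I _ => I.erase i) (fun I _ => insert i I) ?_ ?_ ?_ ?_ ?_
    · intro I _; simp
    · intro I _; simp
    · intro I hI; exact Finset.insert_erase (Finset.mem_filter.1 hI).2
    · intro I hI; exact Finset.erase_insert (Finset.mem_filter.1 hI).2
    · intro I hI; simp only [Finset.insert_erase (Finset.mem_filter.1 hI).2]
  rw [wordSum, ← Finset.sum_filter_add_sum_filter_not Finset.univ (fun I => i ∈ I), h1, sub_mul,
    one_mul, add_comm, sub_eq_add_neg, Finset.mul_sum, ← Finset.sum_neg_distrib]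
  congr 1
  refine Finset.sum_congr rfl fun I hI => ?_
  have hi := (Finset.mem_filter.1 hI).2
  rw [word_insert_mul_wordBar_insert hi, Finset.card_insert_of_notMem hi, smul_smul, mul_smul_comm,
    ← neg_smul, Nichols.neg_one_pow_eq_mul_revSign, Nichols.neg_one_pow_eq_mul_revSign,
    Nichols.revSign_succ]
  congr 1
  have := neg_one_pow_mul_self I.card
  rw [pow_succ]
  linear_combination (-(-1) ^ I.card * revSign I.card) * this

theorem commute_xi_word_mul_wordBar {i : Fin n} {I : Finset (Fin n)} (h : i ∉ I) :
    Commute (xi i) (word I * wordBar I) := by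
  change _ = _
  rw [← mul_assoc, xi_mul_word, smul_mul_assoc,
    mul_assoc, xi_mul_wordBar_of_notMem h, mul_smul_comm, smul_smul, neg_one_pow_mul_self, one_smul,
    mul_assoc]

theorem commute_xibar_word_mul_wordBar {i : Fin n} {I : Finset (Fin n)} (h : i ∉ I) :
    Commute (xibar i) (word I * wordBar I) := by
  change _ = _
  rw [← mul_assoc, xibar_mul_word_of_notMem h, smul_mul_assoc, mul_assoc,
    xibar_mul_wordBar, mul_smul_comm, smul_smul,
    neg_one_pow_mul_self, one_smul, mul_assoc]

theorem commute_K_wordSum : Commute (K n) (wordSum n) :=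
  Commute.sum_right _ _ _ fun _ _ => (commute_K_word_mul_wordBar ⟨_, rfl⟩).smul_right _

theorem commute_Kbar_wordSum : Commute (Kbar n) (wordSum n) :=
  Commute.sum_right _ _ _ fun _ _ => (commute_Kbar_word_mul_wordBar ⟨_, rfl⟩).smul_right _

theorem xi_mul_xi_mul (i : Fin n) (a : NicholsDouble n) : xi i * (xi i * a) = 0 := by
  rw [← mul_assoc, xi_mul_self, zero_mul]

theorem xi_mul_wordSum (i : Fin n) : xi i * wordSum n = cen n * (wordSum n * xi i) := by
  have h : Commute (xi i) (∑ I : Finset (Fin n) with i ∉ I,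
      (-1 : ℂ) ^ ((I.card + 1) / 2) • (word I * wordBar I)) :=
    Commute.sum_right _ _ _ fun I hI =>
      (commute_xi_word_mul_wordBar (Finset.mem_filter.1 hI).2).smul_right _
  rw [wordSum_eq i, mul_assoc _ _ (xi i), ← h.eq, ← mul_assoc, ← mul_assoc, ← mul_assoc]
  congr 1
  rw [mul_sub, mul_one, xi_mul_xi_mul, sub_zero, mul_assoc, sub_mul, one_mul, mul_assoc,
    xibar_mul_xi_self, mul_sub, mul_sub, xi_mul_xi_mul, sub_zero, mul_sub (xi i), mul_one,
    ← cen_mul (xi i), mul_sub, cen_mul_cen_mul]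
  abel

theorem xibar_mul_wordSum (i : Fin n) : wordSum n * xibar i = cen n * (xibar i * wordSum n) := by
  have h : Commute (xibar i) (∑ I : Finset (Fin n) with i ∉ I,
      (-1 : ℂ) ^ ((I.card + 1) / 2) • (word I * wordBar I)) :=
    Commute.sum_right _ _ _ fun I hI =>
      (commute_xibar_word_mul_wordBar (Finset.mem_filter.1 hI).2).smul_right _
  rw [wordSum_eq i, mul_assoc, ← h.eq, ← mul_assoc, ← mul_assoc, ← mul_assoc]
  congr 1
  rw [sub_mul, one_mul, mul_assoc, xibar_mul_self, mul_zero, sub_zero, mul_assoc, mul_sub, mul_one,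
    ← mul_assoc, xibar_mul_xi_self, sub_mul, sub_mul, one_mul, mul_assoc, xibar_mul_self, mul_zero,
    sub_zero, mul_sub, mul_sub, cen_mul_cen_mul]
  abel

/-- The chirality element `½ (K - K̄) ∑_w (-1)^⌊(|w|+1)/2⌋ w w̄`. -/
def chir (n : ℕ) : NicholsDouble n := (1 / 2 : ℂ) • ((K n - Kbar n) * wordSum n)

theorem commute_chir (x : NicholsDouble n) : Commute (chir n) x := by
  have hKK : Commute (K n - Kbar n) (K n) := by
    change _ = _
    rw [sub_mul, mul_sub, Kbar_mul_K]
  have hKKb : Commute (K n - Kbar n) (Kbar n) := by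
    change _ = _
    rw [sub_mul, mul_sub, Kbar_mul_K]
  have hc : cen n * (K n - Kbar n) = -(K n - Kbar n) := by
    rw [mul_sub, cen_mul_K, ← K_mul_cen, ← cen_mul, cen_mul_cen_mul]; abel
  refine commute_of_gens ?_ ?_ ?_ ?_ x
  · exact (hKK.mul_left commute_K_wordSum.symm).smul_left _
  · exact (hKKb.mul_left commute_Kbar_wordSum.symm).smul_left _
  · intro i
    refine Commute.smul_left ?_ _
    have h2 : xi i * (K n - Kbar n) = -((K n - Kbar n) * xi i) := by
      rw [mul_sub, sub_mul, xi_mul_K, xi_mul_Kbar]; abel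
    change _ = _
    rw [← mul_assoc, h2, neg_mul, mul_assoc, mul_assoc, xi_mul_wordSum, ← mul_assoc _ (cen n),
      ← cen_mul, hc, neg_mul, neg_neg]
  · intro i
    refine Commute.smul_left ?_ _
    have h2 : xibar i * (K n - Kbar n) = -((K n - Kbar n) * xibar i) := by
      rw [mul_sub, sub_mul, xibar_mul_K, xibar_mul_Kbar]; abel
    change _ = _
    rw [← mul_assoc, h2, neg_mul, mul_assoc, xibar_mul_wordSum, ← mul_assoc _ (cen n),
      ← cen_mul, hc, neg_mul, mul_assoc]

theorem cen_mul_chir : cen n * chir n = -chir n := by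
  have hc : cen n * (K n - Kbar n) = -(K n - Kbar n) := by
    rw [mul_sub, cen_mul_K, ← K_mul_cen, ← cen_mul, cen_mul_cen_mul]; abel
  rw [chir, mul_smul_comm, ← mul_assoc, hc, neg_mul, smul_neg]

end NicholsDouble

end

noncomputable section

namespace NicholsDouble

open Nichols (revSign sgn)

variable {n : ℕ}

/-! ### Eigenvectors of the group-like elements -/

theorem Label.signK_mul_self (σ : Label) : σ.signK * σ.signK = 1 := by
  cases σ <;> simp [Label.signK]

theorem Label.signKbar_mul_self (σ : Label) : σ.signKbar * σ.signKbar = 1 := by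
  cases σ <;> simp [Label.signKbar]

/-- Four times the idempotent of `ℂ[K, K̄]` on which `K` and `K̄` have the eigenvalues of `V_σ`. -/
def gpart (n : ℕ) (σ : Label) : NicholsDouble n :=
  (1 + σ.signK • K n) * (1 + σ.signKbar • Kbar n)

theorem K_mul_gpart (σ : Label) : K n * gpart n σ = σ.signK • gpart n σ := by
  rw [gpart, ← mul_assoc, ← smul_mul_assoc]
  congr 1
  rw [mul_add, smul_add, mul_smul_comm, K_mul_K, smul_smul, σ.signK_mul_self, one_smul, mul_one,
    add_comm]

theorem commute_Kbar_gpart (σ : Label) : Commute (Kbar n) (gpart n σ) := by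
  have h : Commute (Kbar n) (K n) := Kbar_mul_K
  exact (((Commute.one_right _).add_right (h.smul_right _))).mul_right
    ((Commute.one_right _).add_right ((Commute.refl _).smul_right _))

theorem Kbar_mul_gpart (σ : Label) : Kbar n * gpart n σ = σ.signKbar • gpart n σ := by
  rw [(commute_Kbar_gpart σ).eq, gpart, mul_assoc, ← mul_smul_comm]
  congr 1
  rw [add_mul, smul_add, smul_mul_assoc, Kbar_mul_Kbar, smul_smul, σ.signKbar_mul_self, one_smul,
    one_mul, add_comm]

theorem gpart_mul_top (σ : Label) : gpart n σ * top n = top n * gpart n σ := by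
  have h1 : Commute (1 + σ.signK • K n) (top n) :=
    (Commute.one_left _).add_left (commute_K_top.smul_left _)
  have h2 : Commute (1 + σ.signKbar • Kbar n) (top n) :=
    (Commute.one_left _).add_left (commute_Kbar_top.smul_left _)
  exact h1.mul_left h2

theorem idem_one : idem n .one = (1 / 4 : ℂ) • gpart n .one := by
  simp only [idem, gpart, Label.signK, Label.signKbar, one_smul, mul_add, add_mul, one_mul, mul_one]
  congr 1; abel

theorem idem_KKbar : idem n .KKbar = (1 / 4 : ℂ) • gpart n .KKbar := by
  simp only [idem, gpart, Label.signK, Label.signKbar, neg_smul, one_smul, mul_add, add_mul,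
    one_mul, mul_one, neg_mul, mul_neg]
  congr 1; abel

theorem idem_K : idem n .K = ((-1 : ℂ) ^ (n / 2) / 2 ^ (n + 2)) • (gpart n .K * top n) := by
  simp only [idem, gpart, Label.signK, Label.signKbar, neg_smul, one_smul, mul_add, add_mul,
    one_mul, mul_one, mul_neg, sub_mul, neg_mul]
  congr 1; abel

theorem idem_Kbar : idem n .Kbar = ((-1 : ℂ) ^ (n / 2) / 2 ^ (n + 2)) •
    (gpart n .Kbar * top n) := by
  simp only [idem, gpart, Label.signK, Label.signKbar, neg_smul, one_smul, mul_add, add_mul,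
    one_mul, mul_one, sub_mul, neg_mul]
  congr 1; abel

/-- The two labels of the one-dimensional modules. -/
def Label.IsSmall (σ : Label) : Prop := σ.signK = σ.signKbar

theorem Label.signK_mul_signKbar_of_small {σ : Label} (h : σ.IsSmall) :
    σ.signK * σ.signKbar = 1 := by
  rw [← h, σ.signK_mul_self]

theorem Label.signK_mul_signKbar_of_not_small {σ : Label} (h : ¬σ.IsSmall) :
    σ.signK * σ.signKbar = -1 := by
  cases σ <;> simp_all [Label.signK, Label.signKbar, Label.IsSmall]

theorem idem_of_small {σ : Label} (h : σ.IsSmall) : idem n σ = (1 / 4 : ℂ) • gpart n σ := by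
  have h' : (-1 : ℂ) ≠ 1 := by norm_num
  cases σ
  · exact idem_one
  · exact idem_KKbar
  · exact absurd h.symm h'
  · exact absurd h h'

theorem idem_of_not_small {σ : Label} (h : ¬σ.IsSmall) :
    idem n σ = ((-1 : ℂ) ^ (n / 2) / 2 ^ (n + 2)) • (gpart n σ * top n) := by
  cases σ
  · exact absurd rfl h
  · exact absurd rfl h
  · exact idem_K
  · exact idem_Kbar

theorem K_mul_idem (σ : Label) : K n * idem n σ = σ.signK • idem n σ := by
  by_cases h : σ.IsSmall
  · rw [idem_of_small h, mul_smul_comm, K_mul_gpart, smul_comm]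
  · rw [idem_of_not_small h, mul_smul_comm, ← mul_assoc, K_mul_gpart, smul_mul_assoc, smul_comm]

theorem Kbar_mul_idem (σ : Label) : Kbar n * idem n σ = σ.signKbar • idem n σ := by
  by_cases h : σ.IsSmall
  · rw [idem_of_small h, mul_smul_comm, Kbar_mul_gpart, smul_comm]
  · rw [idem_of_not_small h, mul_smul_comm, ← mul_assoc, Kbar_mul_gpart, smul_mul_assoc, smul_comm]

theorem commute_Kbar_idem (σ : Label) : Commute (Kbar n) (idem n σ) := by
  by_cases h : σ.IsSmall
  · rw [idem_of_small h]; exact (commute_Kbar_gpart σ).smul_right _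
  · rw [idem_of_not_small h]; exact ((commute_Kbar_gpart σ).mul_right commute_Kbar_top).smul_right _

theorem cen_mul_idem (σ : Label) : cen n * idem n σ = (σ.signK * σ.signKbar) • idem n σ := by
  rw [cen, mul_assoc, Kbar_mul_idem, mul_smul_comm, K_mul_idem, smul_smul, mul_comm]

theorem xi_mul_gpart_mul_top (i : Fin n) (σ : Label) : xi i * (gpart n σ * top n) = 0 := by
  rw [gpart]
  simp only [mul_add, add_mul, one_mul, mul_one, smul_mul_assoc, mul_smul_comm, mul_assoc,
    xi_mul_K_mul, xi_mul_Kbar_mul, xi_mul_top, mul_zero, neg_zero, smul_zero, add_zero]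

theorem xi_mul_idem {σ : Label} (h : ¬σ.IsSmall) (i : Fin n) : xi i * idem n σ = 0 := by
  rw [idem_of_not_small h, mul_smul_comm, xi_mul_gpart_mul_top, smul_zero]

theorem idem_mul_xibar {σ : Label} (h : ¬σ.IsSmall) (i : Fin n) : idem n σ * xibar i = 0 := by
  rw [idem_of_not_small h, smul_mul_assoc, mul_assoc, top_mul_xibar, mul_zero, smul_zero]

/-- The central idempotents of the four group-like eigenspaces are orthogonal. -/
theorem gpart_smul {M : Type*} [AddCommGroup M] [Module (NicholsDouble n) M] [Module ℂ M]
    [IsScalarTower ℂ (NicholsDouble n) M] {u : M} {σ : Label} (τ : Label)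
    (hK : K n • u = σ.signK • u) (hKb : Kbar n • u = σ.signKbar • u) [Decidable (τ = σ)] :
    gpart n τ • u = if τ = σ then (4 : ℂ) • u else 0 := by
  have h : gpart n τ • u = ((1 + τ.signK * σ.signK) * (1 + τ.signKbar * σ.signKbar)) • u := by
    have hb : (1 + τ.signKbar • Kbar n) • u = (1 + τ.signKbar * σ.signKbar) • u := by
      rw [add_smul, one_smul, smul_assoc, hKb, smul_smul, add_smul, one_smul]
    have ha : (1 + τ.signK • K n) • u = (1 + τ.signK * σ.signK) • u := by
      rw [add_smul, one_smul, smul_assoc, hK, smul_smul, add_smul, one_smul]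
    rw [gpart, mul_smul, hb, smul_comm, ha, smul_smul, mul_comm]
  rw [h]
  split_ifs with hτ
  · subst hτ
    rw [τ.signK_mul_self, τ.signKbar_mul_self]
    norm_num
  · have : (1 + τ.signK * σ.signK) * (1 + τ.signKbar * σ.signKbar) = 0 := by
      cases τ <;> cases σ <;> simp_all [Label.signK, Label.signKbar]
    rw [this, zero_smul]

/-! ### The simple modules -/

/-- The generating vector of `V_σ`. -/
def vac (n : ℕ) (σ : Label) : SimpleMod n σ := Submodule.Quotient.mk 1

theorem smul_vac (σ : Label) (x : NicholsDouble n) :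
    x • vac n σ = (Submodule.Quotient.mk x : SimpleMod n σ) := by
  rw [vac, ← Submodule.Quotient.mk_smul, smul_eq_mul, mul_one]

theorem smul_vac_eq_zero {σ : Label} {x : NicholsDouble n} (h : x ∈ relations n σ) :
    x • vac n σ = 0 := by
  rw [smul_vac]
  exact (Submodule.Quotient.mk_eq_zero _).2 h

theorem K_smul_vac (σ : Label) : K n • vac n σ = σ.signK • vac n σ := by
  have h : K n - algebraMap ℂ _ σ.signK ∈ relations n σ :=
    Ideal.subset_span (Or.inl (Or.inl (Or.inl rfl)))
  have := smul_vac_eq_zero h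
  rw [sub_smul, sub_eq_zero] at this
  rw [this, algebraMap_smul]

theorem Kbar_smul_vac (σ : Label) : Kbar n • vac n σ = σ.signKbar • vac n σ := by
  have h : Kbar n - algebraMap ℂ _ σ.signKbar ∈ relations n σ :=
    Ideal.subset_span (Or.inl (Or.inl (Or.inr rfl)))
  have := smul_vac_eq_zero h
  rw [sub_smul, sub_eq_zero] at this
  rw [this, algebraMap_smul]

theorem xi_smul_vac (σ : Label) (i : Fin n) : xi i • vac n σ = 0 :=
  smul_vac_eq_zero (Ideal.subset_span (Or.inl (Or.inr ⟨i, rfl⟩)))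

theorem xibar_smul_vac {σ : Label} (h : σ.IsSmall) (i : Fin n) : xibar i • vac n σ = 0 :=
  smul_vac_eq_zero (Ideal.subset_span (Or.inr ⟨h, ⟨i, rfl⟩⟩))

theorem cen_smul_vac (σ : Label) : cen n • vac n σ = (σ.signK * σ.signKbar) • vac n σ := by
  rw [cen, mul_smul, Kbar_smul_vac, smul_comm, K_smul_vac, smul_smul, mul_comm]

/-- A vector that satisfies the defining relations of the generating vector of `V_σ` receives a map
from `V_σ`. -/
theorem relations_smul {M : Type*} [AddCommGroup M] [Module (NicholsDouble n) M] {u : M} {σ : Label}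
    (hK : K n • u = algebraMap ℂ (NicholsDouble n) σ.signK • u)
    (hKb : Kbar n • u = algebraMap ℂ (NicholsDouble n) σ.signKbar • u) (hx : ∀ i : Fin n,
    xi i • u = 0)
    (hxb : σ.IsSmall → ∀ i : Fin n, xibar i • u = 0) {x : NicholsDouble n} (h : x ∈ relations n σ) :
    x • u = 0 := by
  suffices h' : relations n σ ≤ LinearMap.ker (LinearMap.toSpanSingleton (NicholsDouble n) M u) by
    simpa using h' h
  rw [relations, Ideal.span, Submodule.span_le]
  rintro y (((rfl | rfl) | ⟨i, rfl⟩) | ⟨hs, ⟨i, rfl⟩⟩)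
  · simp [sub_smul, hK]
  · simp [sub_smul, hKb]
  · simp [hx]
  · simp [hxb hs]

/-- The map from `V_σ` given by a vector that satisfies the relations of its generator. -/
def fromSimple {M : Type*} [AddCommGroup M] [Module (NicholsDouble n) M] (u : M) (σ : Label)
    (h : ∀ x ∈ relations n σ, x • u = 0) : SimpleMod n σ →ₗ[NicholsDouble n] M :=
  (relations n σ).liftQ (LinearMap.toSpanSingleton (NicholsDouble n) M u) fun x hx => by
    simpa using h x hx

theorem fromSimple_vac {M : Type*} [AddCommGroup M] [Module (NicholsDouble n) M] (u : M) (σ : Label)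
    (h : ∀ x ∈ relations n σ, x • u = 0) : fromSimple u σ h (vac n σ) = u := by
  rw [fromSimple, vac, Submodule.liftQ_apply]
  simp

/-- Modulo `1 - K K̄` all the generators `ξᵢ`, `ξ̄ⱼ` anticommute. -/
theorem xibar_mul_one_add_cen_mul_word (i : Fin n) (I : Finset (Fin n)) :
    xibar i * ((1 + cen n) * word I) = (-1 : ℂ) ^ I.card • ((1 + cen n) * word I * xibar i) := by
  have h1 : ∀ j : Fin n, xibar i * ((1 + cen n) * xi j) = -((1 + cen n) * xi j * xibar i) := by
    intro j
    have h2 : (1 + cen n) * (xibar i * xi j) = -((1 + cen n) * (xi j * xibar i)) := by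
      rw [eq_sub_of_add_eq (xibar_mul_xi i j)]
      split_ifs
      · change (1 + cen n) * (1 - cen n - _) = _
        rw [mul_sub, mul_sub, add_mul 1 (cen n) (cen n), cen_mul_cen]
        rw [one_mul, mul_one, add_comm 1 (cen n), sub_self, zero_sub]
      · rw [zero_sub, mul_neg]
    rw [← mul_assoc, mul_add, mul_one, ← cen_mul, add_mul, mul_assoc, ← one_add_mul, h2, mul_assoc]
  induction I using Finset.induction_on_max with
  | empty => simp only [word_empty, mul_one, Finset.card_empty, pow_zero, one_smul]
             rw [mul_add, add_mul, one_mul, mul_one, cen_mul]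
  | insert j I hj ih =>
    have h6 : j ∉ I := fun hj' => lt_irrefl _ (hj j hj')
    have h3 : (1 + cen n) * (word I * (xibar i * xi j)) =
        -((1 + cen n) * (word I * (xi j * xibar i))) := by
      have := h1 j
      have h4 : ∀ x : NicholsDouble n, (1 + cen n) * (word I * x) = word I * ((1 + cen n) * x) := by
        intro x
        rw [add_mul, add_mul, mul_add, one_mul, one_mul, mul_cen_mul]
      rw [h4, h4, ← mul_neg]
      congr 1
      rw [mul_assoc] at this
      rw [← this, ← mul_assoc, ← mul_assoc, add_mul, mul_add, one_mul, mul_one, cen_mul]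
    rw [word_insert_max hj, ← mul_assoc, ← mul_assoc, mul_assoc (xibar i), ih,
      Finset.card_insert_of_notMem h6, smul_mul_assoc, mul_assoc, mul_assoc, h3, pow_succ,
      mul_neg_one, smul_neg, neg_smul, mul_assoc, mul_assoc]

theorem xibar_mul_top (i : Fin n) : xibar i * ((1 + cen n) * top n) = 0 := by
  rw [top, ← mul_assoc, ← mul_assoc, mul_assoc (xibar i), xibar_mul_one_add_cen_mul_word,
    smul_mul_assoc, mul_assoc, xibar_mul_wordBar_of_mem (Finset.mem_univ i), mul_zero, smul_zero]

theorem xibar_mul_gpart_mul_top {σ : Label} (h : σ.IsSmall) (i : Fin n) :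
    xibar i * (gpart n σ * top n) = 0 := by
  have h1 : gpart n σ = (1 + σ.signK • K n) * (1 + cen n) := by
    rw [gpart, ← h]
    simp only [mul_add, add_mul, one_mul, mul_one, smul_mul_assoc, mul_smul_comm, smul_smul,
      smul_add, σ.signK_mul_self, one_smul, K_mul_cen]
    rw [cen]; abel
  rw [h1, mul_assoc, ← mul_assoc, mul_add, mul_one, mul_smul_comm, xibar_mul_K, smul_neg,
    ← sub_eq_add_neg]
  nth_rw 1 [← one_mul (xibar i)]
  rw [← smul_mul_assoc, ← sub_mul, mul_assoc, xibar_mul_top, mul_zero]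

theorem gpart_mul_top_ne_zero (σ : Label) : gpart n σ * top n ≠ 0 := by
  intro h
  have h1 : gpart n σ * top n = hop n ((1 + σ.signK • Nichols.K n) * Nichols.word Finset.univ) *
      bar n ((1 + (σ.signKbar * (-1) ^ n) • Nichols.K n) * Nichols.word Finset.univ) := by
    simp only [map_mul, map_add, map_one, map_smul, hop_K, bar_K, hop_word, bar_word, gpart, top]
    rw [mul_assoc, mul_assoc]
    congr 1
    rw [← mul_assoc, ← mul_assoc]
    congr 1
    rw [add_mul, mul_add, one_mul, mul_one, smul_mul_assoc, Kbar_mul_word, mul_smul_comm, smul_smul,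
      Finset.card_univ, Fintype.card_fin]
  have h2 := congrArg (coefHB ((Nichols.basis n).coord (0, Finset.univ))
    ((Nichols.basis n).coord (0, Finset.univ))) h
  rw [h1, coefHB_apply, map_zero, add_mul, add_mul, one_mul, smul_mul_assoc, smul_mul_assoc] at h2
  simp only [map_add, map_smul, Nichols.coord_word, Nichols.coord_K_mul_word] at h2
  simp at h2

theorem relations_mul_gpart_mul_top {σ : Label} {x : NicholsDouble n} (h : x ∈ relations n σ) :
    x * (gpart n σ * top n) = 0 := by
  refine relations_smul (M := NicholsDouble n) (u := gpart n σ * top n) ?_ ?_ ?_ ?_ h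
  · rw [smul_eq_mul, smul_eq_mul, ← mul_assoc, K_mul_gpart, smul_mul_assoc, Algebra.smul_def]
  · rw [smul_eq_mul, smul_eq_mul, ← mul_assoc, Kbar_mul_gpart, smul_mul_assoc, Algebra.smul_def]
  · intro i; exact xi_mul_gpart_mul_top i σ
  · intro hs i; exact xibar_mul_gpart_mul_top hs i

theorem vac_ne_zero (σ : Label) : vac n σ ≠ 0 := by
  intro h
  have h1 : (1 : NicholsDouble n) ∈ relations n σ := (Submodule.Quotient.mk_eq_zero _).1 h
  have := relations_mul_gpart_mul_top h1
  rw [one_mul] at this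
  exact gpart_mul_top_ne_zero σ this

/-- `V_σ` is spanned by the vectors `w̄ v`. -/
theorem span_wordBar_smul_vac (σ : Label) :
    Submodule.span ℂ (Set.range fun J : Finset (Fin n) => wordBar J • vac n σ) = ⊤ := by
  set S := Submodule.span ℂ (Set.range fun J : Finset (Fin n) => wordBar J • vac n σ)
  have h1 : ∀ y : Nichols n, ∃ a : ℂ, hop n y • vac n σ = a • vac n σ := by
    intro y
    induction y using Nichols.induction_left with
    | h1 => exact ⟨1, by simp⟩
    | hadd a b ha hb =>
      obtain ⟨r, hr⟩ := ha
      obtain ⟨s, hs⟩ := hb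
      exact ⟨r + s, by rw [map_add, add_smul, hr, hs, add_smul]⟩
    | hsmul r a ha =>
      obtain ⟨s, hs⟩ := ha
      exact ⟨r * s, by rw [map_smul, smul_assoc, hs, smul_smul]⟩
    | hK a ha =>
      obtain ⟨s, hs⟩ := ha
      exact ⟨s * σ.signK, by rw [map_mul, mul_smul, hs, smul_comm, hop_K, K_smul_vac, smul_smul]⟩
    | hx i a ha =>
      obtain ⟨s, hs⟩ := ha
      exact ⟨0, by rw [map_mul, mul_smul, hs, smul_comm, hop_xi, xi_smul_vac, smul_zero, zero_smul]⟩
  have h2 : ∀ x : Nichols n, bar n x • vac n σ ∈ S := by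
    intro x
    rw [← (Nichols.basis n).sum_repr x, map_sum, Finset.sum_smul]
    refine Submodule.sum_mem _ fun b _ => ?_
    rw [map_smul, smul_assoc]
    refine Submodule.smul_mem _ _ ?_
    rcases b with ⟨a, J⟩
    have hJ : wordBar J • vac n σ ∈ S := Submodule.subset_span ⟨J, rfl⟩
    fin_cases a
    · simpa [Nichols.basis_apply] using hJ
    · simp only [Nichols.basis_apply, Fin.mk_one, Fin.val_one, pow_one, map_mul, bar_K, bar_word]
      rw [Kbar_mul_wordBar, smul_assoc, mul_smul, Kbar_smul_vac, smul_comm (wordBar J)]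
      exact Submodule.smul_mem _ _ (Submodule.smul_mem _ _ hJ)
  rw [eq_top_iff]
  intro m _
  obtain ⟨x, rfl⟩ := Submodule.Quotient.mk_surjective _ m
  rw [← smul_vac]
  induction x using induction_bar_hop with
  | h x y =>
    obtain ⟨a, ha⟩ := h1 y
    rw [mul_smul, ha, smul_comm]
    exact Submodule.smul_mem _ _ (h2 x)
  | hadd a b ha hb => rw [add_smul]; exact S.add_mem (ha trivial) (hb trivial)

theorem exists_eq_sum_wordBar {σ : Label} (m : SimpleMod n σ) :
    ∃ a : Finset (Fin n) → ℂ, m = ∑ J, a J • wordBar J • vac n σ := by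
  have : m ∈ Submodule.span ℂ (Set.range fun J : Finset (Fin n) => wordBar J • vac n σ) := by
    rw [span_wordBar_smul_vac]; trivial
  obtain ⟨a, ha⟩ := (Submodule.mem_span_range_iff_exists_fun ℂ).1 this
  exact ⟨a, ha.symm⟩

theorem wordBar_smul_vac {σ : Label} (h : σ.IsSmall) {J : Finset (Fin n)} (hJ : J ≠ ∅) :
    wordBar J • vac n σ = 0 := by
  obtain ⟨i, hi⟩ := Finset.nonempty_iff_ne_empty.2 hJ
  rw [← Finset.insert_erase hi, wordBar_insert (Finset.notMem_erase _ _), smul_assoc,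
    xibar_mul_wordBar, smul_assoc, mul_smul, xibar_smul_vac h, smul_zero, smul_zero, smul_zero]

theorem exists_eq_smul_vac {σ : Label} (h : σ.IsSmall) (m : SimpleMod n σ) :
    ∃ a : ℂ, m = a • vac n σ := by
  obtain ⟨a, ha⟩ := exists_eq_sum_wordBar m
  refine ⟨a ∅, ?_⟩
  rw [ha, Finset.sum_eq_single ∅]
  · rw [wordBar_empty, one_smul]
  · intro J _ hJ
    rw [wordBar_smul_vac h hJ, smul_zero]
  · simp

theorem cen_smul_vac_of_not_small {σ : Label} (h : ¬σ.IsSmall) :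
    cen n • vac n σ = -vac n σ := by
  rw [cen_smul_vac, Label.signK_mul_signKbar_of_not_small h, neg_one_smul]

theorem revSign_mul_two_pow_ne_zero (k : ℕ) : (revSign k * 2 ^ k : ℂ) ≠ 0 :=
  mul_ne_zero (by rw [revSign]; exact pow_ne_zero _ (by norm_num)) (pow_ne_zero _ two_ne_zero)

/-- Every nonzero vector of `V_σ` generates the vacuum: a longest word `w̄` that occurs in it is
stripped off by `w`, which kills all the other terms. -/
theorem exists_smul_eq_vac {σ : Label} {m : SimpleMod n σ} (hm : m ≠ 0) :
    ∃ x : NicholsDouble n, x • m = vac n σ := by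
  by_cases h : σ.IsSmall
  · obtain ⟨a, rfl⟩ := exists_eq_smul_vac h m
    have ha : a ≠ 0 := by rintro rfl; simp at hm
    exact ⟨algebraMap ℂ _ a⁻¹, by rw [algebraMap_smul, smul_smul, inv_mul_cancel₀ ha, one_smul]⟩
  · obtain ⟨a, ha⟩ := exists_eq_sum_wordBar m
    have hne : (Finset.univ.filter fun J => a J ≠ 0).Nonempty := by
      by_contra hcon
      rw [Finset.not_nonempty_iff_eq_empty, Finset.filter_eq_empty_iff] at hcon
      apply hm
      rw [ha]
      refine Finset.sum_eq_zero fun J hJ => ?_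
      rw [not_not.1 (hcon hJ), zero_smul]
    obtain ⟨J, hJ, hmax⟩ := Finset.exists_max_image _ Finset.card hne
    have hJ' : a J ≠ 0 := (Finset.mem_filter.1 hJ).2
    have hw : word J • m = (a J * (revSign J.card * 2 ^ J.card)) • vac n σ := by
      rw [ha, Finset.smul_sum, Finset.sum_eq_single J]
      · rw [smul_comm, word_smul_wordBar_smul_self (xi_smul_vac σ) (cen_smul_vac_of_not_small h),
          smul_smul]
      · intro I _ hI
        rw [smul_comm]
        by_cases h0 : a I = 0
        · rw [h0, zero_smul]
        · rw [word_smul_wordBar_smul_of_ne (xi_smul_vac σ) (hmax I (by simp [h0])) hI, smul_zero]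
      · simp
    have h0 : a J * (revSign J.card * 2 ^ J.card) ≠ 0 :=
      mul_ne_zero hJ' (revSign_mul_two_pow_ne_zero _)
    refine ⟨algebraMap ℂ _ (a J * (revSign J.card * 2 ^ J.card))⁻¹ * word J, ?_⟩
    rw [mul_smul, hw, algebraMap_smul, smul_smul, inv_mul_cancel₀ h0, one_smul]

instance isSimpleModule_simpleMod (σ : Label) :
    IsSimpleModule (NicholsDouble n) (SimpleMod n σ) := by
  rw [isSimpleModule_iff_toSpanSingleton_surjective]
  refine ⟨⟨⟨vac n σ, 0, vac_ne_zero σ⟩⟩, fun m hm m' => ?_⟩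
  obtain ⟨x, hx⟩ := exists_smul_eq_vac hm
  obtain ⟨y, rfl⟩ := Submodule.Quotient.mk_surjective _ m'
  refine ⟨y * x, ?_⟩
  rw [LinearMap.toSpanSingleton_apply, mul_smul, hx, smul_vac]

/-! ### The action of the idempotents on the simple modules -/

theorem top_smul_vac {σ : Label} (h : ¬σ.IsSmall) :
    top n • vac n σ = (revSign n * 2 ^ n : ℂ) • vac n σ := by
  rw [top, mul_smul, word_smul_wordBar_smul_self (xi_smul_vac σ) (cen_smul_vac_of_not_small h),
    Finset.card_univ, Fintype.card_fin]

theorem top_smul {σ : Label} (h : ¬σ.IsSmall) (m : SimpleMod n σ) :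
    ∃ a : ℂ, top n • m = a • vac n σ := by
  obtain ⟨a, ha⟩ := exists_eq_sum_wordBar m
  refine ⟨a ∅ * (revSign n * 2 ^ n), ?_⟩
  rw [ha, Finset.smul_sum, Finset.sum_eq_single ∅]
  · rw [wordBar_empty, one_smul, smul_comm, top_smul_vac h, smul_smul]
  · intro J _ hJ
    obtain ⟨i, hi⟩ := Finset.nonempty_iff_ne_empty.2 hJ
    rw [smul_comm, smul_smul (top n), ← Finset.insert_erase hi,
      wordBar_insert (Finset.notMem_erase _ _), mul_smul_comm, ← mul_assoc, top_mul_xibar, zero_mul,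
      smul_zero, zero_smul, smul_zero]
  · simp

/-- The scalar in `idem` makes `e_K` and `e_K̄` act as the identity on the vacuum. -/
theorem idem_scalar (n : ℕ) :
    (-1 : ℂ) ^ (n / 2) / 2 ^ (n + 2) * (revSign n * 2 ^ n * 4) = 1 := by
  rw [Nichols.revSign_eq, pow_add]
  have h := neg_one_pow_mul_self (n / 2)
  have h2 : (2 : ℂ) ^ n ≠ 0 := pow_ne_zero _ two_ne_zero
  field_simp
  linear_combination 4 * h

theorem idem_smul_vac (σ τ : Label) [Decidable (τ = σ)] :
    idem n τ • vac n σ = if τ = σ then vac n σ else 0 := by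
  by_cases hτ : τ.IsSmall
  · rw [idem_of_small hτ, smul_assoc, gpart_smul τ (K_smul_vac σ) (Kbar_smul_vac σ)]
    split_ifs
    · rw [smul_smul]; norm_num
    · rw [smul_zero]
  · rw [idem_of_not_small hτ, gpart_mul_top, smul_assoc, mul_smul,
      gpart_smul τ (K_smul_vac σ) (Kbar_smul_vac σ)]
    split_ifs with h
    · subst h
      rw [smul_comm (top n), top_smul_vac hτ, smul_smul, smul_smul, mul_assoc,
        mul_comm (4 : ℂ), idem_scalar, one_smul]
    · rw [smul_zero, smul_zero]

theorem exists_idem_smul (σ : Label) (m : SimpleMod n σ) :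
    ∃ a : ℂ, idem n σ • m = a • vac n σ := by
  classical
  by_cases hσ : σ.IsSmall
  · obtain ⟨a, rfl⟩ := exists_eq_smul_vac hσ m
    exact ⟨a, by rw [smul_comm, idem_smul_vac, if_pos rfl]⟩
  · obtain ⟨a, ha⟩ := top_smul hσ m
    refine ⟨(-1 : ℂ) ^ (n / 2) / 2 ^ (n + 2) * (a * 4), ?_⟩
    rw [idem_of_not_small hσ, smul_assoc, mul_smul, ha, smul_comm (gpart n σ) a,
      gpart_smul σ (K_smul_vac σ) (Kbar_smul_vac σ), if_pos rfl, smul_smul, smul_smul, mul_assoc]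

theorem idem_smul_of_ne {σ τ : Label} (h : τ ≠ σ) (m : SimpleMod n σ) : idem n τ • m = 0 := by
  classical
  by_cases hσ : σ.IsSmall
  · obtain ⟨a, rfl⟩ := exists_eq_smul_vac hσ m
    rw [smul_comm, idem_smul_vac, if_neg h, smul_zero]
  · by_cases hτ : τ.IsSmall
    · obtain ⟨x, rfl⟩ := Submodule.Quotient.mk_surjective _ m
      have h1 : idem n τ = idem n τ * cen n := by
        rw [← cen_mul, cen_mul_idem, Label.signK_mul_signKbar_of_small hτ, one_smul]
      rw [← smul_vac]
      have h2 : idem n τ • x • vac n σ = -(idem n τ • x • vac n σ) := by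
        nth_rw 1 [h1]
        rw [mul_smul, cen_smul_smul (cen_smul_vac_of_not_small hσ), smul_neg]
      exact eq_zero_of_eq_neg h2
    · obtain ⟨a, ha⟩ := top_smul hσ m
      rw [idem_of_not_small hτ, smul_assoc, mul_smul, ha, smul_comm (gpart n τ),
        gpart_smul τ (K_smul_vac σ) (Kbar_smul_vac σ), if_neg h, smul_zero, smul_zero]

theorem label_eq_of_equiv {σ σ' : Label}
    (h : Nonempty (SimpleMod n σ ≃ₗ[NicholsDouble n] SimpleMod n σ')) : σ = σ' := by
  classical
  obtain ⟨f⟩ := h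
  by_contra hne
  have h1 : idem n σ • vac n σ = vac n σ := by rw [idem_smul_vac, if_pos rfl]
  have h2 : f (vac n σ) = 0 := by rw [← h1, map_smul, idem_smul_of_ne hne]
  exact vac_ne_zero σ (f.map_eq_zero_iff.1 h2)

/-! ### Classification of the simple modules -/

theorem exists_K_eigenvector {V : Type*} [AddCommGroup V] [Module (NicholsDouble n) V] {v : V}
    (hv : v ≠ 0) (hx : ∀ i : Fin n, xi i • v = 0) :
    ∃ u : V, u ≠ 0 ∧ (∀ i : Fin n, xi i • u = 0) ∧ (K n • u = u ∨ K n • u = -u) := by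
  by_cases h : v + K n • v = 0
  · exact ⟨v, hv, hx, Or.inr (eq_neg_of_add_eq_zero_right h)⟩
  · refine ⟨v + K n • v, h, fun i => ?_, Or.inl ?_⟩
    · rw [smul_add, hx, smul_smul, xi_mul_K, neg_smul, mul_smul, hx, smul_zero, neg_zero, add_zero]
    · rw [smul_add, smul_smul, K_mul_K, one_smul, add_comm]

theorem exists_smul_smul_eq_of_gens {V : Type*} [AddCommGroup V] [Module (NicholsDouble n) V] (a :
    NicholsDouble n)
    (hK : ∀ v : V, ∃ w : V, K n • a • v = a • w) (hKb : ∀ v : V, ∃ w : V, Kbar n • a • v = a • w)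
    (hx : ∀ i : Fin n, ∀ v : V, ∃ w : V, xi i • a • v = a • w)
    (hxb : ∀ i : Fin n, ∀ v : V, ∃ w : V, xibar i • a • v = a • w) (x : NicholsDouble n) (v : V) :
    ∃ w : V, x • a • v = a • w := by
  induction x using induction_left with
  | h1 => exact ⟨v, one_smul _ _⟩
  | hadd x y hx hy =>
    obtain ⟨w, hw⟩ := hx
    obtain ⟨w', hw'⟩ := hy
    exact ⟨w + w', by rw [add_smul, hw, hw', smul_add]⟩
  | hsmul r x hx =>
    obtain ⟨w, hw⟩ := hx
    refine ⟨algebraMap ℂ (NicholsDouble n) r • w, ?_⟩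
    rw [Algebra.smul_def, mul_smul, hw, smul_smul, smul_smul, Algebra.commutes]
  | hK x h =>
    obtain ⟨w, hw⟩ := h
    rw [mul_smul, hw]; exact hK w
  | hKb x h =>
    obtain ⟨w, hw⟩ := h
    rw [mul_smul, hw]; exact hKb w
  | hx i x h =>
    obtain ⟨w, hw⟩ := h
    rw [mul_smul, hw]; exact hx i w
  | hxb i x h =>
    obtain ⟨w, hw⟩ := h
    rw [mul_smul, hw]; exact hxb i w

section classification

variable {V :
Type*} [AddCommGroup V] [Module (NicholsDouble n) V] [IsSimpleModule (NicholsDouble n) V]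

/-- A submodule of a simple module that is given by a commuting or anticommuting element is zero or
everything. -/
theorem smul_range_eq_bot_or_top (a : NicholsDouble n)
    (ha : ∀ x : NicholsDouble n, ∀ v : V, ∃ w : V, x • a • v = a • w) :
    (∀ v : V, a • v = 0) ∨ ∀ v : V, ∃ w : V, a • w = v := by
  let S : Submodule (NicholsDouble n) V :=
    { carrier := Set.range fun v : V => a • v
      zero_mem' := ⟨0, smul_zero a⟩
      add_mem' := by rintro _ _ ⟨v, rfl⟩ ⟨w, rfl⟩; exact ⟨v + w, smul_add _ _ _⟩
      smul_mem' := by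
        rintro x _ ⟨v, rfl⟩
        obtain ⟨w, hw⟩ := ha x v
        exact ⟨w, hw.symm⟩ }
  rcases eq_bot_or_eq_top S with h | h
  · left
    intro v
    have : a • v ∈ S := ⟨v, rfl⟩
    rw [h] at this
    exact (Submodule.mem_bot _).1 this
  · right
    intro v
    have : v ∈ S := by rw [h]; trivial
    exact this

theorem cen_smul_eq_or : (∀ v : V, cen n • v = v) ∨ ∀ v : V, cen n • v = -v := by
  rcases smul_range_eq_bot_or_top (V := V) (1 + cen n) (fun x v => ⟨x • v, by
    rw [smul_smul, smul_smul, mul_add, add_mul, cen_mul, one_mul, mul_one]⟩) with h | h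
  · right
    intro v
    have := h v
    rw [add_smul, one_smul] at this
    exact eq_neg_of_add_eq_zero_right this
  · left
    intro v
    obtain ⟨w, rfl⟩ := h v
    rw [smul_smul, mul_add, mul_one, cen_mul_cen, add_comm]

/-- A simple module on which `K K̄` acts by `1` is killed by an element of square zero that
anticommutes with the generators up to a multiple of `1 - K K̄`. -/
theorem smul_eq_zero_of_cen_smul (hc : ∀ v : V, cen n • v = v) {a : NicholsDouble n} (ha : a * a =
    0)
    (hK : K n * a = -(a * K n)) (hKb : Kbar n * a = -(a * Kbar n))
    (hx : ∀ i, ∃ b, xi i * a = -(a * xi i) + b * (1 - cen n))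
    (hxb : ∀ i, ∃ b, xibar i * a = -(a * xibar i) + b * (1 - cen n)) (v : V) : a • v = 0 := by
  have h0 : ∀ w : V, (1 - cen n) • w = 0 := fun w => by rw [sub_smul, one_smul, hc, sub_self]
  have key : ∀ {y b : NicholsDouble n}, y * a = -(a * y) + b * (1 - cen n) →
      ∀ v : V, ∃ w : V, y • a • v = a • w := by
    intro y b h v
    exact ⟨-(y • v), by rw [smul_smul, h, add_smul, mul_smul b, h0, smul_zero, add_zero, neg_smul,
      mul_smul, smul_neg]⟩
  rcases smul_range_eq_bot_or_top (V := V) a (exists_smul_smul_eq_of_gens a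
    (key (b := 0) (by rw [hK, zero_mul, add_zero])) (key (b := 0) (by rw [hKb, zero_mul, add_zero]))
    (fun i => (hx i).elim fun b hb => key hb) (fun i => (hxb i).elim fun b hb => key hb)) with h | h
  · exact h v
  · obtain ⟨w, rfl⟩ := h v
    obtain ⟨w', rfl⟩ := h w
    rw [smul_smul, ha, zero_smul]

theorem exists_eq_mul_one_sub_cen (i j : Fin n) :
    ∃ b, xi i * xibar j = -(xibar j * xi i) + b * (1 - cen n) := by
  refine ⟨if i = j then 1 else 0, ?_⟩
  rw [eq_sub_of_add_eq (xi_mul_xibar i j)]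
  split_ifs
  · rw [one_mul, cen]; abel
  · rw [zero_mul]; abel

/-- A simple module contains a nonzero vector that all `ξᵢ` kill: a word applied to a nonzero vector
that is nonzero and of maximal length. -/
theorem exists_xi_smul_eq_zero : ∃ v : V, v ≠ 0 ∧ ∀ i : Fin n, xi i • v = 0 := by
  have : Nontrivial V := IsSimpleModule.nontrivial (NicholsDouble n) V
  obtain ⟨v, hv⟩ := exists_ne (0 : V)
  classical
  have hne : (Finset.univ.filter fun I : Finset (Fin n) => word I • v ≠ 0).Nonempty :=
    ⟨∅, by simpa [word_empty] using hv⟩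
  obtain ⟨I, hI, hmax⟩ := Finset.exists_max_image _ Finset.card hne
  refine ⟨word I • v, (Finset.mem_filter.1 hI).2, fun i => ?_⟩
  by_cases hi : i ∈ I
  · rw [smul_smul, xi_mul_word_of_mem hi, zero_smul]
  · by_contra hcon
    have h1 : word (insert i I) • v ≠ 0 := by
      rw [word_insert hi, Algebra.smul_def, mul_smul, mul_smul]
      intro h
      apply hcon
      have h2 : algebraMap ℂ (NicholsDouble n) (sgn i I) • algebraMap ℂ (NicholsDouble n) (sgn i I) •
          xi i • word I • v = 0 := by rw [h, smul_zero]
      rwa [smul_smul, ← map_mul, Nichols.sgn_mul_self, map_one, one_smul] at h2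
    have := hmax _ (Finset.mem_filter.2 ⟨Finset.mem_univ _, h1⟩)
    rw [Finset.card_insert_of_notMem hi] at this
    omega

theorem exists_equiv_simpleMod :
    ∃ σ, Nonempty (V ≃ₗ[NicholsDouble n] SimpleMod n σ) := by
  obtain ⟨v, hv, hx⟩ := exists_xi_smul_eq_zero (n := n) (V := V)
  obtain ⟨u, hu, hxu, hKu⟩ := exists_K_eigenvector hv hx
  have hKb : ∀ w : V, Kbar n • w = K n • cen n • w := fun w => by rw [smul_smul, K_mul_cen]
  have key : ∃ σ : Label, ∀ x ∈ relations n σ, x • u = 0 := by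
    rcases cen_smul_eq_or (n := n) (V := V) with hc | hc
    · have hxb : ∀ i : Fin n, xibar i • u = 0 := fun i =>
        smul_eq_zero_of_cen_smul hc (xibar_mul_self i) (K_mul_xibar i) (Kbar_mul_xibar i)
          (fun j => exists_eq_mul_one_sub_cen j i)
          (fun j => ⟨0, by rw [zero_mul, add_zero, xibar_mul_xibar]⟩) u
      rcases hKu with h | h
      · exact ⟨.one, fun x hx => relations_smul (by simp [Label.signK, h])
          (by simp [Label.signKbar, hKb, hc, h]) hxu (fun _ => hxb) hx⟩
      · exact ⟨.KKbar, fun x hx => relations_smul (by simp [Label.signK, h])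
          (by simp [Label.signKbar, hKb, hc, h]) hxu (fun _ => hxb) hx⟩
    · have hns : (1 : ℂ) ≠ -1 := by norm_num
      rcases hKu with h | h
      · exact ⟨.K, fun x hx => relations_smul (σ := .K) (by simp [Label.signK, h])
          (by simp [Label.signKbar, hKb, hc,
          h]) hxu (fun hs => absurd (show (1 : ℂ) = -1 from hs) hns) hx⟩
      · exact ⟨.Kbar, fun x hx => relations_smul (σ := .Kbar) (by simp [Label.signK, h])
          (by simp [Label.signKbar, hKb, hc,
          h]) hxu (fun hs => absurd (show (-1 : ℂ) = 1 from hs) hns.symm) hx⟩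
  obtain ⟨σ, hσ⟩ := key
  refine ⟨σ,
      ⟨(LinearEquiv.ofBijective (fromSimple u σ hσ) (LinearMap.bijective_of_ne_zero ?_)).symm⟩⟩
  intro h0
  apply hu
  rw [← fromSimple_vac u σ hσ, h0, LinearMap.zero_apply]

end classification

/-! ### Primitive idempotents -/

/-- An idempotent that acts by zero on all simple modules is zero. -/
theorem eq_zero_of_smul_eq_zero {f : NicholsDouble n} (hf : IsIdempotentElem f)
    (h : ∀ σ, ∀ m : SimpleMod n σ, f • m = 0) : f = 0 := by
  by_contra hne
  have htop : Ideal.span {1 - f} ≠ ⊤ := by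
    intro htop
    have h1 : (1 : NicholsDouble n) ∈ Ideal.span {1 - f} := by rw [htop]; trivial
    obtain ⟨a, ha⟩ := Ideal.mem_span_singleton'.1 h1
    apply hne
    rw [← one_mul f, ← ha, mul_assoc, sub_mul, one_mul, hf.eq, sub_self, mul_zero]
  obtain ⟨m, hm, hle⟩ := Ideal.exists_le_maximal _ htop
  have hs : IsSimpleModule (NicholsDouble n) (NicholsDouble n ⧸ m) :=
    isSimpleModule_iff_isCoatom.2 hm.out
  obtain ⟨σ, ⟨e⟩⟩ := exists_equiv_simpleMod (n := n) (V := NicholsDouble n ⧸ m)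
  have h2 : f • (Submodule.Quotient.mk 1 : NicholsDouble n ⧸ m) = 0 := by
    apply e.injective
    rw [map_smul, h, map_zero]
  rw [← Submodule.Quotient.mk_smul, smul_eq_mul, mul_one, Submodule.Quotient.mk_eq_zero] at h2
  have h3 : 1 - f ∈ m := hle (Ideal.subset_span rfl)
  exact hm.ne_top ((Ideal.eq_top_iff_one _).2 (by simpa using m.add_mem h3 h2))

theorem isIdempotentElem_idem (σ : Label) : IsIdempotentElem (idem n σ) := by
  classical
  change _ * _ = _
  by_cases h : σ.IsSmall
  · nth_rw 1 [idem_of_small h]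
    rw [← smul_eq_mul, smul_assoc, gpart_smul (σ := σ) σ (K_mul_idem σ) (Kbar_mul_idem σ),
      if_pos rfl, smul_smul]
    norm_num
  · have hc : cen n • idem n σ = -idem n σ := by
      rw [smul_eq_mul, cen_mul_idem, Label.signK_mul_signKbar_of_not_small h, neg_one_smul]
    have hv := word_smul_wordBar_smul_self (xi_mul_idem h) hc Finset.univ
    nth_rw 1 [idem_of_not_small h]
    rw [gpart_mul_top, ← smul_eq_mul, smul_assoc, mul_smul,
      gpart_smul (σ := σ) σ (K_mul_idem σ) (Kbar_mul_idem σ), if_pos rfl, smul_comm (top n), top,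
      mul_smul, hv, smul_smul, smul_smul, Finset.card_univ, Fintype.card_fin, mul_assoc,
      mul_comm (4 : ℂ), idem_scalar, one_smul]

theorem idem_mul_idem {σ σ' : Label} (h : σ ≠ σ') : idem n σ * idem n σ' = 0 := by
  classical
  have h1 := gpart_smul (n := n) (M := NicholsDouble n) (u := idem n σ') (σ :=
      σ') σ (K_mul_idem σ') (Kbar_mul_idem σ')
  rw [if_neg h, smul_eq_mul] at h1
  by_cases hs : σ.IsSmall
  · rw [idem_of_small hs, smul_mul_assoc, h1, smul_zero]
  · rw [idem_of_not_small hs, gpart_mul_top, smul_mul_assoc, mul_assoc, h1, mul_zero, smul_zero]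

theorem idem_ne_zero (σ : Label) : idem n σ ≠ 0 := by
  classical
  intro h
  have := idem_smul_vac (n := n) σ σ
  rw [h, zero_smul, if_pos rfl] at this
  exact vac_ne_zero σ this.symm

theorem isPrimitiveIdempotent_idem (σ : Label) : IsPrimitiveIdempotent (idem n σ) := by
  classical
  refine ⟨isIdempotentElem_idem σ, idem_ne_zero σ, fun f g hf hg hfg hgf hsum => ?_⟩
  have hef : ∀ {f g : NicholsDouble n}, IsIdempotentElem f → f * g = 0 → g * f = 0 →
      f + g = idem n σ → f * idem n σ = f ∧ idem n σ * f = f := by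
    intro f g hf hfg hgf hsum
    rw [← hsum, mul_add, add_mul, hf.eq, hfg, hgf, add_zero]
    exact ⟨rfl, rfl⟩
  -- an idempotent below `e_σ` acts on `V_σ` through a scalar on the vacuum
  have key : ∀ {f : NicholsDouble n}, IsIdempotentElem f → f * idem n σ = f → idem n σ * f = f →
      f • vac n σ = 0 → f = 0 := by
    intro f hf h1 h2 h0
    refine eq_zero_of_smul_eq_zero hf fun τ m => ?_
    rw [← h1, mul_smul]
    by_cases hτ : σ = τ
    · subst hτ
      obtain ⟨a, ha⟩ := exists_idem_smul σ m
      rw [ha, smul_comm, h0, smul_zero]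
    · rw [idem_smul_of_ne hτ, smul_zero]
  obtain ⟨hf1, hf2⟩ := hef hf hfg hgf hsum
  obtain ⟨hg1, hg2⟩ := hef hg hgf hfg (by rw [add_comm, hsum])
  obtain ⟨a, ha⟩ := exists_idem_smul σ (f • vac n σ)
  rw [smul_smul, hf2] at ha
  by_cases h0 : a = 0
  · left
    exact key hf hf1 hf2 (by rw [ha, h0, zero_smul])
  · right
    refine key hg hg1 hg2 ?_
    have h3 : g • f • vac n σ = 0 := by rw [smul_smul, hgf, zero_smul]
    rw [ha, smul_comm] at h3
    exact (smul_eq_zero.1 h3).resolve_left h0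

theorem exists_surjective_projMod (σ : Label) :
    ∃ f : ProjMod n σ →ₗ[NicholsDouble n] SimpleMod n σ, Function.Surjective f := by
  classical
  refine ⟨(LinearMap.toSpanSingleton (NicholsDouble n) _ (vac n σ)).comp (ProjMod n σ).subtype,
    fun m => ?_⟩
  obtain ⟨x, rfl⟩ := Submodule.Quotient.mk_surjective _ m
  refine ⟨⟨x * idem n σ, Ideal.mem_span_singleton'.2 ⟨x, rfl⟩⟩, ?_⟩
  rw [LinearMap.comp_apply, Submodule.subtype_apply, LinearMap.toSpanSingleton_apply, mul_smul,
    idem_smul_vac, if_pos rfl, smul_vac]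

end NicholsDouble

end

noncomputable section

namespace NicholsDouble

open Nichols (revSign sgn)

variable {n : ℕ}

/-! ### The central elements on which `K K̄` acts by `1` -/

theorem swap_cen : swap n (cen n) = cen n := by
  rw [cen, map_mul, swap_K, swap_Kbar, Kbar_mul_K]

theorem xi_mul_one_add_cen_mul_wordBar (i : Fin n) (J : Finset (Fin n)) :
    xi i * ((1 + cen n) * wordBar J) = (-1 : ℂ) ^ J.card • ((1 + cen n) * wordBar J * xi i) := by
  have h := congrArg (swap n) (xibar_mul_one_add_cen_mul_word i J)
  simpa [swap_cen, swap_word] using h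

theorem cen_mul_one_add_cen : cen n * (1 + cen n) = 1 + cen n := by
  rw [mul_add, mul_one, cen_mul_cen, add_comm]

theorem cen_mul_one_sub_cen : cen n * (1 - cen n) = -(1 - cen n) := by
  rw [mul_sub, mul_one, cen_mul_cen, neg_sub]

theorem commute_one_add_cen (x : NicholsDouble n) : Commute (1 + cen n) x :=
  (Commute.one_left x).add_left (commute_cen x)

theorem commute_one_sub_cen (x : NicholsDouble n) : Commute (1 - cen n) x :=
  (Commute.one_left x).sub_left (commute_cen x)

theorem commute_one_add_cen_mul_word_mul_wordBar {I J : Finset (Fin n)}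
    (h : Even (I.card + J.card)) (x : NicholsDouble n) :
    Commute ((1 + cen n) * (word I * wordBar J)) x := by
  refine commute_of_gens ?_ ?_ (fun i => ?_) (fun i => ?_) x
  · exact (commute_one_add_cen _).mul_left (commute_K_word_mul_wordBar h).symm
  · exact (commute_one_add_cen _).mul_left (commute_Kbar_word_mul_wordBar h).symm
  · change _ = _
    symm
    rw [← mul_assoc (1 + cen n), (commute_one_add_cen (word I)).eq, mul_assoc (word I),
      ← mul_assoc (xi i), xi_mul_word, smul_mul_assoc, mul_assoc (word I),
      xi_mul_one_add_cen_mul_wordBar, mul_smul_comm, smul_smul, ← pow_add, h.neg_one_pow, one_smul]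
    simp only [mul_assoc]
  · change _ = _
    symm
    rw [← mul_assoc (1 + cen n), ← mul_assoc (xibar i), xibar_mul_one_add_cen_mul_word,
      smul_mul_assoc, mul_assoc _ (xibar i), xibar_mul_wordBar, mul_smul_comm, smul_smul, ← pow_add,
      h.neg_one_pow, one_smul]
    simp only [mul_assoc]

theorem commute_of_mem_ZLambda {z : NicholsDouble n} (hz : z ∈ ZLambda n) (x : NicholsDouble n) :
    Commute z x := by
  induction hz using Submodule.span_induction with
  | mem z h =>
    obtain ⟨I, J, hIJ, rfl⟩ := h
    exact commute_one_add_cen_mul_word_mul_wordBar hIJ x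
  | zero => exact Commute.zero_left x
  | add a b _ _ ha hb => exact ha.add_left hb
  | smul r a _ ha => exact ha.smul_left r

theorem one_sub_cen_mul_of_mem_ZLambda {z : NicholsDouble n} (hz : z ∈ ZLambda n) :
    (1 - cen n) * z = 0 := by
  induction hz using Submodule.span_induction with
  | mem z h =>
    obtain ⟨I, J, hIJ, rfl⟩ := h
    change (1 - cen n) * ((1 + cen n) * _) = 0
    rw [← mul_assoc, sub_mul, one_mul, cen_mul_one_add_cen, sub_self, zero_mul]
  | zero => exact mul_zero _
  | add a b _ _ ha hb => rw [mul_add, ha, hb, add_zero]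
  | smul r a _ ha => rw [mul_smul_comm, ha, smul_zero]

theorem one_add_cen_mul_word_mul_wordBar (I J : Finset (Fin n)) :
    (1 + cen n) * (word I * wordBar J) = hop n (Nichols.word I) * bar n (Nichols.word J) +
      (-1 : ℂ) ^ I.card • (hop n (Nichols.K n * Nichols.word I) *
        bar n (Nichols.K n * Nichols.word J)) := by
  simp only [map_mul, hop_K, bar_K, hop_word, bar_word]
  rw [add_mul, one_mul, cen, mul_assoc, ← mul_assoc (Kbar n), Kbar_mul_word, smul_mul_assoc,
    mul_smul_comm]
  simp only [mul_assoc]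

theorem K_add_Kbar_eq : K n + Kbar n = (1 + cen n) * K n := by
  rw [add_mul, one_mul, cen_mul_K]

theorem K_add_Kbar_mul_top : (K n + Kbar n) * top n =
    hop n (Nichols.K n * Nichols.word Finset.univ) * bar n (Nichols.word Finset.univ) +
      (-1 : ℂ) ^ n • (hop n (Nichols.word Finset.univ) *
        bar n (Nichols.K n * Nichols.word Finset.univ)) := by
  simp only [map_mul, hop_K, bar_K, hop_word, bar_word]
  rw [top, add_mul, ← mul_assoc (Kbar n), Kbar_mul_word, smul_mul_assoc, Finset.card_univ,
    Fintype.card_fin]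
  simp only [mul_assoc]

/-- Averaging over conjugation by `K` leaves the even words. -/
theorem mem_ZLambda_of_even (I J : Finset (Fin n)) :
    (1 + cen n) * (word I * wordBar J) + K n * ((1 + cen n) * (word I * wordBar J)) * K n ∈
      ZLambda n := by
  have h : K n * ((1 + cen n) * (word I * wordBar J)) * K n =
      (-1 : ℂ) ^ (I.card + J.card) • ((1 + cen n) * (word I * wordBar J)) := by
    rw [← mul_assoc, ← (commute_one_add_cen (K n)).eq, mul_assoc, mul_assoc, mul_assoc (word I),
      wordBar_mul_K, mul_smul_comm, mul_smul_comm, ← mul_assoc (word I), word_mul_K, smul_mul_assoc]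
    simp only [mul_smul_comm, smul_smul, mul_assoc, K_mul_K_mul, pow_add, mul_comm]
  rw [h]
  by_cases he : Even (I.card + J.card)
  · rw [he.neg_one_pow, one_smul]
    have : (1 + cen n) * (word I * wordBar J) ∈ ZLambda n := Submodule.subset_span ⟨I, J, he, rfl⟩
    exact add_mem this this
  · rw [(Nat.not_even_iff_odd.1 he).neg_one_pow, neg_one_smul, add_neg_cancel]
    exact zero_mem _

theorem exists_add_conj_eq (z : NicholsDouble n) :
    ∃ a ∈ ZLambda n, ∃ b ∈ ZLambda n,
      (1 + cen n) * z + K n * ((1 + cen n) * z) * K n = a + K n * b := by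
  have hadd : ∀ z z' : NicholsDouble n,
      (∃ a ∈ ZLambda n, ∃ b ∈ ZLambda n,
        (1 + cen n) * z + K n * ((1 + cen n) * z) * K n = a + K n * b) →
      (∃ a ∈ ZLambda n, ∃ b ∈ ZLambda n,
        (1 + cen n) * z' + K n * ((1 + cen n) * z') * K n = a + K n * b) →
      ∃ a ∈ ZLambda n, ∃ b ∈ ZLambda n,
        (1 + cen n) * (z + z') + K n * ((1 + cen n) * (z + z')) * K n = a + K n * b := by
    rintro z z' ⟨a, ha, b, hb, h⟩ ⟨a', ha', b', hb', h'⟩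
    refine ⟨a + a', add_mem ha ha', b + b', add_mem hb hb', ?_⟩
    rw [mul_add (1 + cen n), mul_add (K n) _ _, add_mul _ _ (K n), mul_add (K n) b,
        add_add_add_comm,
      h, h']
    abel
  have hsmul : ∀ (r : ℂ) (z : NicholsDouble n),
      (∃ a ∈ ZLambda n, ∃ b ∈ ZLambda n,
        (1 + cen n) * z + K n * ((1 + cen n) * z) * K n = a + K n * b) →
      ∃ a ∈ ZLambda n, ∃ b ∈ ZLambda n,
        (1 + cen n) * (r • z) + K n * ((1 + cen n) * (r • z)) * K n = a + K n * b := by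
    rintro r z ⟨a, ha, b, hb, h⟩
    refine ⟨r • a, Submodule.smul_mem _ _ ha, r • b, Submodule.smul_mem _ _ hb, ?_⟩
    rw [mul_smul_comm, mul_smul_comm, mul_smul_comm, smul_mul_assoc, ← smul_add, ← smul_add, h]
  have hK : ∀ z : NicholsDouble n,
      (∃ a ∈ ZLambda n, ∃ b ∈ ZLambda n,
        (1 + cen n) * z + K n * ((1 + cen n) * z) * K n = a + K n * b) →
      ∃ a ∈ ZLambda n, ∃ b ∈ ZLambda n,
        (1 + cen n) * (K n * z) + K n * ((1 + cen n) * (K n * z)) * K n = a + K n * b := by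
    rintro z ⟨a, ha, b, hb, h⟩
    refine ⟨b, hb, a, ha, ?_⟩
    have h1 : (1 + cen n) * (K n * z) = K n * ((1 + cen n) * z) := by
      rw [← mul_assoc, (commute_one_add_cen (K n)).eq, mul_assoc]
    rw [h1, mul_assoc (K n), ← mul_add, h, mul_add, K_mul_K_mul, add_comm]
  have hw : ∀ I J : Finset (Fin n), ∃ a ∈ ZLambda n, ∃ b ∈ ZLambda n,
      (1 + cen n) * (word I * wordBar J) + K n * ((1 + cen n) * (word I * wordBar J)) * K n =
        a + K n * b := fun I J =>
    ⟨_, mem_ZLambda_of_even I J, 0, zero_mem _, by rw [mul_zero, add_zero]⟩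
  -- modulo `1 - K K̄` the element `K̄` may be replaced by `K`
  have hKb : ∀ z : NicholsDouble n, (1 + cen n) * (Kbar n * z) = (1 + cen n) * (K n * z) := by
    intro z
    rw [← mul_assoc, ← mul_assoc, ← K_mul_cen, ← cen_mul, ← mul_assoc, add_mul 1, one_mul,
      cen_mul_cen, add_comm]
  have hxy : ∀ x y : Nichols n, ∃ a ∈ ZLambda n, ∃ b ∈ ZLambda n,
      (1 + cen n) * (hop n x * bar n y) + K n * ((1 + cen n) * (hop n x * bar n y)) * K n =
        a + K n * b := by
    intro x y
    have hzero : ∃ a ∈ ZLambda n, ∃ b ∈ ZLambda n,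
        (1 + cen n) * (0 : NicholsDouble n) + K n * ((1 + cen n) * 0) * K n = a + K n * b :=
      ⟨0, zero_mem _, 0, zero_mem _, by simp⟩
    rw [← (Nichols.basis n).sum_repr x, ← (Nichols.basis n).sum_repr y, map_sum, map_sum,
      Finset.sum_mul_sum]
    refine Finset.sum_induction _ _ hadd hzero fun b _ => Finset.sum_induction _ _ hadd hzero
      fun b' _ => ?_
    rw [map_smul, map_smul, smul_mul_smul_comm]
    refine hsmul _ _ ?_
    obtain ⟨a, I⟩ := b
    obtain ⟨a', J⟩ := b'
    have h0 : ∃ a ∈ ZLambda n, ∃ b ∈ ZLambda n,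
        (1 + cen n) * (word I * (Kbar n * wordBar J)) +
          K n * ((1 + cen n) * (word I * (Kbar n * wordBar J))) * K n = a + K n * b := by
      rw [← mul_assoc (word I), word_mul_Kbar, smul_mul_assoc, mul_assoc]
      refine hsmul _ _ ?_
      rw [hKb]
      exact hK _ (hw I J)
    fin_cases a <;> fin_cases a'
    · simpa [Nichols.basis_apply] using hw I J
    · simpa [Nichols.basis_apply] using h0
    · simpa [Nichols.basis_apply, mul_assoc] using hK _ (hw I J)
    · simpa [Nichols.basis_apply, mul_assoc] using hK _ h0
  induction z using induction_hop_bar with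
  | h x y => exact hxy x y
  | hadd a b ha hb => exact hadd a b ha hb

theorem mem_range_of_mem_ZLambda {b : NicholsDouble n} (hb : b ∈ ZLambda n) :
    ∃ β : Finset (Fin n) × Finset (Fin n) → ℂ,
      b = ∑ p, β p • ((1 + cen n) * (word p.1 * wordBar p.2)) := by
  have h : b ∈ Submodule.span ℂ (Set.range fun p : Finset (Fin n) × Finset (Fin n) =>
      (1 + cen n) * (word p.1 * wordBar p.2)) := by
    refine Submodule.span_mono ?_ hb
    rintro _ ⟨I, J, -, rfl⟩
    exact ⟨(I, J), rfl⟩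
  obtain ⟨β, hβ⟩ := (Submodule.mem_span_range_iff_exists_fun ℂ).1 h
  exact ⟨β, hβ.symm⟩

theorem coefHB_one_add_cen_mul (I J I' J' : Finset (Fin n)) :
    coefHB ((Nichols.basis n).coord (0, I')) ((Nichols.basis n).coord (0, J'))
      ((1 + cen n) * (word I * wordBar J)) = if I = I' ∧ J = J' then 1 else 0 := by
  rw [one_add_cen_mul_word_mul_wordBar, map_add, map_smul, coefHB_apply, coefHB_apply,
    Nichols.coord_word, Nichols.coord_word, Nichols.coord_K_mul_word, Nichols.coord_K_mul_word]
  by_cases hI : I = I' <;> by_cases hJ : J = J' <;> simp [hI, hJ]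

/-- The socle of the block of `V₁` and `V_{K K̄}`, as far as it meets `Z_Λ`. -/
theorem eq_smul_top_of_mem_ZLambda {b : NicholsDouble n} (hb : b ∈ ZLambda n)
    (hx : ∀ i, xi i * b = 0) (hxb : ∀ i, b * xibar i = 0) :
    ∃ r : ℂ, b = r • ((1 + cen n) * top n) := by
  obtain ⟨β, rfl⟩ := mem_range_of_mem_ZLambda hb
  have hβ : ∀ p, p ≠ (Finset.univ, Finset.univ) → β p = 0 := by
    rintro ⟨I, J⟩ hp
    by_cases hI : I = Finset.univ
    · have hJ : J ≠ Finset.univ := fun hJ => hp (by rw [hI, hJ])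
      obtain ⟨i, hi⟩ : ∃ i, i ∉ J := by
        by_contra! hcon
        exact hJ (Finset.eq_univ_iff_forall.2 hcon)
      have h := congrArg (coefHB ((Nichols.basis n).coord (0, I))
        ((Nichols.basis n).coord (0, insert i J))) (hxb i)
      rw [map_zero, Finset.sum_mul, map_sum, Finset.sum_eq_single (I, J)] at h
      · rw [smul_mul_assoc, map_smul, mul_assoc, mul_assoc] at h
        have h2 : wordBar J * xibar i = ((-1) ^ J.card * sgn i J) • wordBar (insert i J) := by
          rw [wordBar_insert hi, smul_smul, mul_assoc, Nichols.sgn_mul_self, mul_one,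
            xibar_mul_wordBar, smul_smul, neg_one_pow_mul_self, one_smul]
        rw [h2, mul_smul_comm, mul_smul_comm, map_smul, coefHB_one_add_cen_mul, if_pos ⟨rfl, rfl⟩,
          smul_eq_mul, smul_eq_mul, mul_one] at h
        refine (mul_eq_zero.1 h).resolve_right (mul_ne_zero (pow_ne_zero _ (by norm_num)) ?_)
        intro h0
        have := Nichols.sgn_mul_self i J
        rw [h0, zero_mul] at this
        exact zero_ne_one this
      · rintro ⟨I', J'⟩ - hne
        rw [smul_mul_assoc, map_smul, mul_assoc, mul_assoc]
        by_cases hi' : i ∈ J'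
        · rw [wordBar_mul_xibar_of_mem hi', mul_zero, mul_zero, map_zero, smul_zero]
        · have h2 : wordBar J' * xibar i = ((-1) ^ J'.card * sgn i J') • wordBar (insert i J') := by
            rw [wordBar_insert hi', smul_smul, mul_assoc, Nichols.sgn_mul_self, mul_one,
              xibar_mul_wordBar, smul_smul, neg_one_pow_mul_self, one_smul]
          rw [h2, mul_smul_comm, mul_smul_comm, map_smul, coefHB_one_add_cen_mul, if_neg,
            smul_zero, smul_zero]
          rintro ⟨rfl, h3⟩
          apply hne
          rw [← Finset.erase_insert hi', h3, Finset.erase_insert hi]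
      · simp
    · obtain ⟨i, hi⟩ : ∃ i, i ∉ I := by
        by_contra! hcon
        exact hI (Finset.eq_univ_iff_forall.2 hcon)
      have key : ∀ (I' J' : Finset (Fin n)),
          i ∉ I' → xi i * ((1 + cen n) * (word I' * wordBar J')) =
          sgn i I' • ((1 + cen n) * (word (insert i I') * wordBar J')) := by
        intro I' J' hi'
        rw [← mul_assoc, ← (commute_one_add_cen (xi i)).eq, mul_assoc, ← mul_assoc (xi i),
          word_insert hi', smul_mul_assoc, mul_smul_comm, smul_smul, Nichols.sgn_mul_self, one_smul]
      have h := congrArg (coefHB ((Nichols.basis n).coord (0, insert i I))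
        ((Nichols.basis n).coord (0, J))) (hx i)
      rw [map_zero, Finset.mul_sum, map_sum, Finset.sum_eq_single (I, J)] at h
      · rw [mul_smul_comm, map_smul, key I J hi, map_smul, coefHB_one_add_cen_mul,
          if_pos ⟨rfl, rfl⟩, smul_eq_mul, smul_eq_mul, mul_one] at h
        refine (mul_eq_zero.1 h).resolve_right ?_
        intro h0
        have := Nichols.sgn_mul_self i I
        rw [h0, zero_mul] at this
        exact zero_ne_one this
      · rintro ⟨I', J'⟩ - hne
        rw [mul_smul_comm, map_smul]
        by_cases hi' : i ∈ I'
        · rw [← mul_assoc, ← (commute_one_add_cen (xi i)).eq, mul_assoc, ← mul_assoc (xi i),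
            xi_mul_word_of_mem hi', zero_mul, mul_zero, map_zero, smul_zero]
        · rw [key I' J' hi', map_smul, coefHB_one_add_cen_mul, if_neg, smul_zero, smul_zero]
          rintro ⟨h3, rfl⟩
          apply hne
          rw [← Finset.erase_insert hi', h3, Finset.erase_insert hi]
      · simp
  refine ⟨β (Finset.univ, Finset.univ), ?_⟩
  rw [Finset.sum_eq_single (Finset.univ, Finset.univ)]
  · rfl
  · intro p _ hp
    rw [hβ p hp, zero_smul]
  · simp

theorem eq_neg_of_anticomm_of_commute {a x : NicholsDouble n} (h : a * x = x * a)
    (h' : a * x = -(x * a)) : a * x = 0 :=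
  eq_zero_of_eq_neg (by nth_rw 1 [h', ← h])

/-- The part of a central element on which `K K̄` acts by `1`. -/
theorem one_add_cen_mul_mem {z : NicholsDouble n} (hz : ∀ x, Commute z x) :
    ∃ a ∈ ZLambda n, ∃ r : ℂ, (1 + cen n) * z = a + r • ((K n + Kbar n) * top n) := by
  obtain ⟨a, ha, b, hb, h⟩ := exists_add_conj_eq z
  have hc : ∀ x, Commute ((1 + cen n) * z) x := fun x => (commute_one_add_cen x).mul_left (hz x)
  rw [← (hc (K n)).eq, mul_assoc, K_mul_K, mul_one, ← two_smul ℂ] at h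
  have hKb : ∀ x, Commute (K n * b) x := by
    intro x
    rw [eq_sub_of_add_eq' h.symm]
    exact ((hc x).smul_left 2).sub_left (commute_of_mem_ZLambda ha x)
  have hθ : ∀ x : NicholsDouble n, K n * x = -(x * K n) → x * b = 0 := by
    intro x hx
    have h1 : x * (K n * b) = 0 := by
      refine eq_neg_of_anticomm_of_commute (hKb x).eq.symm ?_
      rw [← mul_assoc, mul_assoc (K n), (commute_of_mem_ZLambda hb x).eq, ← mul_assoc, hx, neg_mul,
        neg_neg]
    have h2 : x * (K n * b) = -(K n * (x * b)) := by
      rw [← mul_assoc, ← mul_assoc, hx, neg_mul, neg_neg]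
    rw [h2, neg_eq_zero] at h1
    rw [← K_mul_K_mul (x * b), h1, mul_zero]
  obtain ⟨r, hr⟩ := eq_smul_top_of_mem_ZLambda hb (fun i => hθ _ (K_mul_xi i))
    (fun i => by rw [(commute_of_mem_ZLambda hb _).eq]; exact hθ _ (K_mul_xibar i))
  refine ⟨(1 / 2 : ℂ) • a, Submodule.smul_mem _ _ ha, r / 2, ?_⟩
  have h3 : (1 + cen n) * z = (1 / 2 : ℂ) • (a + K n * b) := by
    rw [← h, smul_smul]; norm_num
  rw [h3, hr, smul_add, mul_smul_comm, smul_smul, ← mul_assoc, ← (commute_one_add_cen (K n)).eq,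
    ← K_add_Kbar_eq]
  congr 2
  ring

/-! ### The central elements on which `K K̄` acts by `-1` -/

theorem exists_hop_mul_idem {σ : Label} (h : ¬σ.IsSmall) (y : Nichols n) :
    ∃ r : ℂ, hop n y * idem n σ = r • idem n σ := by
  induction y using Nichols.induction_left with
  | h1 => exact ⟨1, by rw [map_one, one_mul, one_smul]⟩
  | hadd a b ha hb =>
    obtain ⟨r, hr⟩ := ha
    obtain ⟨s, hs⟩ := hb
    exact ⟨r + s, by rw [map_add, add_mul, hr, hs, add_smul]⟩
  | hsmul r a ha =>
    obtain ⟨s, hs⟩ := ha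
    exact ⟨r * s, by rw [map_smul, smul_mul_assoc, hs, smul_smul]⟩
  | hK a ha =>
    obtain ⟨s, hs⟩ := ha
    exact ⟨s * σ.signK, by rw [map_mul, mul_assoc, hs, mul_smul_comm, hop_K, K_mul_idem, smul_smul]⟩
  | hx i a ha =>
    obtain ⟨s, hs⟩ := ha
    exact ⟨0, by rw [map_mul, mul_assoc, hs, mul_smul_comm, hop_xi, xi_mul_idem h, smul_zero,
      zero_smul]⟩

theorem exists_idem_mul_bar {σ : Label} (h : ¬σ.IsSmall) (x : Nichols n) :
    ∃ r : ℂ, idem n σ * bar n x = r • idem n σ := by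
  induction x using Nichols.induction_left with
  | h1 => exact ⟨1, by rw [map_one, mul_one, one_smul]⟩
  | hadd a b ha hb =>
    obtain ⟨r, hr⟩ := ha
    obtain ⟨s, hs⟩ := hb
    exact ⟨r + s, by rw [map_add, mul_add, hr, hs, add_smul]⟩
  | hsmul r a ha =>
    obtain ⟨s, hs⟩ := ha
    exact ⟨r * s, by rw [map_smul, mul_smul_comm, hs, smul_smul]⟩
  | hK a ha =>
    obtain ⟨s, hs⟩ := ha
    refine ⟨σ.signKbar * s, ?_⟩
    rw [map_mul, bar_K, ← mul_assoc, ← (commute_Kbar_idem σ).eq, Kbar_mul_idem, smul_mul_assoc, hs,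
      smul_smul]
  | hx i a ha =>
    exact ⟨0, by rw [map_mul, ← mul_assoc, bar_xi, idem_mul_xibar h, zero_mul, zero_smul]⟩

/-- `e_K` and `e_K̄` have one-dimensional corner algebras. -/
theorem exists_idem_mul_mul_idem {σ : Label} (h : ¬σ.IsSmall) (x : NicholsDouble n) :
    ∃ r : ℂ, idem n σ * x * idem n σ = r • idem n σ := by
  induction x using induction_bar_hop with
  | h x y =>
    obtain ⟨r, hr⟩ := exists_idem_mul_bar h x
    obtain ⟨s, hs⟩ := exists_hop_mul_idem h y
    refine ⟨r * s, ?_⟩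
    rw [← mul_assoc, hr, mul_assoc, hs, smul_mul_smul_comm, (isIdempotentElem_idem σ).eq]
  | hadd a b ha hb =>
    obtain ⟨r, hr⟩ := ha
    obtain ⟨s, hs⟩ := hb
    exact ⟨r + s, by rw [mul_add, add_mul, hr, hs, add_smul]⟩

theorem exists_central_mul_idem {σ : Label} (h : ¬σ.IsSmall) {z : NicholsDouble n}
    (hz : ∀ x, Commute z x) : ∃ r : ℂ, z * idem n σ = r • idem n σ := by
  obtain ⟨r, hr⟩ := exists_idem_mul_mul_idem h z
  refine ⟨r, ?_⟩
  rw [← hr, ← (hz _).eq, mul_assoc, (isIdempotentElem_idem σ).eq]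

theorem sgn_ne_zero (i : Fin n) (I : Finset (Fin n)) : sgn i I ≠ 0 := fun h => by
  have := Nichols.sgn_mul_self i I
  rw [h, zero_mul] at this
  exact zero_ne_one this

theorem one_sub_cen_mul_one_sub_cen : (1 - cen n) * (1 - cen n) = (2 : ℂ) • (1 - cen n) := by
  rw [sub_mul, one_mul, cen_mul_one_sub_cen, sub_neg_eq_add, two_smul]

/-- A two-sided ideal that contains `(1 - K K̄) ξ₁ ⋯ ξₙ ξ̄₁ ⋯ ξ̄ₙ` contains `1 - K K̄`: the letters are
stripped off one by one by anticommutators. -/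
theorem one_sub_cen_mem_of_top_mem (𝓘 : Submodule ℂ (NicholsDouble n))
    (hl : ∀ a, ∀ x ∈ 𝓘, a * x ∈ 𝓘) (hr : ∀ a, ∀ x ∈ 𝓘, x * a ∈ 𝓘)
    (h : (1 - cen n) * top n ∈ 𝓘) : 1 - cen n ∈ 𝓘 := by
  have h2 : ∀ a : NicholsDouble n, (1 - cen n) * ((1 - cen n) * a) ∈ 𝓘 → (1 - cen n) * a ∈ 𝓘 := by
    intro a ha
    rw [← mul_assoc, one_sub_cen_mul_one_sub_cen, smul_mul_assoc] at ha
    exact (𝓘.smul_mem_iff two_ne_zero).1 ha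
  have hcompl : ∀ {k : Fin n} {S : Finset (Fin n)}, k ∉ S → Sᶜ = insert k (insert k S)ᶜ := by
    intro k S hk
    rw [← Finset.compl_erase, Finset.erase_insert hk]
  have h3 : ∀ S : Finset (Fin n), (1 - cen n) * (word Sᶜ * wordBar Finset.univ) ∈ 𝓘 := by
    intro S
    induction S using Finset.induction_on with
    | empty => rwa [Finset.compl_empty]
    | insert k S hk ih =>
      have hk' : k ∉ (insert k S)ᶜ := by simp
      apply h2
      have h4 := hl (xibar k) _ ih
      rw [← mul_assoc (xibar k), ← (commute_one_sub_cen (xibar k)).eq, mul_assoc, hcompl hk,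
        word_insert hk', smul_mul_assoc, mul_smul_comm, mul_smul_comm, mul_assoc (xi k),
        ← mul_assoc (xibar k), xibar_mul_xi_self, sub_mul (1 - cen n) (xi k * _), mul_assoc (xi k),
        ← mul_assoc (xibar k),
        xibar_mul_word_of_notMem hk', smul_mul_assoc, mul_assoc (word _),
        xibar_mul_wordBar_of_mem (Finset.mem_univ k), mul_zero, smul_zero, mul_zero, sub_zero] at h4
      exact (𝓘.smul_mem_iff (sgn_ne_zero _ _)).1 h4
  have h5 : ∀ S : Finset (Fin n), (1 - cen n) * wordBar Sᶜ ∈ 𝓘 := by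
    intro S
    induction S using Finset.induction_on with
    | empty =>
      have := h3 Finset.univ
      rwa [Finset.compl_univ, word_empty, one_mul, ← Finset.compl_empty] at this
    | insert k S hk ih =>
      have hk' : k ∉ (insert k S)ᶜ := by simp
      apply h2
      rw [hcompl hk, wordBar_insert hk', mul_smul_comm] at ih
      have h6 := (𝓘.smul_mem_iff (sgn_ne_zero _ _)).1 ih
      have h4 := hl (xi k) _ h6
      rw [← mul_assoc (xi k), ← (commute_one_sub_cen (xi k)).eq, mul_assoc, ← mul_assoc (xi k),
        xi_mul_xibar_self, sub_mul (1 - cen n) (xibar k * _), mul_sub (1 - cen n),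
            mul_assoc (xibar k),
        xi_mul_wordBar_of_notMem hk',
        mul_smul_comm, mul_smul_comm, ← mul_assoc (xibar k), ← mul_assoc _ _ (xi k)] at h4
      exact (Submodule.sub_mem_iff_left _ (𝓘.smul_mem _ (hr _ _ h6))).1 h4
  have := h5 Finset.univ
  rwa [Finset.compl_univ, wordBar_empty, mul_one] at this

/-- A central element on which `K K̄` acts by `-1` vanishes if it annihilates `ξ₁ ⋯ ξₙ ξ̄₁ ⋯ ξ̄ₙ`. -/
theorem eq_zero_of_mul_top {y : NicholsDouble n} (hy : ∀ x, Commute y x) (hc : cen n * y = -y)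
    (h : y * top n = 0) : y = 0 := by
  have h1 := one_sub_cen_mem_of_top_mem (LinearMap.ker (LinearMap.mulLeft ℂ y))
    (fun a x hx => by
      rw [LinearMap.mem_ker, LinearMap.mulLeft_apply] at hx ⊢
      rw [← mul_assoc, (hy a).eq, mul_assoc, hx, mul_zero])
    (fun a x hx => by
      rw [LinearMap.mem_ker, LinearMap.mulLeft_apply] at hx ⊢
      rw [← mul_assoc, hx, zero_mul])
    (by rw [LinearMap.mem_ker, LinearMap.mulLeft_apply, ← mul_assoc, (hy _).eq, mul_assoc, h,
      mul_zero])
  rw [LinearMap.mem_ker, LinearMap.mulLeft_apply, mul_sub, mul_one, ← cen_mul, hc, sub_neg_eq_add,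
    ← two_smul ℂ] at h1
  exact (smul_eq_zero.1 h1).resolve_left two_ne_zero

theorem not_isSmall_K : ¬Label.K.IsSmall := by
  intro h
  have : (1 : ℂ) = -1 := h
  norm_num at this

theorem not_isSmall_Kbar : ¬Label.Kbar.IsSmall := by
  intro h
  have : (-1 : ℂ) = 1 := h
  norm_num at this

theorem gpart_K_add_gpart_Kbar : gpart n .K + gpart n .Kbar = (2 : ℂ) • (1 - cen n) := by
  simp only [gpart, Label.signK, Label.signKbar, neg_smul, one_smul, mul_add, add_mul,
    one_mul, mul_one, neg_mul, mul_neg, two_smul, cen]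
  abel

theorem eq_zero_of_mul_idem {y : NicholsDouble n} (hy : ∀ x, Commute y x) (hc : cen n * y = -y)
    (hK : y * idem n .K = 0) (hKb : y * idem n .Kbar = 0) : y = 0 := by
  have h0 : ((-1 : ℂ) ^ (n / 2) / 2 ^ (n + 2)) ≠ 0 :=
    div_ne_zero (pow_ne_zero _ (by norm_num)) (pow_ne_zero _ two_ne_zero)
  rw [idem_of_not_small not_isSmall_K, mul_smul_comm] at hK
  rw [idem_of_not_small not_isSmall_Kbar, mul_smul_comm] at hKb
  have h1 := (smul_eq_zero.1 hK).resolve_left h0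
  have h2 := (smul_eq_zero.1 hKb).resolve_left h0
  have h3 : y * ((gpart n .K + gpart n .Kbar) * top n) = 0 := by
    rw [add_mul, mul_add, h1, h2, add_zero]
  rw [gpart_K_add_gpart_Kbar, smul_mul_assoc, mul_smul_comm] at h3
  have h4 := (smul_eq_zero.1 h3).resolve_left two_ne_zero
  apply eq_zero_of_mul_top hy hc
  rw [sub_mul, one_mul, mul_sub, mul_cen_mul, ← mul_assoc, hc, neg_mul, sub_neg_eq_add,
    ← two_smul ℂ] at h4
  exact (smul_eq_zero.1 h4).resolve_left two_ne_zero

theorem cen_mul_idem_of_not_small {σ : Label} (h : ¬σ.IsSmall) : cen n * idem n σ = -idem n σ := by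
  rw [cen_mul_idem, Label.signK_mul_signKbar_of_not_small h, neg_one_smul]

theorem one_sub_cen_mul_idem {σ : Label} (h : ¬σ.IsSmall) :
    (1 - cen n) * idem n σ = (2 : ℂ) • idem n σ := by
  rw [sub_mul, one_mul, cen_mul_idem_of_not_small h, sub_neg_eq_add, two_smul]

/-- On a vacuum vector the sum over all words is the binomial sum `∑ (-2)^|w|`. -/
theorem wordSum_mul_idem {σ : Label} (h : ¬σ.IsSmall) :
    wordSum n * idem n σ = (-1 : ℂ) ^ n • idem n σ := by
  have hc : cen n • idem n σ = -idem n σ := cen_mul_idem_of_not_small h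
  have hs := Fin.sum_pow_mul_eq_add_pow (n := n) (-2 : ℂ) 1
  norm_num at hs
  rw [wordSum, Finset.sum_mul, ← hs, Finset.sum_smul]
  refine Finset.sum_congr rfl fun I _ => ?_
  rw [smul_mul_assoc, mul_assoc, ← smul_eq_mul (word I), ← smul_eq_mul (wordBar I),
    word_smul_wordBar_smul_self (xi_mul_idem h) hc, smul_smul,
    Nichols.neg_one_pow_eq_mul_revSign]
  congr 1
  rw [show (-2 : ℂ) = -1 * 2 by norm_num, mul_pow]
  linear_combination (-1 : ℂ) ^ I.card * 2 ^ I.card * Nichols.revSign_mul_self I.card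

theorem chir_mul_idem {σ : Label} (h : ¬σ.IsSmall) :
    chir n * idem n σ = (σ.signK * (-1) ^ n) • idem n σ := by
  have h2 : σ.signKbar = -σ.signK := by
    cases σ <;> simp_all [Label.signK, Label.signKbar, Label.IsSmall]
  rw [chir, smul_mul_assoc, mul_assoc, wordSum_mul_idem h, mul_smul_comm, sub_mul, K_mul_idem,
    Kbar_mul_idem, h2, ← sub_smul, smul_smul, smul_smul]
  congr 1
  ring

theorem chir_mul_chir : chir n * chir n = (1 / 2 : ℂ) • (1 - cen n) := by
  rw [← sub_eq_zero]
  have hk : ∀ {σ : Label}, ¬σ.IsSmall →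
      (chir n * chir n - (1 / 2 : ℂ) • (1 - cen n)) * idem n σ = 0 := by
    intro σ h
    rw [sub_mul, mul_assoc, chir_mul_idem h, mul_smul_comm, chir_mul_idem h, smul_smul,
      mul_mul_mul_comm, σ.signK_mul_self, neg_one_pow_mul_self, smul_mul_assoc,
      one_sub_cen_mul_idem h, smul_smul]
    norm_num
  refine eq_zero_of_mul_idem (fun x => ?_) ?_ (hk not_isSmall_K) (hk not_isSmall_Kbar)
  · exact ((commute_chir x).mul_left (commute_chir x)).sub_left ((commute_one_sub_cen x).smul_left _)
  · rw [mul_sub, ← mul_assoc, cen_mul_chir, mul_smul_comm, cen_mul_one_sub_cen, neg_mul, smul_neg,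
      neg_sub_neg, neg_sub]

theorem exists_one_sub_cen_mul_eq {z : NicholsDouble n} (hz : ∀ x, Commute z x) :
    ∃ r s : ℂ, (1 - cen n) * z = r • (1 - cen n) + s • chir n := by
  obtain ⟨a, ha⟩ := exists_central_mul_idem not_isSmall_K hz
  obtain ⟨b, hb⟩ := exists_central_mul_idem not_isSmall_Kbar hz
  refine ⟨(a + b) / 2, (-1) ^ n * (a - b), ?_⟩
  rw [← sub_eq_zero]
  have hk : ∀ {σ : Label} {r : ℂ}, ¬σ.IsSmall → z * idem n σ = r • idem n σ →
      ((1 - cen n) * z - (((a + b) / 2) • (1 - cen n) + ((-1) ^ n * (a - b)) • chir n)) * idem n σ =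
        (2 * r - (a + b) - σ.signK * (a - b)) • idem n σ := by
    intro σ r h hr
    rw [sub_mul, add_mul, mul_assoc, hr, smul_mul_assoc, smul_mul_assoc, chir_mul_idem h,
      mul_smul_comm, one_sub_cen_mul_idem h, smul_smul, smul_smul, smul_smul, ← add_smul,
      ← sub_smul]
    congr 1
    have := neg_one_pow_mul_self n
    linear_combination (-(a - b) * σ.signK) * this
  refine eq_zero_of_mul_idem (fun x => ?_) ?_ ?_ ?_
  · exact ((commute_one_sub_cen x).mul_left (hz x)).sub_left
      (((commute_one_sub_cen x).smul_left _).add_left ((commute_chir x).smul_left _))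
  · rw [mul_sub, mul_add, ← mul_assoc, cen_mul_one_sub_cen, mul_smul_comm, mul_smul_comm,
      cen_mul_one_sub_cen, cen_mul_chir, smul_neg, smul_neg, neg_mul]
    abel
  · rw [hk not_isSmall_K ha]
    have : 2 * a - (a + b) - Label.K.signK * (a - b) = 0 := by simp only [Label.signK]; ring
    rw [this, zero_smul]
  · rw [hk not_isSmall_Kbar hb]
    have : 2 * b - (a + b) - Label.Kbar.signK * (a - b) = 0 := by simp only [Label.signK]; ring
    rw [this, zero_smul]

/-! ### The center -/

/-- The basis of `Z_H`. -/
def basisZH (n : ℕ) : Fin 3 → NicholsDouble n := ![1 - cen n, (K n + Kbar n) * top n, chir n]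

theorem ZH_eq_span : ZH n = Submodule.span ℂ (Set.range (basisZH n)) := by
  apply le_antisymm
  · rw [ZH, Submodule.span_le]
    rintro x (rfl | rfl | rfl)
    · exact Submodule.subset_span ⟨0, rfl⟩
    · exact Submodule.subset_span ⟨1, rfl⟩
    · have h : (K n - Kbar n) * wordSum n = (2 : ℂ) • chir n := by
        rw [chir, smul_smul]; norm_num
      change (K n - Kbar n) * wordSum n ∈ Submodule.span ℂ (Set.range (basisZH n))
      rw [h]
      exact Submodule.smul_mem _ _ (Submodule.subset_span ⟨2, rfl⟩)
  · rw [Submodule.span_le]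
    rintro _ ⟨i, rfl⟩
    fin_cases i
    · exact Submodule.subset_span (Or.inl rfl)
    · exact Submodule.subset_span (Or.inr (Or.inl rfl))
    · exact Submodule.smul_mem _ _ (Submodule.subset_span (Or.inr (Or.inr rfl)))

theorem mem_ZH_iff {x : NicholsDouble n} : x ∈ ZH n ↔
    ∃ a b d : ℂ, x = a • (1 - cen n) + b • ((K n + Kbar n) * top n) + d • chir n := by
  rw [ZH_eq_span, Submodule.mem_span_range_iff_exists_fun]
  constructor
  · rintro ⟨f, rfl⟩
    exact ⟨f 0, f 1, f 2, Fin.sum_univ_three _⟩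
  · rintro ⟨a, b, d, rfl⟩
    exact ⟨![a, b, d], Fin.sum_univ_three _⟩

theorem one_sub_cen_mul_K_add_Kbar_mul_top : (1 - cen n) * ((K n + Kbar n) * top n) = 0 := by
  rw [K_add_Kbar_eq, ← mul_assoc, ← mul_assoc, sub_mul, one_mul, cen_mul_one_add_cen, sub_self,
    zero_mul, zero_mul]

/-- The intersection of `Z_H` and `Z_Λ`, and the relations between the spanning vectors of `Z_H`. -/
theorem coeff_eq_zero_of_mem_ZLambda {a b d : ℂ}
    (h : a • (1 - cen n) + b • ((K n + Kbar n) * top n) + d • chir n ∈ ZLambda n) :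
    a = 0 ∧ b = 0 ∧ d = 0 := by
  have h1 := one_sub_cen_mul_of_mem_ZLambda h
  have hch : (1 - cen n) * chir n = (2 : ℂ) • chir n := by
    rw [sub_mul, one_mul, cen_mul_chir, sub_neg_eq_add, two_smul]
  rw [mul_add, mul_add, mul_smul_comm, mul_smul_comm, mul_smul_comm,
    one_sub_cen_mul_K_add_Kbar_mul_top, smul_zero, add_zero, one_sub_cen_mul_one_sub_cen, hch] at h1
  have h2 : ∀ {σ : Label}, ¬σ.IsSmall → 2 * a + d * (σ.signK * (-1) ^ n) = 0 := by
    intro σ hσ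
    have h3 := congrArg (· * idem n σ) h1
    simp only [add_mul, smul_mul_assoc, chir_mul_idem hσ, one_sub_cen_mul_idem hσ, zero_mul,
        smul_smul, ← add_smul] at h3
    have h5 := (smul_eq_zero.1 h3).resolve_right (idem_ne_zero σ)
    linear_combination h5 / 2
  have h3 := h2 not_isSmall_K
  have h4 := h2 not_isSmall_Kbar
  simp only [Label.signK] at h3 h4
  have ha : a = 0 := by linear_combination (h3 + h4) / 4
  have hd : d = 0 := by
    have h5 := neg_one_pow_mul_self n
    rw [ha] at h3
    linear_combination (-1 : ℂ) ^ n * h3 - d * h5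
  refine ⟨ha, ?_, hd⟩
  rw [ha, hd, zero_smul, zero_smul, zero_add, add_zero] at h
  have hf : ∀ z ∈ ZLambda n, coefHB ((Nichols.basis n).coord (1, Finset.univ))
      ((Nichols.basis n).coord (0, Finset.univ)) z = 0 := by
    intro z hz
    induction hz using Submodule.span_induction with
    | mem z hz =>
      obtain ⟨I, J, -, rfl⟩ := hz
      rw [← cen, one_add_cen_mul_word_mul_wordBar, map_add, map_smul, coefHB_apply, coefHB_apply,
        Nichols.coord_word, Nichols.coord_K_mul_word (0, Finset.univ)]
      simp
    | zero => exact map_zero _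
    | add x y _ _ hx hy => rw [map_add, hx, hy, add_zero]
    | smul r x _ hx => rw [map_smul, hx, smul_zero]
  have h6 := hf _ h
  rw [map_smul, K_add_Kbar_mul_top, map_add, map_smul, coefHB_apply, coefHB_apply,
    Nichols.coord_word, Nichols.coord_word, Nichols.coord_K_mul_word,
    Nichols.coord_K_mul_word] at h6
  simpa using h6

theorem linearIndependent_basisZH : LinearIndependent ℂ (basisZH n) := by
  rw [Fintype.linearIndependent_iff]
  intro g hg
  rw [Fin.sum_univ_three] at hg
  have h : g 0 • (1 - cen n) + g 1 • ((K n + Kbar n) * top n) + g 2 • chir n ∈ ZLambda n := by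
    have : g 0 • (1 - cen n) + g 1 • ((K n + Kbar n) * top n) + g 2 • chir n = 0 := hg
    rw [this]
    exact zero_mem _
  obtain ⟨h0, h1, h2⟩ := coeff_eq_zero_of_mem_ZLambda h
  intro i
  fin_cases i
  exacts [h0, h1, h2]

theorem finrank_ZH : Module.finrank ℂ (ZH n) = 3 := by
  rw [ZH_eq_span, finrank_span_eq_card linearIndependent_basisZH, Fintype.card_fin]

theorem disjoint_ZH_ZLambda : Disjoint (ZH n) (ZLambda n) := by
  rw [Submodule.disjoint_def]
  intro x hx hx'
  obtain ⟨a, b, d, rfl⟩ := mem_ZH_iff.1 hx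
  obtain ⟨h0, h1, h2⟩ := coeff_eq_zero_of_mem_ZLambda hx'
  rw [h0, h1, h2, zero_smul, zero_smul, zero_smul, add_zero, add_zero]

theorem commute_K_add_Kbar_mul_top (x : NicholsDouble n) : Commute ((K n + Kbar n) * top n) x := by
  have htop : ∀ x, Commute ((1 + cen n) * top n) x :=
    commute_one_add_cen_mul_word_mul_wordBar ⟨_, rfl⟩
  have hz : (K n + Kbar n) * top n = K n * ((1 + cen n) * top n) := by
    rw [K_add_Kbar_eq, (commute_one_add_cen (K n)).eq, mul_assoc]
  rw [hz]
  have h0 : ∀ x : NicholsDouble n, K n * x = -(x * K n) → x * ((1 + cen n) * top n) = 0 →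
      Commute (K n * ((1 + cen n) * top n)) x := by
    intro x hx h
    change _ = _
    rw [mul_assoc, (htop x).eq, h, mul_zero, ← mul_assoc x, ← neg_neg (x * K n), ← hx, neg_mul,
      mul_assoc, h, mul_zero, neg_zero]
  refine commute_of_gens ?_ ?_ (fun i => ?_) (fun i => ?_) x
  · exact (Commute.refl _).mul_left (htop _)
  · exact Commute.mul_left K_mul_Kbar (htop _)
  · refine h0 _ (K_mul_xi i) ?_
    rw [← mul_assoc, ← (commute_one_add_cen (xi i)).eq, mul_assoc, xi_mul_top, mul_zero]
  · exact h0 _ (K_mul_xibar i) (xibar_mul_top i)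

theorem commute_of_mem_ZH {z : NicholsDouble n} (hz : z ∈ ZH n) (x : NicholsDouble n) :
    Commute z x := by
  obtain ⟨a, b, d, rfl⟩ := mem_ZH_iff.1 hz
  exact (((commute_one_sub_cen x).smul_left a).add_left
    ((commute_K_add_Kbar_mul_top x).smul_left b)).add_left ((commute_chir x).smul_left d)

theorem center_eq : (Subalgebra.center ℂ (NicholsDouble n)).toSubmodule = ZH n ⊔ ZLambda n := by
  apply le_antisymm
  · intro z hz
    have hz' : ∀ x, Commute z x := fun x => ((Subalgebra.mem_center_iff (R := ℂ)).1 hz x).symm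
    obtain ⟨a, ha, r, h1⟩ := one_add_cen_mul_mem hz'
    obtain ⟨s, t, h2⟩ := exists_one_sub_cen_mul_eq hz'
    have h3 : z = (1 / 2 : ℂ) • (s • (1 - cen n) + r • ((K n + Kbar n) * top n) + t • chir n) +
        (1 / 2 : ℂ) • a := by
      have h4 : (2 : ℂ) • z = (1 + cen n) * z + (1 - cen n) * z := by
        rw [add_mul, sub_mul, one_mul, two_smul]; abel
      have h5 : z = (1 / 2 : ℂ) • (2 : ℂ) • z := by rw [smul_smul]; norm_num
      rw [h5, h4, h1, h2, ← smul_add]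
      congr 1
      abel
    rw [h3]
    exact Submodule.add_mem_sup (Submodule.smul_mem _ _ (mem_ZH_iff.2 ⟨s, r, t, rfl⟩))
      (Submodule.smul_mem _ _ ha)
  · refine sup_le (fun z hz => ?_) (fun z hz => ?_)
    · exact (Subalgebra.mem_center_iff (R := ℂ)).2 fun x => (commute_of_mem_ZH hz x).eq.symm
    · exact (Subalgebra.mem_center_iff (R := ℂ)).2 fun x => (commute_of_mem_ZLambda hz x).eq.symm

end NicholsDouble

end

noncomputable section

namespace NicholsDouble

open Nichols (revSign sgn)

variable {n : ℕ}

/-! ### Trace functionals -/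

/-- Modulo `1 - K K̄` each generator `ξᵢ` generates an ideal of square zero. -/
theorem one_add_cen_mul_xi_mul_xi (i : Fin n) (y : NicholsDouble n) :
    (1 + cen n) * (xi i * (y * xi i)) = 0 := by
  induction y using induction_left with
  | h1 => rw [one_mul, xi_mul_self, mul_zero]
  | hadd a b ha hb => rw [add_mul a b, mul_add (xi i), mul_add, ha, hb, add_zero]
  | hsmul r a ha => rw [smul_mul_assoc, mul_smul_comm, mul_smul_comm, ha, smul_zero]
  | hK a ha =>
    rw [mul_assoc, xi_mul_K_mul, mul_neg, ← mul_assoc, (commute_one_add_cen (K n)).eq, mul_assoc,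
        ha,
      mul_zero, neg_zero]
  | hKb a ha =>
    rw [mul_assoc, xi_mul_Kbar_mul, mul_neg, ← mul_assoc, (commute_one_add_cen (Kbar n)).eq,
        mul_assoc,
      ha, mul_zero, neg_zero]
  | hx j a ha =>
    rw [mul_assoc, ← mul_assoc (xi i), xi_mul_xi, neg_mul, mul_neg, mul_assoc (xi j), ← mul_assoc,
      (commute_one_add_cen (xi j)).eq, mul_assoc, ha, mul_zero, neg_zero]
  | hxb j a ha =>
    have h : (1 + cen n) * (xi i * xibar j) = -(xibar j * ((1 + cen n) * xi i)) := by
      have := xi_mul_one_add_cen_mul_wordBar i {j}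
      have hj : wordBar {j} = xibar j := by
        rw [← insert_empty_eq, wordBar_insert_max (by simp), wordBar_empty, one_mul]
      rw [hj, Finset.card_singleton, pow_one, neg_one_smul, ← mul_assoc,
        ← (commute_one_add_cen (xi i)).eq, mul_assoc] at this
      rw [this, ← mul_assoc, (commute_one_add_cen (xibar j)).eq]
    rw [mul_assoc, ← mul_assoc (xi i), ← mul_assoc (1 + cen n), h, neg_mul, mul_assoc, mul_assoc,
        ha,
      mul_zero, neg_zero]

/-- A functional that behaves like a character: it vanishes on commutators and on the nilpotent ideal
that the `ξᵢ` and `ξ̄ᵢ` generate modulo `1 - K K̄`. -/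
structure IsTraceLike (T : Module.Dual ℂ (NicholsDouble n)) : Prop where
  mul_comm : ∀ x y, T (x * y) = T (y * x)
  xi : ∀ i x, T ((1 + cen n) * (xi i * x)) = 0
  xibar : ∀ i x, T ((1 + cen n) * (xibar i * x)) = 0

theorem IsTraceLike.add {T T' : Module.Dual ℂ (NicholsDouble n)} (h : IsTraceLike T)
    (h' : IsTraceLike T') : IsTraceLike (T + T') where
  mul_comm x y := by rw [LinearMap.add_apply, LinearMap.add_apply, h.mul_comm, h'.mul_comm]
  xi i x := by rw [LinearMap.add_apply, h.xi, h'.xi, add_zero]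
  xibar i x := by rw [LinearMap.add_apply, h.xibar, h'.xibar, add_zero]

theorem IsTraceLike.smul {T : Module.Dual ℂ (NicholsDouble n)} (h : IsTraceLike T) (r : ℂ) :
    IsTraceLike (r • T) where
  mul_comm x y := by rw [LinearMap.smul_apply, LinearMap.smul_apply, h.mul_comm]
  xi i x := by rw [LinearMap.smul_apply, h.xi, smul_zero]
  xibar i x := by rw [LinearMap.smul_apply, h.xibar, smul_zero]

theorem IsTraceLike.sub {T T' : Module.Dual ℂ (NicholsDouble n)} (h : IsTraceLike T)
    (h' : IsTraceLike T') : IsTraceLike (T - T') where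
  mul_comm x y := by rw [LinearMap.sub_apply, LinearMap.sub_apply, h.mul_comm, h'.mul_comm]
  xi i x := by rw [LinearMap.sub_apply, h.xi, h'.xi, sub_zero]
  xibar i x := by rw [LinearMap.sub_apply, h.xibar, h'.xibar, sub_zero]

theorem sq_eq_zero_xi (i : Fin n) (x : NicholsDouble n) :
    ((1 + cen n) * (xi i * x)) * ((1 + cen n) * (xi i * x)) = 0 := by
  rw [mul_assoc, (commute_one_add_cen (xi i * x)).eq, ← mul_assoc (xi i * x),
      ← mul_assoc (1 + cen n),
    ← mul_assoc (xi i * x), mul_assoc (xi i) x (xi i), ← mul_assoc (1 + cen n),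
    one_add_cen_mul_xi_mul_xi, zero_mul, zero_mul]

theorem sq_eq_zero_xibar (i : Fin n) (x : NicholsDouble n) :
    ((1 + cen n) * (xibar i * x)) * ((1 + cen n) * (xibar i * x)) = 0 := by
  have h := congrArg (swap n) (sq_eq_zero_xi i (swap n x))
  simpa [swap_cen, swap_swap] using h

theorem trace_eq_zero_of_mul_self {W : Type*} [AddCommGroup W] [Module ℂ W] {f : Module.End ℂ W}
    (h : f * f = 0) : LinearMap.trace ℂ W f = 0 :=
  (LinearMap.isNilpotent_trace_of_isNilpotent ⟨2, by rw [pow_two, h]⟩).eq_zero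

theorem isTraceLike_trace {W : Type*} [AddCommGroup W] [Module ℂ W]
    (φ : NicholsDouble n →ₐ[ℂ] Module.End ℂ W) :
    IsTraceLike (LinearMap.trace ℂ W ∘ₗ φ.toLinearMap) where
  mul_comm x y := by
    simp only [LinearMap.comp_apply, AlgHom.toLinearMap_apply, map_mul]
    rw [LinearMap.trace_mul_comm]
  xi i x := trace_eq_zero_of_mul_self (by
    rw [AlgHom.toLinearMap_apply, ← map_mul, sq_eq_zero_xi, map_zero])
  xibar i x := trace_eq_zero_of_mul_self (by
    rw [AlgHom.toLinearMap_apply, ← map_mul, sq_eq_zero_xibar, map_zero])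

theorem isTraceLike_character {V : Type*} [AddCommGroup V] [Module ℂ V] [Module (NicholsDouble n) V]
    [IsScalarTower ℂ (NicholsDouble n) V] : IsTraceLike (character (n := n) V) :=
  isTraceLike_trace _

theorem character_apply {V : Type*} [AddCommGroup V] [Module ℂ V] [Module (NicholsDouble n) V]
    [IsScalarTower ℂ (NicholsDouble n) V] (x : NicholsDouble n) :
    character V x = LinearMap.trace ℂ V (Algebra.lsmul ℂ ℂ V x) := rfl

theorem idem_one_add_idem_KKbar : idem n .one + idem n .KKbar = (1 / 2 : ℂ) • (1 + cen n) := by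
  rw [idem, idem, ← smul_add, cen]
  have : (1 + K n + Kbar n + K n * Kbar n) + (1 - K n - Kbar n + K n * Kbar n) =
      (2 : ℂ) • (1 + K n * Kbar n) := by rw [two_smul]; abel
  rw [this, smul_smul]
  norm_num

theorem idem_one_sub_idem_KKbar : idem n .one - idem n .KKbar = (1 / 2 : ℂ) • (K n + Kbar n) := by
  rw [idem, idem, ← smul_sub]
  have : (1 + K n + Kbar n + K n * Kbar n) - (1 - K n - Kbar n + K n * Kbar n) =
      (2 : ℂ) • (K n + Kbar n) := by rw [two_smul]; abel
  rw [this, smul_smul]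
  norm_num

/-- A trace functional is determined by its values at the four primitive idempotents. -/
theorem IsTraceLike.eq_zero {T : Module.Dual ℂ (NicholsDouble n)} (hT : IsTraceLike T)
    (h : ∀ σ, T (idem n σ) = 0) : T = 0 := by
  have hplus : ∀ x, T ((1 + cen n) * x) = 0 ∧ T ((1 + cen n) * (K n * x)) = 0 := by
    intro x
    induction x using induction_left with
    | h1 =>
      have h1 := congrArg T (idem_one_add_idem_KKbar (n := n))
      have h2 := congrArg T (idem_one_sub_idem_KKbar (n := n))
      rw [map_add, h, h, add_zero, map_smul] at h1
      rw [map_sub, h, h, sub_zero, map_smul, K_add_Kbar_eq] at h2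
      rw [mul_one, mul_one]
      exact ⟨(smul_eq_zero.1 h1.symm).resolve_left (by norm_num),
        (smul_eq_zero.1 h2.symm).resolve_left (by norm_num)⟩
    | hadd a b ha hb =>
      rw [mul_add, mul_add, mul_add, map_add, map_add, ha.1, ha.2, hb.1, hb.2]
      simp
    | hsmul r a ha =>
      rw [mul_smul_comm, mul_smul_comm, mul_smul_comm, map_smul, map_smul, ha.1, ha.2]
      simp
    | hK a ha => exact ⟨ha.2, by rw [K_mul_K_mul]; exact ha.1⟩
    | hKb a ha =>
      have h1 : ∀ b : NicholsDouble n, (1 + cen n) * (Kbar n * b) = (1 + cen n) * (K n * b) := by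
        intro b
        rw [← K_mul_cen, mul_assoc, mul_cen_mul, ← mul_assoc (1 + cen n) (cen n), add_mul 1,
          one_mul, cen_mul_cen, add_comm]
      rw [← Kbar_mul_K_mul, h1, h1, K_mul_K_mul]
      exact ⟨ha.2, ha.1⟩
    | hx i a ha => exact ⟨hT.xi i a, by
        rw [← mul_assoc (K n), K_mul_xi, neg_mul, mul_neg, map_neg, mul_assoc, hT.xi, neg_zero]⟩
    | hxb i a ha => exact ⟨hT.xibar i a, by
        rw [← mul_assoc (K n), K_mul_xibar, neg_mul, mul_neg, map_neg, mul_assoc, hT.xibar,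
            neg_zero]⟩
  -- the elements `a` with `T (a x) = 0` for all `x` form a two-sided ideal
  let 𝓘 : Submodule ℂ (NicholsDouble n) :=
    { carrier := {a | ∀ x, T (a * x) = 0}
      zero_mem' := fun x => by rw [zero_mul, map_zero]
      add_mem' := fun {a b} ha hb x => by rw [add_mul, map_add, ha, hb, add_zero]
      smul_mem' := fun r a ha x => by rw [smul_mul_assoc, map_smul, ha, smul_zero] }
  have hr : ∀ a, ∀ x ∈ 𝓘, x * a ∈ 𝓘 := fun a x hx y => by rw [mul_assoc]; exact hx _
  have hl : ∀ a, ∀ x ∈ 𝓘, a * x ∈ 𝓘 := fun a x hx y => by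
    rw [mul_assoc, hT.mul_comm, mul_assoc]; exact hx _
  have he : ∀ {σ : Label}, ¬σ.IsSmall → idem n σ ∈ 𝓘 := by
    intro σ hσ x
    obtain ⟨r, hr⟩ := exists_idem_mul_mul_idem hσ x
    rw [← (isIdempotentElem_idem σ).eq, mul_assoc, hT.mul_comm, hr, map_smul, h, smul_zero]
  have h1 : (1 - cen n) * top n ∈ 𝓘 := by
    have h2 := 𝓘.add_mem (he not_isSmall_K) (he not_isSmall_Kbar)
    rw [idem_of_not_small not_isSmall_K, idem_of_not_small not_isSmall_Kbar, ← smul_add, ← add_mul,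
      gpart_K_add_gpart_Kbar, smul_mul_assoc, smul_smul] at h2
    refine (𝓘.smul_mem_iff ?_).1 h2
    exact mul_ne_zero (div_ne_zero (pow_ne_zero _ (by norm_num)) (pow_ne_zero _ two_ne_zero))
      two_ne_zero
  have h3 : ∀ x, T ((1 - cen n) * x) = 0 := one_sub_cen_mem_of_top_mem 𝓘 hl hr h1
  ext x
  have h4 := (hplus x).1
  have h5 := h3 x
  rw [add_mul, one_mul, map_add] at h4
  rw [sub_mul, one_mul, map_sub] at h5
  rw [LinearMap.zero_apply]
  linear_combination (h4 + h5) / 2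

theorem IsTraceLike.ext {T T' : Module.Dual ℂ (NicholsDouble n)} (hT : IsTraceLike T)
    (hT' : IsTraceLike T') (h : ∀ σ, T (idem n σ) = T' (idem n σ)) : T = T' :=
  sub_eq_zero.1 ((hT.sub hT').eq_zero fun σ => by rw [LinearMap.sub_apply, h, sub_self])

/-! ### The traces of `z ↦ y z x` -/

/-- The trace of `z ↦ y z x` on the double. -/
def biTrace (n : ℕ) : NicholsDouble n →ₗ[ℂ] Module.Dual ℂ (NicholsDouble n) :=
  LinearMap.mk₂ ℂ (fun x y => LinearMap.trace ℂ _ (LinearMap.mulLeft ℂ y ∘ₗ LinearMap.mulRight ℂ x))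
    (fun x x' y => by rw [← map_add, ← LinearMap.comp_add]; congr 2; ext; simp [mul_add])
    (fun r x y => by rw [← map_smul, ← LinearMap.comp_smul]; congr 2; ext; simp)
    (fun x y y' => by rw [← map_add, ← LinearMap.add_comp]; congr 2; ext; simp [add_mul])
    (fun r x y => by rw [← map_smul, ← LinearMap.smul_comp]; congr 2; ext; simp)

theorem biTrace_apply (x y : NicholsDouble n) : biTrace n x y =
    LinearMap.trace ℂ _ (LinearMap.mulLeft ℂ y * LinearMap.mulRight ℂ x) := rfl

theorem isTraceLike_biTrace (x : NicholsDouble n) : IsTraceLike (biTrace n x) where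
  mul_comm a b := by
    have h1 : LinearMap.mulLeft ℂ (a * b) * LinearMap.mulRight ℂ x =
        LinearMap.mulLeft ℂ a * (LinearMap.mulLeft ℂ b * LinearMap.mulRight ℂ x) := by
      ext z; simp
    have h2 : LinearMap.mulLeft ℂ (b * a) * LinearMap.mulRight ℂ x =
        LinearMap.mulLeft ℂ b * LinearMap.mulRight ℂ x * LinearMap.mulLeft ℂ a := by
      ext z; simp [mul_assoc]
    rw [biTrace_apply, biTrace_apply, h1, h2, LinearMap.trace_mul_comm]
  xi i a := trace_eq_zero_of_mul_self (by
    ext z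
    have h := sq_eq_zero_xi i a
    simp only [Module.End.mul_apply, LinearMap.comp_apply, LinearMap.mulLeft_apply,
      LinearMap.mulRight_apply, LinearMap.zero_apply] at *
    rw [mul_assoc _ (z * x) x, ← mul_assoc, h, zero_mul])
  xibar i a := trace_eq_zero_of_mul_self (by
    ext z
    have h := sq_eq_zero_xibar i a
    simp only [Module.End.mul_apply, LinearMap.comp_apply, LinearMap.mulLeft_apply,
      LinearMap.mulRight_apply, LinearMap.zero_apply] at *
    rw [mul_assoc _ (z * x) x, ← mul_assoc, h, zero_mul])

theorem isTraceLike_biTrace_flip (y : NicholsDouble n) : IsTraceLike ((biTrace n).flip y) where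
  mul_comm a b := by
    have h1 : LinearMap.mulLeft ℂ y * LinearMap.mulRight ℂ (a * b) =
        LinearMap.mulLeft ℂ y * LinearMap.mulRight ℂ b * LinearMap.mulRight ℂ a := by
      ext z; simp [mul_assoc]
    have h2 : LinearMap.mulLeft ℂ y * LinearMap.mulRight ℂ (b * a) =
        LinearMap.mulRight ℂ a * (LinearMap.mulLeft ℂ y * LinearMap.mulRight ℂ b) := by
      ext z; simp [mul_assoc]
    rw [LinearMap.flip_apply, LinearMap.flip_apply, biTrace_apply, biTrace_apply, h1, h2,
      LinearMap.trace_mul_comm]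
  xi i a := trace_eq_zero_of_mul_self (by
    ext z
    have h := sq_eq_zero_xi i a
    simp only [Module.End.mul_apply, LinearMap.comp_apply, LinearMap.mulLeft_apply,
      LinearMap.mulRight_apply, LinearMap.zero_apply] at *
    rw [mul_assoc y (z * _), mul_assoc z, h, mul_zero, mul_zero, mul_zero])
  xibar i a := trace_eq_zero_of_mul_self (by
    ext z
    have h := sq_eq_zero_xibar i a
    simp only [Module.End.mul_apply, LinearMap.comp_apply, LinearMap.mulLeft_apply,
      LinearMap.mulRight_apply, LinearMap.zero_apply] at *
    rw [mul_assoc y (z * _), mul_assoc z, h, mul_zero, mul_zero, mul_zero])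

/-- The character of `D e` is the trace of `z ↦ y z e` on the whole algebra, as `z ↦ z e` is a
projection onto `D e`. -/
theorem projChar_eq_biTrace (σ : Label) : projChar n σ = biTrace n (idem n σ) := by
  ext y
  let p : Submodule ℂ (NicholsDouble n) := (ProjMod n σ).restrictScalars ℂ
  let f : Module.End ℂ (NicholsDouble n) := LinearMap.mulLeft ℂ y * LinearMap.mulRight ℂ (idem n σ)
  have hf : ∀ x, f x ∈ p := fun x => Ideal.mem_span_singleton'.2 ⟨y * x, by simp [f, mul_assoc]⟩
  have h := LinearMap.trace_restrict_eq_of_forall_mem p f hf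
  rw [biTrace_apply]
  refine Eq.trans ?_ h
  change LinearMap.trace ℂ p _ = _
  congr 1
  ext ⟨z, hz⟩
  obtain ⟨w, rfl⟩ := Ideal.mem_span_singleton'.1 hz
  change y * (w * idem n σ) = y * (w * idem n σ * idem n σ)
  rw [mul_assoc w, (isIdempotentElem_idem σ).eq]

theorem isTraceLike_projChar (σ : Label) : IsTraceLike (projChar n σ) := isTraceLike_character

theorem trace_eq_one_of_forall_mem_span {W : Type*} [AddCommGroup W] [Module ℂ W]
    [Module.Finite ℂ W] {f : Module.End ℂ W} {u : W} (hu : u ≠ 0) (hfu : f u = u)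
    (hf : ∀ x, ∃ r : ℂ, f x = r • u) : LinearMap.trace ℂ W f = 1 := by
  have hf' : ∀ x, f x ∈ Submodule.span ℂ {u} := fun x => by
    obtain ⟨r, hr⟩ := hf x
    exact Submodule.mem_span_singleton.2 ⟨r, hr.symm⟩
  have h := LinearMap.trace_restrict_eq_of_forall_mem (Submodule.span ℂ {u}) f hf'
  rw [← h]
  have h2 : f.restrict (fun x _ => hf' x) = (LinearMap.id : Module.End ℂ (Submodule.span ℂ {u})) :=
      by
    ext ⟨x, hx⟩
    obtain ⟨r, rfl⟩ := Submodule.mem_span_singleton.1 hx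
    rw [LinearMap.restrict_apply, LinearMap.id_apply]
    simp [hfu]
  rw [h2, LinearMap.trace_id, finrank_span_singleton hu, Nat.cast_one]

/-- The character of `V_σ` is dual to the primitive idempotents. -/
theorem character_simpleMod_idem (σ τ : Label) [Decidable (τ = σ)] :
    character (SimpleMod n σ) (idem n τ) = if τ = σ then 1 else 0 := by
  split_ifs with h
  · subst h
    rw [character_apply]
    refine trace_eq_one_of_forall_mem_span (u := vac n τ) (vac_ne_zero τ) ?_ fun m => ?_
    · rw [Algebra.lsmul_coe]
      exact (idem_smul_vac τ τ).trans (if_pos rfl)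
    · rw [Algebra.lsmul_coe]
      exact exists_idem_smul τ m
  · have : Algebra.lsmul ℂ ℂ (SimpleMod n σ) (idem n τ) = 0 := by
      refine LinearMap.ext fun m => ?_
      rw [Algebra.lsmul_coe]
      exact idem_smul_of_ne h m
    rw [character_apply, this, map_zero]

theorem projChar_idem_self {σ : Label} (h : ¬σ.IsSmall) : projChar n σ (idem n σ) = 1 := by
  rw [projChar_eq_biTrace, biTrace_apply]
  refine trace_eq_one_of_forall_mem_span (idem_ne_zero σ) ?_ fun x => ?_
  · simp [(isIdempotentElem_idem σ).eq]
  · obtain ⟨r, hr⟩ := exists_idem_mul_mul_idem h x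
    exact ⟨r, by rw [← hr]; simp [mul_assoc]⟩

theorem projChar_idem_of_ne {σ τ : Label} (h : ¬σ.IsSmall) (hne : τ ≠ σ) :
    projChar n σ (idem n τ) = 0 := by
  rw [projChar_eq_biTrace, biTrace_apply]
  have : LinearMap.mulLeft ℂ (idem n τ) * LinearMap.mulRight ℂ (idem n σ) = 0 := by
    ext z
    simp only [Module.End.mul_apply, LinearMap.mulLeft_apply, LinearMap.mulRight_apply,
      LinearMap.zero_apply]
    by_cases hτ : τ.IsSmall
    · have h1 : idem n τ * (z * idem n σ) = -(idem n τ * (z * idem n σ)) := by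
        nth_rw 1 [← one_smul ℂ (idem n τ)]
        rw [← Label.signK_mul_signKbar_of_small hτ, ← cen_mul_idem, mul_assoc, ← mul_cen_mul,
          ← mul_cen_mul, cen_mul_idem_of_not_small h, mul_neg, mul_neg]
      exact eq_zero_of_eq_neg h1
    · induction z using induction_bar_hop with
      | h x y =>
        obtain ⟨r, hr⟩ := exists_idem_mul_bar hτ x
        obtain ⟨s, hs⟩ := exists_hop_mul_idem h y
        rw [mul_assoc, hs, ← mul_assoc, hr, mul_smul_comm, smul_mul_assoc, idem_mul_idem hne,
          smul_zero, smul_zero]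
      | hadd a b ha hb => rw [add_mul, mul_add, ha, hb, add_zero]
  rw [this, map_zero]

/-- The simple modules `V_K` and `V_K̄` are projective. -/
theorem character_simpleMod_eq_projChar {σ : Label} (h : ¬σ.IsSmall) :
    character (SimpleMod n σ) = projChar n σ := by
  classical
  refine isTraceLike_character.ext isTraceLike_character fun τ => ?_
  rw [character_simpleMod_idem]
  split_ifs with hτ
  · rw [hτ, projChar_idem_self h]
  · rw [projChar_idem_of_ne h hτ]

end NicholsDouble

end

noncomputable section

namespace Nichols

variable {n : ℕ}

/-! ### Traces on the Nichols algebra -/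

theorem trace_eq_sum (f : Module.End ℂ (Nichols n)) :
    LinearMap.trace ℂ _ f = ∑ b, (basis n).coord b (f (basis n b)) := by
  rw [LinearMap.trace_eq_matrix_trace ℂ (basis n), Matrix.trace]
  refine Finset.sum_congr rfl fun b _ => ?_
  rw [Matrix.diag_apply, LinearMap.toMatrix_apply]
  rfl

theorem trace_mulLeft_K : LinearMap.trace ℂ _ (LinearMap.mulLeft ℂ (K n)) = 0 := by
  rw [trace_eq_sum]
  refine Finset.sum_eq_zero fun b _ => ?_
  obtain ⟨a, I⟩ := b
  rw [LinearMap.mulLeft_apply]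
  fin_cases a
  · have : basis n (0, I) = word I := basis_zero I
    change (basis n).coord (0, I) (K n * basis n (0, I)) = 0
    rw [this, coord_K_mul_word, if_neg (by simp)]
  · have : basis n (1, I) = K n * word I := basis_one I
    change (basis n).coord (1, I) (K n * basis n (1, I)) = 0
    rw [this, K_mul_K_mul, coord_word, if_neg (by simp)]

theorem trace_mulRight_K : LinearMap.trace ℂ _ (LinearMap.mulRight ℂ (K n)) = 0 := by
  rw [trace_eq_sum]
  refine Finset.sum_eq_zero fun b _ => ?_
  obtain ⟨a, I⟩ := b
  rw [LinearMap.mulRight_apply]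
  fin_cases a
  · have : basis n (0, I) = word I := basis_zero I
    change (basis n).coord (0, I) (basis n (0, I) * K n) = 0
    rw [this, word_mul_K, map_smul, coord_K_mul_word, if_neg (by simp), smul_zero]
  · have : basis n (1, I) = K n * word I := basis_one I
    change (basis n).coord (1, I) (basis n (1, I) * K n) = 0
    rw [this, mul_assoc, word_mul_K, mul_smul_comm, K_mul_K_mul, map_smul, coord_word,
      if_neg (by simp), smul_zero]

theorem trace_conj_K (hn : 0 < n) :
    LinearMap.trace ℂ _ (LinearMap.mulLeft ℂ (K n) * LinearMap.mulRight ℂ (K n)) = 0 := by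
  have h : ∀ b : Fin 2 × Finset (Fin n), (basis n).coord b
      ((LinearMap.mulLeft ℂ (K n) * LinearMap.mulRight ℂ (K n)) (basis n b)) =
        (-1 : ℂ) ^ b.2.card := by
    rintro ⟨a, I⟩
    rw [Module.End.mul_apply, LinearMap.mulLeft_apply, LinearMap.mulRight_apply]
    fin_cases a
    · have : basis n (0, I) = word I := basis_zero I
      change (basis n).coord (0, I) (K n * (basis n (0, I) * K n)) = _
      rw [this, word_mul_K, mul_smul_comm, K_mul_K_mul, map_smul, coord_word, if_pos rfl,
        smul_eq_mul, mul_one]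
    · have : basis n (1, I) = K n * word I := basis_one I
      change (basis n).coord (1, I) (K n * (basis n (1, I) * K n)) = _
      rw [this, mul_assoc (K n) (word I), word_mul_K, mul_smul_comm, mul_smul_comm, K_mul_K_mul,
        map_smul, coord_K_mul_word, if_pos rfl, smul_eq_mul, mul_one]
  rw [trace_eq_sum, Finset.sum_congr rfl fun b _ => h b, Fintype.sum_prod_type]
  have hs := Fin.sum_pow_mul_eq_add_pow (n := n) (-1 : ℂ) 1
  simp only [one_pow, mul_one, neg_add_cancel, zero_pow hn.ne'] at hs
  simp [hs]

theorem finrank_eq : Module.finrank ℂ (Nichols n) = 2 * 2 ^ n := by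
  rw [Module.finrank_eq_card_basis (basis n)]
  simp

end Nichols

namespace NicholsDouble

variable {n : ℕ}

theorem trace_eq_mul_of_normalForm {f : Module.End ℂ (NicholsDouble n)}
    (u v : Module.End ℂ (Nichols n))
    (h : ∀ x y, f (bar n x * hop n y) = bar n (u x) * hop n (v y)) :
    LinearMap.trace ℂ _ f = LinearMap.trace ℂ _ u * LinearMap.trace ℂ _ v := by
  rw [← LinearMap.trace_tensorProduct', ← LinearMap.trace_conj' _ (normalForm n)]
  congr 1
  refine lin_ext fun x y => ?_
  rw [h, LinearEquiv.conj_apply_apply, normalForm_symm_mul, TensorProduct.map_tmul, normalForm_tmul]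

theorem biTrace_one_one : biTrace n 1 1 = 4 ^ (n + 1) := by
  rw [biTrace_apply, trace_eq_mul_of_normalForm 1 1 (fun x y => by simp), LinearMap.trace_one,
    Nichols.finrank_eq]
  push_cast
  rw [show (4 : ℂ) = 2 ^ 2 by norm_num, ← pow_mul]
  ring

theorem K_mul_bar (x : Nichols n) : K n * bar n x = bar n
    (Nichols.K n * x * Nichols.K n) * K n := by
  induction x using Nichols.induction_left with
  | h1 => rw [map_one, mul_one, mul_one, Nichols.K_mul_K, map_one, one_mul]
  | hadd a b ha hb => rw [map_add, mul_add, ha, hb, mul_add, add_mul, map_add, add_mul]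
  | hsmul r a ha =>
    rw [map_smul, mul_smul_comm, ha, mul_smul_comm, smul_mul_assoc, map_smul, smul_mul_assoc]
  | hK a ha =>
    rw [map_mul, bar_K, ← mul_assoc, K_mul_Kbar, mul_assoc, ha, ← mul_assoc, ← bar_K, ← map_mul]
    simp only [mul_assoc]
  | hx i a ha =>
    rw [map_mul, bar_xi, ← mul_assoc, K_mul_xibar, neg_mul, mul_assoc, ha, ← mul_assoc, ← bar_xi,
      ← map_mul, ← neg_mul, ← map_neg, ← mul_assoc (Nichols.K n) (Nichols.xi i), Nichols.K_mul_xi]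
    simp only [mul_assoc, neg_mul]


/-! ### Cartan numbers -/

theorem isSmall_one : Label.one.IsSmall := rfl

theorem isSmall_KKbar : Label.KKbar.IsSmall := rfl

theorem biTrace_comm_cen (x y : NicholsDouble n) : biTrace n (cen n * x) y =
    biTrace n x (cen n * y) := by
  rw [biTrace_apply, biTrace_apply]
  congr 1
  ext z
  simp only [Module.End.mul_apply, LinearMap.mulLeft_apply, LinearMap.mulRight_apply]
  rw [mul_cen_mul, mul_cen_mul, mul_assoc (cen n)]

/-- In the normal form `x̄ y`, left multiplication by `K` conjugates `x` by `K`, and conjugation by `K`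
has trace zero on `𝒦ₙ`. -/
theorem biTrace_hop_K (hn : 0 < n) (w : Nichols n) : biTrace n (hop n w) (K n) = 0 := by
  rw [biTrace_apply, trace_eq_mul_of_normalForm
    (LinearMap.mulLeft ℂ (Nichols.K n) * LinearMap.mulRight ℂ (Nichols.K n))
    (LinearMap.mulLeft ℂ (Nichols.K n) * LinearMap.mulRight ℂ w) (fun x y => ?_),
    Nichols.trace_conj_K hn, zero_mul]
  simp only [Module.End.mul_apply, LinearMap.mulLeft_apply, LinearMap.mulRight_apply, map_mul]
  rw [← mul_assoc, ← mul_assoc, K_mul_bar, mul_assoc (Nichols.K n)]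
  simp only [map_mul, hop_K, bar_K, mul_assoc]

theorem biTrace_hop_Kbar (w : Nichols n) : biTrace n (hop n w) (Kbar n) = 0 := by
  rw [biTrace_apply, trace_eq_mul_of_normalForm (LinearMap.mulLeft ℂ (Nichols.K n))
    (LinearMap.mulRight ℂ w) (fun x y => ?_), Nichols.trace_mulLeft_K, zero_mul]
  simp only [Module.End.mul_apply, LinearMap.mulLeft_apply, LinearMap.mulRight_apply, map_mul,
      bar_K,
    mul_assoc]

theorem biTrace_hop_cen (w : Nichols n) : biTrace n (hop n w) (cen n) = 0 := by
  rw [biTrace_apply, trace_eq_mul_of_normalForm (LinearMap.mulRight ℂ (Nichols.K n))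
    (LinearMap.mulLeft ℂ (Nichols.K n) * LinearMap.mulRight ℂ w) (fun x y => ?_),
    Nichols.trace_mulRight_K, zero_mul]
  simp only [Module.End.mul_apply, LinearMap.mulLeft_apply, LinearMap.mulRight_apply, map_mul,
      bar_K,
    hop_K]
  rw [cen, ← Kbar_mul_K]
  simp only [mul_assoc]
  rw [← mul_assoc (K n), K_mul_bar, map_mul, map_mul, bar_K]
  simp only [mul_assoc, Kbar_mul_Kbar_mul]

theorem biTrace_K_one : biTrace n (K n) 1 = 0 := by
  rw [biTrace_apply, trace_eq_mul_of_normalForm 1 (LinearMap.mulRight ℂ (Nichols.K n))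
    (fun x y => ?_), Nichols.trace_mulRight_K, mul_zero]
  simp only [Module.End.mul_apply, LinearMap.mulLeft_apply, LinearMap.mulRight_apply, map_mul,
      hop_K,
    one_mul, Module.End.one_apply, mul_assoc]

theorem idem_eq_of_small {σ : Label} (h : σ.IsSmall) :
    idem n σ = (1 / 4 : ℂ) • (1 + σ.signK • K n + σ.signK • Kbar n + cen n) := by
  rw [idem_of_small h, gpart, ← h]
  simp only [mul_add, add_mul, one_mul, mul_one, smul_mul_smul_comm, σ.signK_mul_self, one_smul,
      cen]
  congr 1
  abel

theorem idem_eq_one_add_cen_mul {σ : Label} (h : σ.IsSmall) :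
    idem n σ = (1 / 4 : ℂ) • ((1 + cen n) * hop n (1 + σ.signK • Nichols.K n)) := by
  rw [idem_eq_of_small h, map_add, map_one, map_smul, hop_K]
  simp only [mul_add, add_mul, one_mul, mul_one, mul_smul_comm, cen_mul_K, smul_add]
  abel

theorem cen_mul_idem_of_small {σ : Label} (h : σ.IsSmall) : cen n * idem n σ = idem n σ := by
  rw [cen_mul_idem, Label.signK_mul_signKbar_of_small h, one_smul]

theorem biTrace_hop_idem (hn : 0 < n) {τ : Label} (h : τ.IsSmall) (w : Nichols n) :
    biTrace n (hop n w) (idem n τ) = (1 / 4 : ℂ) * biTrace n (hop n w) 1 := by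
  rw [idem_eq_of_small h, map_smul, map_add, map_add, map_add, map_smul, map_smul, biTrace_hop_K hn,
    biTrace_hop_Kbar, biTrace_hop_cen, smul_zero, add_zero, add_zero, add_zero, smul_eq_mul]

/-- The Cartan numbers of the block of the trivial module. -/
theorem projChar_idem_of_small (hn : 0 < n) {σ τ : Label} (hσ : σ.IsSmall) (hτ : τ.IsSmall) :
    projChar n σ (idem n τ) = 2 ^ (2 * n - 1) := by
  have h1 : ∀ x, biTrace n ((1 + cen n) * x) (idem n τ) = 2 * biTrace n x (idem n τ) := by
    intro x
    rw [add_mul, one_mul, map_add, LinearMap.add_apply, biTrace_comm_cen, cen_mul_idem_of_small hτ,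
      two_mul]
  rw [projChar_eq_biTrace, idem_eq_one_add_cen_mul hσ, map_smul, LinearMap.smul_apply, h1,
    biTrace_hop_idem hn hτ, map_add, map_one (hop n), map_add, LinearMap.add_apply,
    biTrace_one_one, map_smul,
    map_smul, LinearMap.smul_apply, hop_K, biTrace_K_one]
  obtain ⟨m, rfl⟩ : ∃ m, n = m + 1 := ⟨n - 1, by omega⟩
  rw [show 2 * (m + 1) - 1 = 2 * m + 1 by omega, pow_succ (2 : ℂ) (2 * m), pow_mul, smul_eq_mul]
  norm_num [pow_succ]
  ring

theorem projChar_idem_of_small_of_not_small {σ τ : Label} (hσ : σ.IsSmall) (hτ : ¬τ.IsSmall) :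
    projChar n σ (idem n τ) = 0 := by
  rw [projChar_eq_biTrace]
  apply eq_zero_of_eq_neg
  nth_rw 1 [← cen_mul_idem_of_small hσ]
  rw [biTrace_comm_cen, cen_mul_idem_of_not_small hτ, map_neg]

theorem projChar_KKbar (hn : 0 < n) : projChar n .KKbar = projChar n .one := by
  refine (isTraceLike_projChar _).ext (isTraceLike_projChar _) fun τ => ?_
  by_cases hτ : τ.IsSmall
  · rw [projChar_idem_of_small hn isSmall_KKbar hτ, projChar_idem_of_small hn isSmall_one hτ]
  · rw [projChar_idem_of_small_of_not_small isSmall_KKbar hτ,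
      projChar_idem_of_small_of_not_small isSmall_one hτ]

/-! ### Expansion of trace functionals in simple characters -/

/-- The expansion of a trace-like functional in the simple characters; for `V_K`, `V_K̄` these are the
projective characters. -/
theorem IsTraceLike.eq_sum {T : Module.Dual ℂ (NicholsDouble n)} (hT : IsTraceLike T) :
    T = T (idem n .one) • character (SimpleMod n .one) +
      T (idem n .KKbar) • character (SimpleMod n .KKbar) +
      T (idem n .K) • projChar n .K + T (idem n .Kbar) • projChar n .Kbar := by
  classical
  rw [← character_simpleMod_eq_projChar not_isSmall_K,
      ← character_simpleMod_eq_projChar not_isSmall_Kbar]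
  refine hT.ext ((((isTraceLike_character.smul _).add (isTraceLike_character.smul _)).add
    (isTraceLike_character.smul _)).add (isTraceLike_character.smul _)) fun τ => ?_
  simp only [LinearMap.add_apply, LinearMap.smul_apply, character_simpleMod_idem]
  cases τ <;> simp

theorem projChar_one_eq (hn : 0 < n) : projChar n .one = (2 ^ (2 * n - 1) : ℂ) •
    (character (SimpleMod n .one) + character (SimpleMod n .KKbar)) := by
  have h := (isTraceLike_projChar (n := n) .one).eq_sum
  rw [projChar_idem_of_small hn isSmall_one isSmall_one,
    projChar_idem_of_small hn isSmall_one isSmall_KKbar,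
    projChar_idem_of_small_of_not_small isSmall_one not_isSmall_K,
    projChar_idem_of_small_of_not_small isSmall_one not_isSmall_Kbar, zero_smul, zero_smul,
    add_zero, add_zero,
    ← smul_add] at h
  exact h

theorem isTraceLike_algHom (α : NicholsDouble n →ₐ[ℂ] ℂ) : IsTraceLike α.toLinearMap where
  mul_comm x y := by
    rw [AlgHom.toLinearMap_apply, AlgHom.toLinearMap_apply, map_mul, map_mul, mul_comm]
  xi i x := by
    have h : α (xi i) = 0 := mul_self_eq_zero.1 (by rw [← map_mul, xi_mul_self, map_zero])
    rw [AlgHom.toLinearMap_apply, map_mul, map_mul, h, zero_mul, mul_zero]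
  xibar i x := by
    have h : α (xibar i) = 0 := mul_self_eq_zero.1 (by rw [← map_mul, xibar_mul_self, map_zero])
    rw [AlgHom.toLinearMap_apply, map_mul, map_mul, h, zero_mul, mul_zero]

theorem character_simpleMod_eq_algHom {σ : Label} (h : σ.IsSmall) (α : NicholsDouble n →ₐ[ℂ] ℂ)
    (hK : α (K n) = σ.signK) (hKb : α (Kbar n) = σ.signKbar) :
    character (SimpleMod n σ) = α.toLinearMap := by
  classical
  refine isTraceLike_character.ext (isTraceLike_algHom α) fun τ => ?_
  rw [character_simpleMod_idem, AlgHom.toLinearMap_apply]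
  split_ifs with hτ
  · rw [hτ, idem_of_small h, gpart]
    simp only [map_smul, map_mul, map_add, map_one, hK, hKb, smul_eq_mul, σ.signK_mul_self,
      σ.signKbar_mul_self]
    norm_num
  · have h1 := congrArg α (K_mul_idem (n := n) τ)
    have h2 := congrArg α (Kbar_mul_idem (n := n) τ)
    rw [map_mul, map_smul, hK, smul_eq_mul] at h1
    rw [map_mul, map_smul, hKb, smul_eq_mul] at h2
    by_contra hne
    have h3 := mul_right_cancel₀ (Ne.symm hne) h1
    have h4 := mul_right_cancel₀ (Ne.symm hne) h2
    revert h3 h4 hτ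
    cases σ <;> cases τ <;> simp [Label.signK, Label.signKbar] <;> norm_num

/-- The one-dimensional representation `V_{K K̄}` as an algebra map. -/
def signHom (n : ℕ) : NicholsDouble n →ₐ[ℂ] ℂ :=
  lift (Nichols.kbar n) (Nichols.kbar n) (by simp) (by simp [Nichols.kbar]) (by simp [Nichols.kbar])
    (fun i j => by simp [Nichols.kbar])

theorem signHom_K : signHom n (K n) = -1 := by
  rw [← hop_K, signHom, lift_hop]; simp [Nichols.kbar]

theorem signHom_Kbar : signHom n (Kbar n) = -1 := by
  rw [← bar_K, signHom, lift_bar]; simp [Nichols.kbar]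

theorem signHom_xi (i : Fin n) : signHom n (xi i) = 0 := by
  rw [← hop_xi, signHom, lift_hop]; simp [Nichols.kbar]

theorem signHom_xibar (i : Fin n) : signHom n (xibar i) = 0 := by
  rw [← bar_xi, signHom, lift_bar]; simp [Nichols.kbar]

theorem character_KKbar : character (SimpleMod n .KKbar) = (signHom n).toLinearMap :=
  character_simpleMod_eq_algHom isSmall_KKbar _ signHom_K signHom_Kbar

theorem counitHom_K : counitHom n (K n) = 1 := by
  rw [← hop_K, counitHom, lift_hop]; simp

theorem counitHom_Kbar : counitHom n (Kbar n) = 1 := by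
  rw [← bar_K, counitHom, lift_bar]; simp

theorem counitHom_xi (i : Fin n) : counitHom n (xi i) = 0 := by
  rw [← hop_xi, counitHom, lift_hop]; simp

theorem counitHom_xibar (i : Fin n) : counitHom n (xibar i) = 0 := by
  rw [← bar_xi, counitHom, lift_bar]; simp

theorem character_one : character (SimpleMod n .one) = (counitHom n).toLinearMap :=
  character_simpleMod_eq_algHom isSmall_one _ counitHom_K counitHom_Kbar

/-! ### Products of characters -/

theorem charMul_apply (χ ψ : Module.Dual ℂ (NicholsDouble n)) (x : NicholsDouble n) :
    charMul χ ψ x = TensorProduct.dualDistrib ℂ _ _ (χ ⊗ₜ ψ) (comulHom n x) := by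
  rw [charMul, comulD_eq]; rfl

theorem charMul_add_right (χ ψ ψ' : Module.Dual ℂ (NicholsDouble n)) :
    charMul χ (ψ + ψ') = charMul χ ψ + charMul χ ψ' := by
  rw [charMul, TensorProduct.tmul_add, map_add, LinearMap.add_comp]; rfl

theorem charMul_smul_right (r : ℂ) (χ ψ : Module.Dual ℂ (NicholsDouble n)) :
    charMul χ (r • ψ) = r • charMul χ ψ := by
  rw [charMul, TensorProduct.tmul_smul, map_smul, LinearMap.smul_comp]; rfl

/-- `(α ⊗ id) ∘ Δ`. -/
def translateLeft (α : NicholsDouble n →ₐ[ℂ] ℂ) : NicholsDouble n →ₐ[ℂ] NicholsDouble n :=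
  ((Algebra.TensorProduct.lid ℂ (NicholsDouble n)).toAlgHom.comp
    (Algebra.TensorProduct.map α (AlgHom.id ℂ _))).comp (comulHom n)

/-- `(id ⊗ α) ∘ Δ`. -/
def translateRight (α : NicholsDouble n →ₐ[ℂ] ℂ) : NicholsDouble n →ₐ[ℂ] NicholsDouble n :=
  ((Algebra.TensorProduct.rid ℂ ℂ (NicholsDouble n)).toAlgHom.comp
    (Algebra.TensorProduct.map (AlgHom.id ℂ _) α)).comp (comulHom n)

theorem charMul_algHom_left (α : NicholsDouble n →ₐ[ℂ] ℂ) (ψ : Module.Dual ℂ (NicholsDouble n)) :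
    charMul α.toLinearMap ψ = ψ ∘ₗ (translateLeft α).toLinearMap := by
  ext x
  rw [charMul_apply, LinearMap.comp_apply, AlgHom.toLinearMap_apply, translateLeft,
      AlgHom.comp_apply]
  induction comulHom n x with
  | zero => simp
  | add s t hs ht => rw [map_add, map_add, map_add, hs, ht]
  | tmul s t => simp

theorem charMul_algHom_right (α : NicholsDouble n →ₐ[ℂ] ℂ) (ψ : Module.Dual ℂ (NicholsDouble n)) :
    charMul ψ α.toLinearMap = ψ ∘ₗ (translateRight α).toLinearMap := by
  ext x
  rw [charMul_apply, LinearMap.comp_apply, AlgHom.toLinearMap_apply, translateRight,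
      AlgHom.comp_apply]
  induction comulHom n x with
  | zero => simp
  | add s t hs ht => rw [map_add, map_add, map_add, hs, ht]
  | tmul s t => simp [mul_comm]

theorem translateLeft_counitHom : translateLeft (counitHom n) = AlgHom.id ℂ _ :=
  algHom_ext (by simp [translateLeft, comulHom_K, counitHom_K])
    (by simp [translateLeft, comulHom_Kbar, counitHom_Kbar])
    (fun i => by simp [translateLeft, comulHom_xi, counitHom_xi, counitHom_K])
    (fun i => by simp [translateLeft, comulHom_xibar, counitHom_xibar, counitHom_Kbar])

theorem translateRight_counitHom : translateRight (counitHom n) = AlgHom.id ℂ _ :=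
  algHom_ext (by simp [translateRight, comulHom_K, counitHom_K])
    (by simp [translateRight, comulHom_Kbar, counitHom_Kbar])
    (fun i => by simp [translateRight, comulHom_xi, counitHom_xi])
    (fun i => by simp [translateRight, comulHom_xibar, counitHom_xibar])

/-- Tensoring with `V_{K K̄}` exchanges `V₁` with `V_{K K̄}` and `V_K` with `V_K̄`. -/
def Label.flip : Label → Label
  | .one => .KKbar
  | .KKbar => .one
  | .K => .Kbar
  | .Kbar => .K

theorem orderedProd_smul {A : Type*} [Ring A] [Algebra ℂ A] (s : ℂ) (x : Fin n → A)
    (I : Finset (Fin n)) : orderedProd (fun i => s • x i) I = s ^ I.card • orderedProd x I := by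
  induction I using Finset.induction_on_max with
  | empty => simp [orderedProd_empty]
  | insert i I hi ih =>
    rw [orderedProd_insert_max _ hi, orderedProd_insert_max _ hi, ih,
      Finset.card_insert_of_notMem fun h => lt_irrefl _ (hi i h), smul_mul_smul_comm, pow_succ]

theorem map_idem_flip (f : NicholsDouble n →ₐ[ℂ] NicholsDouble n) {s : ℂ} (hs : s * s = 1)
    (hK : f (K n) = -K n) (hKb : f (Kbar n) = -Kbar n) (hx : ∀ i, f (xi i) = s • xi i)
    (hxb : ∀ i, f (xibar i) = s • xibar i) (σ : Label) : f (idem n σ) = idem n σ.flip := by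
  have ht : f (top n) = top n := by
    rw [top, map_mul, word, wordBar, map_orderedProd, map_orderedProd,
      show (fun i => f (xi i)) = fun i => s • xi i from funext hx,
      show (fun i => f (xibar i)) = fun i => s • xibar i from funext hxb, orderedProd_smul,
          orderedProd_smul,
      smul_mul_smul_comm, ← mul_pow, hs, one_pow, one_smul]
  cases σ <;> simp only [idem, Label.flip, map_smul, map_mul, map_add, map_sub, map_one, hK, hKb,
      ht,
    neg_mul_neg] <;> congr 2 <;> abel

theorem translateLeft_signHom_idem (σ : Label) : translateLeft (signHom n) (idem n σ) =
    idem n σ.flip :=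
  map_idem_flip _ (s := -1) (by norm_num) (by simp [translateLeft, comulHom_K, signHom_K])
    (by simp [translateLeft, comulHom_Kbar, signHom_Kbar])
    (fun i => by simp [translateLeft, comulHom_xi, signHom_xi, signHom_K])
    (fun i => by simp [translateLeft, comulHom_xibar, signHom_xibar, signHom_Kbar]) σ

theorem translateRight_signHom_idem (σ : Label) :
    translateRight (signHom n) (idem n σ) = idem n σ.flip :=
  map_idem_flip _ (s := 1) (by norm_num) (by simp [translateRight, comulHom_K, signHom_K])
    (by simp [translateRight, comulHom_Kbar, signHom_Kbar])
    (fun i => by simp [translateRight, comulHom_xi, signHom_xi])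
    (fun i => by simp [translateRight, comulHom_xibar, signHom_xibar]) σ

theorem isTraceLike_charMul {V W : Type*} [AddCommGroup V] [Module ℂ V] [Module (NicholsDouble n) V]
    [IsScalarTower ℂ (NicholsDouble n) V] [Module.Finite ℂ V] [AddCommGroup W] [Module ℂ W]
    [Module (NicholsDouble n) W] [IsScalarTower ℂ (NicholsDouble n) W] [Module.Finite ℂ W] :
    IsTraceLike (charMul (character (n := n) V) (character W)) := by
  have h := isTraceLike_trace (((Module.endTensorEndAlgHom (R := ℂ) (S := ℂ) (A := ℂ) (M :=
      V) (N := W)).comp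
    (Algebra.TensorProduct.map (Algebra.lsmul ℂ ℂ V : NicholsDouble n →ₐ[ℂ] Module.End ℂ V)
      (Algebra.lsmul ℂ ℂ W : NicholsDouble n →ₐ[ℂ] Module.End ℂ W))).comp (comulHom n))
  convert h using 1
  ext x
  rw [charMul_apply, LinearMap.comp_apply, AlgHom.toLinearMap_apply, AlgHom.comp_apply]
  induction comulHom n x with
  | zero => simp
  | add s t hs ht => rw [map_add, map_add, map_add, hs, ht]
  | tmul s t =>
    rw [TensorProduct.dualDistrib_apply, AlgHom.comp_apply, Algebra.TensorProduct.map_tmul,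
      Module.endTensorEndAlgHom_apply]
    exact (LinearMap.trace_tensorProduct' _ _).symm

theorem isTraceLike_charMul_projChar (V : Type*) [AddCommGroup V] [Module ℂ V]
    [Module (NicholsDouble n) V] [IsScalarTower ℂ (NicholsDouble n) V] [Module.Finite ℂ V] (σ :
    Label) :
    IsTraceLike (charMul (character (n := n) V) (projChar n σ)) :=
  haveI : Module.Finite ℂ (ProjMod n σ) :=
    Module.Finite.of_injective ((ProjMod n σ).subtype.restrictScalars ℂ) Subtype.val_injective
  isTraceLike_charMul (W := ProjMod n σ)

theorem charMul_one_left (ψ : Module.Dual ℂ (NicholsDouble n)) :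
    charMul (character (SimpleMod n .one)) ψ = ψ := by
  rw [character_one, charMul_algHom_left, translateLeft_counitHom]; rfl

theorem charMul_one_right (ψ : Module.Dual ℂ (NicholsDouble n)) :
    charMul ψ (character (SimpleMod n .one)) = ψ := by
  rw [character_one, charMul_algHom_right, translateRight_counitHom]; rfl

theorem projChar_idem_flip (hn : 0 < n) (σ τ : Label) :
    projChar n σ (idem n τ.flip) = projChar n σ.flip (idem n τ) := by
  cases σ <;> cases τ <;>
  simp only [Label.flip, projChar_KKbar hn, projChar_idem_of_small hn isSmall_one isSmall_one,
    projChar_idem_of_small hn isSmall_one isSmall_KKbar, projChar_idem_self not_isSmall_K,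
    projChar_idem_of_small_of_not_small isSmall_one not_isSmall_K,
    projChar_idem_of_small_of_not_small isSmall_one not_isSmall_Kbar,
    projChar_idem_self not_isSmall_Kbar, ne_eq, reduceCtorEq, not_false_eq_true,
    projChar_idem_of_ne not_isSmall_K, projChar_idem_of_ne not_isSmall_Kbar]

theorem charMul_KKbar_left (hn : 0 < n) (σ : Label) :
    charMul (character (SimpleMod n .KKbar)) (projChar n σ) = projChar n σ.flip := by
  refine (isTraceLike_charMul_projChar _ σ).ext (isTraceLike_projChar _) fun τ => ?_
  rw [character_KKbar, charMul_algHom_left, LinearMap.comp_apply, AlgHom.toLinearMap_apply,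
    translateLeft_signHom_idem, projChar_idem_flip hn]

theorem charMul_KKbar_right (hn : 0 < n) {σ : Label} (hσ : ¬σ.IsSmall) :
    charMul (projChar n σ) (character (SimpleMod n .KKbar)) = projChar n σ.flip := by
  rw [← character_simpleMod_eq_projChar hσ]
  refine isTraceLike_charMul.ext (isTraceLike_projChar _) fun τ => ?_
  rw [character_simpleMod_eq_projChar hσ, character_KKbar, charMul_algHom_right,
      LinearMap.comp_apply,
    AlgHom.toLinearMap_apply, translateRight_signHom_idem, projChar_idem_flip hn]

theorem charMul_projChar_one (hn : 0 < n) {σ : Label} (hσ : ¬σ.IsSmall) :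
    charMul (projChar n σ) (projChar n .one) =
      (2 ^ (2 * n - 1) : ℂ) • (projChar n σ + projChar n σ.flip) := by
  rw [projChar_one_eq hn, charMul_smul_right, charMul_add_right, charMul_one_right,
    charMul_KKbar_right hn hσ]

theorem charMul_of_comul_eq {χ ψ : Module.Dual ℂ (NicholsDouble n)} {g : NicholsDouble n}
    (h : comulHom n g = g ⊗ₜ g) : charMul χ ψ g = χ g * ψ g := by
  rw [charMul_apply, h, TensorProduct.dualDistrib_apply]

theorem comulHom_cen : comulHom n (cen n) = cen n ⊗ₜ cen n := by
  rw [cen, map_mul, comulHom_K, comulHom_Kbar, Algebra.TensorProduct.tmul_mul_tmul]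

theorem projChar_cen_mul {σ : Label} (hσ : ¬σ.IsSmall) (x : NicholsDouble n) :
    projChar n σ (cen n * x) = -projChar n σ x := by
  rw [projChar_eq_biTrace, ← biTrace_comm_cen, cen_mul_idem_of_not_small hσ, map_neg]; rfl

/-- Moving `ξᵢ` cyclically past `K ξ̄ᵢ` reverses a sign, so a trace vanishes on
`K (ξᵢ ξ̄ᵢ + ξ̄ᵢ ξᵢ) = K (1 - K K̄)`. This needs `n > 0`. -/
theorem IsTraceLike.apply_K_mul_one_sub_cen {T : Module.Dual ℂ (NicholsDouble n)} (hT :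
    IsTraceLike T)
    (hn : 0 < n) : T (K n * (1 - cen n)) = 0 := by
  let i : Fin n := ⟨0, hn⟩
  have h : T (K n * (NicholsDouble.xi i * NicholsDouble.xibar i)) =
      -T (K n * (NicholsDouble.xibar i * NicholsDouble.xi i)) := by
    rw [← mul_assoc, hT.mul_comm, ← mul_assoc, xibar_mul_K, neg_mul, map_neg, mul_assoc]
  rw [xi_mul_xibar_self, mul_sub, map_sub] at h
  linear_combination h

theorem projChar_K (hn : 0 < n) {σ : Label} (hσ : ¬σ.IsSmall) : projChar n σ (K n) = 0 := by
  have h := (isTraceLike_projChar (n := n) σ).apply_K_mul_one_sub_cen hn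
  rw [mul_sub, mul_one, ← cen_mul, map_sub, projChar_cen_mul hσ] at h
  linear_combination h / 2

theorem projChar_Kbar (hn : 0 < n) {σ : Label} (hσ : ¬σ.IsSmall) : projChar n σ (Kbar n) = 0 := by
  rw [← cen_mul_K, projChar_cen_mul hσ, projChar_K hn hσ, neg_zero]

theorem projChar_flip_apply_one (hn : 0 < n) (σ : Label) : projChar n σ.flip 1 =
    projChar n σ 1 := by
  rw [← charMul_KKbar_left hn, character_KKbar, charMul_algHom_left, LinearMap.comp_apply,
    AlgHom.toLinearMap_apply, map_one]

/-- The dimension of `V_K` up to sign. It is forced by evaluating at `1` the expansion of the regular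
character in simple characters. -/
theorem projChar_one_mul_self (hn : 0 < n) {σ : Label} (hσ : ¬σ.IsSmall) :
    projChar n σ 1 * projChar n σ 1 = 4 ^ n := by
  have h := congrArg (fun f => f 1) (isTraceLike_biTrace_flip (n := n) 1).eq_sum
  simp only [LinearMap.add_apply, LinearMap.smul_apply, LinearMap.flip_apply, ← projChar_eq_biTrace,
    biTrace_one_one, smul_eq_mul] at h
  have h1 : projChar n .one 1 = 4 ^ n := by
    rw [projChar_one_eq hn, LinearMap.smul_apply, LinearMap.add_apply, character_one,
        character_KKbar,
      AlgHom.toLinearMap_apply, AlgHom.toLinearMap_apply, map_one, map_one, smul_eq_mul]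
    rw [show (1 + 1 : ℂ) = 2 by norm_num, ← pow_succ, show 2 * n - 1 + 1 = 2 * n by omega, pow_mul]
    norm_num
  have h2 : projChar n .Kbar 1 = projChar n .K 1 := projChar_flip_apply_one hn .K
  rw [projChar_KKbar hn, h1, h2, character_one, character_KKbar, AlgHom.toLinearMap_apply,
    AlgHom.toLinearMap_apply, map_one, map_one, pow_succ] at h
  cases σ
  · exact absurd isSmall_one hσ
  · exact absurd isSmall_KKbar hσ
  · linear_combination -h / 2
  · rw [h2]; linear_combination -h / 2

/-- The product is invariant under `K K̄`, so only the one-dimensional characters contribute, and since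
`p_σ` vanishes at `K` and `K̄` their multiplicities are given by the dimensions. -/
theorem charMul_projChar (hn : 0 < n) {σ τ : Label} (hσ : ¬σ.IsSmall) (hτ : ¬τ.IsSmall) :
    charMul (projChar n σ) (projChar n τ) = projChar n .one := by
  have hd : projChar n σ 1 * projChar n τ 1 = 4 ^ n := by
    have h : τ = σ ∨ τ = σ.flip := by
      revert hσ hτ
      cases σ <;> cases τ <;> simp [Label.IsSmall, Label.signK, Label.signKbar, Label.flip]
    rcases h with rfl | rfl
    · exact projChar_one_mul_self hn hτ
    · rw [projChar_flip_apply_one hn, projChar_one_mul_self hn hσ]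
  have hT : IsTraceLike (charMul (projChar n σ) (projChar n τ)) := by
    rw [← character_simpleMod_eq_projChar hσ]
    exact isTraceLike_charMul_projChar _ τ
  refine hT.ext (isTraceLike_projChar _) fun ρ => ?_
  by_cases hρ : ρ.IsSmall
  · rw [projChar_idem_of_small hn isSmall_one hρ, idem_eq_of_small hρ, map_smul, map_add, map_add,
      map_add, map_smul, map_smul, charMul_of_comul_eq comulHom_K,
      charMul_of_comul_eq comulHom_Kbar,
      charMul_of_comul_eq comulHom_cen,
      charMul_of_comul_eq (show comulHom n 1 = 1 ⊗ₜ 1 by rw [map_one]; rfl), projChar_K hn hσ,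
      projChar_Kbar hn hσ]
    have h1 : projChar n σ (cen n) = -projChar n σ 1 := by
      rw [← projChar_cen_mul hσ, mul_one]
    have h2 : projChar n τ (cen n) = -projChar n τ 1 := by
      rw [← projChar_cen_mul hτ, mul_one]
    rw [h1, h2, neg_mul_neg, hd, show (4 : ℂ) ^ n = 2 * 2 ^ (2 * n - 1) by
      rw [← pow_succ', show 2 * n - 1 + 1 = 2 * n by omega, pow_mul]; norm_num]
    simp only [smul_eq_mul]
    ring
  · rw [projChar_idem_of_small_of_not_small isSmall_one hρ]
    have h : ∀ x, charMul (projChar n σ) (projChar n τ) (cen n * x) =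
        charMul (projChar n σ) (projChar n τ) x := by
      intro x
      rw [charMul_apply, charMul_apply, map_mul, comulHom_cen]
      induction comulHom n x with
      | zero => rw [mul_zero]
      | add s t hs ht => rw [mul_add, map_add, map_add, hs, ht]
      | tmul s t =>
        rw [Algebra.TensorProduct.tmul_mul_tmul, TensorProduct.dualDistrib_apply,
          TensorProduct.dualDistrib_apply, projChar_cen_mul hσ, projChar_cen_mul hτ, neg_mul_neg]
    apply eq_zero_of_eq_neg
    nth_rw 1 [← h]
    rw [cen_mul_idem_of_not_small hρ, map_neg]

theorem charMul_character_projChar (hn : 0 < n) (σ : Label) (j : Fin 3) :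
    charMul (character (SimpleMod n σ)) (projChar n (idx j)) =
      ∑ k, fusion n σ k j • projChar n (idx k) := by
  rw [Fin.sum_univ_three]
  have hK : ∀ {σ : Label}, ¬σ.IsSmall → charMul (character (SimpleMod n σ)) (projChar n .one) =
      (2 ^ (2 * n - 1) : ℂ) • (projChar n σ + projChar n σ.flip) := fun h => by
    rw [character_simpleMod_eq_projChar h, charMul_projChar_one hn h]
  have hKK : ∀ {σ τ : Label}, ¬σ.IsSmall → ¬τ.IsSmall →
      charMul (character (SimpleMod n σ)) (projChar n τ) = projChar n .one := fun h h' => by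
    rw [character_simpleMod_eq_projChar h, charMul_projChar hn h h']
  cases σ
  · rw [charMul_one_left]
    have h : ∀ k, fusion n .one k j = if k = j then 1 else 0 := fun k => Matrix.one_apply
    simp only [h]
    fin_cases j <;> simp [idx]
  · rw [charMul_KKbar_left hn]
    fin_cases j <;> simp [fusion, idx, Label.flip, projChar_KKbar hn]
  · fin_cases j <;> simp [fusion, idx, Label.flip, hK not_isSmall_K,
      hKK not_isSmall_K not_isSmall_K,
      hKK not_isSmall_K not_isSmall_Kbar]
  · fin_cases j <;> simp [fusion, idx, Label.flip, hK not_isSmall_Kbar,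
      hKK not_isSmall_Kbar not_isSmall_K, hKK not_isSmall_Kbar not_isSmall_Kbar, add_comm]

end NicholsDouble

end

noncomputable section

namespace Nichols

open Coalgebra

variable {n : ℕ}

/-! ### Integrals of the Nichols algebra and of its dual -/

/-- The coefficient of `ξ₁ ⋯ ξₙ`. -/
def topCoord (n : ℕ) : Module.Dual ℂ (Nichols n) := (basis n).coord (0, Finset.univ)

theorem topCoord_word (I : Finset (Fin n)) : topCoord n (word I) = if I =
    Finset.univ then 1 else 0 := by
  rw [topCoord, coord_word]
  simp

theorem topCoord_K_mul_word (I : Finset (Fin n)) : topCoord n (K n * word I) = 0 := by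
  rw [topCoord, coord_K_mul_word]
  simp

/-- The two-sided integral of `𝒦ₙ` that the self-duality turns into `topCoord`. -/
def topIntegral (n : ℕ) : Nichols n :=
  (revSign n / 2) • (word Finset.univ + K n * word Finset.univ)

theorem dualMap_topIntegral (hn : Even n) : dualMap n (topIntegral n) = topCoord n := by
  rw [topCoord, coord_eq_dualMap, Finset.card_univ, Fintype.card_fin, topIntegral]
  simp [hn.neg_one_pow]

theorem word_univ_mul_K (hn : Even n) :
    (word Finset.univ : Nichols n) * K n = K n * word Finset.univ := by
  rw [word_mul_K, Finset.card_univ, Fintype.card_fin, hn.neg_one_pow, one_smul]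

theorem mul_topIntegral (x : Nichols n) : x * topIntegral n =
    counit (R := ℂ) x • topIntegral n := by
  induction x using induction_left with
  | h1 => simp
  | hadd a b ha hb => rw [add_mul, ha, hb, map_add, add_smul]
  | hsmul r a ha => rw [smul_mul_assoc, ha, map_smul, smul_assoc]
  | hK a ha =>
    rw [mul_assoc, ha, mul_smul_comm, Bialgebra.counit_mul, counit_K, one_mul]
    congr 1
    rw [topIntegral, mul_smul_comm, mul_add, K_mul_K_mul, add_comm]
  | hx i a ha =>
    rw [mul_assoc, ha, mul_smul_comm, Bialgebra.counit_mul, counit_xi, zero_mul, zero_smul,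
      topIntegral, mul_smul_comm, mul_add, ← mul_assoc (xi i), xi_mul_K, neg_mul, mul_assoc,
      xi_mul_word_of_mem (Finset.mem_univ i), mul_zero, neg_zero, add_zero, smul_zero, smul_zero]

theorem topIntegral_mul (hn : Even n) (x : Nichols n) :
    topIntegral n * x = counit (R := ℂ) x • topIntegral n := by
  induction x using induction_left with
  | h1 => simp
  | hadd a b ha hb => rw [mul_add, ha, hb, map_add, add_smul]
  | hsmul r a ha => rw [mul_smul_comm, ha, map_smul, smul_assoc]
  | hK a ha =>
    have h : topIntegral n * K n = topIntegral n := by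
      rw [topIntegral, smul_mul_assoc, add_mul, mul_assoc, word_univ_mul_K hn, K_mul_K_mul,
          add_comm]
    rw [← mul_assoc, h, ha, Bialgebra.counit_mul, counit_K, one_mul]
  | hx i a ha =>
    have h : topIntegral n * xi i = 0 := by
      rw [topIntegral, smul_mul_assoc, add_mul, mul_assoc, word_mul_xi_of_mem (Finset.mem_univ i),
        mul_zero, add_zero, smul_zero]
    rw [← mul_assoc, h, zero_mul, Bialgebra.counit_mul, counit_xi, zero_mul, zero_smul]

theorem eq_of_forall_dualMap {x y : Nichols n} (h : ∀ a, dualMap n a x = dualMap n a y) : x =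
    y := by
  refine (basis n).ext_elem fun b => ?_
  obtain ⟨a, ha⟩ := dualMap_surjective ((basis n).coord b)
  have := h a
  rw [ha] at this
  exact this

/-- `topCoord` is an integral of `𝒦ₙ*`, because it corresponds to a two-sided integral of `𝒦ₙ` under the
self-duality. -/
theorem lTensor_topCoord_comul (hn : Even n) (y : Nichols n) :
    TensorProduct.rid ℂ _ ((topCoord n).lTensor _ (comul (R := ℂ) y)) = topCoord n y • 1 := by
  refine eq_of_forall_dualMap fun a => ?_
  have h1 : dualMap n a (TensorProduct.rid ℂ _ ((topCoord n).lTensor _ (comul (R := ℂ) y))) =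
      dualMul (dualMap n a) (topCoord n) y := by
    rw [dualMul_apply]
    induction comul (R := ℂ) y with
    | zero => simp
    | add s t hs ht => simp only [map_add, hs, ht]
    | tmul s t => simp [mul_comm]
  rw [h1, ← dualMap_topIntegral hn, ← dualMap_mul, mul_topIntegral, map_smul, map_smul,
    NicholsDouble.dualMap_apply_one, LinearMap.smul_apply, smul_eq_mul, smul_eq_mul, mul_comm]

theorem rTensor_topCoord_comul (hn : Even n) (y : Nichols n) :
    TensorProduct.lid ℂ _ ((topCoord n).rTensor _ (comul (R := ℂ) y)) = topCoord n y • 1 := by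
  refine eq_of_forall_dualMap fun a => ?_
  rw [← dualMul_comp, ← dualMap_topIntegral hn, ← dualMap_mul, topIntegral_mul hn, map_smul,
      map_smul,
    NicholsDouble.dualMap_apply_one, LinearMap.smul_apply, smul_eq_mul, smul_eq_mul, mul_comm]

theorem topCoord_K_mul_mul_K (hn : Even n) (x : Nichols n) :
    topCoord n (K n * x * K n) = topCoord n x := by
  suffices h : topCoord n ∘ₗ (LinearMap.mulLeft ℂ (K n) ∘ₗ LinearMap.mulRight ℂ (K n)) =
      topCoord n by
    have := congrArg (fun f => f x) h
    simpa [mul_assoc] using this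
  refine lin_ext (fun I => ?_) (fun I => ?_)
  · rw [LinearMap.comp_apply, LinearMap.comp_apply, LinearMap.mulRight_apply,
      LinearMap.mulLeft_apply,
      word_mul_K, mul_smul_comm, K_mul_K_mul, map_smul, topCoord_word]
    split_ifs with h
    · rw [h, Finset.card_univ, Fintype.card_fin, hn.neg_one_pow, one_smul]
    · rw [smul_zero]
  · rw [LinearMap.comp_apply, LinearMap.comp_apply, LinearMap.mulRight_apply,
      LinearMap.mulLeft_apply,
      mul_assoc (K n) (word I), word_mul_K, mul_smul_comm, mul_smul_comm, K_mul_K_mul, map_smul,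
      topCoord_K_mul_word, smul_zero]

end Nichols

namespace NicholsDouble

open Nichols (revSign sgn topCoord)

variable {n : ℕ}

/-! ### The integrals of the double -/

/-- In the normal form `x̄ y` the functional `λ` is a product of two integrals of `𝒦ₙ*`. -/
theorem cointegral_bar_mul_hop (hn : Even n) (x y : Nichols n) :
    cointegral n (bar n x * hop n y) = 2 * (topCoord n x * topCoord n y) := by
  have h : cointegral n (bar n x * hop n y) = (-1) ^ (n + n / 2) *
      Nichols.dualMap n x ((1 + Nichols.K n) * Nichols.word Finset.univ) * topCoord n y := by
    rw [← tmul_dualMap]; rfl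
  rw [h, ← mul_assoc]
  congr 1
  have hc : (Finset.univ : Finset (Fin n)).card = n := by simp
  rw [add_mul, one_mul]
  suffices h2 : ((-1 : ℂ) ^ (n + n / 2)) • (Nichols.dualMap n).flip
      (Nichols.word Finset.univ + Nichols.K n * Nichols.word Finset.univ) =
      (2 : ℂ) • topCoord n from congrArg (fun f => f x) h2
  refine Nichols.lin_ext (fun I => ?_) (fun I => ?_)
  · rw [LinearMap.smul_apply, LinearMap.flip_apply, map_add]
    simp only [LinearMap.smul_apply,
      Nichols.dualMap_word_K_mul, Nichols.dualMap_word_word, Nichols.topCoord_word, smul_eq_mul]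
    by_cases hI : I = Finset.univ
    · subst hI
      rw [if_pos rfl, if_pos rfl, hc, pow_add, hn.neg_one_pow, one_mul, ← Nichols.revSign_eq,
          mul_add,
        Nichols.revSign_mul_self]
      norm_num
    · rw [if_neg hI, if_neg (Ne.symm hI)]
      simp
  · rw [LinearMap.smul_apply, LinearMap.flip_apply, map_add]
    simp only [LinearMap.smul_apply,
      Nichols.dualMap_K_mul_apply, map_mul, Nichols.kappa_K, Nichols.kappa_word, neg_mul, map_neg,
      mul_smul_comm, map_smul, Nichols.dualMap_word_K_mul, Nichols.topCoord_K_mul_word]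
    simp

/-- The slices of the comultiplication of `x̄ y` by a product functional are products of slices. -/
theorem slice_comulHom (x y : Nichols n) (f : Module.Dual ℂ (NicholsDouble n))
    (g : Module.Dual ℂ (Nichols n)) (r : ℂ)
    (h : ∀ x y, f (bar n x * hop n y) = r * (g x * g y)) :
    TensorProduct.rid ℂ _ (f.lTensor _ (comulHom n (bar n x * hop n y))) =
      r • (bar n (TensorProduct.rid ℂ _ (g.lTensor _ (Coalgebra.comul (R := ℂ) x))) *
        hop n (TensorProduct.rid ℂ _ (g.lTensor _ (Coalgebra.comul (R := ℂ) y)))) ∧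
    TensorProduct.lid ℂ _ (f.rTensor _ (comulHom n (bar n x * hop n y))) =
      r • (bar n (TensorProduct.lid ℂ _ (g.rTensor _ (Coalgebra.comul (R := ℂ) x))) *
        hop n (TensorProduct.lid ℂ _ (g.rTensor _ (Coalgebra.comul (R := ℂ) y)))) := by
  rw [comulHom, lift_bar_mul_hop, AlgHom.comp_apply, AlgHom.comp_apply, Bialgebra.comulAlgHom_apply,
    Bialgebra.comulAlgHom_apply]
  induction Coalgebra.comul (R := ℂ) x with
  | zero => simp
  | add s t hs ht =>
    simp only [map_add, add_mul, smul_add, hs.1, hs.2, ht.1, ht.2, and_self]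
  | tmul s t =>
    induction Coalgebra.comul (R := ℂ) y with
    | zero => simp
    | add u v hu hv =>
      simp only [map_add, mul_add, smul_add, hu.1, hu.2, hv.1, hv.2, and_self]
    | tmul u v =>
      simp only [Algebra.TensorProduct.map_tmul, Algebra.TensorProduct.tmul_mul_tmul,
        LinearMap.lTensor_tmul, LinearMap.rTensor_tmul, TensorProduct.rid_tmul,
        TensorProduct.lid_tmul,
        h, map_smul, smul_mul_assoc, mul_smul_comm, smul_smul]
      constructor <;> congr 1 <;> ring

theorem lTensor_cointegral (hn : Even n) (z : NicholsDouble n) :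
    TensorProduct.rid ℂ _ ((cointegral n).lTensor _ (comulHom n z)) = cointegral n z • 1 := by
  induction z using induction_bar_hop with
  | h x y =>
    rw [(slice_comulHom x y _ _ 2 (cointegral_bar_mul_hop hn)).1, Nichols.lTensor_topCoord_comul hn,
      Nichols.lTensor_topCoord_comul hn, cointegral_bar_mul_hop hn, map_smul, map_smul, map_one,
      map_one,
      smul_mul_smul_comm, one_mul, smul_smul]
  | hadd a b ha hb => simp only [map_add, ha, hb, add_smul]

theorem rTensor_cointegral (hn : Even n) (z : NicholsDouble n) :
    TensorProduct.lid ℂ _ ((cointegral n).rTensor _ (comulHom n z)) = cointegral n z • 1 := by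
  induction z using induction_bar_hop with
  | h x y =>
    rw [(slice_comulHom x y _ _ 2 (cointegral_bar_mul_hop hn)).2, Nichols.rTensor_topCoord_comul hn,
      Nichols.rTensor_topCoord_comul hn, cointegral_bar_mul_hop hn, map_smul, map_smul, map_one,
      map_one,
      smul_mul_smul_comm, one_mul, smul_smul]
  | hadd a b ha hb => simp only [map_add, ha, hb, add_smul]

theorem charMul_cointegral (hn : Even n) (β : Module.Dual ℂ (NicholsDouble n)) :
    charMul β (cointegral n) = β 1 • cointegral n := by
  ext z
  have h : ∀ t, TensorProduct.dualDistrib ℂ _ _ (β ⊗ₜ cointegral n) t =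
      β (TensorProduct.rid ℂ _ ((cointegral n).lTensor _ t)) := by
    intro t
    induction t with
    | zero => simp
    | add s t hs ht => simp only [map_add, hs, ht]
    | tmul s t => simp [mul_comm]
  rw [charMul_apply, h, lTensor_cointegral hn, map_smul, LinearMap.smul_apply, smul_eq_mul,
      smul_eq_mul,
    mul_comm]

theorem K_mul_bar_mul_hop (x y : Nichols n) : K n * (bar n x * hop n y) =
    bar n (Nichols.K n * x * Nichols.K n) * hop n (Nichols.K n * y) := by
  rw [← mul_assoc, K_mul_bar, map_mul (hop n), hop_K, mul_assoc]

theorem cointegral_K_mul_mul_K (hn : Even n) (x : NicholsDouble n) :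
    cointegral n (K n * x * K n) = cointegral n x := by
  induction x using induction_bar_hop with
  | h x y =>
    rw [K_mul_bar_mul_hop, mul_assoc (bar n _), ← hop_K, ← map_mul, cointegral_bar_mul_hop hn,
        cointegral_bar_mul_hop hn, Nichols.topCoord_K_mul_mul_K hn,
      Nichols.topCoord_K_mul_mul_K hn]
  | hadd a b ha hb => rw [mul_add, add_mul, map_add, map_add, ha, hb]

theorem one_add_cen_mul_top_central (x : NicholsDouble n) : Commute ((1 + cen n) * top n) x :=
  commute_one_add_cen_mul_word_mul_wordBar ⟨_, rfl⟩ x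

theorem xi_mul_one_add_cen_mul_top (i : Fin n) : xi i * ((1 + cen n) * top n) = 0 := by
  rw [← mul_assoc, ← (commute_one_add_cen (xi i)).eq, mul_assoc, xi_mul_top, mul_zero]

theorem integral_eq : integral n = (1 / 2 : ℂ) • ((1 + K n) * ((1 + cen n) * top n)) := by
  rw [integral, ← mul_assoc]
  congr 2
  rw [mul_add, mul_one, add_mul 1, one_mul, K_mul_cen, cen]
  abel

theorem mul_integral (x : NicholsDouble n) : x * integral n = counitD n x • integral n := by
  rw [counitD_eq, AlgHom.toLinearMap_apply]
  induction x using induction_left with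
  | h1 => simp
  | hadd a b ha hb => rw [add_mul, ha, hb, map_add, add_smul]
  | hsmul r a ha => rw [smul_mul_assoc, ha, map_smul, smul_assoc]
  | hK a ha =>
    rw [mul_assoc, ha, mul_smul_comm, map_mul, counitHom_K, one_mul]
    congr 1
    rw [integral_eq, mul_smul_comm, ← mul_assoc, mul_add, mul_one, K_mul_K, add_comm]
  | hKb a ha =>
    rw [mul_assoc, ha, mul_smul_comm, map_mul, counitHom_Kbar, one_mul]
    congr 1
    rw [integral_eq, mul_smul_comm, ← cen_mul_K, mul_assoc, ← mul_assoc (K n), mul_add (K n),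
        mul_one,
      K_mul_K, ← mul_cen_mul, ← mul_assoc (cen n), cen_mul_one_add_cen, add_comm]
  | hx i a ha =>
    rw [mul_assoc, ha, mul_smul_comm, map_mul, counitHom_xi, zero_mul, zero_smul, integral_eq,
      mul_smul_comm, ← mul_assoc, mul_add, mul_one, xi_mul_K, add_mul, neg_mul, mul_assoc,
      xi_mul_one_add_cen_mul_top, mul_zero, neg_zero, add_zero, smul_zero, smul_zero]
  | hxb i a ha =>
    rw [mul_assoc, ha, mul_smul_comm, map_mul, counitHom_xibar, zero_mul, zero_smul, integral_eq,
      mul_smul_comm, ← mul_assoc, mul_add, mul_one, xibar_mul_K, add_mul, neg_mul, mul_assoc,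
      xibar_mul_top, mul_zero, neg_zero, add_zero, smul_zero, smul_zero]

theorem integral_mul (x : NicholsDouble n) : integral n * x = counitD n x • integral n := by
  have h : ∀ y,
      integral n * y = (1 / 2 : ℂ) • ((1 + K n) * (y * ((1 + cen n) * top n))) := fun y => by
    rw [integral_eq, smul_mul_assoc, mul_assoc, (one_add_cen_mul_top_central y).eq]
  rw [counitD_eq, AlgHom.toLinearMap_apply]
  induction x using induction_left with
  | h1 => simp
  | hadd a b ha hb => rw [mul_add, ha, hb, map_add, add_smul]
  | hsmul r a ha => rw [mul_smul_comm, ha, map_smul, smul_assoc]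
  | hK a ha =>
    rw [map_mul, counitHom_K, one_mul, ← ha, ← mul_assoc, h (K n), ← mul_assoc, add_mul, one_mul,
        K_mul_K,
      add_comm, ← integral_eq]
  | hKb a ha =>
    rw [map_mul, counitHom_Kbar, one_mul, ← ha, ← mul_assoc, h (Kbar n), ← K_mul_cen,
        mul_assoc (K n),
      ← mul_assoc (cen n), cen_mul_one_add_cen, ← mul_assoc, add_mul, one_mul, K_mul_K, add_comm,
      ← integral_eq]
  | hx i a ha =>
    rw [map_mul, counitHom_xi, zero_mul, zero_smul, ← mul_assoc, h, xi_mul_one_add_cen_mul_top,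
        mul_zero,
      smul_zero, zero_mul]
  | hxb i a ha =>
    rw [map_mul, counitHom_xibar, zero_mul, zero_smul, ← mul_assoc, h, xibar_mul_top, mul_zero,
        smul_zero,
      zero_mul]

theorem one_add_cen_mul_top_eq (hn : Even n) : (1 + cen n) * top n =
    bar n (Nichols.word Finset.univ) * hop n (Nichols.word Finset.univ) +
      bar n (Nichols.K n * Nichols.word Finset.univ) * hop n (Nichols.K n * Nichols.word Finset.univ) := by
  have hc : (Finset.univ : Finset (Fin n)).card = n := by simp
  have h : ∀ I : Finset (Fin n), Commute (word I) ((1 + cen n) * wordBar Finset.univ) := by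
    intro I
    induction I using Finset.induction_on_max with
    | empty => rw [word_empty]; exact Commute.one_left _
    | insert i I hi ih =>
      rw [word_insert_max hi]
      refine ih.mul_left ?_
      have := xi_mul_one_add_cen_mul_wordBar i (Finset.univ : Finset (Fin n))
      rwa [hc, hn.neg_one_pow, one_smul] at this
  rw [top, ← mul_assoc, (commute_one_add_cen (word Finset.univ)).eq, mul_assoc, (h _).eq, add_mul,
      one_mul,
    add_mul, map_mul, map_mul, bar_word, hop_word, bar_K, hop_K]
  congr 1
  rw [cen, ← Kbar_mul_K]
  simp only [mul_assoc]
  rw [← mul_assoc (wordBar _) (K n), wordBar_mul_K, hc, hn.neg_one_pow, one_smul, mul_assoc]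

theorem cointegral_one_add_cen_mul_top (hn : Even n) : cointegral n ((1 + cen n) * top n) = 2 := by
  rw [one_add_cen_mul_top_eq hn, map_add, cointegral_bar_mul_hop hn, cointegral_bar_mul_hop hn,
    Nichols.topCoord_K_mul_word, Nichols.topCoord_word, if_pos rfl]
  norm_num

theorem cointegral_K_add_Kbar_mul_top (hn : Even n) : cointegral n ((K n + Kbar n) * top n) =
    0 := by
  rw [K_add_Kbar_eq, (commute_one_add_cen (K n)).eq, mul_assoc, one_add_cen_mul_top_eq hn, mul_add,
    K_mul_bar_mul_hop, K_mul_bar_mul_hop, Nichols.K_mul_K_mul, map_add, cointegral_bar_mul_hop hn,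
    cointegral_bar_mul_hop hn,
    Nichols.topCoord_K_mul_mul_K hn, Nichols.word_univ_mul_K hn, Nichols.topCoord_K_mul_word]
  ring

theorem cointegral_integral (hn : Even n) : cointegral n (integral n) = 1 := by
  rw [integral_eq, add_mul, one_mul, ← mul_assoc, ← (commute_one_add_cen (K n)).eq, ← K_add_Kbar_eq,
    map_smul, map_add, cointegral_one_add_cen_mul_top hn, cointegral_K_add_Kbar_mul_top hn]
  norm_num

end NicholsDouble

end

noncomputable section

namespace NicholsDouble

open Nichols (revSign sgn topCoord)

variable {n : ℕ}

/-! ### The Casimir element and the symmetric form -/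

/-- The symmetrizing form `λ(G -)`. -/
def symForm (n : ℕ) : Module.Dual ℂ (NicholsDouble n) := cointegral n ∘ₗ LinearMap.mulLeft ℂ (K n)

theorem symForm_apply (x : NicholsDouble n) : symForm n x = cointegral n (K n * x) := rfl

/-- The map `a ⊗ b ↦ S(b) ⊗ a G⁻¹`. -/
def twistComul (n : ℕ) :
    NicholsDouble n ⊗[ℂ] NicholsDouble n →ₗ[ℂ] NicholsDouble n ⊗[ℂ] NicholsDouble n :=
  TensorProduct.map (antipodeD n) (LinearMap.mulRight ℂ (K n)) ∘ₗ
    (TensorProduct.comm ℂ _ _).toLinearMap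

theorem twistComul_tmul (a b : NicholsDouble n) :
    twistComul n (a ⊗ₜ b) = antipodeD n b ⊗ₜ (a * K n) := rfl

/-- The Casimir element `S(Λ₍₂₎) ⊗ Λ₍₁₎ G⁻¹` of the symmetrizing form. -/
def casimir (n : ℕ) : NicholsDouble n ⊗[ℂ] NicholsDouble n := twistComul n (comulHom n (integral n))

theorem twistComul_mul_tmul (T : NicholsDouble n ⊗[ℂ] NicholsDouble n) (a b : NicholsDouble n) :
    twistComul n (T * (a ⊗ₜ b)) =
      (antipodeD n b ⊗ₜ 1) * twistComul n T * (1 ⊗ₜ (K n * a * K n)) := by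
  induction T with
  | zero => simp
  | add s t hs ht => simp only [add_mul, mul_add, map_add, hs, ht]
  | tmul p q =>
    simp only [Algebra.TensorProduct.tmul_mul_tmul, twistComul_tmul, antipodeD_mul, mul_one,
        one_mul,
      mul_assoc, K_mul_K_mul]

theorem twistComul_tmul_mul (T : NicholsDouble n ⊗[ℂ] NicholsDouble n) (a b : NicholsDouble n) :
    twistComul n ((a ⊗ₜ b) * T) = (1 ⊗ₜ a) * twistComul n T * (antipodeD n b ⊗ₜ 1) := by
  induction T with
  | zero => simp
  | add s t hs ht => simp only [add_mul, mul_add, map_add, hs, ht]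
  | tmul p q =>
    simp only [Algebra.TensorProduct.tmul_mul_tmul, twistComul_tmul, antipodeD_mul, mul_one,
        one_mul,
      mul_assoc]

theorem tmul_one_mul (a b : NicholsDouble n) :
    (a ⊗ₜ 1 : NicholsDouble n ⊗[ℂ] NicholsDouble n) * (b ⊗ₜ 1) = (a * b) ⊗ₜ 1 := by
  rw [Algebra.TensorProduct.tmul_mul_tmul, one_mul]

theorem one_tmul_mul (a b : NicholsDouble n) :
    (1 ⊗ₜ a : NicholsDouble n ⊗[ℂ] NicholsDouble n) * (1 ⊗ₜ b) = 1 ⊗ₜ (a * b) := by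
  rw [Algebra.TensorProduct.tmul_mul_tmul, one_mul]

theorem antipodeD_one : antipodeD n 1 = 1 := by rw [antipodeD_eq, map_one]; rfl

theorem groupLike_casimir {g : NicholsDouble n} (hg : g * g = 1) (hgK : K n * g * K n = g)
    (hΔ : comulHom n g = g ⊗ₜ g) (hS : antipodeD n g = g) (hε : counitD n g = 1) :
    (g ⊗ₜ 1) * casimir n = casimir n * (1 ⊗ₜ g) ∧ casimir n * (g ⊗ₜ 1) = (1 ⊗ₜ g) * casimir n := by
  have h := congrArg (fun z => twistComul n (comulHom n z)) (integral_mul g)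
  have h' := congrArg (fun z => twistComul n (comulHom n z)) (mul_integral g)
  simp only [hε, one_smul, map_mul, hΔ, twistComul_mul_tmul, twistComul_tmul_mul, hS, hgK] at h h'
  change _ * casimir n * _ = casimir n at h h'
  constructor
  · nth_rw 1 [← h]
    rw [mul_assoc, ← mul_assoc, tmul_one_mul, hg, ← Algebra.TensorProduct.one_def, one_mul]
  · nth_rw 1 [← h']
    rw [mul_assoc, tmul_one_mul, hg, ← Algebra.TensorProduct.one_def, mul_one]

/-- For a group-like `g` and a skew primitive `x` the relations `(x ⊗ 1) C = C (1 ⊗ x)` and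
`C (x ⊗ 1) = (1 ⊗ x) C` follow from `Λ x = 0` and `x Λ = 0`. -/
theorem skewPrimitive_casimir {g x : NicholsDouble n} (hg : g * g = 1) (hgK : K n * g * K n = g)
    (hΔg : comulHom n g = g ⊗ₜ g) (hSg : antipodeD n g = g) (hεg : counitD n g = 1)
    (hx : g * x = -(x * g)) (hxK : K n * x * K n = -x) (hΔ : comulHom n x = g ⊗ₜ x + x ⊗ₜ 1)
    (hS : antipodeD n x = -(g * x)) (hε : counitD n x = 0) :
    (x ⊗ₜ 1) * casimir n = casimir n * (1 ⊗ₜ x) ∧ casimir n * (x ⊗ₜ 1) = (1 ⊗ₜ x) * casimir n := by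
  obtain ⟨h1, h1'⟩ := groupLike_casimir hg hgK hΔg hSg hεg
  have h := congrArg (fun z => twistComul n (comulHom n z)) (integral_mul x)
  have h' := congrArg (fun z => twistComul n (comulHom n z)) (mul_integral x)
  simp only [hε, zero_smul, map_zero, map_mul, hΔ, mul_add, add_mul, map_add, twistComul_mul_tmul,
    twistComul_tmul_mul, hS, hgK, hxK, antipodeD_one] at h h'
  change _ * casimir n * _ + _ * casimir n * _ = 0 at h h'
  rw [mul_assoc, ← h1, ← mul_assoc, tmul_one_mul, ← Algebra.TensorProduct.one_def, one_mul, hx,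
      neg_neg,
    mul_assoc x, hg, mul_one, ← neg_one_smul ℂ x, TensorProduct.tmul_smul, mul_smul_comm,
    neg_one_smul,
    add_neg_eq_zero] at h
  rw [← h1', mul_assoc, tmul_one_mul, ← Algebra.TensorProduct.one_def, mul_one, mul_neg,
      ← mul_assoc, hg,
    one_mul, ← neg_one_smul ℂ x, ← TensorProduct.smul_tmul', mul_smul_comm, neg_one_smul,
    neg_add_eq_zero] at h'
  exact ⟨h, h'⟩

/-- The Casimir element intertwines the two tensor factors. -/
theorem mul_casimir (z : NicholsDouble n) :
    (z ⊗ₜ 1) * casimir n = casimir n * (1 ⊗ₜ z) ∧ casimir n * (z ⊗ₜ 1) = (1 ⊗ₜ z) * casimir n := by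
  have hε : ∀ x, counitD n x = counitHom n x := fun x => by rw [counitD_eq]; rfl
  have hmul : ∀ g a : NicholsDouble n,
      ((g ⊗ₜ 1) * casimir n = casimir n * (1 ⊗ₜ g) ∧ casimir n * (g ⊗ₜ 1) = (1 ⊗ₜ g) * casimir n) →
      ((a ⊗ₜ 1) * casimir n = casimir n * (1 ⊗ₜ a) ∧ casimir n * (a ⊗ₜ 1) = (1 ⊗ₜ a) * casimir n) →
      (((g * a) ⊗ₜ 1) * casimir n = casimir n * (1 ⊗ₜ (g * a)) ∧
        casimir n * ((g * a) ⊗ₜ 1) = (1 ⊗ₜ (g * a)) * casimir n) := by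
    rintro g a ⟨hg, hg'⟩ ⟨ha, ha'⟩
    rw [← tmul_one_mul, ← one_tmul_mul]
    exact ⟨by rw [mul_assoc, ha, ← mul_assoc, hg, mul_assoc],
      by rw [← mul_assoc, hg', mul_assoc, ha', mul_assoc]⟩
  have hK : K n * K n * K n = K n := by rw [K_mul_K, one_mul]
  have hKb : K n * Kbar n * K n = Kbar n := by rw [mul_assoc, Kbar_mul_K, K_mul_K_mul]
  have hεK : counitD n (K n) = 1 := by rw [hε, counitHom_K]
  have hεKb : counitD n (Kbar n) = 1 := by rw [hε, counitHom_Kbar]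
  induction z using induction_left with
  | h1 => rw [← Algebra.TensorProduct.one_def, one_mul, mul_one]; exact ⟨rfl, rfl⟩
  | hadd a b ha hb =>
    rw [TensorProduct.add_tmul, TensorProduct.tmul_add, add_mul, mul_add, ha.1, hb.1, mul_add,
        add_mul,
      ha.2, hb.2]
    exact ⟨rfl, rfl⟩
  | hsmul r a ha =>
    rw [← TensorProduct.smul_tmul', TensorProduct.tmul_smul, smul_mul_assoc, mul_smul_comm, ha.1,
      mul_smul_comm, smul_mul_assoc, ha.2]
    exact ⟨rfl, rfl⟩
  | hK a ha => exact hmul _ _ (groupLike_casimir K_mul_K hK comulHom_K antipodeD_K hεK) ha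
  | hKb a ha => exact hmul _ _ (groupLike_casimir Kbar_mul_Kbar hKb comulHom_Kbar antipodeD_Kbar hεKb) ha
  | hx i a ha =>
    exact hmul _ _ (skewPrimitive_casimir K_mul_K hK comulHom_K antipodeD_K hεK (K_mul_xi i)
      (by rw [mul_assoc, xi_mul_K, mul_neg, K_mul_K_mul]) (comulHom_xi i) (antipodeD_xi i)
      (by rw [hε, counitHom_xi])) ha
  | hxb i a ha =>
    exact hmul _ _ (skewPrimitive_casimir Kbar_mul_Kbar hKb comulHom_Kbar antipodeD_Kbar hεKb
      (Kbar_mul_xibar i) (by rw [mul_assoc, xibar_mul_K, mul_neg, K_mul_K_mul]) (comulHom_xibar i)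
      (antipodeD_xibar i) (by rw [hε, counitHom_xibar])) ha

/-- The contraction `a ⊗ b ↦ f(b) a`. -/
def slice (f : Module.Dual ℂ
    (NicholsDouble n)) : NicholsDouble n ⊗[ℂ] NicholsDouble n →ₗ[ℂ] NicholsDouble n :=
  (TensorProduct.rid ℂ _).toLinearMap ∘ₗ f.lTensor _

theorem slice_tmul (f : Module.Dual ℂ (NicholsDouble n)) (a b : NicholsDouble n) :
    slice f (a ⊗ₜ b) = f b • a := by simp [slice]

theorem slice_tmul_one_mul (f : Module.Dual ℂ (NicholsDouble n)) (z : NicholsDouble n)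
    (T : NicholsDouble n ⊗[ℂ] NicholsDouble n) : slice f ((z ⊗ₜ 1) * T) = z * slice f T := by
  induction T with
  | zero => simp
  | add s t hs ht => simp only [mul_add, map_add, hs, ht]
  | tmul p q => rw [Algebra.TensorProduct.tmul_mul_tmul, slice_tmul, slice_tmul, one_mul,
      mul_smul_comm]

theorem slice_mul_tmul_one (f : Module.Dual ℂ (NicholsDouble n)) (z : NicholsDouble n)
    (T : NicholsDouble n ⊗[ℂ] NicholsDouble n) : slice f (T * (z ⊗ₜ 1)) = slice f T * z := by
  induction T with
  | zero => simp
  | add s t hs ht => simp only [add_mul, map_add, hs, ht]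
  | tmul p q => rw [Algebra.TensorProduct.tmul_mul_tmul, slice_tmul, slice_tmul, mul_one,
      smul_mul_assoc]

theorem slice_one_tmul_mul (f : Module.Dual ℂ (NicholsDouble n)) (z : NicholsDouble n)
    (T : NicholsDouble n ⊗[ℂ] NicholsDouble n) :
    slice f ((1 ⊗ₜ z) * T) = slice (f ∘ₗ LinearMap.mulLeft ℂ z) T := by
  induction T with
  | zero => simp
  | add s t hs ht => simp only [mul_add, map_add, hs, ht]
  | tmul p q => rw [Algebra.TensorProduct.tmul_mul_tmul, slice_tmul, slice_tmul, one_mul]; rfl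

theorem slice_mul_one_tmul (f : Module.Dual ℂ (NicholsDouble n)) (z : NicholsDouble n)
    (T : NicholsDouble n ⊗[ℂ] NicholsDouble n) :
    slice f (T * (1 ⊗ₜ z)) = slice (f ∘ₗ LinearMap.mulRight ℂ z) T := by
  induction T with
  | zero => simp
  | add s t hs ht => simp only [add_mul, map_add, hs, ht]
  | tmul p q => rw [Algebra.TensorProduct.tmul_mul_tmul, slice_tmul, slice_tmul, mul_one]; rfl

theorem slice_symForm_casimir (hn : Even n) : slice (symForm n) (casimir n) = 1 := by
  have h : ∀ T, slice (symForm n) (twistComul n T) =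
      antipodeD n (TensorProduct.lid ℂ _ ((cointegral n).rTensor _ T)) := by
    intro T
    induction T with
    | zero => simp
    | add s t hs ht => simp only [map_add, hs, ht]
    | tmul p q =>
      rw [twistComul_tmul, slice_tmul, symForm_apply, ← mul_assoc, cointegral_K_mul_mul_K hn]
      simp
  rw [casimir, h, rTensor_cointegral hn, cointegral_integral hn, one_smul, antipodeD_one]

/-- The Casimir element and the symmetrizing form give dual bases. -/
theorem slice_symForm_mulRight_casimir (hn : Even n) (z : NicholsDouble n) :
    slice (symForm n ∘ₗ LinearMap.mulRight ℂ z) (casimir n) = z := by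
  rw [← slice_mul_one_tmul, ← (mul_casimir z).1, slice_tmul_one_mul, slice_symForm_casimir hn,
      mul_one]

theorem eq_of_slice_casimir_eq (hn : Even n) {f g : Module.Dual ℂ (NicholsDouble n)}
    (h : slice f (casimir n) = slice g (casimir n)) : f = g := by
  let L : Module.Dual ℂ (NicholsDouble n) →ₗ[ℂ] NicholsDouble n :=
    { toFun := fun f => slice f (casimir n)
      map_add' := fun f g => by simp [slice, LinearMap.lTensor_add]
      map_smul' := fun r f => by simp [slice, LinearMap.lTensor_smul] }
  have hL : Function.Injective L :=
    (LinearMap.injective_iff_surjective_of_finrank_eq_finrank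
      (Subspace.dual_finrank_eq (K := ℂ) (V := NicholsDouble n))).2
      fun z => ⟨_, slice_symForm_mulRight_casimir hn z⟩
  exact hL h

theorem symForm_mul_comm (hn : Even n) (x y : NicholsDouble n) :
    symForm n (x * y) = symForm n (y * x) := by
  have h : symForm n ∘ₗ LinearMap.mulRight ℂ y ∘ₗ LinearMap.mulLeft ℂ x =
      symForm n ∘ₗ LinearMap.mulRight ℂ (y * x) := by
    apply eq_of_slice_casimir_eq hn
    rw [slice_symForm_mulRight_casimir hn, ← LinearMap.comp_assoc, ← slice_one_tmul_mul,
      ← (mul_casimir x).2, slice_mul_tmul_one, slice_symForm_mulRight_casimir hn]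
  have := congrArg (fun f => f 1) h
  simpa using this

theorem eq_of_symForm_eq (hn : Even n) {x y : NicholsDouble n}
    (h : ∀ z, symForm n (z * x) = symForm n (z * y)) : x = y := by
  rw [← slice_symForm_mulRight_casimir hn x, ← slice_symForm_mulRight_casimir hn y]
  congr 1
  exact congrArg slice (LinearMap.ext h)

theorem cointegral_hop_mul_bar (hn : Even n) (x y : Nichols n) :
    cointegral n (hop n x * bar n y) = 2 * (topCoord n x * topCoord n y) := by
  have h1 : hop n x * bar n y = K n * (K n * hop n x * bar n y) := by rw [mul_assoc, K_mul_K_mul]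
  have h2 : K n * (bar n y * (K n * hop n x)) =
      bar n (Nichols.K n * y * Nichols.K n) * hop n (Nichols.K n * (Nichols.K n * x)) := by
    rw [← hop_K, ← map_mul, hop_K, K_mul_bar_mul_hop]
  rw [h1, ← symForm_apply, symForm_mul_comm hn, symForm_apply, h2, cointegral_bar_mul_hop hn,
    Nichols.topCoord_K_mul_mul_K hn, Nichols.K_mul_K_mul, mul_comm (topCoord n y)]

/-! ### The trace map -/

/-- The map `a ⊗ b ↦ (x ↦ a x b)`. -/
def sandwichMap (n : ℕ) : NicholsDouble n ⊗[ℂ] NicholsDouble n →ₗ[ℂ] Module.End ℂ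
    (NicholsDouble n) :=
  TensorProduct.lift (LinearMap.mk₂ ℂ (fun a b => LinearMap.mulLeft ℂ a ∘ₗ LinearMap.mulRight ℂ b)
    (fun a a' b => by ext; simp [add_mul]) (fun r a b => by ext; simp)
    (fun a b b' => by ext; simp [mul_add]) (fun r a b => by ext; simp))

theorem sandwichMap_tmul (a b x : NicholsDouble n) : sandwichMap n (a ⊗ₜ b) x = a * (x * b) := rfl

theorem higmanTrace_eq : higmanTrace n = sandwichMap n (casimir n) := by
  rw [higmanTrace, casimir, comulD_eq, AlgHom.toLinearMap_apply]
  induction comulHom n (integral n) with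
  | zero => simp
  | add s t hs ht => rw [map_add, map_add, map_add, hs, ht]
  | tmul p q =>
    rw [twistComul_tmul]
    ext x
    simp [sandwichMap_tmul, balancing, mul_assoc]

/-- The trace map is adjoint to the regular bimodule trace. -/
theorem symForm_mul_higmanTrace (hn : Even n) (x y : NicholsDouble n) :
    symForm n (y * higmanTrace n x) = biTrace n x y := by
  let f : Module.End ℂ (NicholsDouble n) := LinearMap.mulLeft ℂ y * LinearMap.mulRight ℂ x
  let G : NicholsDouble n ⊗[ℂ] NicholsDouble n →ₗ[ℂ]
      Module.Dual ℂ (NicholsDouble n) ⊗[ℂ] NicholsDouble n :=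
    TensorProduct.map ((LinearMap.mul ℂ (NicholsDouble n)).compr₂ (symForm n)) f ∘ₗ
      (TensorProduct.comm ℂ _ _).toLinearMap
  have h1 : ∀ T w,
      dualTensorHom ℂ _ _ (G T) w = f (slice (symForm n ∘ₗ LinearMap.mulRight ℂ w) T) := by
    intro T w
    induction T with
    | zero => simp
    | add s t hs ht => rw [map_add, map_add, LinearMap.add_apply, hs, ht, map_add, map_add]
    | tmul p q => rw [slice_tmul, map_smul]; simp [G]
  have h2 : dualTensorHom ℂ _ _ (G (casimir n)) = f := by
    ext w
    rw [h1, slice_symForm_mulRight_casimir hn]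
  have h3 : ∀ T, contractLeft ℂ _ (G T) = symForm n (y * sandwichMap n T x) := by
    intro T
    induction T with
    | zero => simp
    | add s t hs ht => rw [map_add, map_add, hs, ht, map_add, LinearMap.add_apply, mul_add, map_add]
    | tmul p q =>
      have : contractLeft ℂ _ (G (p ⊗ₜ q)) = symForm n (q * (y * (p * x))) := by
        simp [G, f]
      rw [this, symForm_mul_comm hn, sandwichMap_tmul]
      simp only [mul_assoc]
  rw [higmanTrace_eq, ← h3, ← LinearMap.trace_eq_contract_apply, h2]
  rfl

theorem higmanTrace_ext (hn : Even n) {x z : NicholsDouble n}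
    (h : ∀ y, biTrace n x y = symForm n (z * y)) : higmanTrace n x = z := by
  refine eq_of_symForm_eq hn fun y => ?_
  rw [symForm_mul_higmanTrace hn, h, symForm_mul_comm hn]

end NicholsDouble

end

noncomputable section

namespace NicholsDouble

open Nichols (revSign sgn topCoord)

variable {n : ℕ}

/-! ### The Higman ideal -/

theorem cointegral_top (hn : Even n) : cointegral n (top n) = 2 := by
  rw [top, ← hop_word, ← bar_word, cointegral_hop_mul_bar hn, Nichols.topCoord_word, if_pos rfl]
  norm_num

theorem cointegral_cen_mul_top (hn : Even n) : cointegral n (cen n * top n) = 0 := by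
  have h := cointegral_one_add_cen_mul_top hn
  rw [add_mul, one_mul, map_add, cointegral_top hn] at h
  linear_combination h

theorem cointegral_K_mul_top (hn : Even n) : cointegral n (K n * top n) = 0 := by
  rw [top, ← hop_word, ← bar_word, ← mul_assoc, ← hop_K, ← map_mul, cointegral_hop_mul_bar hn,
    Nichols.topCoord_K_mul_word]
  ring

theorem cointegral_Kbar_mul_top (hn : Even n) : cointegral n (Kbar n * top n) = 0 := by
  have h := cointegral_K_add_Kbar_mul_top hn
  rw [add_mul, map_add, cointegral_K_mul_top hn] at h
  linear_combination h

theorem cointegral_idem (hn : Even n) {σ : Label} (hσ : ¬σ.IsSmall) :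
    cointegral n (idem n σ) = (-1) ^ (n / 2) / 2 ^ (n + 1) := by
  have h := cointegral_cen_mul_top hn
  rw [cen] at h
  cases σ
  · exact absurd isSmall_one hσ
  · exact absurd isSmall_KKbar hσ
  all_goals
    simp only [idem, map_smul, add_mul, sub_mul, map_add, map_sub, one_mul, cointegral_top hn,
      cointegral_K_mul_top hn, cointegral_Kbar_mul_top hn, h, smul_eq_mul, pow_succ]
    field_simp
    norm_num

theorem symForm_mul_idem (x : NicholsDouble n) (hx : ∀ y, Commute x y) (σ : Label) :
    symForm n (x * idem n σ) = σ.signK * cointegral n (x * idem n σ) := by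
  rw [symForm_apply, ← mul_assoc, ← (hx (K n)).eq, mul_assoc, K_mul_idem, mul_smul_comm, map_smul,
    smul_eq_mul]

theorem isTraceLike_symForm (hn : Even n) {x : NicholsDouble n} (hx : ∀ y, Commute x y)
    (h : ∀ i, x * ((1 + cen n) * xi i) = 0) (h' : ∀ i, x * ((1 + cen n) * xibar i) = 0) :
    IsTraceLike (symForm n ∘ₗ LinearMap.mulLeft ℂ x) where
  mul_comm y z := by
    rw [LinearMap.comp_apply, LinearMap.comp_apply, LinearMap.mulLeft_apply,
        LinearMap.mulLeft_apply,
      ← mul_assoc, symForm_mul_comm hn, ← mul_assoc, ← (hx z).eq, mul_assoc]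
  xi i y := by
    rw [LinearMap.comp_apply, LinearMap.mulLeft_apply, ← mul_assoc (1 + cen n), ← mul_assoc x, h,
        zero_mul,
      map_zero]
  xibar i y := by
    rw [LinearMap.comp_apply, LinearMap.mulLeft_apply, ← mul_assoc (1 + cen n), ← mul_assoc x, h',
      zero_mul, map_zero]

theorem K_add_Kbar_mul_top_eq : (K n + Kbar n) * top n = K n * ((1 + cen n) * top n) := by
  rw [K_add_Kbar_eq, (commute_one_add_cen (K n)).eq, mul_assoc]

theorem K_add_Kbar_mul_top_mul_xi (i : Fin n) : (K n + Kbar n) * top n * xi i = 0 := by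
  rw [(commute_K_add_Kbar_mul_top (xi i)).eq, K_add_Kbar_mul_top_eq, ← mul_assoc, xi_mul_K, neg_mul,
    mul_assoc, xi_mul_one_add_cen_mul_top, mul_zero, neg_zero]

theorem K_add_Kbar_mul_top_mul_xibar (i : Fin n) : (K n + Kbar n) * top n * xibar i = 0 := by
  rw [mul_assoc, top_mul_xibar, mul_zero]

theorem cen_mul_K_add_Kbar_mul_top :
    cen n * ((K n + Kbar n) * top n) = (K n + Kbar n) * top n := by
  rw [K_add_Kbar_eq, ← mul_assoc, ← mul_assoc, cen_mul_one_add_cen]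

theorem K_mul_K_add_Kbar_mul_top : K n * ((K n + Kbar n) * top n) = (1 + cen n) * top n := by
  rw [K_add_Kbar_mul_top_eq, K_mul_K_mul]

theorem Kbar_mul_K_add_Kbar_mul_top : Kbar n * ((K n + Kbar n) * top n) = (1 + cen n) * top n := by
  rw [← K_mul_K_add_Kbar_mul_top]
  nth_rw 2 [← cen_mul_K_add_Kbar_mul_top]
  rw [← mul_assoc (K n), K_mul_cen]

/-- The functional `λ(G - (K + K̄) ξ₁ ⋯ ξ̄ₙ)` is the sum of the characters of the two
one-dimensional modules. -/
theorem symForm_K_add_Kbar_mul_top_mul_idem (hn : Even n) (σ : Label) [Decidable σ.IsSmall] :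
    symForm n ((K n + Kbar n) * top n * idem n σ) = if σ.IsSmall then 1 else 0 := by
  split_ifs with h
  · rw [symForm_mul_idem _ commute_K_add_Kbar_mul_top, (commute_K_add_Kbar_mul_top (idem n σ)).eq,
      idem_eq_of_small h, smul_mul_assoc, add_mul, add_mul, add_mul, one_mul, smul_mul_assoc,
      smul_mul_assoc, cen_mul_K_add_Kbar_mul_top, Kbar_mul_K_add_Kbar_mul_top,
      K_mul_K_add_Kbar_mul_top]
    simp only [map_smul, map_add, cointegral_K_add_Kbar_mul_top hn,
        cointegral_one_add_cen_mul_top hn,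
      smul_eq_mul]
    linear_combination σ.signK_mul_self
  · apply eq_zero_of_eq_neg
    rw [← map_neg]
    congr 1
    nth_rw 1 [← cen_mul_K_add_Kbar_mul_top]
    rw [cen_mul, mul_assoc, cen_mul_idem_of_not_small h, mul_neg]

/-- The central element `z_σ` with `p_σ = λ(G z_σ -)`. -/
def charElem (n : ℕ) (σ : Label) : NicholsDouble n :=
  open Classical in if σ.IsSmall then (2 ^ (2 * n - 1) : ℂ) • ((K n + Kbar n) * top n) else
    ((-1) ^ (n / 2) * 2 ^ n : ℂ) • (σ.signK • (1 / 2 : ℂ) • (1 - cen n) + chir n)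

theorem charElem_of_small {σ : Label} (h : σ.IsSmall) :
    charElem n σ = (2 ^ (2 * n - 1) : ℂ) • ((K n + Kbar n) * top n) := if_pos h

theorem charElem_of_not_small {σ : Label} (h : ¬σ.IsSmall) : charElem n σ =
    ((-1) ^ (n / 2) * 2 ^ n : ℂ) • (σ.signK • (1 / 2 : ℂ) • (1 - cen n) + chir n) := if_neg h

theorem charElem_mem_ZH (σ : Label) : charElem n σ ∈ ZH n := by
  rw [mem_ZH_iff]
  by_cases h : σ.IsSmall
  · exact ⟨0, 2 ^ (2 * n - 1), 0, by rw [charElem_of_small h]; simp⟩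
  · exact ⟨(-1) ^ (n / 2) * 2 ^ n * (σ.signK * (1 / 2)), 0, (-1) ^ (n / 2) * 2 ^ n, by
      rw [charElem_of_not_small h, smul_add, smul_smul, smul_smul, mul_assoc _ σ.signK]; simp⟩

theorem commute_charElem (σ : Label) (x : NicholsDouble n) : Commute (charElem n σ) x :=
  commute_of_mem_ZH (charElem_mem_ZH σ) x

theorem one_add_cen_mul_one_sub_cen : (1 + cen n) * (1 - cen n) = 0 := by
  rw [add_mul, one_mul, cen_mul_one_sub_cen, add_neg_cancel]

theorem one_add_cen_mul_chir : (1 + cen n) * chir n = 0 := by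
  rw [add_mul, one_mul, cen_mul_chir, add_neg_cancel]

theorem charElem_mul_one_add_cen {σ : Label} (h : ¬σ.IsSmall) : charElem n σ * (1 + cen n) = 0 := by
  rw [(commute_charElem σ _).eq, charElem_of_not_small h, mul_smul_comm, mul_add, mul_smul_comm,
    mul_smul_comm, one_add_cen_mul_one_sub_cen, one_add_cen_mul_chir, smul_zero, smul_zero,
    add_zero,
    smul_zero]

theorem isTraceLike_symForm_charElem (hn : Even n) (σ : Label) :
    IsTraceLike (symForm n ∘ₗ LinearMap.mulLeft ℂ (charElem n σ)) := by
  refine isTraceLike_symForm hn (commute_charElem σ) (fun i => ?_) fun i => ?_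
  all_goals
    by_cases h : σ.IsSmall
    · rw [charElem_of_small h, smul_mul_assoc, (commute_one_add_cen _).eq, ← mul_assoc]
      simp only [K_add_Kbar_mul_top_mul_xi, K_add_Kbar_mul_top_mul_xibar, zero_mul, smul_zero]
    · rw [← mul_assoc, charElem_mul_one_add_cen h, zero_mul]

theorem charElem_mul_idem (hn : Even n) {σ τ : Label} (hσ : ¬σ.IsSmall) (hτ : ¬τ.IsSmall) :
    charElem n σ * idem n τ =
      ((-1) ^ (n / 2) * 2 ^ n * (σ.signK + τ.signK) : ℂ) • idem n τ := by
  rw [charElem_of_not_small hσ, smul_mul_assoc, add_mul, smul_mul_assoc, smul_mul_assoc,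
    one_sub_cen_mul_idem hτ, chir_mul_idem hτ, hn.neg_one_pow, smul_smul, smul_smul, ← add_smul,
    smul_smul]
  congr 1
  ring

/-- Both sides are trace-like, so it suffices to compare them on the four idempotents. -/
theorem projChar_eq_symForm (hn : Even n) (hn0 : 0 < n) (σ : Label) :
    projChar n σ = symForm n ∘ₗ LinearMap.mulLeft ℂ (charElem n σ) := by
  classical
  refine (isTraceLike_projChar σ).ext (isTraceLike_symForm_charElem hn σ) fun τ => ?_
  rw [LinearMap.comp_apply, LinearMap.mulLeft_apply]
  by_cases hσ : σ.IsSmall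
  · rw [charElem_of_small hσ, smul_mul_assoc, map_smul, symForm_K_add_Kbar_mul_top_mul_idem hn]
    split_ifs with hτ
    · rw [projChar_idem_of_small hn0 hσ hτ, smul_eq_mul, mul_one]
    · rw [projChar_idem_of_small_of_not_small hσ hτ, smul_zero]
  · by_cases hτ : τ.IsSmall
    · have h0 : charElem n σ * idem n τ = 0 := by
        have h := idem_eq_one_add_cen_mul (n := n) hτ
        rw [h, mul_smul_comm, ← mul_assoc, charElem_mul_one_add_cen hσ, zero_mul, smul_zero]
      rw [h0, map_zero, projChar_idem_of_ne hσ]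
      rintro rfl
      exact hσ hτ
    · rw [symForm_mul_idem _ (commute_charElem σ), charElem_mul_idem hn hσ hτ, map_smul,
        cointegral_idem hn hτ, smul_eq_mul]
      have h2 : (2 : ℂ) ^ n ≠ 0 := pow_ne_zero _ two_ne_zero
      have h3 := neg_one_pow_mul_self (n / 2)
      have h1 : τ.signK * ((-1) ^ (n / 2) * 2 ^ n * (σ.signK + τ.signK) *
          ((-1) ^ (n / 2) / 2 ^ (n + 1))) = (τ.signK * σ.signK + 1) / 2 := by
        rw [pow_succ]
        field_simp
        linear_combination (τ.signK * (σ.signK + τ.signK)) * h3 + τ.signK_mul_self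
      rw [h1]
      by_cases hne : τ = σ
      · rw [hne, projChar_idem_self hσ, σ.signK_mul_self]
        norm_num
      · rw [projChar_idem_of_ne hσ hne]
        revert hne hσ hτ
        cases σ <;> cases τ <;> simp [Label.IsSmall, Label.signK, Label.signKbar]

theorem higmanTrace_idem (hn : Even n) (hn0 : 0 < n) (σ : Label) :
    higmanTrace n (idem n σ) = charElem n σ := by
  refine higmanTrace_ext hn fun y => ?_
  rw [← projChar_eq_biTrace, projChar_eq_symForm hn hn0]
  rfl

theorem biTrace_idem_KKbar (hn0 : 0 < n) (x : NicholsDouble n) :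
    biTrace n x (idem n .KKbar) = biTrace n x (idem n .one) := by
  have h : (biTrace n).flip (idem n .KKbar) = (biTrace n).flip (idem n .one) := by
    refine (isTraceLike_biTrace_flip _).ext (isTraceLike_biTrace_flip _) fun σ => ?_
    rw [LinearMap.flip_apply, LinearMap.flip_apply, ← projChar_eq_biTrace]
    by_cases hσ : σ.IsSmall
    · rw [projChar_idem_of_small hn0 hσ isSmall_KKbar, projChar_idem_of_small hn0 hσ isSmall_one]
    · rw [projChar_idem_of_ne hσ, projChar_idem_of_ne hσ]
      · rintro rfl; exact hσ isSmall_one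
      · rintro rfl; exact hσ isSmall_KKbar
  exact congrArg (fun f => f x) h

/-- The trace map has its image in the span of the three `charElem`s: the functional that `τ(x)`
represents is trace-like, hence a combination of projective characters. -/
theorem higmanTrace_eq_sum (hn : Even n) (hn0 : 0 < n) (x : NicholsDouble n) :
    higmanTrace n x = (biTrace n x (idem n .one) / 2 ^ (2 * n - 1)) • charElem n .one +
      biTrace n x (idem n .K) • charElem n .K + biTrace n x (idem n .Kbar) • charElem n .Kbar := by
  refine higmanTrace_ext hn fun y => ?_
  have h := congrArg (fun f => f y) (isTraceLike_biTrace x).eq_sum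
  have h1 := congrArg (fun f => f y) (projChar_one_eq hn0)
  have hp : ∀ σ, symForm n (charElem n σ * y) = projChar n σ y := fun σ => by
    rw [projChar_eq_symForm hn hn0]; rfl
  simp only [LinearMap.add_apply, LinearMap.smul_apply, smul_eq_mul, biTrace_idem_KKbar hn0] at h h1
  simp only [add_mul, smul_mul_assoc, map_add, map_smul, hp, smul_eq_mul]
  rw [h, h1]
  have h2 : (2 : ℂ) ^ (2 * n - 1) ≠ 0 := pow_ne_zero _ two_ne_zero
  field_simp

theorem basisTau_eq (hn : Even n) (hn0 : 0 < n) (j : Fin 3) : basisTau n j = charElem n (idx j) :=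
  higmanTrace_idem hn hn0 _

theorem higmanIdeal_eq_span (hn : Even n) (hn0 : 0 < n) :
    higmanIdeal n = Submodule.span ℂ (Set.range (basisTau n)) := by
  apply le_antisymm
  · rintro _ ⟨x, rfl⟩
    have hmem : ∀ j, charElem n (idx j) ∈ Submodule.span ℂ (Set.range (basisTau n)) := fun j =>
      Submodule.subset_span ⟨j, basisTau_eq hn hn0 j⟩
    rw [higmanTrace_eq_sum hn hn0]
    exact Submodule.add_mem _ (Submodule.add_mem _ (Submodule.smul_mem _ _ (hmem 0))
      (Submodule.smul_mem _ _ (hmem 1))) (Submodule.smul_mem _ _ (hmem 2))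
  · rw [Submodule.span_le]
    rintro _ ⟨j, rfl⟩
    exact ⟨_, rfl⟩

theorem sign_mul_two_pow_mul_self (n : ℕ) :
    ((-1) ^ (n / 2) / 2 ^ n : ℂ) * ((-1) ^ (n / 2) * 2 ^ n) = 1 := by
  have h2 : (2 : ℂ) ^ n ≠ 0 := pow_ne_zero _ two_ne_zero
  have h3 := neg_one_pow_mul_self (n / 2)
  field_simp
  linear_combination h3

theorem ZH_eq_span_basisTau (hn : Even n) (hn0 : 0 < n) :
    ZH n = Submodule.span ℂ (Set.range (basisTau n)) := by
  have h1 := sign_mul_two_pow_mul_self n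
  have h2 : (2 : ℂ) ^ (2 * n - 1) ≠ 0 := pow_ne_zero _ two_ne_zero
  apply le_antisymm
  · intro x hx
    obtain ⟨a, b, d, rfl⟩ := mem_ZH_iff.1 hx
    rw [Submodule.mem_span_range_iff_exists_fun]
    refine ⟨![b / 2 ^ (2 * n - 1), ((-1) ^ (n / 2) / 2 ^ n) * (a + d / 2),
      ((-1) ^ (n / 2) / 2 ^ n) * (d / 2 - a)], ?_⟩
    rw [Fin.sum_univ_three, basisTau_eq hn hn0, basisTau_eq hn hn0, basisTau_eq hn hn0]
    change _ • charElem n .one + _ • charElem n .K + _ • charElem n .Kbar = _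
    rw [charElem_of_small isSmall_one, charElem_of_not_small not_isSmall_K,
      charElem_of_not_small not_isSmall_Kbar]
    simp only [Matrix.cons_val_zero, Matrix.cons_val_one, Matrix.cons_val, Label.signK, smul_add,
        smul_smul]
    rw [div_mul_cancel₀ _ h2]
    match_scalars
    · ring
    · linear_combination a * h1
    · linear_combination (-a) * h1
    · linear_combination d * h1
  · rw [Submodule.span_le]
    rintro _ ⟨j, rfl⟩
    rw [SetLike.mem_coe, basisTau_eq hn hn0]
    exact charElem_mem_ZH _

theorem ZH_eq_higmanIdeal (hn : Even n) (hn0 : 0 < n) : ZH n = higmanIdeal n := by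
  rw [ZH_eq_span_basisTau hn hn0, higmanIdeal_eq_span hn hn0]

theorem linearIndependent_of_span_eq_ZH {v : Fin 3 → NicholsDouble n}
    (h : Submodule.span ℂ (Set.range v) = ZH n) : LinearIndependent ℂ v := by
  rw [linearIndependent_iff_card_eq_finrank_span, Set.finrank, h, finrank_ZH, Fintype.card_fin]

end NicholsDouble

end

noncomputable section

namespace Nichols

open Coalgebra

variable {n : ℕ}

/-! ### The self-duality as a canonical element -/

/-- The basis of `𝒦ₙ` that the self-duality sends to the dual basis of `W ∪ KW`. -/
def dualVec (b : Fin 2 × Finset (Fin n)) : Nichols n :=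
  (LinearEquiv.ofBijective (dualMap n) dualMap_bijective).symm ((basis n).coord b)

theorem dualMap_dualVec (b : Fin 2 × Finset (Fin n)) : dualMap n (dualVec b) = (basis n).coord b :=
  (LinearEquiv.ofBijective (dualMap n) dualMap_bijective).apply_symm_apply _

theorem sum_dualMap_smul_dualVec (p : Nichols n) : ∑ b, dualMap n p (basis n b) • dualVec b =
    p := by
  apply dualMap_bijective.1
  rw [map_sum]
  simp only [map_smul, dualMap_dualVec]
  exact (basis n).sum_dual_apply_smul_coord _

theorem sum_coord_smul_basis (q : Nichols n) : ∑ b, (basis n).coord b q • basis n b = q :=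
  (basis n).sum_repr q

theorem exists_flip_dualMap_eq (g : Module.Dual ℂ (Nichols n)) : ∃ q, (dualMap n).flip q = g := by
  have h : Function.Injective (dualMap n).flip := fun x y hxy =>
    eq_of_forall_dualMap fun a => congrArg (fun f => f a) hxy
  exact (LinearMap.injective_iff_surjective_of_finrank_eq_finrank
    (Subspace.dual_finrank_eq (K := ℂ) (V := Nichols n)).symm).1 h g

theorem tensor_ext {u v : Nichols n ⊗[ℂ] Nichols n}
    (h : ∀ f g : Module.Dual ℂ (Nichols n), LinearMap.mul' ℂ ℂ (TensorProduct.map f g u) =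
      LinearMap.mul' ℂ ℂ (TensorProduct.map f g v)) : u = v := by
  refine ((basis n).tensorProduct (basis n)).ext_elem fun b => ?_
  have h1 : ∀ w, ((basis n).tensorProduct (basis n)).repr w b =
      LinearMap.mul' ℂ ℂ (TensorProduct.map ((basis n).coord b.1) ((basis n).coord b.2) w) := by
    intro w
    induction w with
    | zero => simp
    | add s t hs ht => simp only [map_add, Finsupp.add_apply, hs, ht]
    | tmul s t => rw [Module.Basis.tensorProduct_repr_tmul_apply]; simp [mul_comm]
  rw [h1, h1, h]

/-- The contraction `x ⊗ z ↦ ⟨z, y⟩ x` of the second tensor factor with `y` by means of the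
self-duality. -/
def contractRight (y : Nichols n) : Nichols n ⊗[ℂ] Nichols n →ₗ[ℂ] Nichols n :=
  (TensorProduct.rid ℂ _).toLinearMap ∘ₗ ((dualMap n).flip y).lTensor _

theorem contractRight_tmul (x y z : Nichols n) : contractRight y (x ⊗ₜ z) = dualMap n z y • x := by
  simp [contractRight]

theorem eq_of_contractRight_eq {u v : Nichols n ⊗[ℂ] Nichols n}
    (h : ∀ y, contractRight y u = contractRight y v) : u = v := by
  refine tensor_ext fun f g => ?_
  obtain ⟨y, rfl⟩ := exists_flip_dualMap_eq g
  have h1 : ∀ w, LinearMap.mul' ℂ ℂ (TensorProduct.map f ((dualMap n).flip y) w) =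
      f (contractRight y w) := by
    intro w
    induction w with
    | zero => simp
    | add s t hs ht => simp only [map_add, hs, ht]
    | tmul s t => rw [contractRight_tmul]; simp [mul_comm]
  rw [h1, h1, h]

/-- The canonical elements of two endomorphisms multiply by convolution. -/
theorem contractRight_mul (A B : Module.End ℂ (Nichols n)) (y : Nichols n) :
    contractRight y ((∑ b, A (basis n b) ⊗ₜ dualVec b) * ∑ b, B (basis n b) ⊗ₜ dualVec b) =
      LinearMap.mul' ℂ _ (TensorProduct.map A B (comul (R := ℂ) y)) := by
  have hA : ∀ (A : Module.End ℂ (Nichols n)) s,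
      A s = ∑ b, (basis n).coord b s • A (basis n b) := fun A s => by
    conv_lhs => rw [← sum_coord_smul_basis s]
    rw [map_sum]
    simp only [map_smul]
  rw [Finset.sum_mul_sum, map_sum]
  simp only [map_sum, Algebra.TensorProduct.tmul_mul_tmul, contractRight_tmul, dualMap_mul,
    dualMap_dualVec, dualMul_apply]
  induction comul (R := ℂ) y with
  | zero => simp
  | add s t hs ht => simp only [map_add, add_smul, Finset.sum_add_distrib, hs, ht]
  | tmul s t =>
    rw [TensorProduct.map_tmul, LinearMap.mul'_apply, hA A s, hA B t, Finset.sum_mul_sum]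
    simp only [TensorProduct.dualDistrib_apply, smul_mul_smul_comm]

theorem contractRight_one (y : Nichols n) : contractRight y 1 = counit (R := ℂ) y • 1 := by
  rw [Algebra.TensorProduct.one_def, contractRight_tmul, dualMap_one]

theorem canonical_mul_antipode :
    (∑ b, basis n b ⊗ₜ dualVec b) * (∑ b, antipodeLin (basis n b) ⊗ₜ[ℂ] dualVec b) = 1 := by
  refine eq_of_contractRight_eq fun y => ?_
  rw [contractRight_one]
  refine (contractRight_mul LinearMap.id antipodeLin y).trans ?_
  have h := HopfAlgebra.mul_antipode_lTensor_comul_apply (R := ℂ) y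
  rw [Algebra.algebraMap_eq_smul_one] at h
  exact h

theorem antipode_mul_canonical :
    (∑ b, antipodeLin (basis n b) ⊗ₜ[ℂ] dualVec b) * (∑ b, basis n b ⊗ₜ dualVec b) = 1 := by
  refine eq_of_contractRight_eq fun y => ?_
  rw [contractRight_one]
  refine (contractRight_mul antipodeLin LinearMap.id y).trans ?_
  have h := HopfAlgebra.mul_antipode_rTensor_comul_apply (R := ℂ) y
  rw [Algebra.algebraMap_eq_smul_one] at h
  exact h

end Nichols

namespace NicholsDouble

open Nichols (revSign sgn topCoord dualVec)

variable {n : ℕ}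

/-! ### The R-matrix and the Drinfeld map -/

theorem ofDual_coord (b : Fin 2 × Finset (Fin n)) :
    ofDual ((Nichols.basis n).coord b) = bar n (dualVec b) := by
  rw [bar_apply, Nichols.dualMap_dualVec]

theorem rMatrix_eq : rMatrix n = ∑ b, hop n (Nichols.basis n b) ⊗ₜ bar n (dualVec b) := by
  simp only [rMatrix, ofDual_coord, hop_apply]

theorem inverse_rMatrix : Ring.inverse (rMatrix n) =
    ∑ b, hop n (Nichols.antipodeLin (Nichols.basis n b)) ⊗ₜ bar n (dualVec b) := by
  have h1 :=
      congrArg (Algebra.TensorProduct.map (hop n) (bar n)) (Nichols.canonical_mul_antipode (n := n))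
  have h2 :=
      congrArg (Algebra.TensorProduct.map (hop n) (bar n)) (Nichols.antipode_mul_canonical (n := n))
  simp only [map_mul, map_sum, map_one, Algebra.TensorProduct.map_tmul] at h1 h2
  rw [← rMatrix_eq] at h1 h2
  exact Ring.inverse_unit ⟨_, _, h1, h2⟩

/-- The pairing of `x ȳ` with `p ⊗ q` given by the self-duality, `⟨p, x⟩ ⟨y, q⟩`. -/
def pairHB (p q : Nichols n) : Module.Dual ℂ (NicholsDouble n) :=
  coefHB (Nichols.dualMap n p) ((Nichols.dualMap n).flip q)

theorem pairHB_apply (p q x y : Nichols n) :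
    pairHB p q (hop n x * bar n y) = Nichols.dualMap n p x * Nichols.dualMap n y q :=
  coefHB_apply _ _ x y

theorem eq_of_pairHB_eq {x y : NicholsDouble n} (h : ∀ p q, pairHB p q x = pairHB p q y) : x =
    y := by
  have h1 : (normalForm n).symm (swap n x) = (normalForm n).symm (swap n y) := by
    refine Nichols.tensor_ext fun f g => ?_
    obtain ⟨p, rfl⟩ := Nichols.dualMap_surjective f
    obtain ⟨q, rfl⟩ := Nichols.exists_flip_dualMap_eq g
    exact h p q
  have h2 := (normalForm n).symm.injective h1
  rw [← swap_swap x, h2, swap_swap]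

/-- A bilinear form evaluated on the dual bases of the self-duality and contracted with `p ⊗ q`. -/
theorem sum_sum_dualVec (Ξ : Nichols n →ₗ[ℂ] Nichols n →ₗ[ℂ] ℂ) (B : Module.End ℂ (Nichols n))
    (p q : Nichols n) :
    ∑ b, ∑ b', Ξ (dualVec b) (B (Nichols.basis n b')) *
      (Nichols.dualMap n p (Nichols.basis n b) * (Nichols.basis n).coord b' q) = Ξ p (B q) := by
  conv_rhs => rw [← Nichols.sum_dualMap_smul_dualVec p, ← Nichols.sum_coord_smul_basis q]
  rw [map_sum, LinearMap.sum_apply]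
  refine Finset.sum_congr rfl fun b _ => ?_
  rw [map_sum, map_sum]
  refine Finset.sum_congr rfl fun b' _ => ?_
  rw [map_smul, map_smul, LinearMap.smul_apply, map_smul, smul_eq_mul, smul_eq_mul]
  ring

/-- The bilinear form `λ(z p̄ q)`. -/
def cointegralForm (z : NicholsDouble n) : Nichols n →ₗ[ℂ] Nichols n →ₗ[ℂ] ℂ :=
  LinearMap.mk₂ ℂ (fun p q => cointegral n (z * (bar n p * hop n q)))
    (fun p p' q => by simp [add_mul, mul_add]) (fun r p q => by simp)
    (fun p q q' => by simp [mul_add]) (fun r p q => by simp)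

theorem cointegralForm_apply (z : NicholsDouble n) (p q : Nichols n) :
    cointegralForm z p q = cointegral n (z * (bar n p * hop n q)) := rfl

theorem pairHB_drinfeldMap {z : NicholsDouble n} (hz : ∀ y, Commute z y) (p q : Nichols n) :
    pairHB p q (drinfeldMap (symForm n ∘ₗ LinearMap.mulLeft ℂ z)) = cointegralForm z p q := by
  rw [← LinearMap.id_apply (R := ℂ) q, ← sum_sum_dualVec (cointegralForm z) LinearMap.id,
    LinearMap.id_apply, drinfeldMap, drinfeldMatrix, rMatrix_eq, map_sum, Finset.sum_mul_sum]
  simp only [map_sum, TensorProduct.comm_tmul, Algebra.TensorProduct.tmul_mul_tmul,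
    LinearMap.rTensor_tmul, TensorProduct.lid_tmul, map_smul, pairHB_apply, smul_eq_mul,
    Nichols.dualMap_dualVec]
  refine Finset.sum_congr rfl fun b _ => Finset.sum_congr rfl fun b' _ => ?_
  congr 1
  rw [cointegralForm_apply, LinearMap.comp_apply, LinearMap.comp_apply, LinearMap.mulLeft_apply,
    LinearMap.mulLeft_apply, symForm_apply, balancing, ← mul_assoc z, (hz (K n)).eq, mul_assoc,
    K_mul_K_mul, LinearMap.id_apply]

theorem pairHB_lmS {z : NicholsDouble n} (hz : ∀ y, Commute z y) (p q : Nichols n) :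
    pairHB p q (lmS z) = cointegralForm z (Nichols.antipodeInv p) (Nichols.antipodeLin q) := by
  rw [← sum_sum_dualVec (cointegralForm z) Nichols.antipodeLin, lmS, inverse_rMatrix, map_sum,
    Finset.sum_mul, Finset.sum_mul_sum]
  simp only [map_sum, TensorProduct.comm_tmul, Algebra.TensorProduct.tmul_mul_tmul,
    LinearMap.lTensor_tmul, TensorProduct.rid_tmul, map_smul, pairHB_apply, smul_eq_mul,
    Nichols.dualMap_dualVec, mul_one, Nichols.dualMap_antipode]
  refine Finset.sum_congr rfl fun b _ => Finset.sum_congr rfl fun b' _ => ?_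
  congr 1
  rw [cointegralForm_apply, ← (hz (bar n _)).eq, mul_assoc]

end NicholsDouble

end

noncomputable section

namespace NicholsDouble

open Coalgebra
open Nichols (revSign sgn topCoord dualVec)

variable {n : ℕ}

/-! ### The Drinfeld map on the Higman ideal -/

/-- The bilinear form `(p, q) ↦ pairHB p q x`. -/
def pairForm (x : NicholsDouble n) : Nichols n →ₗ[ℂ] Nichols n →ₗ[ℂ] ℂ :=
  LinearMap.mk₂ ℂ (fun p q => pairHB p q x)
    (fun p p' q => by
      induction x using induction_hop_bar with
      | h u v => simp only [pairHB_apply, map_add, LinearMap.add_apply, add_mul]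
      | hadd a b ha hb => simp only [map_add, ha, hb]; ring)
    (fun r p q => by
      induction x using induction_hop_bar with
      | h u v => simp only [pairHB_apply, map_smul, LinearMap.smul_apply, smul_mul_assoc]
      | hadd a b ha hb => simp only [map_add, ha, hb, smul_add])
    (fun p q q' => by
      induction x using induction_hop_bar with
      | h u v => simp only [pairHB_apply, map_add, mul_add]
      | hadd a b ha hb => simp only [map_add, ha, hb]; ring)
    (fun r p q => by
      induction x using induction_hop_bar with
      | h u v => simp only [pairHB_apply, map_smul, mul_smul_comm]
      | hadd a b ha hb => simp only [map_add, ha, hb, smul_add])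

theorem pairForm_apply (x : NicholsDouble n) (p q : Nichols n) : pairForm x p q =
    pairHB p q x := rfl

theorem drinfeldMap_eq {x z : NicholsDouble n} (hz : ∀ y, Commute z y)
    (h : cointegralForm z = pairForm x) :
    drinfeldMap (symForm n ∘ₗ LinearMap.mulLeft ℂ z) = x :=
  eq_of_pairHB_eq fun p q => by rw [pairHB_drinfeldMap hz, h, pairForm_apply]

/-- Two bilinear forms agree if they agree on `(w, w')` and `(w, K w')` and a factor `K` can be moved
from the first argument to the second one in the same way. -/
theorem lin_ext₂ {Φ Ψ : Nichols n →ₗ[ℂ] Nichols n →ₗ[ℂ] ℂ}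
    (h00 : ∀ I J, Φ (Nichols.word I) (Nichols.word J) = Ψ (Nichols.word I) (Nichols.word J))
    (h01 : ∀ I J, Φ (Nichols.word I) (Nichols.K n * Nichols.word J) =
      Ψ (Nichols.word I) (Nichols.K n * Nichols.word J))
    (hΦ : ∀ I y, Φ (Nichols.K n * Nichols.word I) y =
      -((-1) ^ I.card * Φ (Nichols.word I) (Nichols.K n * y)))
    (hΨ : ∀ I y, Ψ (Nichols.K n * Nichols.word I) y =
      -((-1) ^ I.card * Ψ (Nichols.word I) (Nichols.K n * y))) : Φ = Ψ := by
  have h : ∀ I, Φ (Nichols.word I) = Ψ (Nichols.word I) := fun I =>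
    Nichols.lin_ext (h00 I) (h01 I)
  refine Nichols.lin_ext h fun I => LinearMap.ext fun y => ?_
  rw [hΦ, hΨ, h]

theorem K_mul_eq_of_cen_mul {z : NicholsDouble n} (hc : cen n * z = -z) : Kbar n * z =
    -(K n * z) := by
  rw [← K_mul_cen, mul_assoc, hc, mul_neg]

/-- On the block `K K̄ = -1` left multiplication by `K` is `-K̄`, which moves a factor `K` of `q` to `p`. -/
theorem cointegralForm_K_mul_word {z : NicholsDouble n} (hz : ∀ y, Commute z y) (hc : cen n * z =
    -z)
    (I : Finset (Fin n)) (y : Nichols n) : cointegralForm z (Nichols.K n * Nichols.word I) y =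
      -((-1) ^ I.card * cointegralForm z (Nichols.word I) (Nichols.K n * y)) := by
  have h : z * (bar n (Nichols.K n * Nichols.word I) * hop n y) =
      -((-1 : ℂ) ^ I.card • (z * (bar n (Nichols.word I) * hop n (Nichols.K n * y)))) := by
    rw [map_mul, map_mul (hop n), bar_K, hop_K, bar_word, ← mul_assoc (wordBar I), wordBar_mul_K,
      smul_mul_assoc, mul_smul_comm, smul_smul, neg_one_pow_mul_self, one_smul, mul_assoc,
      mul_assoc,
      ← mul_assoc, (hz (Kbar n)).eq, K_mul_eq_of_cen_mul hc, ← mul_assoc z (K n), (hz (K n)).eq,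
      neg_mul]
  rw [cointegralForm_apply, h, map_neg, map_smul, smul_eq_mul]
  rfl

/-! ### Traces on which `K K̄` acts by `-1` -/

/-- A trace on the block `K K̄ = -1` is given on the products `w̄ w'` by the self-duality: moving a letter
`ξ̄ᵢ` cyclically to the right end and back through `w'` contracts it with `w'`. -/
theorem trace_wordBar_mul_word {T : Module.Dual ℂ (NicholsDouble n)} (hT : ∀ x y, T (x * y) =
    T (y * x))
    (hc : ∀ x, T (cen n * x) = -T x) (J L : Finset (Fin n)) :
    T (wordBar J * word L) = Nichols.dualMap n (Nichols.word J) (Nichols.word L) * T 1 := by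
  have hpar : ∀ J L : Finset (Fin n), T (wordBar J * word L) =
      (-1) ^ (J.card + L.card) * T (wordBar J * word L) := by
    intro J L
    have h := hT (K n) (wordBar J * word L * K n)
    rw [mul_assoc (wordBar J * word L), K_mul_K, mul_one, mul_assoc, word_mul_K, mul_smul_comm,
        mul_smul_comm, ← mul_assoc (wordBar J),
      wordBar_mul_K, smul_mul_assoc, mul_smul_comm, mul_assoc, K_mul_K_mul, smul_smul, map_smul,
      smul_eq_mul] at h
    rw [pow_add]
    linear_combination -h
  induction J using Finset.induction_on generalizing L with
  | empty =>
    rw [wordBar_empty, one_mul, Nichols.word_empty, Nichols.dualMap_one, Nichols.counit_word]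
    split_ifs with h
    · rw [h, word_empty, one_mul]
    · obtain ⟨i, hi⟩ := Finset.nonempty_iff_ne_empty.2 h
      have h1 := hpar ∅ L
      have h2 := hT (xi i) (word (L.erase i))
      have h3 := congrArg T (xi_mul_word i (L.erase i))
      rw [wordBar_empty, one_mul, ← Finset.insert_erase hi,
        Finset.card_insert_of_notMem (Finset.notMem_erase _ _),
        word_insert (Finset.notMem_erase _ _), map_smul, smul_eq_mul, Finset.card_empty, zero_add,
        pow_succ] at h1
      rw [map_smul, ← h2, smul_eq_mul] at h3
      rw [← Finset.insert_erase hi, word_insert (Finset.notMem_erase _ _), map_smul, smul_eq_mul]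
      rcases neg_one_pow_eq_or ℂ (L.erase i).card with h4 | h4 <;> rw [h4] at h1 h3
      · linear_combination h1 / 2
      · linear_combination (sgn i (L.erase i) / 2) * h3
  | insert i J hi ih =>
    rw [wordBar_insert hi, Nichols.word_insert hi, map_smul, LinearMap.smul_apply, smul_mul_assoc,
      smul_mul_assoc, map_smul, Nichols.dualMap_xi_mul_apply]
    congr 1
    have h1 := hpar (insert i J) L
    rw [wordBar_insert hi, smul_mul_assoc, map_smul, smul_eq_mul,
      Finset.card_insert_of_notMem hi] at h1
    replace h1 := mul_left_cancel₀ (sgn_ne_zero i J) (h1.trans (mul_left_comm _ _ _))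
    have h2 := hT (xibar i) (wordBar J * word L)
    have hJ : wordBar J * xibar i = (-1 : ℂ) ^ J.card • (xibar i * wordBar J) :=
      orderedProd_mul_of_anticomm fun j _ => xibar_mul_xibar i j
    rw [← mul_assoc, mul_assoc (wordBar J)] at h2
    by_cases hL : i ∈ L
    · obtain ⟨L, hiL, rfl⟩ : ∃ L', i ∉ L' ∧ insert i L' = L :=
        ⟨L.erase i, Finset.notMem_erase _ _, Finset.insert_erase hL⟩
      have h3 : word (insert i L) * xibar i = (sgn i L * (-1) ^ L.card) • ((1 - cen n) * word L) -
          (-1 : ℂ) ^ L.card • (xibar i * word (insert i L)) := by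
        rw [word_insert hiL, smul_mul_assoc, mul_assoc, word_mul_xibar_of_notMem hiL, mul_smul_comm,
          ← mul_assoc, xi_mul_xibar_self, sub_mul, mul_smul_comm, mul_assoc]
        module
      rw [h3, mul_sub, mul_smul_comm, mul_smul_comm, ← mul_assoc (wordBar J) (xibar i), hJ,
        smul_mul_assoc, map_sub, map_smul, map_smul, map_smul, sub_mul, one_mul, mul_sub, map_sub,
        mul_cen_mul, hc, ih] at h2
      rw [Finset.card_insert_of_notMem hiL] at h1
      rw [Nichols.skewDer_word_insert hiL, map_smul, smul_mul_assoc]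
      simp only [smul_eq_mul, pow_succ, pow_add] at h1 h2 ⊢
      linear_combination (1 / 2 : ℂ) * h1 + (1 / 2 : ℂ) * h2
    · rw [Nichols.skewDer_word_of_notMem hL, map_zero, zero_mul]
      rw [word_mul_xibar_of_notMem hL, mul_smul_comm, ← mul_assoc, hJ, smul_mul_assoc, map_smul,
        map_smul] at h2
      simp only [smul_eq_mul, pow_succ, pow_add] at h1 h2
      linear_combination (1 / 2 : ℂ) * h1 + (1 / 2 : ℂ) * h2

/-! ### The three values -/

theorem symForm_trace (hn : Even n) {z : NicholsDouble n} (hz : ∀ y, Commute z y) (x y :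
    NicholsDouble n) :
    symForm n (z * (x * y)) = symForm n (z * (y * x)) := by
  rw [← mul_assoc, symForm_mul_comm hn, ← mul_assoc, ← (hz y).eq, mul_assoc]

theorem cointegralForm_word_K_mul_word (hn : Even n) {z : NicholsDouble n} (hz : ∀ y, Commute z y)
    (hc : cen n * z = -z) (I J : Finset (Fin n)) :
    cointegralForm z (Nichols.word I) (Nichols.K n * Nichols.word J) =
      (-1) ^ I.card * Nichols.dualMap n (Nichols.word I) (Nichols.word J) * symForm n z := by
  have h := trace_wordBar_mul_word (T := symForm n ∘ₗ LinearMap.mulLeft ℂ z) (symForm_trace hn hz)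
    (fun x => by
      rw [LinearMap.comp_apply, LinearMap.mulLeft_apply, ← mul_assoc, (hz _).eq, hc, neg_mul,
          map_neg]
      rfl) I J
  rw [LinearMap.comp_apply, LinearMap.comp_apply, LinearMap.mulLeft_apply, LinearMap.mulLeft_apply,
    mul_one] at h
  rw [mul_assoc, ← h, cointegralForm_apply, map_mul (hop n), hop_K, hop_word, bar_word,
      ← mul_assoc (wordBar I),
    wordBar_mul_K, smul_mul_assoc, mul_smul_comm, map_smul, mul_assoc, ← mul_assoc z, (hz _).eq,
    mul_assoc, symForm_apply, smul_eq_mul]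

theorem cointegral_cen_mul_bar_mul_hop (hn : Even n) (x y : Nichols n) :
    cointegral n (cen n * (bar n x * hop n y)) =
      2 * (topCoord n (x * Nichols.K n) * topCoord n (Nichols.K n * y)) := by
  rw [cen, mul_assoc, ← mul_assoc (Kbar n), ← bar_K, ← map_mul, K_mul_bar_mul_hop,
    Nichols.K_mul_K_mul, cointegral_bar_mul_hop hn]

/-- `K̄ w = (-1)^|w| w K̄` turns the sum into one over products `x ȳ`. -/
theorem chir_eq : chir n = (1 / 2 : ℂ) • ∑ I : Finset (Fin n), (-1 : ℂ) ^ ((I.card + 1) / 2) •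
    (hop n (Nichols.K n * Nichols.word I) * bar n (Nichols.word I) -
      (-1 : ℂ) ^ I.card • (hop n (Nichols.word I) * bar n (Nichols.K n * Nichols.word I))) := by
  rw [chir, wordSum, Finset.mul_sum]
  congr 1
  refine Finset.sum_congr rfl fun I _ => ?_
  rw [mul_smul_comm, sub_mul, map_mul, map_mul (bar n), hop_K, bar_K, hop_word, bar_word, mul_assoc,
    ← mul_assoc (Kbar n), Kbar_mul_word, smul_mul_assoc, mul_assoc (word I)]

theorem K_add_Kbar_mul_top_eq_add : (K n + Kbar n) * top n =
    hop n (Nichols.K n * Nichols.word Finset.univ) * bar n (Nichols.word Finset.univ) +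
      (-1 : ℂ) ^ n • (hop n (Nichols.word Finset.univ) * bar n (Nichols.K n * Nichols.word Finset.univ)) := by
  rw [add_mul, top, map_mul, map_mul (bar n), hop_K, bar_K, hop_word, bar_word, mul_assoc,
    ← mul_assoc (Kbar n), Kbar_mul_word, smul_mul_assoc, mul_assoc (word _), Finset.card_fin]

/-- Only the longest word contributes, with the sign `(-1)^⌊(n+1)/2⌋ = (-1)^(n/2)`. -/
theorem symForm_chir (hn : Even n) : symForm n (chir n) = (-1) ^ (n / 2) := by
  have h : ∀ I : Finset (Fin n), cointegral n (K n * (hop n (Nichols.K n * Nichols.word I) *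
      bar n (Nichols.word I) - (-1 : ℂ) ^ I.card • (hop n (Nichols.word I) *
        bar n (Nichols.K n * Nichols.word I)))) = if I = Finset.univ then 2 else 0 := by
    intro I
    rw [mul_sub, map_sub, ← mul_assoc, ← hop_K, ← map_mul, Nichols.K_mul_K_mul, mul_smul_comm,
      map_smul, ← mul_assoc, ← map_mul, cointegral_hop_mul_bar hn, cointegral_hop_mul_bar hn,
      Nichols.topCoord_word,
      Nichols.topCoord_K_mul_word]
    split_ifs <;> simp
  rw [symForm_apply, chir_eq, mul_smul_comm, Finset.mul_sum, map_smul, map_sum]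
  simp only [mul_smul_comm, map_smul, h, smul_eq_mul, mul_ite, mul_zero, Finset.sum_ite_eq',
    Finset.mem_univ, if_true, Finset.card_fin]
  obtain ⟨k, rfl⟩ := hn
  rw [show (k + k + 1) / 2 = (k + k) / 2 by omega]
  ring

theorem symForm_one_sub_cen (hn : Even n) : symForm n (1 - cen n) = 0 := by
  have h : topCoord n (Nichols.K n) = 0 := by
    rw [← mul_one (Nichols.K n), ← Nichols.word_empty, Nichols.topCoord_K_mul_word]
  have h1 := cointegral_hop_mul_bar hn (Nichols.K n) 1
  have h2 := cointegral_hop_mul_bar hn 1 (Nichols.K n)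
  rw [h, map_one, hop_K, mul_one] at h1
  rw [h, map_one, bar_K, one_mul] at h2
  rw [symForm_apply, mul_sub, mul_one, K_mul_cen, map_sub, h1, h2]
  ring

/-- The automorphism `(sign ⊗ id) ∘ Δ` of the double preserves `λ` and sends `chir` to `-chir`; together
with conjugation by `K` this makes the value its own negative. -/
theorem cointegral_chir_mul_wordBar_mul_word (hn : Even n) (I J : Finset (Fin n)) :
    cointegral n (chir n * (wordBar I * word J)) = 0 := by
  have h1 : cointegral n (chir n * (wordBar I * word J)) =
      (-1) ^ I.card * (-1) ^ J.card * cointegral n (chir n * (wordBar I * word J)) := by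
    conv_lhs => rw [← cointegral_K_mul_mul_K hn]
    rw [mul_assoc, mul_assoc, mul_assoc, word_mul_K, mul_smul_comm, ← mul_assoc (wordBar I),
        wordBar_mul_K,
      smul_mul_assoc, mul_smul_comm, mul_smul_comm, mul_smul_comm, mul_smul_comm, mul_assoc (K n),
      ← mul_assoc (chir n),
      (commute_chir (K n)).eq, mul_assoc (K n), K_mul_K_mul, smul_smul, map_smul, smul_eq_mul]
    ring
  have h2 : cointegral n (translateLeft (signHom n) (chir n * (wordBar I * word J))) =
      cointegral n (chir n * (wordBar I * word J)) := by
    have h := charMul_cointegral hn (signHom n).toLinearMap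
    rw [charMul_algHom_left, AlgHom.toLinearMap_apply, map_one, one_smul] at h
    exact congrArg (fun g => g (chir n * (wordBar I * word J))) h
  have hK : translateLeft (signHom n) (K n) = -K n := by simp [translateLeft, comulHom_K, signHom_K]
  have hKb : translateLeft (signHom n) (Kbar n) = -Kbar n := by
    simp [translateLeft, comulHom_Kbar, signHom_Kbar]
  have hw : ∀ I, translateLeft (signHom n) (word I) = (-1 : ℂ) ^ I.card • word I := fun I => by
    rw [word, map_orderedProd, ← orderedProd_smul]
    congr 1
    funext i
    simp [translateLeft, comulHom_xi, signHom_xi, signHom_K]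
  have hwb : ∀ I,
      translateLeft (signHom n) (wordBar I) = (-1 : ℂ) ^ I.card • wordBar I := fun I => by
    rw [wordBar, map_orderedProd, ← orderedProd_smul]
    congr 1
    funext i
    simp [translateLeft, comulHom_xibar, signHom_xibar, signHom_Kbar]
  have hs : translateLeft (signHom n) (chir n) = -chir n := by
    rw [chir, map_smul, map_mul, map_sub, hK, hKb, wordSum, map_sum]
    simp only [map_smul, map_mul, hw, hwb, smul_mul_smul_comm, neg_one_pow_mul_self, one_smul]
    rw [← smul_neg, ← neg_mul]
    abel_nf
  rw [map_mul (translateLeft _), hs, map_mul (translateLeft _), hw, hwb, smul_mul_smul_comm,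
      mul_smul_comm, map_smul, neg_mul, map_neg,
    smul_eq_mul] at h2
  linear_combination (1 / 2 : ℂ) * h1 - (1 / 2 : ℂ) * h2

theorem pairHB_word_add (I J : Finset (Fin n)) (s : ℂ) (q : Nichols n) :
    pairHB (Nichols.word I) q (hop n (Nichols.K n * Nichols.word J) * bar n (Nichols.word J) +
      s • (hop n (Nichols.word J) * bar n (Nichols.K n * Nichols.word J))) =
      if J = I then revSign J.card * (Nichols.dualMap n (Nichols.word J) q +
        s * Nichols.dualMap n (Nichols.K n * Nichols.word J) q) else 0 := by
  rw [map_add, map_smul, pairHB_apply, pairHB_apply, Nichols.dualMap_word_K_mul,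
    Nichols.dualMap_word_word]
  split_ifs with h
  · rw [h, smul_eq_mul]; ring
  · simp

theorem dualMap_K_mul_K_mul (x y : Nichols n) :
    Nichols.dualMap n (Nichols.K n * x) (Nichols.K n * y) =
      -Nichols.dualMap n x (Nichols.K n * Nichols.kappa n y) := by
  rw [Nichols.dualMap_K_mul_apply, map_mul, Nichols.kappa_K, neg_mul, map_neg]

/-- The rule of `cointegralForm_K_mul_word` for the elements from which `(K + K̄) t` and `chir` are
built. -/
theorem pairHB_K_mul_word_add (I J : Finset (Fin n)) (s : ℂ) (q : Nichols n) :
    pairHB (Nichols.K n * Nichols.word I) q (hop n (Nichols.K n * Nichols.word J) * bar n (Nichols.word J) +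
      s • (hop n (Nichols.word J) * bar n (Nichols.K n * Nichols.word J))) =
    -((-1) ^ I.card * pairHB (Nichols.word I) (Nichols.K n * q)
      (hop n (Nichols.K n * Nichols.word J) * bar n (Nichols.word J) +
      s • (hop n (Nichols.word J) * bar n (Nichols.K n * Nichols.word J)))) := by
  rw [pairHB_word_add, map_add, map_smul, pairHB_apply, pairHB_apply, dualMap_K_mul_K_mul,
    dualMap_K_mul_K_mul, Nichols.dualMap_K_mul_apply, Nichols.kappa_word, mul_smul_comm, map_smul,
    map_smul,
    Nichols.dualMap_word_K_mul, Nichols.dualMap_word_word, Nichols.dualMap_word_K_mul,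
    Nichols.dualMap_word_K_mul, Nichols.dualMap_K_mul_apply]
  split_ifs with h
  · subst h; simp only [smul_eq_mul]; ring
  · simp

theorem drinfeldMap_one_sub_cen (hn : Even n) :
    drinfeldMap (symForm n ∘ₗ LinearMap.mulLeft ℂ (1 - cen n)) = (K n + Kbar n) * top n := by
  refine drinfeldMap_eq commute_one_sub_cen (lin_ext₂ (fun I J => ?_) (fun I J => ?_)
    (cointegralForm_K_mul_word commute_one_sub_cen cen_mul_one_sub_cen) fun I y => ?_)
  · rw [cointegralForm_apply, sub_mul, one_mul, map_sub, cointegral_bar_mul_hop hn,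
      cointegral_cen_mul_bar_mul_hop hn, Nichols.topCoord_K_mul_word, Nichols.topCoord_word,
      Nichols.topCoord_word,
      pairForm_apply, K_add_Kbar_mul_top_eq_add, pairHB_word_add, Nichols.dualMap_K_mul_apply,
      Nichols.kappa_word, map_smul, Nichols.dualMap_word_word, Finset.card_fin, hn.neg_one_pow]
    by_cases hI : I = Finset.univ <;> by_cases hJ : J = Finset.univ
    · subst hI hJ
      have := Nichols.revSign_mul_self n
      simp [hn.neg_one_pow]
      linear_combination -2 * this
    all_goals simp [hI, hJ, eq_comm (a := Finset.univ)]
  · rw [cointegralForm_word_K_mul_word hn commute_one_sub_cen cen_mul_one_sub_cen,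
      symForm_one_sub_cen hn, pairForm_apply, K_add_Kbar_mul_top_eq_add, pairHB_word_add,
      dualMap_K_mul_K_mul, Nichols.kappa_word, mul_smul_comm, map_smul, Nichols.dualMap_word_K_mul,
      Nichols.dualMap_word_word, Finset.card_fin, hn.neg_one_pow]
    by_cases hJ : J = Finset.univ
    · subst hJ; simp [hn.neg_one_pow]
    · rw [Nichols.dualMap_word_word, if_neg hJ]; simp
  · rw [pairForm_apply, pairForm_apply, K_add_Kbar_mul_top_eq_add, pairHB_K_mul_word_add]

theorem drinfeldMap_chir (hn : Even n) :
    drinfeldMap (symForm n ∘ₗ LinearMap.mulLeft ℂ (chir n)) = (-1 : ℂ) ^ (n / 2) • chir n := by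
  have hx : ∀ p q, pairForm ((-1 : ℂ) ^ (n / 2) • chir n) p q = (-1) ^ (n / 2) * ((1 / 2) *
      ∑ L : Finset (Fin n), (-1) ^ L.card * revSign L.card *
        pairHB p q (hop n (Nichols.K n * Nichols.word L) * bar n (Nichols.word L) +
          (-(-1) ^ L.card :
          ℂ) • (hop n (Nichols.word L) * bar n (Nichols.K n * Nichols.word L)))) := by
    intro p q
    rw [pairForm_apply, chir_eq, map_smul, map_smul, map_sum]
    simp only [neg_smul, ← sub_eq_add_neg, map_smul, smul_eq_mul,
        Nichols.neg_one_pow_eq_mul_revSign]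
  refine drinfeldMap_eq commute_chir (lin_ext₂ (fun I J => ?_) (fun I J => ?_)
    (cointegralForm_K_mul_word commute_chir cen_mul_chir) fun I y => ?_)
  · rw [cointegralForm_apply, bar_word, hop_word, cointegral_chir_mul_wordBar_mul_word hn, hx]
    simp only [pairHB_word_add, Nichols.dualMap_K_mul_apply, Nichols.kappa_word, map_smul,
        smul_eq_mul,
      mul_ite, mul_zero, Finset.sum_ite_eq', Finset.mem_univ, if_true, Nichols.dualMap_word_word]
    split_ifs with h
    · subst h
      have := neg_one_pow_mul_self J.card
      linear_combination (1 / 2 * (-1) ^ (n / 2) * (-1) ^ J.card * revSign J.card * revSign J.card * revSign J.card) * this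
    · simp
  · rw [cointegralForm_word_K_mul_word hn commute_chir cen_mul_chir, symForm_chir hn, hx]
    simp only [pairHB_word_add, dualMap_K_mul_K_mul, Nichols.kappa_word, mul_smul_comm, map_smul,
        smul_eq_mul,
      mul_ite, mul_zero, Finset.sum_ite_eq', Finset.mem_univ, if_true, Nichols.dualMap_word_K_mul]
    rw [Nichols.dualMap_word_word]
    split_ifs with h
    · subst h
      have h1 := neg_one_pow_mul_self J.card
      have h2 := Nichols.revSign_mul_self J.card
      linear_combination (-((-1) ^ (n / 2) * (-1) ^ J.card * revSign J.card)) * h2 -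
        (1 / 2 * (-1) ^ (n / 2) * (-1) ^ J.card * revSign J.card * revSign J.card ^ 2) * h1
    · simp
  · simp only [hx, pairHB_K_mul_word_add]
    rw [Finset.mul_sum, Finset.mul_sum, Finset.mul_sum, Finset.mul_sum, Finset.mul_sum,
        ← Finset.sum_neg_distrib]
    exact Finset.sum_congr rfl fun L _ => by ring

theorem symForm_K_add_Kbar_mul_top (hn : Even n) :
    symForm n ∘ₗ LinearMap.mulLeft ℂ ((K n + Kbar n) * top n) =
      (counitHom n).toLinearMap + (signHom n).toLinearMap := by
  classical
  refine IsTraceLike.ext (isTraceLike_symForm hn commute_K_add_Kbar_mul_top (fun i => ?_) fun i => ?_)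
    ((isTraceLike_algHom _).add (isTraceLike_algHom _)) fun σ => ?_
  · rw [(commute_one_add_cen _).eq, ← mul_assoc, K_add_Kbar_mul_top_mul_xi, zero_mul]
  · rw [(commute_one_add_cen _).eq, ← mul_assoc, K_add_Kbar_mul_top_mul_xibar, zero_mul]
  · rw [LinearMap.comp_apply, LinearMap.mulLeft_apply, symForm_K_add_Kbar_mul_top_mul_idem hn,
      ← character_one, ← character_KKbar, LinearMap.add_apply, character_simpleMod_idem,
      character_simpleMod_idem]
    cases σ <;> simp [Label.IsSmall, Label.signK, Label.signKbar] <;> norm_num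

theorem dualMap_apply_K (x : Nichols n) : Nichols.dualMap n x (Nichols.K n) = Nichols.kbar n x := by
  have h : (Nichols.dualMap n).flip (Nichols.K n) = (Nichols.kbar n).toLinearMap := by
    refine Nichols.lin_ext (fun I => ?_) fun I => ?_
    · rw [LinearMap.flip_apply, ← mul_one (Nichols.K n), Nichols.dualMap_word_K_mul,
        dualMap_apply_one,
        Nichols.counit_word, AlgHom.toLinearMap_apply, Nichols.kbar_word]
    · rw [LinearMap.flip_apply, ← mul_one (Nichols.K n), mul_assoc, one_mul, dualMap_K_mul_K_mul,
        map_one,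
        Nichols.dualMap_word_K_mul, dualMap_apply_one,
        Nichols.counit_word, AlgHom.toLinearMap_apply, map_mul, Nichols.kbar_word, Nichols.kbar_K]
      split_ifs <;> simp
  exact congrArg (fun f => f x) h

/-- The functional is the sum of the two one-dimensional characters, which the shifted Drinfeld map
sends to `1` and `-K K̄`. -/
theorem drinfeldMap_K_add_Kbar_mul_top (hn : Even n) :
    drinfeldMap (symForm n ∘ₗ LinearMap.mulLeft ℂ ((K n + Kbar n) * top n)) = 1 - cen n := by
  refine drinfeldMap_eq commute_K_add_Kbar_mul_top (LinearMap.ext fun p => LinearMap.ext fun q => ?_)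
  have h := congrArg (fun f => f (K n * (bar n p * hop n q))) (symForm_K_add_Kbar_mul_top hn)
  have h1 : (1 - cen n : NicholsDouble n) =
      hop n 1 * bar n 1 - hop n (Nichols.K n) * bar n (Nichols.K n) := by
    rw [map_one, map_one, one_mul, hop_K, bar_K, cen]
  have hs : ∀ x, signHom n (hop n x) = Nichols.kbar n x ∧ signHom n (bar n x) = Nichols.kbar n x :=
    fun x => ⟨lift_hop _ _ _ _ _ _ x, lift_bar _ _ _ _ _ _ x⟩
  have he : ∀ x,
      counitHom n (hop n x) = counit (R := ℂ) x ∧ counitHom n (bar n x) = counit (R := ℂ) x :=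
    fun x => ⟨lift_hop _ _ _ _ _ _ x, lift_bar _ _ _ _ _ _ x⟩
  rw [cointegralForm_apply, pairForm_apply, h1, map_sub, pairHB_apply, pairHB_apply,
      dualMap_apply_one,
    dualMap_apply_K, Nichols.dualMap_one, Nichols.dualMap_K]
  simp only [LinearMap.comp_apply, LinearMap.mulLeft_apply, symForm_apply, LinearMap.add_apply,
    AlgHom.toLinearMap_apply, map_mul, counitHom_K, signHom_K, (hs _).1, (hs _).2, (he _).1,
    (he _).2] at h
  rw [← mul_assoc, ← (commute_K_add_Kbar_mul_top (K n)).eq, mul_assoc, K_mul_K_mul] at h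
  rw [h, AlgHom.toLinearMap_apply]
  ring

end NicholsDouble

end

noncomputable section

namespace Nichols

variable {n : ℕ}

theorem antipodeInv_word (I : Finset (Fin n)) : antipodeInv (word I) = K n ^ I.card * word I := by
  induction I using Finset.induction_on_max with
  | empty => simp [word_empty]
  | insert i I hi ih =>
    have hw : xi i * word I = (-1 : ℂ) ^ I.card • (word I * xi i) :=
      mul_orderedProd_of_anticomm fun j _ => xi_mul_xi i j
    have hK : ∀ k : ℕ, xi i * K n ^ k = (-1 : ℂ) ^ k • (K n ^ k * xi i) := by
      intro k
      induction k with
      | zero => simp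
      | succ k ih =>
        rw [pow_succ, ← mul_assoc, ih, smul_mul_assoc, mul_assoc, xi_mul_K, mul_neg, mul_assoc,
            pow_succ]
        module
    rw [word_insert_max hi, antipodeInv_mul, ih, antipodeInv_xi,
      Finset.card_insert_of_notMem fun h => lt_irrefl _ (hi i h), mul_assoc, ← mul_assoc (xi i), hK,
      smul_mul_assoc, mul_assoc, hw, mul_smul_comm, mul_smul_comm, mul_smul_comm, smul_smul,
      NicholsDouble.neg_one_pow_mul_self,
      one_smul, pow_succ', mul_assoc]

theorem antipodeLin_word (I : Finset (Fin n)) :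
    antipodeLin (word I) = (-1 : ℂ) ^ I.card • (K n ^ I.card * word I) := by
  have h : ∀ k : ℕ, antipodeLin (K n ^ k) = K n ^ k := by
    intro k
    induction k with
    | zero => simp
    | succ k ih => rw [pow_succ, antipodeLin_mul, ih, antipodeLin_K, ← pow_succ', pow_succ]
  have hK : ∀ k : ℕ, K n ^ k * K n ^ k = 1 := fun k => by
    rw [← pow_add, ← two_mul, pow_mul, sq, K_mul_K, one_pow]
  have hw : ∀ k : ℕ, K n ^ k * word I = ((-1 : ℂ) ^ I.card) ^ k • (word I * K n ^ k) := by
    intro k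
    induction k with
    | zero => simp
    | succ k ih =>
      rw [pow_succ, mul_assoc, K_mul_word, mul_smul_comm, ← mul_assoc, ih, smul_mul_assoc,
          mul_assoc,
        smul_smul, ← pow_succ']
  have h1 := congrArg antipodeLin (antipodeInv_word I)
  have h2 : antipodeLin (antipodeInv (word I)) = word I := antipode_antipodeInv _
  rw [h2, antipodeLin_mul, h] at h1
  have h3 := congrArg (· * K n ^ I.card) h1
  simp only [mul_assoc, hK, mul_one] at h3
  rw [← h3, hw, smul_smul, ← pow_succ', ← pow_mul, Even.neg_one_pow (Nat.even_mul_succ_self _),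
      one_smul]

end Nichols

namespace NicholsDouble

open Coalgebra
open Nichols (revSign sgn topCoord dualVec)

variable {n : ℕ}

/-! ### The Lyubashenko–Majid maps on the Higman ideal -/

theorem pairHB_antipode (p q x y : Nichols n) :
    pairHB (Nichols.antipodeInv p) (Nichols.antipodeLin q) (hop n x * bar n y) =
      pairHB p q (hop n (Nichols.antipodeLin x) * bar n (Nichols.antipodeInv y)) := by
  rw [pairHB_apply, pairHB_apply, Nichols.dualMap_antipode, ← Nichols.dualMap_antipode]

theorem pairHB_antipode_add {J : Finset (Fin n)} {s : ℂ} (h : Even J.card ∨ s = 1) (p q :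
    Nichols n) :
    pairHB (Nichols.antipodeInv p) (Nichols.antipodeLin q)
      (hop n (Nichols.K n * Nichols.word J) * bar n (Nichols.word J) +
        s • (hop n (Nichols.word J) * bar n (Nichols.K n * Nichols.word J))) =
    pairHB p q (hop n (Nichols.K n * Nichols.word J) * bar n (Nichols.word J) +
        s • (hop n (Nichols.word J) * bar n (Nichols.K n * Nichols.word J))) := by
  have hKe : ∀ k : ℕ, Even k → Nichols.K n ^ k = 1 := by
    rintro _ ⟨k, rfl⟩
    rw [← two_mul, pow_mul, sq, Nichols.K_mul_K, one_pow]
  rw [map_add, map_smul, pairHB_antipode, pairHB_antipode, ← map_smul, ← map_add]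
  congr 1
  rw [Nichols.antipodeLin_mul, Nichols.antipodeInv_mul, Nichols.antipodeInv_word,
    Nichols.antipodeLin_word, Nichols.antipodeLin_K, Nichols.antipodeInv_K]
  rcases Nat.even_or_odd J.card with hJ | hJ
  · rw [hKe _ hJ, hJ.neg_one_pow, one_smul, one_mul, Nichols.word_mul_K, hJ.neg_one_pow, one_smul]
  · have hs : s = 1 := h.resolve_left (Nat.not_even_iff_odd.2 hJ)
    obtain ⟨k, hk⟩ := hJ
    have hK1 : Nichols.K n ^ J.card = Nichols.K n := by
      rw [hk, pow_succ, hKe _ (even_two_mul k), one_mul]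
    have hJ' : Odd J.card := ⟨k, hk⟩
    rw [hK1, hJ'.neg_one_pow, smul_mul_assoc, mul_assoc, Nichols.word_mul_K, hJ'.neg_one_pow, hs,
      mul_smul_comm, Nichols.K_mul_K_mul]
    simp only [map_smul, smul_mul_assoc, mul_smul_comm]
    module

theorem cointegralForm_eq_pairForm {x z : NicholsDouble n} (hz : ∀ y, Commute z y)
    (h : drinfeldMap (symForm n ∘ₗ LinearMap.mulLeft ℂ z) = x) (p q : Nichols n) :
    cointegralForm z p q = pairHB p q x := by rw [← h, pairHB_drinfeldMap hz]

theorem cointegralForm_add_smul (hn : Even n) (a b d : ℂ) (p q : Nichols n) :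
    cointegralForm (a • (1 - cen n) + b • ((K n + Kbar n) * top n) + d • chir n) p q =
      pairHB p q (a • ((K n + Kbar n) * top n) + b • (1 - cen n) +
        (d * (-1) ^ (n / 2)) • chir n) := by
  have h1 := cointegralForm_eq_pairForm commute_one_sub_cen (drinfeldMap_one_sub_cen hn) p q
  have h2 :=
      cointegralForm_eq_pairForm commute_K_add_Kbar_mul_top (drinfeldMap_K_add_Kbar_mul_top hn) p q
  have h3 := cointegralForm_eq_pairForm commute_chir (drinfeldMap_chir hn) p q
  rw [mul_smul]
  rw [cointegralForm_apply] at *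
  simp only [add_mul _ _ (bar n p * hop n q), smul_mul_assoc, map_add, map_smul] at *
  rw [h1, h2, h3]

theorem drinfeldMap_of_ZH (hn : Even n) (a b d : ℂ) : drinfeldMap (symForm n ∘ₗ LinearMap.mulLeft ℂ
      (a • (1 - cen n) + b • ((K n + Kbar n) * top n) + d • chir n)) =
    a • ((K n + Kbar n) * top n) + b • (1 - cen n) + (d * (-1) ^ (n / 2)) • chir n :=
  eq_of_pairHB_eq fun p q => by
    rw [pairHB_drinfeldMap (commute_of_mem_ZH (mem_ZH_iff.2 ⟨a, b, d, rfl⟩)),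
      cointegralForm_add_smul hn]

theorem lmS_of_ZH (hn : Even n) (a b d : ℂ) :
    lmS (a • (1 - cen n) + b • ((K n + Kbar n) * top n) + d • chir n) =
      a • ((K n + Kbar n) * top n) + b • (1 - cen n) + (d * (-1) ^ (n / 2)) • chir n := by
  refine eq_of_pairHB_eq fun p q => ?_
  rw [pairHB_lmS (commute_of_mem_ZH (mem_ZH_iff.2 ⟨a, b, d, rfl⟩)), cointegralForm_add_smul hn]
  simp only [map_add, map_smul]
  congr 1
  · congr 2
    · rw [K_add_Kbar_mul_top_eq_add, pairHB_antipode_add (Or.inl (by simpa using hn))]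
    · have h1 : (1 - cen n : NicholsDouble n) =
          hop n 1 * bar n 1 - hop n (Nichols.K n) * bar n (Nichols.K n) := by
        rw [map_one, map_one, one_mul, hop_K, bar_K, cen]
      rw [h1, map_sub, map_sub, pairHB_antipode, pairHB_antipode]
      simp
  · rw [chir_eq, map_smul, map_smul, map_sum, map_sum]
    congr 2
    refine Finset.sum_congr rfl fun I _ => ?_
    rw [map_smul, map_smul, sub_eq_add_neg, ← neg_smul, pairHB_antipode_add]
    rcases Nat.even_or_odd I.card with h | h
    · exact Or.inl h
    · exact Or.inr (by rw [h.neg_one_pow, neg_neg])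

/-- On the Higman ideal the Lyubashenko–Majid map agrees with the Drinfeld map, since both antipodes
preserve the three values of the latter. -/
theorem lmS_eq_drinfeldMap (hn : Even n) {z : NicholsDouble n} (hz : z ∈ ZH n) :
    lmS z = drinfeldMap (symForm n ∘ₗ LinearMap.mulLeft ℂ z) := by
  obtain ⟨a, b, d, rfl⟩ := mem_ZH_iff.1 hz
  rw [lmS_of_ZH hn, drinfeldMap_of_ZH hn]

theorem lmS_basisTau (hn : Even n) (hn0 : 0 < n) (j : Fin 3) : lmS (basisTau n j) =
    basisChi n j := by
  rw [basisTau_eq hn hn0, lmS_eq_drinfeldMap hn (charElem_mem_ZH _), basisChi,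
    projChar_eq_symForm hn hn0]

theorem charElem_idx (j : Fin 3) : charElem n (idx j) =
    (![0, (-1) ^ (n / 2) * 2 ^ n / 2, -((-1) ^ (n / 2) * 2 ^ n / 2)] j : ℂ) • (1 - cen n) +
      (![2 ^ (2 * n - 1), 0, 0] j : ℂ) • ((K n + Kbar n) * top n) +
      (![0, (-1) ^ (n / 2) * 2 ^ n, (-1) ^ (n / 2) * 2 ^ n] j : ℂ) • chir n := by
  fin_cases j
  · exact (charElem_of_small isSmall_one).trans (by simp)
  · refine (charElem_of_not_small not_isSmall_K).trans ?_
    simp only [Label.signK, Fin.mk_one, Matrix.cons_val_one, Matrix.cons_val_zero]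
    module
  · refine (charElem_of_not_small not_isSmall_Kbar).trans ?_
    simp only [Label.signK, Fin.reduceFinMk, Matrix.cons_val]
    module

theorem basisChi_eq_sum (hn : Even n) (hn0 : 0 < n) (j : Fin 3) :
    basisChi n j = ∑ k, SCW n k j • basisTau n k := by
  obtain ⟨m, rfl⟩ : ∃ m, n = m + 1 := ⟨n - 1, by omega⟩
  have h1 := neg_one_pow_mul_self ((m + 1) / 2)
  have h2 : (2 : ℂ) ^ m ≠ 0 := pow_ne_zero _ two_ne_zero
  have hp : (2 : ℂ) ^ (2 * (m + 1) - 1) = 2 * 2 ^ m * 2 ^ m := by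
    rw [show 2 * (m + 1) - 1 = m + m + 1 by omega, pow_succ, pow_add]; ring
  rw [← lmS_basisTau hn hn0, Fin.sum_univ_three, basisTau_eq hn hn0, basisTau_eq hn hn0,
    basisTau_eq hn hn0, basisTau_eq hn hn0]
  simp only [charElem_idx]
  rw [lmS_of_ZH hn]
  rw [SCW]
  generalize (-1 : ℂ) ^ ((m + 1) / 2) = e at *
  generalize hr : (2 : ℂ) ^ m = r at *
  fin_cases j <;> simp [hp, pow_succ, hr] <;> match_scalars <;> field_simp <;> ring_nf
  · linear_combination (-2) * h1
  · linear_combination 2 * h1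

theorem SCW_mul_SCW (hn0 : 0 < n) : SCW n * SCW n = 1 := by
  obtain ⟨m, rfl⟩ : ∃ m, n = m + 1 := ⟨n - 1, by omega⟩
  have h1 := neg_one_pow_mul_self ((m + 1) / 2)
  have h2 : (2 : ℂ) ^ m ≠ 0 := pow_ne_zero _ two_ne_zero
  rw [SCW, Matrix.smul_mul, Matrix.mul_smul, smul_smul, h1, one_smul]
  ext i j
  fin_cases i <;> fin_cases j <;> simp [Matrix.mul_apply, Fin.sum_univ_three, pow_succ] <;>
    field_simp <;> norm_num

theorem inv_SCW (hn0 : 0 < n) : (SCW n)⁻¹ = SCW n := Matrix.inv_eq_right_inv (SCW_mul_SCW hn0)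

theorem isUnit_SCW (hn0 : 0 < n) : IsUnit (SCW n) :=
  ⟨⟨SCW n, SCW n, SCW_mul_SCW hn0, SCW_mul_SCW hn0⟩, rfl⟩

theorem SCW_mul_fusion_mul_inv (hn0 : 0 < n) (σ : Label) :
    SCW n * fusion n σ * (SCW n)⁻¹ = fusionDiag n σ := by
  obtain ⟨m, rfl⟩ : ∃ m, n = m + 1 := ⟨n - 1, by omega⟩
  have h1 := neg_one_pow_mul_self ((m + 1) / 2)
  have h2 : (2 : ℂ) ^ m ≠ 0 := pow_ne_zero _ two_ne_zero
  have hp : (2 : ℂ) ^ (2 * (m + 1) - 1) = 2 * 2 ^ m * 2 ^ m := by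
    rw [show 2 * (m + 1) - 1 = m + m + 1 by omega, pow_succ, pow_add]; ring
  rw [inv_SCW hn0, SCW, Matrix.smul_mul, Matrix.smul_mul, Matrix.mul_smul, smul_smul, h1, one_smul]
  cases σ
  · rw [fusion, mul_one]
    have h := SCW_mul_SCW hn0
    rwa [SCW, Matrix.smul_mul, Matrix.mul_smul, smul_smul, h1, one_smul] at h
  all_goals
    ext i j
    fin_cases i <;> fin_cases j <;> simp [fusion, fusionDiag, Matrix.mul_apply, Fin.sum_univ_three,
        pow_succ, hp] <;>
      (try field_simp) <;> (try norm_num)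

theorem basisTau_eq_sum (hn : Even n) (hn0 : 0 < n) (j : Fin 3) :
    basisTau n j = ∑ k, SCW n k j • basisChi n k := by
  have h : ∑ k, SCW n k j • basisChi n k = ∑ l, (SCW n * SCW n) l j • basisTau n l := by
    simp only [basisChi_eq_sum hn hn0, Finset.smul_sum, Matrix.mul_apply, Finset.sum_smul]
    rw [Finset.sum_comm]
    refine Finset.sum_congr rfl fun k _ => Finset.sum_congr rfl fun l _ => ?_
    rw [smul_smul, mul_comm]
  rw [h, SCW_mul_SCW hn0]
  simp [Matrix.one_apply]

theorem span_basisChi (hn : Even n) (hn0 : 0 < n) :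
    Submodule.span ℂ (Set.range (basisChi n)) = ZH n := by
  rw [ZH_eq_span_basisTau hn hn0]
  apply le_antisymm <;> rw [Submodule.span_le] <;> rintro _ ⟨j, rfl⟩
  · rw [basisChi_eq_sum hn hn0]
    exact Submodule.sum_mem _ fun k _ => Submodule.smul_mem _ _ (Submodule.subset_span ⟨k, rfl⟩)
  · rw [basisTau_eq_sum hn hn0]
    exact Submodule.sum_mem _ fun k _ => Submodule.smul_mem _ _ (Submodule.subset_span ⟨k, rfl⟩)

/-! ### The ribbon element -/

theorem ribbon_eq : ribbon n = (1 / 2 : ℂ) • ((1 + cen n) * wordSum n) + chir n := by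
  have h : ∑ I : Finset (Fin n), ((-1 : ℂ) ^ ((I.card + 1) / 2) / 2) • (word I * wordBar I) =
      (1 / 2 : ℂ) • wordSum n := by
    rw [wordSum, Finset.smul_sum]
    refine Finset.sum_congr rfl fun I _ => ?_
    rw [smul_smul]
    congr 1
    ring
  rw [ribbon, h, chir, mul_smul_comm, ← smul_add, ← add_mul, cen]
  congr 2
  abel

theorem wordSum_mul_K_add_Kbar_mul_top :
    wordSum n * ((K n + Kbar n) * top n) = (K n + Kbar n) * top n := by
  rw [wordSum, Finset.sum_mul, Finset.sum_eq_single ∅]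
  · simp [word_empty, wordBar_empty]
  · intro I _ hI
    obtain ⟨i, hi⟩ := Finset.nonempty_iff_ne_empty.2 hI
    rw [smul_mul_assoc, mul_assoc, ← (commute_K_add_Kbar_mul_top (wordBar I)).eq,
      ← Finset.insert_erase hi, wordBar_insert (Finset.notMem_erase _ _), mul_smul_comm,
      ← mul_assoc ((K n + Kbar n) * top n), K_add_Kbar_mul_top_mul_xibar, zero_mul, smul_zero,
      mul_zero, smul_zero]
  · simp

theorem chir_mul_K_add_Kbar_mul_top : chir n * ((K n + Kbar n) * top n) = 0 := by
  apply eq_zero_of_eq_neg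
  nth_rw 1 [← cen_mul_K_add_Kbar_mul_top]
  rw [mul_cen_mul, ← mul_assoc, cen_mul_chir, neg_mul]

theorem lmT_of_ZH (a b d : ℂ) : lmT (a • (1 - cen n) + b • ((K n + Kbar n) * top n) + d • chir n) =
    (d / 2) • (1 - cen n) + b • ((K n + Kbar n) * top n) + (2 * a) • chir n := by
  have h1 : ribbon n * (1 - cen n) = (2 : ℂ) • chir n := by
    rw [ribbon_eq, add_mul, smul_mul_assoc, mul_assoc, ← (commute_one_sub_cen (wordSum n)).eq,
      ← mul_assoc, one_add_cen_mul_one_sub_cen, zero_mul, smul_zero, zero_add,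
      ← (commute_one_sub_cen (chir n)).eq, sub_mul, one_mul, cen_mul_chir, sub_neg_eq_add, two_smul]
  have h2 : ribbon n * ((K n + Kbar n) * top n) = (K n + Kbar n) * top n := by
    rw [ribbon_eq, add_mul, smul_mul_assoc, mul_assoc, wordSum_mul_K_add_Kbar_mul_top, add_mul,
        one_mul,
      cen_mul_K_add_Kbar_mul_top, chir_mul_K_add_Kbar_mul_top]
    module
  have h3 : ribbon n * chir n = (1 / 2 : ℂ) • (1 - cen n) := by
    rw [ribbon_eq, add_mul, smul_mul_assoc, mul_assoc, ← (commute_chir (wordSum n)).eq,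
      ← mul_assoc, one_add_cen_mul_chir, zero_mul, smul_zero, zero_add, chir_mul_chir]
  rw [lmT, mul_add, mul_add, mul_smul_comm, mul_smul_comm, mul_smul_comm, h1, h2, h3]
  module

theorem lmT_basisTau (hn : Even n) (hn0 : 0 < n) (j : Fin 3) :
    lmT (basisTau n j) = ∑ k, TCW k j • basisTau n k := by
  have h : ∑ k, TCW k j • basisTau n k = (![1, 1, -1] j : ℂ) • basisTau n j := by
    rw [Finset.sum_eq_single j]
    · rw [TCW, Matrix.diagonal_apply_eq]
    · intro k _ hk
      rw [TCW, Matrix.diagonal_apply_ne _ hk, zero_smul]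
    · simp
  rw [h, basisTau_eq hn hn0, charElem_idx, lmT_of_ZH]
  fin_cases j <;> simp <;> module

end NicholsDouble

end

theorem mainTheorem11 (n : ℕ) (hn : 0 < n) :
    -- the center
    ((Subalgebra.center ℂ (NicholsDouble n)).toSubmodule =
        NicholsDouble.ZH n ⊔ NicholsDouble.ZLambda n ∧
      Disjoint (NicholsDouble.ZH n) (NicholsDouble.ZLambda n) ∧
      Module.finrank ℂ (NicholsDouble.ZH n) = 3) ∧
    (Even n →
      -- the Higman ideal
      NicholsDouble.ZH n = NicholsDouble.higmanIdeal n ∧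
      -- normalized integrals
      ((∀ x : NicholsDouble n,
          x * NicholsDouble.integral n = NicholsDouble.counitD n x • NicholsDouble.integral n ∧
          NicholsDouble.integral n * x = NicholsDouble.counitD n x • NicholsDouble.integral n) ∧
        (∀ β : Module.Dual ℂ (NicholsDouble n),
          NicholsDouble.charMul β (NicholsDouble.cointegral n) =
            β 1 • NicholsDouble.cointegral n) ∧
        NicholsDouble.cointegral n (NicholsDouble.integral n) = 1) ∧
      -- the simple modules, and the primitive idempotents of their projective covers
      ((∀ σ, IsSimpleModule (NicholsDouble n) (NicholsDouble.SimpleMod n σ)) ∧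
        (∀ σ σ', Nonempty (NicholsDouble.SimpleMod n σ ≃ₗ[NicholsDouble n]
          NicholsDouble.SimpleMod n σ') → σ = σ') ∧
        (∀ (V : Type*) [AddCommGroup V] [Module (NicholsDouble n) V],
          IsSimpleModule (NicholsDouble n) V →
            ∃ σ, Nonempty (V ≃ₗ[NicholsDouble n] NicholsDouble.SimpleMod n σ)) ∧
        (∀ σ, IsPrimitiveIdempotent (NicholsDouble.idem n σ)) ∧
        (∀ σ σ', σ ≠ σ' → NicholsDouble.idem n σ * NicholsDouble.idem n σ' = 0) ∧
        (∀ σ, ∃ f : NicholsDouble.ProjMod n σ →ₗ[NicholsDouble n] NicholsDouble.SimpleMod n σ,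
          Function.Surjective f) ∧
        NicholsDouble.projChar n .KKbar = NicholsDouble.projChar n .one) ∧
      -- the two bases of the Higman ideal
      (LinearIndependent ℂ (NicholsDouble.basisChi n) ∧
        Submodule.span ℂ (Set.range (NicholsDouble.basisChi n)) = NicholsDouble.higmanIdeal n) ∧
      (LinearIndependent ℂ (NicholsDouble.basisTau n) ∧
        Submodule.span ℂ (Set.range (NicholsDouble.basisTau n)) = NicholsDouble.higmanIdeal n) ∧
      -- the matrix `S_CW`: change of basis, and matrix of `S_LM`
      (∀ j, NicholsDouble.basisTau n j =
        ∑ k, NicholsDouble.SCW n k j • NicholsDouble.basisChi n k) ∧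
      (∀ j, NicholsDouble.lmS (NicholsDouble.basisTau n j) =
        ∑ k, NicholsDouble.SCW n k j • NicholsDouble.basisTau n k) ∧
      -- the matrix `T_CW`: matrix of `T_LM`
      (∀ j, NicholsDouble.lmT (NicholsDouble.basisTau n j) =
        ∑ k, NicholsDouble.TCW k j • NicholsDouble.basisTau n k) ∧
      -- the mixed fusion matrices and their diagonalization
      (∀ σ j, NicholsDouble.charMul (NicholsDouble.character (NicholsDouble.SimpleMod n σ))
          (NicholsDouble.projChar n (NicholsDouble.idx j)) =
        ∑ k, NicholsDouble.fusion n σ k j •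
          NicholsDouble.projChar n (NicholsDouble.idx k)) ∧
      IsUnit (NicholsDouble.SCW n) ∧
      (∀ σ, NicholsDouble.SCW n * NicholsDouble.fusion n σ * (NicholsDouble.SCW n)⁻¹ =
        NicholsDouble.fusionDiag n σ)) := by
  refine ⟨⟨NicholsDouble.center_eq, NicholsDouble.disjoint_ZH_ZLambda, NicholsDouble.finrank_ZH⟩,
    fun he => ?_⟩
  have hH := NicholsDouble.ZH_eq_higmanIdeal he hn
  have hτ := NicholsDouble.ZH_eq_span_basisTau he hn
  have hχ := NicholsDouble.span_basisChi he hn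
  refine ⟨hH, ⟨fun x => ⟨NicholsDouble.mul_integral x, NicholsDouble.integral_mul x⟩,
      NicholsDouble.charMul_cointegral he, NicholsDouble.cointegral_integral he⟩,
    ⟨NicholsDouble.isSimpleModule_simpleMod, fun _ _ => NicholsDouble.label_eq_of_equiv,
      fun V _ _ _ => NicholsDouble.exists_equiv_simpleMod, NicholsDouble.isPrimitiveIdempotent_idem,
      fun σ σ' h => NicholsDouble.idem_mul_idem h, NicholsDouble.exists_surjective_projMod,
      NicholsDouble.projChar_KKbar hn⟩,
    ⟨NicholsDouble.linearIndependent_of_span_eq_ZH hχ, hχ.trans hH⟩,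
    ⟨NicholsDouble.linearIndependent_of_span_eq_ZH hτ.symm, hτ.symm.trans hH⟩,
    NicholsDouble.basisTau_eq_sum he hn, fun j => ?_, NicholsDouble.lmT_basisTau he hn,
    NicholsDouble.charMul_character_projChar hn, NicholsDouble.isUnit_SCW hn,
    NicholsDouble.SCW_mul_fusion_mul_inv hn⟩
  rw [NicholsDouble.lmS_basisTau he hn, NicholsDouble.basisChi_eq_sum he hn]
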